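/- **Proposition 3.2.** Let $N\ge 1$ and let $k,m,n$ be nonnegative integers with $$k>\tfrac N2,\qquad n>\max\bigl\{\tfrac N2+1,\tfrac{N(N+1)}4\bigr\},\qquad 2m\ge k+n+1,$$ and put $J=2m+2+k+n$, $\langle x\rangle=(1+|x|^2)^{1/2}$. Let $\mathcal S$ be the space of all $u\in H^J(\mathbb R^N)$ (complex valued, identified with their continuous representatives) such that $\langle x\rangle^nD^\beta u\in L^\infty$ for $|\beta|\le 2m$, $\langle x\rangle^nD^\beta u\in L^2$ for $2m+1\le|\beta|\le 2m+2+k$, and $\langle x\rangle^{J-|\beta|}D^\beta u\in L^2$ for $2m+2+k<|\beta|\le J$, with the norm $$\|u\|_{\mathcal S}=\sum_{j=0}^{2m}\sup_{|\beta|=j}\|\langle x\rangle^nD^\beta u\|_{L^\infty}+\sum_{\nu=0}^{k+1}\sum_{\mu=0}^{n}\ \sum_{|\beta|=\nu+\mu+2m+1}\|\langle x\rangle^{n-\mu}D^\beta u\|_{L^2}.$$ For $\ell\in\mathbb N$ put $$\|u\|_{1,\ell}=\sup_{|\beta|\le\ell}\|\langle x\rangle^nD^\beta u\|_{L^\infty},\quad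 \|u\|_{2,\ell}=\sup_{2m+1\le|\beta|\le\ell}\|\langle x\rangle^nD^\beta u\|_{L^2},\quad \|u\|_{3,\ell}=\sup_{2m+3+k\le|\beta|\le\ell}\|\langle x\rangle^{J-\ell}D^\beta u\|_{L^2}$$ (suprema over empty sets are $0$; in the last one $\ell\le J$). Given $\alpha>0$, let $\sigma_0=0$ and $$\sigma_1=\frac1{4\,[4J(J-2m-1)+4J+\frac4N+1]\,(8m+1)^{2m}},\qquad \sigma_j=(8m+1)^j\sigma_1\ (2\le j\le 2m),$$ $$\sigma_{2m+1}=\tfrac{2-N\alpha}2+(4J+2\alpha+1)\sigma_{2m},\qquad \sigma_j=4J\sigma_{2m}(j-2m-1)+\sigma_{2m+1}\ (2m+2\le j\le J).$$ For $b>0$, $0\le T<\frac1b$ and $v\in C([0,T],\mathcal S)$ with $\inf_{t,x}\langle x\rangle^n|v(t,x)|>0$, let $$\Phi_{1,T}=\sup_{0\le t\le T}\ \sup_{0\le j\le 2m}(1-bt)^{\sigma_j}\|v(t)\|_{1,j},\qquad \Phi_{2,T}=\sup_{0\le t\le T}\ \sup_{2m+1\le j\le 2m+2+k}(1-bt)^{\sigma_j}\|v(t)\|_{2,j},$$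 $$\Phi_{3,T}=\sup_{0\le t\le T}\ \sup_{2m+3+k\le j\le J}(1-bt)^{\sigma_j}\|v(t)\|_{3,j},\qquad \Phi_{4,T}=\sup_{0\le t\le T}\frac{(1-bt)^{\sigma_1}}{\inf_x\langle x\rangle^n|v(t,x)|},$$ and $\Psi_T=\max\{\Phi_{1,T},\Phi_{2,T},\Phi_{3,T},\Phi_{4,T}\}$. There are constants $C_1,C_2,C_3\ge1$, depending only on $N,k,m,n$, such that (a), (b), (c) and (d) hold. Write $\underline\alpha=\max\{\frac3{2N},\frac2{N+1}\}$. (a) If $T\ge0$, $f,v\in C([0,T],\mathcal S)$ and $\partial_tv=i\Delta v+f$ on $[0,T]$, then for all $0\le t\le T$: $$\|\langle x\rangle^nD^\beta v(t)\|_{L^\infty}\le\|v(0)\|_{\mathcal S}+C_1\int_0^t\bigl(\|v(s)\|_{\mathcal S}+\|\langle x\rangle^nD^\beta f(s)\|_{L^\infty}\bigr)ds\quad\text{if }|\beta|\le2m,$$ $$\|\langle x\rangle^{n-\mu}D^\beta v(t)\|_{L^2}\le\|v(0)\|_{\mathcal S}+C_1\int_0^t\bigl(\|v(s)\|_{\mathcal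 S}+\|\langle x\rangle^{n-\mu}D^\beta f(s)\|_{L^2}\bigr)ds$$ if $|\beta|=\nu+\mu+2m+1$ with $0\le\nu\le k+1$, $0\le\mu\le n$. (b) If $\underline\alpha\le\alpha\le\frac2N$, $\eta\ge1$, $v\in\mathcal S$ and $\eta\inf_x\langle x\rangle^n|v(x)|\ge1$, then, with $A=\eta\|v\|_{1,2m}$ and $g=|v|^\alpha v$, $$\|\langle x\rangle^nD^\beta g\|_{L^\infty}\le C_2\|v\|_{L^\infty}^\alpha\|\langle x\rangle^nD^\beta v\|_{L^\infty}\qquad(|\beta|\le1),$$ $$\|\langle x\rangle^nD^\beta g\|_{L^\infty}\le C_2\|v\|_{L^\infty}^\alpha\|\langle x\rangle^nD^\beta v\|_{L^\infty}+C_2\|v\|_{L^\infty}^\alpha(\eta\|v\|_{1,|\beta|-1})^{2|\beta|}\|v\|_{1,|\beta|-1}\qquad(2\le|\beta|\le2m),$$ $$\|\langle x\rangle^nD^\beta g\|_{L^2}\le C_2\|v\|_{L^\infty}^\alpha\|\langle x\rangle^nD^\beta v\|_{L^2}+C_2A^{2J+\alpha}\|v\|_{1,2m}+C_2\|v\|_{L^\infty}^\alpha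 A^{2J}\|v\|_{2,|\beta|-1}\qquad(2m+1\le|\beta|\le2m+2+k),$$ $$\|\langle x\rangle^{J-|\beta|}D^\beta g\|_{L^2}\le C_2\|v\|_{L^\infty}^\alpha\|\langle x\rangle^{J-|\beta|}D^\beta v\|_{L^2}+C_2A^{2J+\alpha}\|v\|_{1,2m}+C_2\|v\|_{L^\infty}^\alpha A^{2J}\bigl(\|v\|_{2,2m+2+k}+\|v\|_{3,|\beta|-1}\bigr)\qquad(2m+3+k\le|\beta|\le J).$$ (c) If $\underline\alpha\le\alpha\le\frac2N$, $b>0$, $0<T<\frac1b$ and $v\in C([0,T],\mathcal S)$ satisfies $\inf_{t,x}\langle x\rangle^n|v(t,x)|>0$, then $\|v\|_{L^\infty((0,t),\mathcal S)}\le C_3(1-bt)^{-\sigma_J}\Psi_T$ for $0\le t\le T$. (d) Let $\lambda\in\mathbb C$ with $\operatorname{Re}\lambda<0$ and let $K\ge1$. There is $\alpha_1\in(\underline\alpha,\frac2N)$ with $$\frac{12\,C_1C_2(4K)^{4J+1}|\lambda|}{\sigma_1|\operatorname{Re}\lambda|}\Bigl(\frac2{\alpha_1}-N\Bigr)=1 .$$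 For $\alpha\in[\alpha_1,\frac2N)$ let $$b_1=\max\Bigl\{\frac{16}N(4K)^{\frac4N+2},\ 8C_3,\ \frac{32(4K)^{4J+4}|\lambda|C_1C_2}{\sigma_1},\ \frac{2^{\frac4N+3}\alpha(4K)^2}{3^{1/N}-1}\Bigr\}.$$ If $v_0\in\mathcal S$ satisfies $\|v_0\|_{\mathcal S}+\bigl(\inf_x\langle x\rangle^n|v_0(x)|\bigr)^{-1}\le K$, then for every $\alpha\in[\alpha_1,\frac2N)$ and every $b\ge b_1$ the equation $$\partial_tv=i\Delta v+\lambda(1-bt)^{-\frac{4-N\alpha}2}|v|^\alpha v,\qquad v(0)=v_0,$$ has a solution $v\in C([0,\frac1b),\mathcal S)$ with $\inf_{0\le t\le T}\inf_x\langle x\rangle^n|v(t,x)|>0$ for all $T<\frac1b$. Every solution of this kind on an interval $[0,T)$ with $0<T\le\frac1b$ coincides with $v$ on $[0,T)$ (so the maximal existence time of the solution is $\frac1b$), and $$\sup_{0\le T<1/b}\Psi_T\le4K .$$ -/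

import Mathlib

open Set Filter Topology MeasureTheory
open scoped ENNReal ContDiff Laplacian

noncomputable section

namespace DissipativeNLS

/-- The Euclidean space `ℝ^N`. -/
abbrev Sp (N : ℕ) : Type := EuclideanSpace ℝ (Fin N)

/-- The Japanese bracket `⟨x⟩ = (1 + |x|²)^{1/2}`. -/
def bracket {N : ℕ} (x : Sp N) : ℝ := Real.sqrt (1 + ‖x‖ ^ 2)

/-! ### Multi-indices and weak derivatives -/

/-- The length `|β|` of a multi-index. -/
def order {N : ℕ} (β : Fin N → ℕ) : ℕ := ∑ i, β i

/-- The classical partial derivative in the `i`-th coordinate direction. -/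
def partialD {N : ℕ} (i : Fin N) (φ : Sp N → ℝ) : Sp N → ℝ :=
  fun x => fderiv ℝ φ x (EuclideanSpace.single i 1)

/-- The classical derivative `∂₀^{β₀} ⋯ ∂_{N-1}^{β_{N-1}} φ`; it is used for smooth `φ` only. -/
def multiD {N : ℕ} (β : Fin N → ℕ) (φ : Sp N → ℝ) : Sp N → ℝ :=
  (List.finRange N).foldr (fun i g => (partialD i)^[β i] g) φ

/-- `g` is the weak derivative `D^β u` on `ℝ^N`. -/
def IsWeakDeriv {N : ℕ} (β : Fin N → ℕ) (u g : Sp N → ℂ) : Prop :=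
  LocallyIntegrable u volume ∧ LocallyIntegrable g volume ∧
    ∀ φ : Sp N → ℝ, ContDiff ℝ ∞ φ → HasCompactSupport φ →
      ∫ x, multiD β φ x • u x = (-1 : ℝ) ^ order β • ∫ x, φ x • g x

/-- The weighted norm `‖⟨x⟩^a D^β u‖_{L^p}`. Weak derivatives are unique up to null sets, so that
the infimum is over one value; the norm is `⊤` if `u` has no weak derivative `D^β u`. -/
def wnorm {N : ℕ} (p : ℝ≥0∞) (a : ℕ) (β : Fin N → ℕ) (u : Sp N → ℂ) : ℝ≥0∞ :=
  ⨅ g : Sp N → ℂ, ⨅ _ : IsWeakDeriv β u g,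
    eLpNorm (fun x => (bracket x ^ a) • g x) p volume

/-! ### The space `𝓢` -/

/-- `J = 2m + 2 + k + n`. -/
def bigJ (k m n : ℕ) : ℕ := 2 * m + 2 + k + n

/-- Membership in the space `𝓢`. Elements of `H^J` have a unique continuous representative,
because `J > N / 2`; an element of `𝓢` is identified with that representative. -/
structure MemS (N k m n : ℕ) (u : Sp N → ℂ) : Prop where
  continuous : Continuous u
  sobolev : ∀ β : Fin N → ℕ, order β ≤ bigJ k m n → wnorm 2 0 β u < ⊤
  low : ∀ β : Fin N → ℕ, order β ≤ 2 * m → wnorm ∞ n β u < ⊤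
  middle : ∀ β : Fin N → ℕ, 2 * m + 1 ≤ order β → order β ≤ 2 * m + 2 + k →
    wnorm 2 n β u < ⊤
  high : ∀ β : Fin N → ℕ, 2 * m + 2 + k < order β → order β ≤ bigJ k m n →
    wnorm 2 (bigJ k m n - order β) β u < ⊤

/-- The norm of `𝓢`, as an extended nonnegative number. -/
def normS (N k m n : ℕ) (u : Sp N → ℂ) : ℝ≥0∞ :=
  (∑ j ∈ Finset.range (2 * m + 1),
      ⨆ β : Fin N → ℕ, ⨆ _ : order β = j, wnorm ∞ n β u) +
    ∑ ν ∈ Finset.range (k + 2), ∑ μ ∈ Finset.range (n + 1),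
      ∑ β ∈ Finset.piAntidiag (Finset.univ : Finset (Fin N)) (ν + μ + 2 * m + 1),
        wnorm 2 (n - μ) β u

/-- `v ∈ C(I, 𝓢)`. -/
def ContInS (N k m n : ℕ) (I : Set ℝ) (v : ℝ → Sp N → ℂ) : Prop :=
  ∀ t ∈ I, MemS N k m n (v t) ∧
    Tendsto (fun s => normS N k m n (v s - v t)) (𝓝[I] t) (𝓝 0)

/-- `inf_x ⟨x⟩^n |u(x)|`. -/
def lowerS {N : ℕ} (n : ℕ) (u : Sp N → ℂ) : ℝ≥0∞ :=
  ⨅ x : Sp N, ENNReal.ofReal (bracket x ^ n * ‖u x‖)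

/-! ### The equations -/

/-- `∂ₜ v = i Δ v + F` on `I × ℝ^N`, in the classical sense (one-sided in `t` at an end point that
belongs to `I`). It is used for `v ∈ C(I, 𝓢)`; functions in `𝓢` are of class `C²`. -/
def SolvesSchrodinger {N : ℕ} (I : Set ℝ) (F v : ℝ → Sp N → ℂ) : Prop :=
  ∀ t ∈ I, ∀ x : Sp N,
    HasDerivWithinAt (fun s => v s x) (Complex.I * (Δ (v t)) x + F t x) I t

/-- The nonlinearity `|u|^α u`. -/
def powNL {N : ℕ} (α : ℝ) (u : Sp N → ℂ) : Sp N → ℂ :=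
  fun x => ((‖u x‖ ^ α : ℝ) : ℂ) * u x

/-- `v ∈ C([0, T), 𝓢)` is a solution on `[0, T)` of
`∂ₜ v = i Δ v + lam (1 - b t)^{-(4 - N α)/2} |v|^α v`, `v(0) = v₀`, such that
`inf_{0 ≤ t ≤ T'} inf_x ⟨x⟩^n |v(t, x)| > 0` for all `T' < T`. -/
structure IsSolution (N k m n : ℕ) (lam : ℂ) (α b : ℝ) (v₀ : Sp N → ℂ) (T : ℝ)
    (v : ℝ → Sp N → ℂ) : Prop where
  cont : ContInS N k m n (Ico 0 T) v
  init : v 0 = v₀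
  eqn : SolvesSchrodinger (Ico 0 T)
    (fun t x => lam * (((1 - b * t) ^ (-((4 - N * α) / 2)) : ℝ) : ℂ) * powNL α (v t) x) v
  lower : ∀ T' ∈ Ico 0 T, 0 < ⨅ t ∈ Icc 0 T', lowerS n (v t)

/-! ### Seminorms, exponents and growth quantities -/

/-- `‖u‖_{1,ℓ}`. -/
def norm1 {N : ℕ} (n l : ℕ) (u : Sp N → ℂ) : ℝ≥0∞ :=
  ⨆ β : Fin N → ℕ, ⨆ _ : order β ≤ l, wnorm ∞ n β u

/-- `‖u‖_{2,ℓ}`; it is `0` for `ℓ ≤ 2m`. -/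
def norm2 {N : ℕ} (m n l : ℕ) (u : Sp N → ℂ) : ℝ≥0∞ :=
  ⨆ β : Fin N → ℕ, ⨆ _ : 2 * m + 1 ≤ order β ∧ order β ≤ l, wnorm 2 n β u

/-- `‖u‖_{3,ℓ}`, for `ℓ ≤ J`; it is `0` for `ℓ ≤ 2m + 2 + k`. -/
def norm3 {N : ℕ} (k m n l : ℕ) (u : Sp N → ℂ) : ℝ≥0∞ :=
  ⨆ β : Fin N → ℕ, ⨆ _ : 2 * m + 3 + k ≤ order β ∧ order β ≤ l,
    wnorm 2 (bigJ k m n - l) β u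

/-- The exponent `σ₁`. -/
def sigmaOne (N k m n : ℕ) : ℝ :=
  1 / (4 * (4 * (bigJ k m n : ℝ) * ((bigJ k m n : ℝ) - 2 * m - 1) + 4 * (bigJ k m n : ℝ)
    + 4 / (N : ℝ) + 1) * (8 * (m : ℝ) + 1) ^ (2 * m))

/-- The exponents `σ_j`, `0 ≤ j ≤ J`. -/
def sigma (N k m n : ℕ) (α : ℝ) (j : ℕ) : ℝ :=
  if j = 0 then 0
  else if j = 1 then sigmaOne N k m n
  else if j ≤ 2 * m then (8 * (m : ℝ) + 1) ^ j * sigmaOne N k m n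
  else
    4 * (bigJ k m n : ℝ) * ((8 * (m : ℝ) + 1) ^ (2 * m) * sigmaOne N k m n)
        * ((j : ℝ) - 2 * m - 1)
      + ((2 - N * α) / 2
        + (4 * (bigJ k m n : ℝ) + 2 * α + 1) * ((8 * (m : ℝ) + 1) ^ (2 * m) * sigmaOne N k m n))

/-- The factor `(1 - b t)^{σ_j}`. -/
def decayFactor (N k m n : ℕ) (α b : ℝ) (j : ℕ) (t : ℝ) : ℝ≥0∞ :=
  ENNReal.ofReal ((1 - b * t) ^ sigma N k m n α j)

/-- `Φ_{1,T}`. -/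
def phi1 (N k m n : ℕ) (α b T : ℝ) (v : ℝ → Sp N → ℂ) : ℝ≥0∞ :=
  ⨆ t ∈ Icc 0 T, ⨆ j ∈ Icc 0 (2 * m), decayFactor N k m n α b j t * norm1 n j (v t)

/-- `Φ_{2,T}`. -/
def phi2 (N k m n : ℕ) (α b T : ℝ) (v : ℝ → Sp N → ℂ) : ℝ≥0∞ :=
  ⨆ t ∈ Icc 0 T, ⨆ j ∈ Icc (2 * m + 1) (2 * m + 2 + k),
    decayFactor N k m n α b j t * norm2 m n j (v t)

/-- `Φ_{3,T}`. -/
def phi3 (N k m n : ℕ) (α b T : ℝ) (v : ℝ → Sp N → ℂ) : ℝ≥0∞ :=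
  ⨆ t ∈ Icc 0 T, ⨆ j ∈ Icc (2 * m + 3 + k) (bigJ k m n),
    decayFactor N k m n α b j t * norm3 k m n j (v t)

/-- `Φ_{4,T}`. -/
def phi4 (N k m n : ℕ) (α b T : ℝ) (v : ℝ → Sp N → ℂ) : ℝ≥0∞ :=
  ⨆ t ∈ Icc 0 T, decayFactor N k m n α b 1 t / lowerS n (v t)

/-- `Ψ_T = max {Φ_{1,T}, Φ_{2,T}, Φ_{3,T}, Φ_{4,T}}`. -/
def bigPsi (N k m n : ℕ) (α b T : ℝ) (v : ℝ → Sp N → ℂ) : ℝ≥0∞ :=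
  max (max (max (phi1 N k m n α b T v) (phi2 N k m n α b T v)) (phi3 N k m n α b T v))
    (phi4 N k m n α b T v)

/-! ### The constants -/

/-- The lower end `max {3/(2N), 2/(N+1)}` of the admissible range of powers. -/
def alphaMin (N : ℕ) : ℝ := max (3 / (2 * (N : ℝ))) (2 / ((N : ℝ) + 1))

/-- `C` is a constant in the estimates of the solutions of `∂ₜ v = i Δ v + f` in `𝓢`. -/
def IsLinearConst (N k m n : ℕ) (C : ℝ) : Prop :=
  ∀ T : ℝ, 0 ≤ T → ∀ f v : ℝ → Sp N → ℂ,
    ContInS N k m n (Icc 0 T) f → ContInS N k m n (Icc 0 T) v →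
    SolvesSchrodinger (Icc 0 T) f v → ∀ t ∈ Icc 0 T,
      (∀ β : Fin N → ℕ, order β ≤ 2 * m →
        wnorm ∞ n β (v t) ≤ normS N k m n (v 0) + ENNReal.ofReal C *
          ∫⁻ s in Icc 0 t, (normS N k m n (v s) + wnorm ∞ n β (f s))) ∧
      (∀ ν μ : ℕ, ν ≤ k + 1 → μ ≤ n → ∀ β : Fin N → ℕ, order β = ν + μ + 2 * m + 1 →
        wnorm 2 (n - μ) β (v t) ≤ normS N k m n (v 0) + ENNReal.ofReal C *
          ∫⁻ s in Icc 0 t, (normS N k m n (v s) + wnorm 2 (n - μ) β (f s)))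

/-- `C` is a constant in the estimates of the nonlinearity `|v|^α v` in `𝓢`, uniformly for
`α ∈ [max {3/(2N), 2/(N+1)}, 2/N]`. -/
def IsNonlinearConst (N k m n : ℕ) (C : ℝ) : Prop :=
  ∀ α ∈ Icc (alphaMin N) (2 / (N : ℝ)), ∀ v : Sp N → ℂ, MemS N k m n v →
    ∀ η : ℝ, 1 ≤ η → 1 ≤ ENNReal.ofReal η * lowerS n v →
      (∀ β : Fin N → ℕ, order β ≤ 1 →
        wnorm ∞ n β (powNL α v) ≤
          ENNReal.ofReal C * eLpNorm v ∞ volume ^ α * wnorm ∞ n β v) ∧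
      (∀ β : Fin N → ℕ, 2 ≤ order β → order β ≤ 2 * m →
        wnorm ∞ n β (powNL α v) ≤
          ENNReal.ofReal C * eLpNorm v ∞ volume ^ α * wnorm ∞ n β v
          + ENNReal.ofReal C * eLpNorm v ∞ volume ^ α
            * (ENNReal.ofReal η * norm1 n (order β - 1) v) ^ (2 * order β)
            * norm1 n (order β - 1) v) ∧
      (∀ β : Fin N → ℕ, 2 * m + 1 ≤ order β → order β ≤ 2 * m + 2 + k →
        wnorm 2 n β (powNL α v) ≤
          ENNReal.ofReal C * eLpNorm v ∞ volume ^ α * wnorm 2 n β v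
          + ENNReal.ofReal C
            * (ENNReal.ofReal η * norm1 n (2 * m) v) ^ (2 * (bigJ k m n : ℝ) + α)
            * norm1 n (2 * m) v
          + ENNReal.ofReal C * eLpNorm v ∞ volume ^ α
            * (ENNReal.ofReal η * norm1 n (2 * m) v) ^ (2 * bigJ k m n)
            * norm2 m n (order β - 1) v) ∧
      (∀ β : Fin N → ℕ, 2 * m + 3 + k ≤ order β → order β ≤ bigJ k m n →
        wnorm 2 (bigJ k m n - order β) β (powNL α v) ≤
          ENNReal.ofReal C * eLpNorm v ∞ volume ^ α * wnorm 2 (bigJ k m n - order β) β v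
          + ENNReal.ofReal C
            * (ENNReal.ofReal η * norm1 n (2 * m) v) ^ (2 * (bigJ k m n : ℝ) + α)
            * norm1 n (2 * m) v
          + ENNReal.ofReal C * eLpNorm v ∞ volume ^ α
            * (ENNReal.ofReal η * norm1 n (2 * m) v) ^ (2 * bigJ k m n)
            * (norm2 m n (2 * m + 2 + k) v + norm3 k m n (order β - 1) v))

/-- `C` is a constant in the bound `‖v‖_{L^∞((0,t), 𝓢)} ≤ C (1 - b t)^{-σ_J} Ψ_T`. -/
def IsGrowthConst (N k m n : ℕ) (C : ℝ) : Prop :=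
  ∀ α ∈ Icc (alphaMin N) (2 / (N : ℝ)), ∀ b : ℝ, 0 < b → ∀ T ∈ Ioo 0 (1 / b),
    ∀ v : ℝ → Sp N → ℂ, ContInS N k m n (Icc 0 T) v →
      (0 < ⨅ t ∈ Icc 0 T, lowerS n (v t)) → ∀ t ∈ Icc 0 T,
        (⨆ s ∈ Ioo 0 t, normS N k m n (v s)) ≤
          ENNReal.ofReal (C * (1 - b * t) ^ (-sigma N k m n α (bigJ k m n)))
            * bigPsi N k m n α b T v

/-- The threshold `b₁`. -/
def bOne (N k m n : ℕ) (C₁ C₂ C₃ : ℝ) (lam : ℂ) (K α : ℝ) : ℝ :=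
  max (max (16 / (N : ℝ) * (4 * K) ^ (4 / (N : ℝ) + 2)) (8 * C₃))
    (max (32 * (4 * K) ^ (4 * bigJ k m n + 4) * ‖lam‖ * C₁ * C₂ / sigmaOne N k m n)
      ((2 : ℝ) ^ (4 / (N : ℝ) + 3) * α * (4 * K) ^ 2 / ((3 : ℝ) ^ (1 / (N : ℝ)) - 1)))

end DissipativeNLS

end

open DissipativeNLS

open scoped Real
open ENNReal (add_lt_top mul_lt_top ofReal ofReal_add ofReal_le_iff_le_toReal ofReal_le_ofReal
  ofReal_le_ofReal_iff ofReal_lt_top ofReal_mul ofReal_natCast ofReal_ne_top ofReal_one ofReal_pos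
  ofReal_pow ofReal_rpow_of_nonneg ofReal_toReal ofReal_zero one_le_ofReal sum_lt_top
  toReal_le_of_le_ofReal toReal_nonneg)
open Real (exp exp_add exp_le_exp exp_neg exp_pos log mul_rpow norm_eq_abs norm_of_nonneg one_rpow rpow_add
  rpow_le_one rpow_le_rpow rpow_le_rpow_of_exponent_ge rpow_mul rpow_natCast rpow_neg rpow_nonneg
  rpow_pos_of_pos rpow_two rpow_zero sqrt)
open Complex (I I_im I_re I_sq conjCLE conj_ofReal continuous_ofReal imCLM mul_im mul_re neg_im neg_re
  norm_I norm_ofNat norm_real ofRealCLM ofRealCLM_apply reCLM re_add_im real_smul)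
open Finset (card_univ mem_filter mul_sum piAntidiag single_le_sum sum_add_distrib sum_congr sum_const
  sum_le_card_nsmul sum_le_sum sum_mul sum_nonneg sum_product sum_smul sum_sub_distrib)
open EuclideanSpace (basisFun basisFun_apply)
open ContinuousLinearMap (coe_coe coe_smul' flip_apply lsmul lsmul_apply smulRightL)
open TemperedDistribution (fourierInv_apply lineDerivOp_apply_apply smulLeftCLM smulLeftCLM_smul)
open Function (comp_def iterate_succ_apply')
open Filter.Eventually (of_forall)
open Nat (cast_nonneg le_succ)
open MeasureTheory.Lp (coeFn_add coeFn_smul coeFn_sub enorm_def norm_fourier_eq toTemperedDistribution_apply)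

noncomputable section

namespace DissipativeNLS

variable {N k m n : ℕ} {β : Fin N → ℕ}

local notation "𝕄" => Fin N → ℕ
local notation "𝐞" i:max => Pi.single i 1
local notation "𝕀" => Icc (alphaMin N) (2 / (N : ℝ))
local notation "J" => bigJ k m n
local notation "𝔰" => sigma N k m n
local notation "σ₁" => sigmaOne N k m n

/-! ### Test functions -/

/-- Real valued test functions. -/
def IsTest (φ : Sp N → ℝ) : Prop := ContDiff ℝ ∞ φ ∧ HasCompactSupport φ

/-- The `i`-th standard basis vector. -/
abbrev stdVec (i : Fin N) : Sp N := EuclideanSpace.single i (1 : ℝ)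

lemma partialD_contDiff {φ : Sp N → ℝ} (h : ContDiff ℝ ∞ φ) (i : Fin N) : ContDiff ℝ ∞ (partialD i φ) :=
  (h.fderiv_right (m := ∞) (by simp)).clm_apply contDiff_const

lemma IsTest.partialD {φ : Sp N → ℝ} (h : IsTest φ) (i : Fin N) : IsTest (partialD i φ) :=
  ⟨partialD_contDiff h.1 i, h.2.fderiv_apply (𝕜 := ℝ) _⟩

lemma partialD_comm {φ : Sp N → ℝ} (h : ContDiff ℝ ∞ φ) (i j : Fin N) :
    partialD i (partialD j φ) = partialD j (partialD i φ) := by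
  funext x
  have hd : DifferentiableAt ℝ (fderiv ℝ φ) x := ((h.fderiv_right (m := ∞) (by simp)).differentiable (by simp)) x
  have key : ∀ a b : Fin N, partialD a (partialD b φ) x = fderiv ℝ (fderiv ℝ φ) x (stdVec a) (stdVec b) := by
    intro a b
    unfold DissipativeNLS.partialD
    rw [fderiv_clm_apply hd (differentiableAt_const _)]
    simp
  rw [key, key]
  have := (h.contDiffAt (x := x)).isSymmSndFDerivAt
    (by simpa using (WithTop.coe_le_coe.2 le_top : ((2 : ℕ∞) : WithTop ℕ∞) ≤ ((⊤ : ℕ∞) : WithTop ℕ∞)))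
  exact this _ _

lemma iterate_partialD_contDiff {φ : Sp N → ℝ} (h : ContDiff ℝ ∞ φ) (i : Fin N) (n : ℕ) :
    ContDiff ℝ ∞ ((partialD i)^[n] φ) := by
  induction n with
  | zero => exact h
  | succ n ih => rw [iterate_succ_apply']; exact partialD_contDiff ih i

lemma iterate_partialD_comm {φ : Sp N → ℝ} (h : ContDiff ℝ ∞ φ) (i j : Fin N) (n : ℕ) :
    partialD j ((partialD i)^[n] φ) = (partialD i)^[n] (partialD j φ) := by
  induction n with
  | zero => rfl
  | succ n ih =>
    rw [iterate_succ_apply', iterate_succ_apply', ← ih, partialD_comm (iterate_partialD_contDiff h i n)]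

lemma foldD_contDiff (l : List (Fin N)) (β : 𝕄) {φ : Sp N → ℝ} (h : ContDiff ℝ ∞ φ) :
    ContDiff ℝ ∞ (l.foldr (fun i g => (partialD i)^[β i] g) φ) := by
  induction l with
  | nil => exact h
  | cons a l ih => exact iterate_partialD_contDiff ih a _

lemma foldD_comm (l : List (Fin N)) (β : 𝕄) {φ : Sp N → ℝ} (h : ContDiff ℝ ∞ φ) (j : Fin N) :
    partialD j (l.foldr (fun i g => (partialD i)^[β i] g) φ)
      = l.foldr (fun i g => (partialD i)^[β i] g) (partialD j φ) := by
  induction l with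
  | nil => rfl
  | cons a l ih =>
    simp only [List.foldr_cons]
    rw [iterate_partialD_comm (foldD_contDiff l β h), ih]

lemma foldD_add_single (l : List (Fin N)) (hl : l.Nodup) (β : 𝕄) {φ : Sp N → ℝ} (h : ContDiff ℝ ∞ φ) (j : Fin N) :
    l.foldr (fun i g => (partialD i)^[(β + Pi.single j 1 : 𝕄) i] g) φ
      = if j ∈ l then l.foldr (fun i g => (partialD i)^[β i] g) (partialD j φ)
        else l.foldr (fun i g => (partialD i)^[β i] g) φ := by
  induction l with
  | nil => simp
  | cons a l ih =>
    have hl' := List.nodup_cons.mp hl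
    simp only [List.foldr_cons]
    rw [ih hl'.2]
    by_cases haj : j = a
    · subst haj
      simp only [hl'.1, if_false, List.mem_cons, true_or, if_true, Pi.add_apply, Pi.single_eq_same,
        Function.iterate_succ_apply]
      rw [foldD_comm l β h]
    · have : j ∈ a :: l ↔ j ∈ l := by simp [haj]
      simp only [this, Pi.add_apply, Pi.single_apply, if_neg (Ne.symm haj), add_zero]
      split_ifs <;> rfl

lemma multiD_add_single (β : 𝕄) {φ : Sp N → ℝ} (h : ContDiff ℝ ∞ φ) (j : Fin N) :
    multiD (β + Pi.single j 1) φ = multiD β (partialD j φ) := by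
  unfold multiD
  rw [foldD_add_single _ (List.nodup_finRange N) β h]
  simp

lemma multiD_zero (φ : Sp N → ℝ) : multiD 0 φ = φ := by
  unfold multiD
  induction List.finRange N with
  | nil => rfl
  | cons a l ih => simpa using ih

lemma partialD_multiD (β : 𝕄) {φ : Sp N → ℝ} (h : ContDiff ℝ ∞ φ) (j : Fin N) :
    partialD j (multiD β φ) = multiD β (partialD j φ) := foldD_comm _ β h j

lemma order_zero : order (0 : 𝕄) = 0 := by simp [order]

lemma order_add_single (β : 𝕄) (j : Fin N) : order (β + Pi.single j 1) = order β + 1 := by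
  simp [order, sum_add_distrib]

lemma order_add (β γ : 𝕄) : order (β + γ) = order β + order γ := by simp [order, sum_add_distrib]

lemma order_eq_zero : order β = 0 ↔ β = 0 := by simp [order, funext_iff]

lemma exists_add_single {n : ℕ} (h : order β = n + 1) : ∃ γ j, β = γ + Pi.single j 1 ∧ order γ = n := by
  obtain ⟨j, hj⟩ : ∃ j, β j ≠ 0 := by
    by_contra! hc
    have : order β = 0 := order_eq_zero.2 (funext hc)
    omega
  refine ⟨β - Pi.single j 1, j, ?_, ?_⟩
  · funext i
    by_cases hij : i = j
    · subst hij; simp; omega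
    · simp [Pi.single_apply, hij]
  · have : β = (β - Pi.single j 1) + Pi.single j 1 := by
      funext i
      by_cases hij : i = j
      · subst hij; simp; omega
      · simp [Pi.single_apply, hij]
    rw [this, order_add_single] at h
    omega

/-- Induction on multi-indices. -/
lemma multiIndex_induction {P : 𝕄 → Prop} (h0 : P 0) (hs : ∀ β j, P β → P (β + Pi.single j 1)) (β : 𝕄) : P β := by
  induction hn : order β generalizing β with
  | zero => rw [order_eq_zero.1 hn]; exact h0
  | succ n ih =>
    obtain ⟨γ, j, rfl, hγ⟩ := exists_add_single hn
    exact hs _ _ (ih _ hγ)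

lemma IsTest.multiD {φ : Sp N → ℝ} (h : IsTest φ) (β : 𝕄) : IsTest (multiD β φ) := by
  induction β using multiIndex_induction with
  | h0 => rwa [multiD_zero]
  | hs β j ih => rw [multiD_add_single β h.1, ← partialD_multiD β h.1]; exact ih.partialD j

lemma IsTest.integrable_smul {φ : Sp N → ℝ} (h : IsTest φ) {u : Sp N → ℂ}
    (hu : LocallyIntegrable u) : Integrable (fun x => φ x • u x) :=
  hu.integrable_smul_left_of_hasCompactSupport h.1.continuous h.2

lemma ae_eq_of_forall_test {u g : Sp N → ℂ} (hu : LocallyIntegrable u) (hg : LocallyIntegrable g)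
    (h : ∀ φ : Sp N → ℝ, IsTest φ → ∫ x, φ x • u x = ∫ x, φ x • g x) : u =ᵐ[volume] g :=
  ae_eq_of_integral_contDiff_smul_eq hu hg fun φ h1 h2 => h φ ⟨h1, h2⟩

/-! ### First order weak derivatives -/

/-- `g` is the weak derivative of `u` in the `i`-th coordinate direction. -/
structure WeakPartial (i : Fin N) (u g : Sp N → ℂ) : Prop where
  left : LocallyIntegrable u
  right : LocallyIntegrable g
  eq : ∀ φ : Sp N → ℝ, IsTest φ → ∫ x, partialD i φ x • u x = -∫ x, φ x • g x

namespace WeakPartial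

variable {i : Fin N} {u v g h : Sp N → ℂ}

lemma congr (H : WeakPartial i u g) (hu : u =ᵐ[volume] v) (hg : g =ᵐ[volume] h) : WeakPartial i v h := by
  refine ⟨H.left.congr hu, H.right.congr hg, fun φ hφ => ?_⟩
  have := H.eq φ hφ
  rw [integral_congr_ae (g := fun x => partialD i φ x • u x), this, integral_congr_ae (g := fun x => φ x • h x)]
  · filter_upwards [hg] with x hx using by simp [hx]
  · filter_upwards [hu] with x hx using by simp [hx]

lemma unique (H : WeakPartial i u g) (H' : WeakPartial i u h) : g =ᵐ[volume] h := by
  refine ae_eq_of_forall_test H.right H'.right fun φ hφ => ?_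
  have := (H.eq φ hφ).symm.trans (H'.eq φ hφ)
  exact neg_inj.1 this

lemma add (H : WeakPartial i u g) (H' : WeakPartial i v h) :
    WeakPartial i (fun x => u x + v x) (fun x => g x + h x) := by
  refine ⟨H.left.add H'.left, H.right.add H'.right, fun φ hφ => ?_⟩
  simp only [smul_add, Pi.add_apply]
  rw [integral_add ((hφ.partialD i).integrable_smul H.left)
    ((hφ.partialD i).integrable_smul H'.left), integral_add (hφ.integrable_smul H.right)
    (hφ.integrable_smul H'.right), H.eq φ hφ, H'.eq φ hφ]
  ring

lemma const_mul (H : WeakPartial i u g) (c : ℂ) : WeakPartial i (fun x => c * u x) (fun x => c * g x) := by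
  refine ⟨H.left.smul c, H.right.smul c, fun φ hφ => ?_⟩
  have e : ∀ (a : ℝ) (b : ℂ), a • (c * b) = c * (a • b) := fun a b => by
    simp only [real_smul]; ring
  simp only [e]
  rw [integral_const_mul, integral_const_mul, H.eq φ hφ]
  ring

lemma sub (H : WeakPartial i u g) (H' : WeakPartial i v h) :
    WeakPartial i (fun x => u x - v x) (fun x => g x - h x) := by
  have := H.add (H'.const_mul (-1))
  simpa [sub_eq_add_neg] using this

lemma conj (H : WeakPartial i u g) :
    WeakPartial i (fun x => (starRingEnd ℂ) (u x)) (fun x => (starRingEnd ℂ) (g x)) := by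
  have hc : ∀ {w : Sp N → ℂ}, LocallyIntegrable w → LocallyIntegrable (fun x => (starRingEnd ℂ) (w x)) := by
    intro w hw
    refine fun x => ?_
    obtain ⟨s, hs, hi⟩ := hw x
    exact ⟨s, hs, conjCLE.toContinuousLinearMap.integrable_comp hi⟩
  refine ⟨hc H.left, hc H.right, fun φ hφ => ?_⟩
  have e : ∀ (ψ : Sp N → ℝ) (w : Sp N → ℂ), ∫ x, ψ x • (starRingEnd ℂ) (w x) = (starRingEnd ℂ) (∫ x, ψ x • w x) := by
    intro ψ w
    rw [← integral_conj]
    congr 1 with x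
    simp
  rw [e, e, H.eq φ hφ, map_neg]

lemma zero : WeakPartial i (fun _ : Sp N => (0 : ℂ)) (fun _ => 0) := by
  refine ⟨locallyIntegrable_const _, locallyIntegrable_const _, fun φ hφ => by simp⟩

end WeakPartial

/-- Bump functions that concentrate at the origin. -/
def mollifier (n : ℕ) : ContDiffBump (0 : Sp N) :=
  ⟨1 / (n + 2), 1 / (n + 1), by positivity, one_div_lt_one_div_of_lt (by positivity) (by linarith)⟩

lemma tendsto_mollifier : Tendsto (fun n => (mollifier (N := N) n).rOut) atTop (𝓝 0) :=
  tendsto_one_div_add_atTop_nhds_zero_nat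

/-- Mollification. -/
def moll {E : Type*} [NormedAddCommGroup E] [NormedSpace ℝ E] (n : ℕ) (w : Sp N → E) : Sp N → E :=
  convolution ((mollifier n).normed volume) w (lsmul ℝ ℝ) volume

lemma tendsto_moll {E : Type*} [NormedAddCommGroup E] [NormedSpace ℝ E] [CompleteSpace E] {w : Sp N → E}
    (hw : Continuous w) (x : Sp N) :
    Tendsto (fun q : ℕ × Sp N => moll q.1 w q.2) (atTop ×ˢ 𝓝 x) (𝓝 (w x)) :=
  ContDiffBump.convolution_tendsto_right (tendsto_mollifier.comp tendsto_fst)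
    (of_forall fun _ => hw.aestronglyMeasurable) ((hw.tendsto x).comp tendsto_snd) tendsto_snd

/-- The defining identity of a weak derivative extends to test functions of class `C¹`. -/
lemma WeakPartial.eq_of_contDiff_one {i : Fin N} {u g : Sp N → ℂ} (H : WeakPartial i u g)
    {ψ : Sp N → ℝ} (h1 : ContDiff ℝ 1 ψ) (h2 : HasCompactSupport ψ) :
    ∫ x, fderiv ℝ ψ x (stdVec i) • u x = -∫ x, ψ x • g x := by
  set D : Sp N → ℝ := fun x => fderiv ℝ ψ x (stdVec i) with hD
  have hs := fun n => (mollifier (N := N) n).hasCompactSupport_normed (μ := volume)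
  have hcd := fun n => (mollifier (N := N) n).contDiff_normed (μ := volume) (n := (⊤ : ℕ∞))
  have htest : ∀ n, IsTest (moll n ψ) := fun n =>
    ⟨(hs n).contDiff_convolution_left _ (hcd n) h1.continuous.locallyIntegrable, (hs n).convolution _ h2⟩
  have hder : ∀ n, partialD i (moll n ψ) = moll n D := fun n => by
    have hli := (hcd n).continuous.locallyIntegrable (μ := volume)
    funext x
    unfold partialD moll
    rw [(h2.hasFDerivAt_convolution_right (lsmul ℝ ℝ) hli h1 x).fderiv,
      convolution_precompR_apply _ hli (h2.fderiv (𝕜 := ℝ)) (h1.continuous_fderiv (by simp))]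
  have hlim : ∀ w : Sp N → ℝ, Continuous w → HasCompactSupport w → ∀ f : Sp N → ℂ, LocallyIntegrable f →
      Tendsto (fun n => ∫ x, moll n w x • f x) atTop (𝓝 (∫ x, w x • f x)) := by
    intro w hw hws f hf
    obtain ⟨C, hC⟩ := hw.bounded_above_of_compact_support hws
    set S : Set (Sp N) := Metric.cthickening 1 (tsupport w)
    have hS : IsCompact S := hws.isCompact.cthickening
    have hb : ∀ n x, ‖moll n w x‖ ≤ S.indicator (fun _ => 3 * C) x := by
      intro n x
      have key := fun ε => (mollifier (N := N) n).dist_normed_convolution_le (x₀ := x) (ε := ε) hw.aestronglyMeasurable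
        (μ := volume)
      have hn := norm_le_norm_add_norm_sub' (moll n w x) (w x)
      by_cases hx : x ∈ S
      · rw [indicator_of_mem hx]
        have := key (2 * C) fun y _ => (dist_le_norm_add_norm _ _).trans (by linarith [hC x, hC y])
        rw [dist_eq_norm] at this
        exact hn.trans (by linarith! [hC x])
      · have h0 : ∀ y, dist x y ≤ 1 → w y = 0 := fun y hy => by
          by_contra hne
          exact hx (Metric.mem_cthickening_of_dist_le _ _ _ _ (subset_tsupport _ hne) hy)
        have hx0 := h0 x (by simp)
        have hr : (mollifier (N := N) n).rOut ≤ 1 := Nat.one_div_le_one_div (Nat.zero_le n) |>.trans (by simp)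
        have := key 0 fun y hy => by
          rw [h0 y (by rw [dist_comm]; exact (Metric.mem_ball.1 hy).le.trans hr), hx0, dist_self]
        rw [hx0, dist_zero_right] at this
        rw [indicator_of_notMem hx]
        exact this
    have hfi : Integrable (fun x => S.indicator (fun _ => 3 * C) x * ‖f x‖) := by
      refine ((integrable_indicator_iff hS.measurableSet).2 ((hf.integrableOn_isCompact hS).norm.const_mul
        (3 * C))).congr (of_forall fun x => ?_)
      by_cases hx : x ∈ S <;> simp [hx]
    refine tendsto_integral_of_dominated_convergence _ (fun n => ?_) hfi (fun n => ?_) ?_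
    · have hc : Continuous (moll n w) := ((hs n).contDiff_convolution_left _ (hcd n) hw.locallyIntegrable).continuous
      exact hc.aestronglyMeasurable.smul hf.aestronglyMeasurable
    · refine of_forall fun x => ?_
      rw [norm_smul]
      exact mul_le_mul_of_nonneg_right (hb n x) (norm_nonneg _)
    · exact of_forall fun x => ((tendsto_moll hw x).comp (tendsto_id.prodMk tendsto_const_nhds)).smul_const _
  have l1 := hlim D ((h1.continuous_fderiv (by simp)).clm_apply continuous_const) (h2.fderiv_apply (𝕜 := ℝ) _) u H.left
  refine tendsto_nhds_unique l1 ((hlim ψ h1.continuous h2 g H.right).neg.congr fun n => ?_)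
  rw [← hder n]
  exact (H.eq _ (htest n)).symm

/-- Product rule: a function of class `C¹` times a weakly differentiable function. -/
lemma WeakPartial.mul_real {i : Fin N} {u g : Sp N → ℂ} (H : WeakPartial i u g) {f : Sp N → ℝ} (hf : ContDiff ℝ 1 f) :
    WeakPartial i (fun x => f x • u x) (fun x => f x • g x + fderiv ℝ f x (stdVec i) • u x) := by
  have hDc : Continuous fun x => fderiv ℝ f x (stdVec i) :=
    (hf.continuous_fderiv (by simp)).clm_apply continuous_const
  have l : ∀ {a : Sp N → ℝ} {w : Sp N → ℂ}, Continuous a → LocallyIntegrable w →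
      LocallyIntegrable (fun x => a x • w x) := by
    intro a w ha hw
    exact (locallyIntegrableOn_univ.1
      ((locallyIntegrableOn_univ.2 hw).continuousOn_smul isOpen_univ.isLocallyClosed ha.continuousOn))
  refine ⟨l hf.continuous H.left, (l hf.continuous H.right).add (l hDc H.left), fun φ hφ => ?_⟩
  have h1 : ContDiff ℝ 1 (fun x => φ x * f x) := (hφ.1.of_le (by exact_mod_cast le_top)).mul hf
  have := H.eq_of_contDiff_one h1 hφ.2.mul_right
  have hφd : Differentiable ℝ φ := hφ.1.differentiable (by simp)
  have hfd : Differentiable ℝ f := hf.differentiable (by simp)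
  have e : ∀ x, fderiv ℝ (fun x => φ x * f x) x (stdVec i)
      = partialD i φ x * f x + φ x * fderiv ℝ f x (stdVec i) := by
    intro x
    rw [fderiv_fun_mul (hφd x) (hfd x)]
    simp [partialD]
    ring
  simp only [e] at this
  have i1 : Integrable (fun x => partialD i φ x • f x • u x) :=
    (hφ.partialD i).integrable_smul (l hf.continuous H.left)
  have i2 : Integrable (fun x => φ x • fderiv ℝ f x (stdVec i) • u x) := hφ.integrable_smul (l hDc H.left)
  have i3 : Integrable (fun x => φ x • f x • g x) := hφ.integrable_smul (l hf.continuous H.right)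
  simp only [smul_add, add_smul, mul_smul] at this ⊢
  rw [integral_add i1 i2] at this
  rw [integral_add i3 i2, neg_add, ← this]
  ring

lemma weakPartial_const (i : Fin N) : WeakPartial i (fun _ => 1) (fun _ => 0) := by
  refine ⟨locallyIntegrable_const _, locallyIntegrable_const _, fun φ hφ => ?_⟩
  have := integral_mul_fderiv_eq_neg_fderiv_mul_of_integrable (μ := (volume : Measure (Sp N)))
    (f := fun _ => (1 : ℝ)) (g := φ) (v := stdVec i) (𝕜 := ℝ) (by simp)
    (by
      have := (hφ.partialD i).1.continuous.integrable_of_hasCompactSupport (μ := volume) (hφ.partialD i).2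
      unfold partialD at this
      simpa using this)
    (by simpa using hφ.1.continuous.integrable_of_hasCompactSupport hφ.2)
    (by simp) (fun x _ => (hφ.1.differentiable (by simp)) x)
  simp only [one_mul, fderiv_fun_const, Pi.zero_apply, _root_.zero_apply, zero_mul, integral_zero, neg_zero] at this
  have e : ∫ x, partialD i φ x • (1 : ℂ) = ((∫ x, partialD i φ x : ℝ) : ℂ) := by
    rw [← integral_complex_ofReal]; simp
  rw [e]
  unfold partialD
  rw [this]
  simp

lemma WeakPartial.mul {i : Fin N} {u g : Sp N → ℂ} (H : WeakPartial i u g) {f : Sp N → ℂ} (hf : ContDiff ℝ 1 f) :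
    WeakPartial i (fun x => f x * u x) (fun x => f x * g x + fderiv ℝ f x (stdVec i) * u x) := by
  have hre : ContDiff ℝ 1 (fun x => (f x).re) := reCLM.contDiff.comp hf
  have him : ContDiff ℝ 1 (fun x => (f x).im) := imCLM.contDiff.comp hf
  have hfd : Differentiable ℝ f := hf.differentiable (by simp)
  have dre : ∀ x v, fderiv ℝ (fun x => (f x).re) x v = (fderiv ℝ f x v).re := fun x v => by
    have := (reCLM.hasFDerivAt.comp x (hfd x).hasFDerivAt).fderiv
    change fderiv ℝ (reCLM ∘ f) x v = _
    rw [this]; rfl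
  have dim : ∀ x v, fderiv ℝ (fun x => (f x).im) x v = (fderiv ℝ f x v).im := fun x v => by
    have := (imCLM.hasFDerivAt.comp x (hfd x).hasFDerivAt).fderiv
    change fderiv ℝ (imCLM ∘ f) x v = _
    rw [this]; rfl
  have := (H.mul_real hre).add ((H.mul_real him).const_mul I)
  refine this.congr (of_forall fun x => ?_) (of_forall fun x => ?_)
  · simp only [real_smul]
    conv_rhs => rw [← re_add_im (f x)]
    ring
  · simp only [real_smul, dre, dim]
    conv_rhs => rw [← re_add_im (f x), ← re_add_im (fderiv ℝ f x (stdVec i))]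
    ring

lemma weakPartial_of_contDiff {f : Sp N → ℂ} (hf : ContDiff ℝ 1 f) (i : Fin N) :
    WeakPartial i f (fun x => fderiv ℝ f x (stdVec i)) := by
  simpa using (weakPartial_const i).mul hf

/-! ### Continuous weak derivatives are classical -/

/-- The differential with prescribed partial derivatives. -/
def gradForm (g : Fin N → ℂ) : Sp N →L[ℝ] ℂ := ∑ i, (EuclideanSpace.proj i : Sp N →L[ℝ] ℝ).smulRight (g i)

lemma gradForm_apply (g : Fin N → ℂ) (h : Sp N) : gradForm g h = ∑ i, h i • g i := by
  simp [gradForm, ContinuousLinearMap.sum_apply]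

lemma gradForm_stdVec (g : Fin N → ℂ) (i : Fin N) : gradForm g (stdVec i) = g i := by
  rw [gradForm_apply, Finset.sum_eq_single i]
  · simp
  · intro j _ hj; simp [hj]
  · simp

lemma gradForm_of_clm (L : Sp N →L[ℝ] ℂ) : gradForm (fun i => L (stdVec i)) = L := by
  ext x
  conv_rhs => rw [show x = ∑ i, x i • stdVec i by ext j; simp [Finset.sum_apply, Pi.single_apply]]
  simp [gradForm_apply, map_sum]

lemma continuous_gradForm : Continuous (gradForm (N := N)) :=
  continuous_finset_sum _ fun i _ => ((smulRightL ℝ (Sp N) ℂ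
    (EuclideanSpace.proj i)).continuous).comp (continuous_apply i)

lemma hasFDerivAt_moll {u : Sp N → ℂ} {g : Fin N → Sp N → ℂ} (H : ∀ i, WeakPartial i u (g i)) (hu : Continuous u)
    (n : ℕ) (x : Sp N) : HasFDerivAt (moll n u) (gradForm fun i => moll n (g i) x) x := by
  set ρ : Sp N → ℝ := (mollifier n).normed volume with hρ
  have hs : HasCompactSupport ρ := (mollifier n).hasCompactSupport_normed
  have hcd : ContDiff ℝ ∞ ρ := (mollifier n).contDiff_normed
  have hc1 : ContDiff ℝ 1 ρ := hcd.of_le (by exact_mod_cast le_top)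
  have h := hs.hasFDerivAt_convolution_right (lsmul ℝ ℝ : ℝ →L[ℝ] ℂ →L[ℝ] ℂ).flip
    (hu.locallyIntegrable (μ := volume)) hc1 x
  rw [convolution_flip] at h
  refine h.congr_fderiv (.symm (.trans (congrArg gradForm (funext fun i => ?_)) (gradForm_of_clm _)))
  rw [convolution_precompR_apply _ hu.locallyIntegrable (hs.fderiv (𝕜 := ℝ)) (hc1.continuous_fderiv (by simp))]
  have ht : IsTest fun t => ρ (x - t) := ⟨hcd.comp (by fun_prop), hs.comp_homeomorph (Homeomorph.subLeft x)⟩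
  have hd : ∀ t, partialD i (fun t => ρ (x - t)) t = -fderiv ℝ ρ (x - t) (stdVec i) := fun t => by
    have := ((hc1.differentiable (by simp)) (x - t)).hasFDerivAt.comp t ((hasFDerivAt_id t).const_sub x)
    change fderiv ℝ (ρ ∘ HSub.hSub x) t (stdVec i) = _
    rw [this.fderiv]
    simp
  have := (H i).eq _ ht
  simp only [hd, neg_smul, integral_neg, neg_inj] at this
  rw [moll, ← convolution_flip]
  exact this.symm

lemma hasFDerivAt_of_weakPartial {u : Sp N → ℂ} {g : Fin N → Sp N → ℂ} (hu : Continuous u)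
    (hg : ∀ i, Continuous (g i)) (H : ∀ i, WeakPartial i u (g i)) (x : Sp N) :
    HasFDerivAt u (gradForm fun i => g i x) x := by
  have h1 : Tendsto (fun q : ℕ × Sp N => gradForm fun i => moll q.1 (g i) q.2) (atTop ×ˢ 𝓝 x)
      (𝓝 (gradForm fun i => g i x)) :=
    (continuous_gradForm.tendsto _).comp (tendsto_pi_nhds.2 fun i => tendsto_moll (hg i) x)
  have h2 : Tendsto (fun y => gradForm fun i => g i y) (𝓝 x) (𝓝 (gradForm fun i => g i x)) :=
    (continuous_gradForm.comp (continuous_pi hg)).tendsto x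
  have h3 : TendstoUniformlyOnFilter (fun n y => gradForm fun i => moll n (g i) y)
      (fun y => gradForm fun i => g i y) atTop (𝓝 x) := tendstoUniformlyOnFilter_iff_tendsto.2
    (((h2.comp tendsto_snd).prodMk_nhds h1).mono_right (nhds_le_uniformity _))
  exact hasFDerivAt_of_tendstoUniformlyOnFilter h3 (of_forall fun q => hasFDerivAt_moll H hu q.1 q.2)
    (of_forall fun y => (tendsto_moll hu y).comp (tendsto_id.prodMk tendsto_const_nhds))

lemma contDiff_one_of_weakPartial {u : Sp N → ℂ} {g : Fin N → Sp N → ℂ} (hu : Continuous u)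
    (hg : ∀ i, Continuous (g i)) (H : ∀ i, WeakPartial i u (g i)) : ContDiff ℝ 1 u :=
  contDiff_one_iff_hasFDerivAt.2 ⟨_, continuous_gradForm.comp (continuous_pi hg), hasFDerivAt_of_weakPartial hu hg H⟩

/-! ### Jets of weak derivatives -/

/-- `d` is a family of weak derivatives of `d 0`, of orders up to `M`. -/
structure IsJet (M : ℕ) (d : 𝕄 → Sp N → ℂ) : Prop where
  locInt : LocallyIntegrable (d 0)
  step : ∀ β i, order β < M → WeakPartial i (d β) (d (β + 𝐞 i))

lemma IsWeakDeriv.unique {u g h : Sp N → ℂ} (H : IsWeakDeriv β u g) (H' : IsWeakDeriv β u h) : g =ᵐ[volume] h := by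
  refine ae_eq_of_forall_test H.2.1 H'.2.1 fun φ hφ => ?_
  have := (H.2.2 φ hφ.1 hφ.2).symm.trans (H'.2.2 φ hφ.1 hφ.2)
  exact smul_right_injective ℂ (pow_ne_zero _ (by norm_num : (-1 : ℝ) ≠ 0)) this

lemma IsWeakDeriv.congr {u v g h : Sp N → ℂ} (H : IsWeakDeriv β u g)
    (hu : u =ᵐ[volume] v) (hg : g =ᵐ[volume] h) : IsWeakDeriv β v h := by
  refine ⟨H.1.congr hu, H.2.1.congr hg, fun φ h1 h2 => ?_⟩
  have := H.2.2 φ h1 h2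
  rw [integral_congr_ae (g := fun x => multiD β φ x • u x), this, integral_congr_ae (g := fun x => φ x • h x)]
  · filter_upwards [hg] with x hx using by simp [hx]
  · filter_upwards [hu] with x hx using by simp [hx]

namespace IsJet

variable {M : ℕ} {d e : (Fin N → ℕ) → Sp N → ℂ}

lemma isWeakDeriv (H : IsJet M d) (β : 𝕄) (h : order β ≤ M) : IsWeakDeriv β (d 0) (d β) := by
  induction β using multiIndex_induction with
  | h0 => exact ⟨H.locInt, H.locInt, fun φ _ _ => by simp [multiD_zero, order_zero]⟩
  | hs β i ih =>
    rw [order_add_single] at h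
    obtain ⟨h1, h2, h3⟩ := ih (by omega)
    have hw := H.step β i (by omega)
    refine ⟨h1, hw.right, fun φ ha hb => ?_⟩
    have ht := (IsTest.partialD ⟨ha, hb⟩ i : IsTest (partialD i φ))
    rw [multiD_add_single β ha, h3 _ ht.1 ht.2, hw.eq φ ⟨ha, hb⟩, order_add_single, pow_succ]
    simp

lemma locallyIntegrable (H : IsJet M d) (β : 𝕄) (h : order β ≤ M) : LocallyIntegrable (d β) := (H.isWeakDeriv β h).2.1

lemma wnorm_eq (H : IsJet M d) (p : ℝ≥0∞) (a : ℕ) (β : 𝕄) (h : order β ≤ M) :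
    wnorm p a β (d 0) = eLpNorm (fun x => bracket x ^ a • d β x) p := by
  unfold wnorm
  refine le_antisymm (iInf₂_le _ (H.isWeakDeriv β h)) (le_iInf₂ fun g hg => ?_)
  refine (eLpNorm_congr_ae ?_).le
  filter_upwards [hg.unique (H.isWeakDeriv β h)] with x hx
  rw [hx]

lemma mono (H : IsJet M d) {M' : ℕ} (h : M' ≤ M) : IsJet M' d := ⟨H.locInt, fun β i hb => H.step β i (by omega)⟩

lemma congr (H : IsJet M d) (h : ∀ β, order β ≤ M → d β =ᵐ[volume] e β) : IsJet M e := by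
  refine ⟨H.locInt.congr (h 0 (by simp [order_zero])), fun β i hb => ?_⟩
  exact (H.step β i hb).congr (h _ hb.le) (h _ (by rw [order_add_single]; omega))

lemma sub (H : IsJet M d) (H' : IsJet M e) : IsJet M (fun β x => d β x - e β x) :=
  ⟨H.locInt.sub H'.locInt, fun β i hb => (H.step β i hb).sub (H'.step β i hb)⟩

lemma add (H : IsJet M d) (H' : IsJet M e) : IsJet M (fun β x => d β x + e β x) :=
  ⟨H.locInt.add H'.locInt, fun β i hb => (H.step β i hb).add (H'.step β i hb)⟩

lemma const_mul (H : IsJet M d) (c : ℂ) : IsJet M (fun β x => c * d β x) :=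
  ⟨H.locInt.smul c, fun β i hb => (H.step β i hb).const_mul c⟩

lemma ae_eq (H : IsJet M d) (H' : IsJet M e) (h0 : d 0 =ᵐ[volume] e 0) (β : 𝕄)
    (h : order β ≤ M) : d β =ᵐ[volume] e β :=
  ((H.isWeakDeriv β h).congr h0 EventuallyEq.rfl).unique (H'.isWeakDeriv β h)

end IsJet

lemma isJet_of_isWeakDeriv {M : ℕ} {d : 𝕄 → Sp N → ℂ}
    (H : ∀ β, order β ≤ M → IsWeakDeriv β (d 0) (d β)) : IsJet M d := by
  refine ⟨(H 0 (by simp [order_zero])).1, fun β i hb => ?_⟩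
  have h1 := H β hb.le
  have h2 := H (β + 𝐞 i) (by rw [order_add_single]; omega)
  refine ⟨h1.2.1, h2.2.1, fun φ hφ => ?_⟩
  have ht := hφ.partialD i
  have a := h1.2.2 _ ht.1 ht.2
  have b := h2.2.2 _ hφ.1 hφ.2
  rw [multiD_add_single β hφ.1, a, order_add_single, pow_succ, mul_smul] at b
  have := smul_right_injective ℂ (pow_ne_zero _ (by norm_num : (-1 : ℝ) ≠ 0)) b
  simpa using this

lemma exists_isWeakDeriv_of_wnorm {p : ℝ≥0∞} {a : ℕ} {u : Sp N → ℂ}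
    (h : wnorm p a β u < ⊤) : ∃ g, IsWeakDeriv β u g := by
  by_contra! hc
  have : wnorm p a β u = ⊤ := by
    unfold wnorm
    simp [hc]
  exact h.ne this

/-- A function with finite weighted norms has a jet. -/
lemma exists_isJet {M : ℕ} {u : Sp N → ℂ} (h : ∀ β : 𝕄, order β ≤ M → ∃ g, IsWeakDeriv β u g) :
    ∃ d : 𝕄 → Sp N → ℂ, IsJet M d ∧ d 0 = u := by
  classical
  choose! g hg using h
  let d : 𝕄 → Sp N → ℂ := fun β => if β = 0 then u else g β
  have d0 : d 0 = u := by simp [d]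
  refine ⟨d, isJet_of_isWeakDeriv fun β hb => ?_, d0⟩
  rw [d0]
  by_cases h0 : β = 0
  · subst h0
    rw [d0]
    have hu := (hg 0 (by simp [order_zero])).1
    exact ⟨hu, hu, fun φ _ _ => by simp [multiD_zero, order_zero]⟩
  · simpa [d, h0] using hg β hb

open scoped FourierTransform SchwartzMap LineDeriv ComplexConjugate

/-- The Hilbert space `L²(ℝ^N)`. -/
abbrev L2 (N : ℕ) : Type := Lp ℂ 2 (volume : Measure (Sp N))

/-! ### Test functions are dense -/

lemma _root_.MeasureTheory.MemLp.integrable_smul {w : Sp N → ℂ} {φ : Sp N → ℝ} (hw : MemLp w 2) (h : MemLp φ 2) :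
    Integrable fun x => φ x • w x :=
  memLp_one_iff_integrable.1 (hw.smul h)

/-- The sum of the second derivatives of a test function. -/
def lapT (φ : Sp N → ℝ) : Sp N → ℝ := fun x => ∑ i, partialD i (partialD i φ) x

/-- Dilation by the factor `n + 1`. -/
def dilate (n : ℕ) (η : Sp N → ℝ) : Sp N → ℝ := fun x => η ((1 / ((n : ℝ) + 1)) • x)

lemma partialD_mul {f g : Sp N → ℝ} (hf : ContDiff ℝ ∞ f) (hg : ContDiff ℝ ∞ g) (i : Fin N) :
    partialD i (fun x => f x * g x) = fun x => partialD i f x * g x + f x * partialD i g x := by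
  funext x
  simp only [partialD, fderiv_fun_mul (hf.differentiable (by simp) x) (hg.differentiable (by simp) x), add_apply,
    smul_apply, smul_eq_mul]
  ring

lemma partialD_dilate (n : ℕ) (η : Sp N → ℝ) (i : Fin N) :
    partialD i (dilate n η) = fun x => 1 / ((n : ℝ) + 1) * dilate n (partialD i η) x := by
  funext x
  change fderiv ℝ (fun x => η ((1 / ((n : ℝ) + 1)) • x)) x (stdVec i) = _
  rw [fderiv_comp_smul]
  rfl

section cutoff

variable {η φ : Sp N → ℝ} (hη : IsTest η)
include hη

lemma isTest_dilate (n : ℕ) : IsTest (dilate n η) := have h : 1 / ((n : ℝ) + 1) ≠ 0 := by positivity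
  ⟨hη.1.comp (contDiff_const_smul (1 / ((n : ℝ) + 1))), hη.2.comp_homeomorph (Homeomorph.smulOfNeZero _ h)⟩

lemma isTest_dilate_mul (n : ℕ) (hφ : ContDiff ℝ ∞ φ) : IsTest fun x => dilate n η x * φ x :=
  ⟨(isTest_dilate hη n).1.mul hφ, (isTest_dilate hη n).2.mul_right⟩

lemma integrable_dilate_smul {F : Sp N → ℂ} (hF : Integrable F) (n : ℕ) : Integrable fun x => dilate n η x • F x :=
  (isTest_dilate hη n).integrable_smul hF.locallyIntegrable

lemma tendsto_dilate {F : Sp N → ℂ} (hF : Integrable F) :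
    Tendsto (fun n => ∫ x, dilate n η x • F x) atTop (𝓝 (η 0 • ∫ x, F x)) := by
  obtain ⟨C, hC⟩ := hη.1.continuous.bounded_above_of_compact_support hη.2
  rw [← integral_smul]
  refine tendsto_integral_of_dominated_convergence _ (fun n => (integrable_dilate_smul hη hF n).1)
    (hF.norm.const_mul C) (fun n => of_forall fun x => ?_) (of_forall fun x => ?_)
  · rw [norm_smul]
    exact mul_le_mul_of_nonneg_right (hC _) (norm_nonneg _)
  · have := (tendsto_one_div_add_atTop_nhds_zero_nat (𝕜 := ℝ)).smul_const x
    rw [zero_smul] at this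
    exact ((hη.1.continuous.tendsto 0).comp this).smul_const _

variable (hφ : ContDiff ℝ ∞ φ) (h0 : MemLp φ 2) {w : Sp N → ℂ} (hw : MemLp w 2) {i : Fin N}
  (h1 : MemLp (partialD i φ) 2)
include hφ h0 hw h1

lemma tendsto_partialD : Tendsto (fun n => ∫ x, partialD i (fun x => dilate n η x * φ x) x • w x) atTop
    (𝓝 (η 0 • ∫ x, partialD i φ x • w x)) := by
  have := (tendsto_one_div_add_atTop_nhds_zero_nat (𝕜 := ℝ)).smul (tendsto_dilate (hη.partialD i) (hw.integrable_smul h0))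
    |>.add (tendsto_dilate hη (hw.integrable_smul h1))
  rw [zero_smul, zero_add] at this
  refine this.congr fun n => ?_
  rw [← integral_smul]
  refine (integral_add ((integrable_dilate_smul (hη.partialD i) (hw.integrable_smul h0) n).smul (1 / ((n : ℝ) + 1)))
    (integrable_dilate_smul hη (hw.integrable_smul h1) n)).symm.trans ?_
  rw [partialD_mul (isTest_dilate hη n).1 hφ, partialD_dilate]
  simp only [add_smul, mul_smul, Pi.smul_apply]

lemma tendsto_partialD_partialD (h2 : MemLp (partialD i (partialD i φ)) 2) :
    Tendsto (fun n => ∫ x, partialD i (partialD i (fun x => dilate n η x * φ x)) x • w x) atTop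
      (𝓝 (η 0 • ∫ x, partialD i (partialD i φ) x • w x)) := by
  have hη' := hη.partialD i
  have hφ' := partialD_contDiff hφ i
  have := (tendsto_one_div_add_atTop_nhds_zero_nat (𝕜 := ℝ)).smul (tendsto_partialD hη' hφ h0 hw h1)
    |>.add (tendsto_partialD hη hφ' h1 hw h2)
  rw [zero_smul, zero_add] at this
  refine this.congr fun n => ?_
  have d1 := isTest_dilate_mul hη' n hφ
  have d2 := isTest_dilate_mul hη n hφ'
  have hl : LocallyIntegrable w := hw.locallyIntegrable (by norm_num)
  rw [← integral_smul]
  refine (integral_add (((d1.partialD i).integrable_smul hl).smul (1 / ((n : ℝ) + 1))) ((d2.partialD i).integrable_smul hl)).symm.trans ?_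
  congr 1 with x
  rw [partialD_mul (isTest_dilate hη n).1 hφ, partialD_dilate]
  simp only [partialD, mul_assoc] at d1 d2 ⊢
  rw [fderiv_fun_add ((d1.1.differentiable (by simp) x).const_mul _) (d2.1.differentiable (by simp) x),
    fderiv_const_mul (d1.1.differentiable (by simp) x), add_apply, smul_apply, add_smul, smul_assoc]
  rfl

end cutoff

lemma exists_cutoff : ∃ η : Sp N → ℝ, IsTest η ∧ η 0 = 1 := by
  let χ : ContDiffBump (0 : Sp N) := ⟨1, 2, one_pos, one_lt_two⟩
  exact ⟨χ, ⟨χ.contDiff, χ.hasCompactSupport⟩, χ.one_of_mem_closedBall (by simp [χ])⟩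

section schwartz

variable (φ : 𝓢(Sp N, ℂ)) (ℓ : ℂ →L[ℝ] ℝ) {w g : Sp N → ℂ} (hw : MemLp w 2) (hg : MemLp g 2)

lemma memLp_clm : MemLp (fun x => ℓ (φ x)) 2 := ℓ.comp_memLp' (φ.memLp 2)

lemma partialD_clm (i : Fin N) : partialD i (fun x => ℓ (φ x)) = fun x => ℓ ((∂_{stdVec i} φ) x) := by
  funext x
  rw [SchwartzMap.lineDerivOp_apply_eq_fderiv]
  exact congrArg (· (stdVec i)) (ℓ.hasFDerivAt.comp x (φ.differentiableAt.hasFDerivAt)).fderiv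

include hw

lemma schwartz_split : ∫ x, φ x * w x = (∫ x, reCLM (φ x) • w x) + I * ∫ x, imCLM (φ x) • w x := by
  have h := fun ℓ => hw.integrable_smul (memLp_clm φ ℓ)
  rw [← integral_const_mul, ← integral_add (h _) ((h _).const_mul _)]
  congr 1 with x
  conv_lhs => rw [← re_add_im (φ x)]
  simp only [real_smul, Complex.reCLM_apply, Complex.imCLM_apply]
  ring

include hg

lemma WeakPartial.eq_schwartz {i : Fin N} (H : WeakPartial i w g) :
    ∫ x, (∂_{stdVec i} φ) x * w x = -∫ x, φ x * g x := by
  obtain ⟨η, hη, h1⟩ := exists_cutoff (N := N)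
  have key : ∀ ℓ : ℂ →L[ℝ] ℝ, ∫ x, ℓ ((∂_{stdVec i} φ) x) • w x = -∫ x, ℓ (φ x) • g x := fun ℓ => by
    have hφ : ContDiff ℝ ∞ fun x => ℓ (φ x) := ℓ.contDiff.comp (φ.smooth ⊤)
    have t1 := tendsto_partialD hη hφ (memLp_clm φ ℓ) hw (i := i) (by rw [partialD_clm]; exact memLp_clm _ ℓ)
    have t2 := (tendsto_dilate hη (hg.integrable_smul (memLp_clm φ ℓ))).neg
    rw [h1, one_smul] at t1 t2
    rw [partialD_clm φ ℓ] at t1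
    refine tendsto_nhds_unique t1 (t2.congr fun n => ?_)
    rw [H.eq _ (isTest_dilate_mul hη n hφ)]
    simp only [mul_smul]
  rw [schwartz_split _ hw, schwartz_split _ hg, key, key]
  ring

lemma laplacian_eq_schwartz (H : ∀ φ : Sp N → ℝ, IsTest φ → ∫ x, φ x • g x = ∫ x, lapT φ x • w x) :
    ∫ x, (Δ φ) x * w x = ∫ x, φ x * g x := by
  obtain ⟨η, hη, h1⟩ := exists_cutoff (N := N)
  have hl : LocallyIntegrable w := hw.locallyIntegrable (by norm_num)
  have e : ∀ x, (Δ φ) x = ∑ i, (∂_{stdVec i} (∂_{stdVec i} φ) : 𝓢(Sp N, ℂ)) x := fun x => by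
    rw [SchwartzMap.laplacian_eq_sum (basisFun (Fin N) ℝ), sum_apply]
    simp only [basisFun_apply]
    rfl
  have key : ∀ ℓ : ℂ →L[ℝ] ℝ, ∫ x, ℓ ((Δ φ) x) • w x = ∫ x, ℓ (φ x) • g x := fun ℓ => by
    have hφ : ContDiff ℝ ∞ fun x => ℓ (φ x) := ℓ.contDiff.comp (φ.smooth ⊤)
    have m : ∀ i, MemLp (partialD i (partialD i fun x => ℓ (φ x))) 2 := fun i => by
      rw [partialD_clm, partialD_clm]; exact memLp_clm _ ℓ
    have t1 := tendsto_finset_sum Finset.univ fun i _ => tendsto_partialD_partialD hη hφ (memLp_clm φ ℓ) hw (i := i)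
      (by rw [partialD_clm]; exact memLp_clm _ ℓ) (m i)
    have t2 := tendsto_dilate hη (hg.integrable_smul (memLp_clm φ ℓ))
    simp only [h1, one_smul] at t1 t2
    rw [← integral_finset_sum _ fun i _ => hw.integrable_smul (m i)] at t1
    refine .trans ?_ (tendsto_nhds_unique (t1.congr fun n => ?_) t2)
    rotate_left
    · have ht := isTest_dilate_mul hη n hφ
      have := H _ ht
      simp only [mul_smul, lapT, sum_smul] at this
      rw [this, integral_finset_sum _ fun i _ => ((ht.partialD i).partialD i).integrable_smul hl]
    · congr 1 with x
      simp only [e, map_sum, sum_smul, partialD_clm]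
  rw [schwartz_split _ hw, schwartz_split _ hg, key, key]

end schwartz

/-! ### Weak derivatives and the Fourier transform -/

lemma L2.locallyIntegrable (w : L2 N) : LocallyIntegrable w := (Lp.memLp w).locallyIntegrable (by norm_num)

lemma fderiv_ofReal {φ : Sp N → ℝ} (h : Differentiable ℝ φ) (i : Fin N) (x : Sp N) :
    fderiv ℝ (fun x => (φ x : ℂ)) x (stdVec i) = (partialD i φ x : ℂ) :=
  congrArg (· (stdVec i)) (ofRealCLM.hasFDerivAt.comp x (h x).hasFDerivAt).fderiv

lemma weakPartial_iff_lineDeriv {i : Fin N} {w g : L2 N} :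
    WeakPartial i w g ↔ ∂_{stdVec i} (w : 𝓢'(Sp N, ℂ)) = (g : 𝓢'(Sp N, ℂ)) := by
  constructor
  · intro H
    ext φ
    rw [lineDerivOp_apply_apply, toTemperedDistribution_apply, toTemperedDistribution_apply]
    have := H.eq_schwartz φ (Lp.memLp w) (Lp.memLp g)
    simp only [neg_apply, smul_eq_mul, neg_mul, integral_neg, this, neg_neg]
  · intro H
    refine ⟨L2.locallyIntegrable w, L2.locallyIntegrable g, fun φ hφ => ?_⟩
    have h1 : HasCompactSupport (fun x => (φ x : ℂ)) := hφ.2.comp_left (g := Complex.ofReal) rfl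
    have h2 : ContDiff ℝ ∞ (fun x => (φ x : ℂ)) := ofRealCLM.contDiff.comp hφ.1
    have := DFunLike.congr_fun H (h1.toSchwartzMap h2)
    rw [lineDerivOp_apply_apply, toTemperedDistribution_apply, toTemperedDistribution_apply] at this
    have e : ∀ x, (∂_{stdVec i} (h1.toSchwartzMap h2)) x = (partialD i φ x : ℂ) := fun x => by
      rw [SchwartzMap.lineDerivOp_apply_eq_fderiv]
      exact fderiv_ofReal (hφ.1.differentiable (by simp)) i x
    simp only [neg_apply, e, smul_eq_mul, neg_mul, integral_neg] at this
    simp only [real_smul]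
    rw [← neg_eq_iff_eq_neg, this]
    rfl

lemma ae_eq_mul_of_tempered {m : Sp N → ℂ} (hm : m.HasTemperateGrowth) {w g : L2 N} :
    (g : 𝓢'(Sp N, ℂ)) = smulLeftCLM ℂ m (w : 𝓢'(Sp N, ℂ)) ↔ g =ᵐ[volume] fun x => m x * w x := by
  have hmc : Continuous m := hm.1.continuous
  constructor
  · intro H
    refine ae_eq_of_forall_test (L2.locallyIntegrable g) ?_ fun φ hφ => ?_
    · exact (locallyIntegrableOn_univ.1 ((locallyIntegrableOn_univ.2 (L2.locallyIntegrable w)).continuousOn_smul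
          isOpen_univ.isLocallyClosed hmc.continuousOn))
    have h1 : HasCompactSupport (fun x => (φ x : ℂ)) := hφ.2.comp_left (g := Complex.ofReal) rfl
    have h2 : ContDiff ℝ ∞ (fun x => (φ x : ℂ)) := ofRealCLM.contDiff.comp hφ.1
    have := DFunLike.congr_fun H (h1.toSchwartzMap h2)
    rw [TemperedDistribution.smulLeftCLM_apply_apply, toTemperedDistribution_apply,
      toTemperedDistribution_apply] at this
    simp only [SchwartzMap.smulLeftCLM_apply_apply hm] at this
    simp only [real_smul]
    refine Eq.trans (Eq.trans ?_ this) ?_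
    · rfl
    · congr 1 with x
      simp only [HasCompactSupport.toSchwartzMap_toFun, smul_eq_mul]
      ring
  · intro H
    ext φ
    rw [TemperedDistribution.smulLeftCLM_apply_apply, toTemperedDistribution_apply, toTemperedDistribution_apply]
    refine integral_congr_ae ?_
    filter_upwards [H] with x hx
    rw [hx, SchwartzMap.smulLeftCLM_apply_apply hm]
    simp only [smul_eq_mul]
    ring

lemma hasTemperateGrowth_coord (i : Fin N) (c : ℂ) : (fun x : Sp N => c * (x i : ℂ)).HasTemperateGrowth := by
  have : (fun x : Sp N => c * (x i : ℂ))
      = fun x => c * ((ofRealCLM.comp (EuclideanSpace.proj i : Sp N →L[ℝ] ℝ)) x) := rfl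
  rw [this]
  fun_prop

lemma inner_stdVec (i : Fin N) (x : Sp N) : inner ℝ x (stdVec i) = x i := by simp [EuclideanSpace.inner_single_right]

lemma smulLeft_inner (i : Fin N) (c : ℂ) (T : 𝓢'(Sp N, ℂ)) :
    c • smulLeftCLM ℂ (fun x : Sp N => ((inner ℝ x (stdVec i) : ℝ) : ℂ)) T
      = smulLeftCLM ℂ (fun x : Sp N => c * (x i : ℂ)) T := by
  have h : (fun x : Sp N => (x i : ℂ)).HasTemperateGrowth := by simpa using hasTemperateGrowth_coord i 1
  have e : (fun x : Sp N => ((inner ℝ x (stdVec i) : ℝ) : ℂ)) = fun x => (x i : ℂ) := by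
    funext x; rw [inner_stdVec]
  rw [e]
  have := smulLeftCLM_smul (F := ℂ) h c
  have e2 : (fun x : Sp N => c * (x i : ℂ)) = c • fun x : Sp N => (x i : ℂ) := rfl
  rw [e2, this]
  rfl

lemma weakPartial_iff_fourier {i : Fin N} {w g : L2 N} : WeakPartial i w g ↔ (𝓕 g : L2 N) =ᵐ[volume]
      fun ξ => (2 * π * I * (ξ i : ℂ)) * (𝓕 w : L2 N) ξ := by
  rw [weakPartial_iff_lineDeriv, ← ae_eq_mul_of_tempered
    (m := fun ξ => 2 * π * I * (ξ i : ℂ)) (hasTemperateGrowth_coord i _),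
    ← smulLeft_inner, ← Lp.fourier_toTemperedDistribution_eq,
    ← Lp.fourier_toTemperedDistribution_eq, ← TemperedDistribution.fourier_lineDerivOp_eq]
  constructor
  · intro h; rw [h]
  · intro h
    have := congrArg (fun T : 𝓢'(Sp N, ℂ) => 𝓕⁻ T) h
    simpa using this.symm

lemma weakPartial_iff_fourierInv {i : Fin N} {w g : L2 N} : WeakPartial i w g ↔ (𝓕⁻ g : L2 N) =ᵐ[volume]
      fun ξ => (-(2 * π * I) * (ξ i : ℂ)) * (𝓕⁻ w : L2 N) ξ := by
  rw [weakPartial_iff_lineDeriv, ← ae_eq_mul_of_tempered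
    (m := fun ξ => -(2 * π * I) * (ξ i : ℂ)) (hasTemperateGrowth_coord i _),
    ← smulLeft_inner, ← Lp.fourierInv_toTemperedDistribution_eq,
    ← Lp.fourierInv_toTemperedDistribution_eq, ← TemperedDistribution.fourierInv_lineDerivOp_eq]
  constructor
  · intro h; rw [h]
  · intro h
    have := congrArg (fun T : 𝓢'(Sp N, ℂ) => 𝓕 T) h
    simpa using this.symm

/-- The Fourier transform of a weak Laplacian. -/
lemma fourier_of_weak_laplacian {w g : L2 N} (H : ∀ φ : Sp N → ℝ, IsTest φ → ∫ x, φ x • g x = ∫ x, lapT φ x • w x) :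
    (𝓕 g : L2 N) =ᵐ[volume] fun ξ => -(((2 * π) ^ 2 * ‖ξ‖ ^ 2 : ℝ) : ℂ) * (𝓕 w : L2 N) ξ := by
  have hL : Δ (w : 𝓢'(Sp N, ℂ)) = (g : 𝓢'(Sp N, ℂ)) := by
    ext φ
    rw [TemperedDistribution.laplacian_apply_apply, toTemperedDistribution_apply, toTemperedDistribution_apply]
    exact laplacian_eq_schwartz φ (Lp.memLp w) (Lp.memLp g) H
  have hg : (fun ξ : Sp N => -(((2 * π) ^ 2 * ‖ξ‖ ^ 2 : ℝ) : ℂ)).HasTemperateGrowth := by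
    have : (fun ξ : Sp N => -(((2 * π) ^ 2 * ‖ξ‖ ^ 2 : ℝ) : ℂ))
      = fun ξ => (-(2 * π : ℂ) ^ 2) * ((‖ξ‖ ^ 2 : ℝ) : ℂ) := by funext ξ; push_cast; ring
    rw [this]
    fun_prop
  rw [← ae_eq_mul_of_tempered hg, ← Lp.fourier_toTemperedDistribution_eq,
    ← Lp.fourier_toTemperedDistribution_eq, ← hL, TemperedDistribution.laplacian_eq_fourierMultiplierCLM,
    TemperedDistribution.fourierMultiplierCLM_apply]
  have h2 : (fun ξ : Sp N => ((‖ξ‖ ^ 2 : ℝ) : ℂ)).HasTemperateGrowth := by fun_prop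
  have := smulLeftCLM_smul (F := ℂ) h2 (-(2 * π : ℂ) ^ 2)
  have e2 : (fun ξ : Sp N => -(((2 * π) ^ 2 * ‖ξ‖ ^ 2 : ℝ) : ℂ))
      = (-(2 * π : ℂ) ^ 2) • fun ξ : Sp N => ((‖ξ‖ ^ 2 : ℝ) : ℂ) := by
    funext ξ
    simp only [Pi.smul_apply, smul_eq_mul]
    push_cast; ring
  rw [e2, this]
  ext φ
  simp

/-! ### Multiplication operators on `L²` -/

lemma memLp_bdd_mul {m w : Sp N → ℂ} (hm : Measurable m) {C : ℝ} (hC : ∀ x, ‖m x‖ ≤ C)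
    (hw : MemLp w 2) : MemLp (fun x => m x * w x) 2 :=
  hw.of_le_mul (c := C) (hm.aestronglyMeasurable.mul hw.1) (of_forall fun x => by
    rw [norm_mul]; exact mul_le_mul_of_nonneg_right (hC x) (norm_nonneg _))

/-- Multiplication by a bounded measurable function. -/
def mulL2 (m : Sp N → ℂ) (hm : Measurable m) (C : ℝ) (hC : ∀ x, ‖m x‖ ≤ C) : L2 N →L[ℂ] L2 N := LinearMap.mkContinuous
    { toFun := fun w => (memLp_bdd_mul hm hC (Lp.memLp w)).toLp _
      map_add' := fun w v => by
        rw [← MemLp.toLp_add]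
        apply MemLp.toLp_congr
        filter_upwards [coeFn_add w v] with x hx
        change m x * (w + v : L2 N) x = _
        rw [hx]
        exact mul_add _ _ _
      map_smul' := fun c w => by
        rw [RingHom.id_apply, ← MemLp.toLp_const_smul]
        apply MemLp.toLp_congr
        filter_upwards [coeFn_smul c w] with x hx
        simp only [hx, Pi.smul_apply, smul_eq_mul]
        ring } C (fun w => by
    refine Lp.norm_le_mul_norm_of_ae_le_mul ?_
    filter_upwards [MemLp.coeFn_toLp (memLp_bdd_mul hm hC (Lp.memLp w))] with x hx
    change ‖((memLp_bdd_mul hm hC (Lp.memLp w)).toLp _ : Sp N → ℂ) x‖ ≤ _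
    rw [hx, norm_mul]
    exact mul_le_mul_of_nonneg_right (hC x) (norm_nonneg _))

lemma coeFn_mulL2 (m : Sp N → ℂ) (hm : Measurable m) (C : ℝ) (hC : ∀ x, ‖m x‖ ≤ C) (w : L2 N) :
    mulL2 m hm C hC w =ᵐ[volume] fun x => m x * w x :=
  MemLp.coeFn_toLp (memLp_bdd_mul hm hC (Lp.memLp w))

lemma norm_mulL2_le (m : Sp N → ℂ) (hm : Measurable m) (C : ℝ) (hC : ∀ x, ‖m x‖ ≤ C) (w : L2 N) :
    ‖mulL2 m hm C hC w‖ ≤ C * ‖w‖ := by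
  refine Lp.norm_le_mul_norm_of_ae_le_mul ?_
  filter_upwards [coeFn_mulL2 m hm C hC w] with x hx
  rw [hx, norm_mul]
  exact mul_le_mul_of_nonneg_right (hC x) (norm_nonneg _)

lemma L2.norm_sq_eq (f : L2 N) : ‖f‖ ^ 2 = ∫ x, ‖f x‖ ^ 2 := by
  have h := L2.inner_def (𝕜 := ℂ) f f
  rw [inner_self_eq_norm_sq_to_K] at h
  have e : ∀ x, inner ℂ (f x) (f x) = ((‖f x‖ ^ 2 : ℝ) : ℂ) := fun x => by
    rw [inner_self_eq_norm_sq_to_K]; push_cast; rfl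
  simp only [e] at h
  rw [integral_complex_ofReal] at h
  apply Complex.ofReal_injective
  rw [← h]
  push_cast
  rfl

lemma L2.integrable_norm_sq (f : L2 N) : Integrable (fun x => ‖f x‖ ^ 2) :=
  (Lp.memLp f).integrable_norm_pow (by norm_num)

lemma L2.integrable_norm_mul (f g : L2 N) : Integrable (fun x => ‖f x‖ * ‖g x‖) :=
  (Lp.memLp f).norm.integrable_mul (Lp.memLp g).norm

/-! ### The Schrödinger group on `L²` -/

/-- The symbol of the Schrödinger group. -/
def phase (t : ℝ) (ξ : Sp N) : ℂ := Complex.exp (((-(4 * π ^ 2 * t * ‖ξ‖ ^ 2) : ℝ) : ℂ) * I)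

lemma norm_phase (t : ℝ) (ξ : Sp N) : ‖phase t ξ‖ = 1 := Complex.norm_exp_ofReal_mul_I _

lemma phase_contDiff (t : ℝ) {n : WithTop ℕ∞} : ContDiff ℝ n (phase t : Sp N → ℂ) := by
  unfold phase
  refine ContDiff.cexp (ContDiff.mul (ofRealCLM.contDiff.comp ?_) contDiff_const)
  exact (contDiff_const.mul (contDiff_norm_sq ℝ)).neg

lemma phase_continuous (t : ℝ) : Continuous (phase t : Sp N → ℂ) := (phase_contDiff t (n := 0)).continuous

lemma phase_add (s t : ℝ) (ξ : Sp N) : phase (s + t) ξ = phase s ξ * phase t ξ := by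
  unfold phase
  rw [← Complex.exp_add]
  congr 1
  push_cast
  ring

lemma phase_zero (ξ : Sp N) : phase 0 ξ = 1 := by simp [phase]

lemma hasDerivAt_phase (t : ℝ) (ξ : Sp N) :
    HasDerivAt (fun t => phase t ξ) (-(I * (((2 * π) ^ 2 * ‖ξ‖ ^ 2 : ℝ) : ℂ)) * phase t ξ) t := by
  unfold phase
  have h1 : HasDerivAt (fun t : ℝ => ((-(4 * π ^ 2 * t * ‖ξ‖ ^ 2) : ℝ) : ℂ) * I)
      (((-(4 * π ^ 2 * 1 * ‖ξ‖ ^ 2) : ℝ) : ℂ) * I) t :=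
    ((((hasDerivAt_id t).const_mul _).mul_const _).neg.ofReal_comp).mul_const _
  convert h1.cexp using 1
  push_cast
  ring

lemma continuous_phase_time (ξ : Sp N) : Continuous fun t => phase t ξ :=
  continuous_iff_continuousAt.2 fun t => (hasDerivAt_phase t ξ).continuousAt

/-- The Schrödinger group `e^{itΔ}` on `L²`. -/
def schr (t : ℝ) : L2 N →L[ℂ] L2 N :=
  ((Lp.fourierTransformₗᵢ (Sp N) ℂ).symm.toContinuousLinearEquiv : L2 N →L[ℂ] L2 N) ∘L
    mulL2 (phase t) (phase_continuous t).measurable 1 (fun ξ => (norm_phase t ξ).le) ∘L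
    ((Lp.fourierTransformₗᵢ (Sp N) ℂ).toContinuousLinearEquiv : L2 N →L[ℂ] L2 N)

lemma fourier_schr_eq (t : ℝ) (w : L2 N) : (𝓕 (schr t w) : L2 N)
    = mulL2 (phase t) (phase_continuous t).measurable 1 (fun ξ => (norm_phase t ξ).le) (𝓕 w) :=
  (Lp.fourierTransformₗᵢ (Sp N) ℂ).apply_symm_apply _

lemma fourier_schr (t : ℝ) (w : L2 N) : (𝓕 (schr t w) : L2 N) =ᵐ[volume] fun ξ => phase t ξ * (𝓕 w : L2 N) ξ := by
  rw [fourier_schr_eq]; exact coeFn_mulL2 _ _ _ _ _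

lemma L2.fourier_ext {w v : L2 N} (h : (𝓕 w : L2 N) =ᵐ[volume] (𝓕 v : L2 N)) : w = v :=
  (Lp.fourierTransformₗᵢ (Sp N) ℂ).injective (Lp.ext h)

lemma schr_zero (w : L2 N) : schr 0 w = w := by
  refine L2.fourier_ext ?_
  filter_upwards [fourier_schr 0 w] with x hx
  rw [hx, phase_zero, one_mul]

lemma schr_add (s t : ℝ) (w : L2 N) : schr (s + t) w = schr s (schr t w) := by
  refine L2.fourier_ext ?_
  filter_upwards [fourier_schr (s + t) w, fourier_schr s (schr t w), fourier_schr t w] with x h1 h2 h3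
  rw [h1, h2, h3, phase_add, mul_assoc]

lemma norm_schr (t : ℝ) (w : L2 N) : ‖schr t w‖ = ‖w‖ := by
  rw [← norm_fourier_eq (schr t w), ← norm_fourier_eq w]
  refine le_antisymm (Lp.norm_le_norm_of_ae_le ?_) (Lp.norm_le_norm_of_ae_le ?_) <;>
  · filter_upwards [fourier_schr t w] with x hx
    rw [hx, norm_mul, norm_phase, one_mul]

lemma continuous_schr (w : L2 N) : Continuous fun t => schr t w := by
  rw [continuous_iff_continuousAt]
  intro s
  rw [ContinuousAt, tendsto_iff_norm_sub_tendsto_zero]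
  have hsq : ∀ t, ‖schr t w - schr s w‖ ^ 2 = ∫ ξ, ‖phase t ξ - phase s ξ‖ ^ 2 * ‖(𝓕 w : L2 N) ξ‖ ^ 2 := by
    intro t
    rw [← norm_fourier_eq, L2.norm_sq_eq]
    refine integral_congr_ae ?_
    have e : (𝓕 (schr t w - schr s w) : L2 N) = 𝓕 (schr t w) - 𝓕 (schr s w) :=
      (Lp.fourierTransformₗᵢ (Sp N) ℂ).map_sub _ _
    rw [e]
    filter_upwards [coeFn_sub (𝓕 (schr t w) : L2 N) (𝓕 (schr s w)), fourier_schr t w,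
      fourier_schr s w] with x h1 h2 h3
    rw [h1, Pi.sub_apply, h2, h3, ← sub_mul, norm_mul, mul_pow]
  have lim : Tendsto (fun t => ∫ ξ, ‖phase t ξ - phase s ξ‖ ^ 2 * ‖(𝓕 w : L2 N) ξ‖ ^ 2) (𝓝 s)
      (𝓝 (∫ ξ : Sp N, 0)) := by
    refine tendsto_integral_filter_of_dominated_convergence
      (fun ξ => 4 * ‖(𝓕 w : L2 N) ξ‖ ^ 2) (of_forall fun t => ?_)
      (of_forall fun t => of_forall fun ξ => ?_)
      ((L2.integrable_norm_sq _).const_mul 4) (of_forall fun ξ => ?_)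
    · exact (((phase_continuous t).sub (phase_continuous s)).norm.pow 2).aestronglyMeasurable.mul
        ((L2.integrable_norm_sq _).1)
    · rw [norm_of_nonneg (by positivity)]
      refine mul_le_mul_of_nonneg_right ?_ (by positivity)
      have : ‖phase t ξ - phase s ξ‖ ≤ 2 := by
        refine (norm_sub_le _ _).trans ?_
        rw [norm_phase, norm_phase]; norm_num
      nlinarith [norm_nonneg (phase t ξ - phase s ξ)]
    · have h1 : Tendsto (fun t => phase t ξ) (𝓝 s) (𝓝 (phase s ξ)) := (continuous_phase_time ξ).tendsto s
      have h2 : Tendsto (fun t => ‖phase t ξ - phase s ξ‖) (𝓝 s) (𝓝 0) := tendsto_iff_norm_sub_tendsto_zero.1 h1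
      simpa using (h2.pow 2).mul_const (‖(𝓕 w : L2 N) ξ‖ ^ 2)
  rw [integral_zero] at lim
  have := (Real.continuous_sqrt.tendsto 0).comp (lim.congr fun t => (hsq t).symm)
  rw [Real.sqrt_zero] at this
  refine this.congr fun t => ?_
  simp [Real.sqrt_sq]

lemma WeakPartial.evol {i : Fin N} {w g : L2 N} (H : WeakPartial i w g) (t : ℝ) :
    WeakPartial i (schr t w : L2 N) (schr t g : L2 N) := by
  rw [weakPartial_iff_fourier] at H ⊢
  filter_upwards [H, fourier_schr t w, fourier_schr t g] with x h1 h2 h3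
  rw [h2, h3, h1]
  ring

lemma fderiv_phase (t : ℝ) (ξ : Sp N) (j : Fin N) :
    fderiv ℝ (phase t) ξ (stdVec j) = -(8 * π ^ 2 * t * ξ j) * I * phase t ξ := by
  have h1 : HasFDerivAt (fun ξ : Sp N => ‖ξ‖ ^ 2) (2 • innerSL ℝ ξ) ξ := (hasStrictFDerivAt_norm_sq ξ).hasFDerivAt
  have h2 := (ofRealCLM.hasFDerivAt.comp ξ ((h1.const_mul (4 * π ^ 2 * t)).neg)).mul_const I
  have h3 := h2.cexp
  have h4 : fderiv ℝ (phase t) ξ = _ := h3.fderiv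
  rw [h4]
  have e : inner ℝ ξ (stdVec j) = ξ j := inner_stdVec j ξ
  simp only [smul_apply, ContinuousLinearMap.comp_apply, neg_apply,
    nsmul_eq_mul, smul_eq_mul, innerSL_apply_apply, ofRealCLM_apply, coe_smul', Pi.smul_apply]
  rw [e]
  unfold phase
  have e2 : ∀ f : Sp N → ℝ, ((-f) ξ : ℝ) = -(f ξ) := fun _ => rfl
  simp only [Function.comp, ofRealCLM_apply, mul_assoc, e2]
  push_cast
  ring_nf

/-- The commutation relation `x_j e^{itΔ} = e^{itΔ} (x_j - 2 i t ∂_j)`. -/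
lemma coord_mul_schr {j : Fin N} {w g h : L2 N} (hx : g =ᵐ[volume] fun x => (x j : ℂ) * w x)
    (hd : WeakPartial j w h) (t : ℝ) :
    (schr t g - (2 * t * I : ℂ) • schr t h : L2 N) =ᵐ[volume] fun x => (x j : ℂ) * schr t w x := by
  have hpi : (π : ℂ) ≠ 0 := by exact_mod_cast Real.pi_ne_zero
  have hc : (-(2 * π * I) : ℂ) ≠ 0 := by simp [hpi]
  -- the Fourier transform of `w` is weakly differentiable
  have H1 : WeakPartial j (𝓕 w : L2 N) (𝓕 ((-(2 * π * I) : ℂ) • g) : L2 N) := by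
    rw [weakPartial_iff_fourierInv]
    simp only [FourierTransform.fourierInv_fourier_eq]
    filter_upwards [hx, coeFn_smul (-(2 * π * I) : ℂ) g] with x h1 h2
    rw [h2, Pi.smul_apply, h1, smul_eq_mul]
    ring
  have H2 := H1.mul (phase_contDiff t (n := 1))
  have hF := weakPartial_iff_fourier.1 hd
  set k : L2 N := schr t g - (2 * t * I : ℂ) • schr t h with hk
  have hsm : ∀ (c : ℂ) (v : L2 N), (𝓕 (c • v) : L2 N) = c • 𝓕 v := fun c v =>
    (Lp.fourierTransformₗᵢ (Sp N) ℂ).map_smul c v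
  have hsub : ∀ (u v : L2 N), (𝓕 (u - v) : L2 N) = 𝓕 u - 𝓕 v := fun u v =>
    (Lp.fourierTransformₗᵢ (Sp N) ℂ).map_sub u v
  have H3 : WeakPartial j (𝓕 (schr t w) : L2 N) (𝓕 ((-(2 * π * I) : ℂ) • k) : L2 N) := by
    refine H2.congr (fourier_schr t w).symm ?_
    rw [hsm, hsm, hk, hsub, hsm]
    filter_upwards [hF, fourier_schr t g, fourier_schr t h, coeFn_smul (-(2 * π * I) : ℂ) (𝓕 g : L2 N),
      coeFn_smul (-(2 * π * I) : ℂ) ((𝓕 (schr t g) : L2 N) - (2 * t * I : ℂ) • (𝓕 (schr t h) : L2 N)),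
      coeFn_sub (𝓕 (schr t g) : L2 N) ((2 * t * I : ℂ) • (𝓕 (schr t h) : L2 N)),
      coeFn_smul (2 * t * I : ℂ) (𝓕 (schr t h) : L2 N)] with x h1 h2 h3 h4 h5 h6 h7
    rw [h5, h4, Pi.smul_apply, Pi.smul_apply, h6, Pi.sub_apply, h7, Pi.smul_apply, h2, h3, h1, fderiv_phase]
    simp only [smul_eq_mul]
    linear_combination (-8 * π ^ 2 * t * (x j : ℂ) * phase t x * (𝓕 w : L2 N) x * I) * I_sq
  rw [weakPartial_iff_fourierInv] at H3
  simp only [FourierTransform.fourierInv_fourier_eq] at H3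
  filter_upwards [H3, coeFn_smul (-(2 * π * I) : ℂ) k] with x h1 h2
  rw [h2, Pi.smul_apply, smul_eq_mul, mul_assoc (-(2 * π * I) : ℂ)] at h1
  exact mul_left_cancel₀ hc h1

/-! ### Weak formulation of the Schrödinger equation -/

lemma memLp_test {φ : Sp N → ℝ} (hφ : IsTest φ) : MemLp (fun x => (φ x : ℂ)) 2 :=
  (continuous_ofReal.comp hφ.1.continuous).memLp_of_hasCompactSupport (hφ.2.comp_left (g := Complex.ofReal) rfl)

/-- A test function as an element of `L²`. -/
def testL2 {φ : Sp N → ℝ} (hφ : IsTest φ) : L2 N := (memLp_test hφ).toLp _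

lemma coeFn_testL2 {φ : Sp N → ℝ} (hφ : IsTest φ) : testL2 hφ =ᵐ[volume] fun x => (φ x : ℂ) := MemLp.coeFn_toLp _

lemma inner_testL2 {φ : Sp N → ℝ} (hφ : IsTest φ) (w : L2 N) : inner ℂ (testL2 hφ) w = ∫ x, φ x • w x := by
  rw [L2.inner_def]
  refine integral_congr_ae ?_
  filter_upwards [coeFn_testL2 hφ] with x hx
  rw [hx, real_smul, RCLike.inner_apply]
  simp [mul_comm]

lemma isTest_lapT {φ : Sp N → ℝ} (hφ : IsTest φ) : IsTest (lapT φ) := by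
  have := Finset.sum_induction (s := Finset.univ) (fun i => partialD i (partialD i φ)) IsTest
    (fun _ _ h h' => ⟨h.1.add h'.1, h.2.add h'.2⟩) ⟨contDiff_const, HasCompactSupport.zero⟩
    fun i _ => (hφ.partialD i).partialD i
  rwa [Finset.sum_fn] at this

lemma integral_lapT_smul {u : Sp N → ℂ} {g h : Fin N → Sp N → ℂ}
    (H1 : ∀ i, WeakPartial i u (g i)) (H2 : ∀ i, WeakPartial i (g i) (h i)) {φ : Sp N → ℝ}
    (hφ : IsTest φ) : ∫ x, lapT φ x • u x = ∫ x, φ x • ∑ i, h i x := by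
  by_cases hN : Nonempty (Fin N)
  · obtain ⟨i0⟩ := hN
    simp only [lapT, sum_smul, Finset.smul_sum]
    rw [integral_finset_sum _ fun i _ => ((hφ.partialD i).partialD i).integrable_smul (H1 i0).left,
      integral_finset_sum _ fun i _ => hφ.integrable_smul (H2 i).right]
    refine sum_congr rfl fun i _ => ?_
    rw [(H1 i).eq _ (hφ.partialD i), (H2 i).eq _ hφ, neg_neg]
  · rw [not_nonempty_iff] at hN
    simp [lapT]

lemma lapT_symm {φ η : Sp N → ℝ} (hφ : IsTest φ) (hη : IsTest η) :
    ∫ x, lapT η x • (φ x : ℂ) = ∫ x, η x • (lapT φ x : ℂ) := by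
  have wp : ∀ (ψ : Sp N → ℝ), IsTest ψ → ∀ i, WeakPartial i (fun x => (ψ x : ℂ)) (fun x => (partialD i ψ x : ℂ)) := by
    intro ψ hψ i
    have := weakPartial_of_contDiff (f := fun x => (ψ x : ℂ))
      ((ofRealCLM.contDiff.comp hψ.1).of_le (by exact_mod_cast le_top)) i
    refine this.congr EventuallyEq.rfl (of_forall fun x => ?_)
    exact fderiv_ofReal (hψ.1.differentiable (by simp)) i x
  rw [integral_lapT_smul (fun i => wp φ hφ i) (fun i => wp _ (hφ.partialD i) i) hη]
  congr 1 with x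
  simp [lapT]

lemma fourier_testL2_lapT {φ : Sp N → ℝ} (hφ : IsTest φ) : (𝓕 (testL2 (isTest_lapT hφ)) : L2 N) =ᵐ[volume]
      fun ξ => -(((2 * π) ^ 2 * ‖ξ‖ ^ 2 : ℝ) : ℂ) * (𝓕 (testL2 hφ) : L2 N) ξ := by
  refine fourier_of_weak_laplacian fun η hη => ?_
  have e1 : ∫ x, η x • (testL2 (isTest_lapT hφ) : L2 N) x = ∫ x, η x • (lapT φ x : ℂ) := by
    refine integral_congr_ae ?_
    filter_upwards [coeFn_testL2 (isTest_lapT hφ)] with x hx using by rw [hx]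
  have e2 : ∫ x, lapT η x • (testL2 hφ : L2 N) x = ∫ x, lapT η x • (φ x : ℂ) := by
    refine integral_congr_ae ?_
    filter_upwards [coeFn_testL2 hφ] with x hx using by rw [hx]
  rw [e1, e2, lapT_symm hφ hη]

lemma hasDerivAt_schr_pairing {φ : Sp N → ℝ} (hφ : IsTest φ) (w : L2 N) (t : ℝ) :
    HasDerivAt (fun t => ∫ x, φ x • (schr t w : L2 N) x) (I * ∫ x, lapT φ x • (schr t w : L2 N) x) t := by
  have form : ∀ {ψ : Sp N → ℝ} (hψ : IsTest ψ) (s : ℝ), ∫ x, ψ x • (schr s w : L2 N) x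
      = ∫ ξ, conj ((𝓕 (testL2 hψ) : L2 N) ξ) * (phase s ξ * (𝓕 w : L2 N) ξ) := by
    intro ψ hψ s
    rw [← inner_testL2 hψ, ← Lp.inner_fourier_eq, L2.inner_def]
    refine integral_congr_ae ?_
    filter_upwards [fourier_schr s w] with x hx
    rw [hx, RCLike.inner_apply, mul_comm]
  simp only [form hφ, form (isTest_lapT hφ)]
  set Φ : L2 N := 𝓕 (testL2 hφ)
  set Λ : L2 N := 𝓕 (testL2 (isTest_lapT hφ))
  have hΛ : Λ =ᵐ[volume] fun ξ => -(((2 * π) ^ 2 * ‖ξ‖ ^ 2 : ℝ) : ℂ) * Φ ξ := fourier_testL2_lapT hφ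
  set W : L2 N := 𝓕 w
  have hm : ∀ (A : L2 N) s, AEStronglyMeasurable (fun ξ => conj (A ξ) * (phase s ξ * W ξ)) := fun A s =>
    (Complex.continuous_conj.comp_aestronglyMeasurable (Lp.aestronglyMeasurable A)).mul
      ((phase_continuous s).aestronglyMeasurable.mul (Lp.aestronglyMeasurable W))
  have key := hasDerivAt_integral_of_dominated_loc_of_deriv_le (μ := (volume : Measure (Sp N)))
    (F := fun s ξ => conj (Φ ξ) * (phase s ξ * W ξ))
    (F' := fun s ξ => conj (Φ ξ) * (-(I * (((2 * π) ^ 2 * ‖ξ‖ ^ 2 : ℝ) : ℂ)) * phase s ξ * W ξ)) (x₀ := t) (s := univ)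
    (bound := fun ξ => ‖Λ ξ‖ * ‖W ξ‖) univ_mem (of_forall fun s => hm Φ s)
    (by
      refine (L2.integrable_norm_mul Φ W).mono' (hm Φ t) (of_forall fun ξ => ?_)
      simp [norm_phase])
    (by
      refine AEStronglyMeasurable.congr ((hm Λ t).const_mul I) ?_
      filter_upwards [hΛ] with ξ hξ
      simp only [hξ, map_mul, map_neg, conj_ofReal]
      ring)
    (by
      filter_upwards [hΛ] with ξ hξ s _
      simp only [norm_mul, hξ, norm_neg, norm_phase, norm_I, RCLike.norm_conj]
      apply le_of_eq
      ring)
    (L2.integrable_norm_mul Λ W)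
    (of_forall fun ξ s _ => by exact ((hasDerivAt_phase s ξ).mul_const (W ξ)).const_mul _)
  refine key.2.congr_deriv ?_
  rw [← integral_const_mul]
  refine integral_congr_ae ?_
  filter_upwards [hΛ] with ξ hξ
  simp only [hξ, map_mul, map_neg, conj_ofReal]
  ring

lemma continuous_pairing {φ : Sp N → ℝ} (hφ : IsTest φ) {z : ℝ → L2 N} (hz : Continuous z) :
    Continuous fun t => ∫ x, φ x • (z t) x := by
  simp only [← inner_testL2 hφ]
  exact continuous_const.inner hz

lemma integral_schr_pairing {φ : Sp N → ℝ} (hφ : IsTest φ) (w : L2 N) (s t : ℝ) :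
    (∫ x, φ x • (schr t w : L2 N) x) - ∫ x, φ x • (schr s w : L2 N) x
      = ∫ r in s..t, I * ∫ x, lapT φ x • (schr r w : L2 N) x := by
  rw [intervalIntegral.integral_eq_sub_of_hasDerivAt (fun r _ => hasDerivAt_schr_pairing hφ w r)]
  exact (continuous_const.mul (continuous_pairing (isTest_lapT hφ) (continuous_schr w))).intervalIntegrable _ _

/-! ### The energy inequality for weak solutions -/

lemma L2.inner_real_eq (f g : L2 N) : inner ℝ f g = ∫ x, inner ℝ (f x) (g x) := L2.inner_def f g

lemma norm_le_of_weak_schrodinger {z G : ℝ → L2 N} (hz : Continuous z) (hG : Continuous G)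
    {T : ℝ} (H : ∀ φ : Sp N → ℝ, IsTest φ → ∀ t ∈ Icc 0 T, (∫ x, φ x • (z t) x) - ∫ x, φ x • (z 0) x
        = ∫ s in (0 : ℝ)..t, (I * (∫ x, lapT φ x • (z s) x) + ∫ x, φ x • (G s) x))
    {t : ℝ} (ht : t ∈ Icc 0 T) : ‖z t‖ ≤ ‖z 0‖ + ∫ s in (0 : ℝ)..t, ‖G s‖ := by
  set Z : ℝ → L2 N := fun t => ∫ s in (0 : ℝ)..t, z s with hZ
  set K : ℝ → L2 N := fun t => ∫ s in (0 : ℝ)..t, G s with hK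
  have hcomm : ∀ {f : ℝ → L2 N}, Continuous f → ∀ (Φ : L2 N) (t : ℝ),
      inner ℂ Φ (∫ s in (0 : ℝ)..t, f s) = ∫ s in (0 : ℝ)..t, inner ℂ Φ (f s) := by
    intro f hf Φ t
    exact ((innerSL ℂ Φ).intervalIntegral_comp_comm (hf.intervalIntegrable _ _)).symm
  -- the equation on the Fourier side
  have hF : ∀ t ∈ Icc 0 T, (𝓕 (z t - z 0 - K t) : L2 N) =ᵐ[volume]
      fun ξ => -(((2 * π) ^ 2 * ‖ξ‖ ^ 2 : ℝ) : ℂ) * (𝓕 (I • Z t) : L2 N) ξ := by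
    intro t ht
    refine fourier_of_weak_laplacian fun η hη => ?_
    have h1 := H η hη t ht
    simp only [← inner_testL2 hη, ← inner_testL2 (isTest_lapT hη)] at h1 ⊢
    rw [inner_sub_right, inner_sub_right, h1, inner_smul_right, hcomm hz, hcomm hG,
      intervalIntegral.integral_add, intervalIntegral.integral_const_mul]
    · ring
    · exact (continuous_const.mul (continuous_const.inner hz)).intervalIntegrable _ _
    · exact (continuous_const.inner hG).intervalIntegrable _ _
  let Fc : L2 N →L[ℂ] L2 N := ((Lp.fourierTransformₗᵢ (Sp N) ℂ).toContinuousLinearEquiv : L2 N →L[ℂ] L2 N)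
  have hFc : ∀ w, Fc w = 𝓕 w := fun _ => rfl
  have hFn : ∀ w, ‖Fc w‖ = ‖w‖ := fun w => norm_fourier_eq w
  -- localization in frequency
  have main : ∀ R : ℝ, 0 < R → ∀ t ∈ Icc 0 T,
      (∫ ξ, (Metric.ball (0 : Sp N) R).indicator (fun ξ => ‖(𝓕 (z t) : L2 N) ξ‖ ^ 2) ξ)
        ≤ (‖z 0‖ + ∫ s in (0 : ℝ)..t, ‖G s‖) ^ 2 := by
    intro R hR
    set m : Sp N → ℂ := (Metric.ball (0 : Sp N) R).indicator (fun _ => 1) with hm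
    have hmm : Measurable m := measurable_const.indicator Metric.isOpen_ball.measurableSet
    have hmb : ∀ ξ, ‖m ξ‖ ≤ 1 := fun ξ => by
      by_cases h : ξ ∈ Metric.ball (0 : Sp N) R <;> simp [hm, h]
    set a : Sp N → ℂ := (Metric.ball (0 : Sp N) R).indicator
      (fun ξ => -(I * (((2 * π) ^ 2 * ‖ξ‖ ^ 2 : ℝ) : ℂ))) with ha
    have ham : Measurable a := by
      refine Measurable.indicator ?_ Metric.isOpen_ball.measurableSet
      exact (by fun_prop : Continuous fun ξ : Sp N => -(I * (((2 * π) ^ 2 * ‖ξ‖ ^ 2 : ℝ) : ℂ))).measurable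
    have hab : ∀ ξ, ‖a ξ‖ ≤ (2 * π) ^ 2 * R ^ 2 := fun ξ => by
      by_cases h : ξ ∈ Metric.ball (0 : Sp N) R
      · simp only [ha, h, indicator_of_mem, norm_neg, norm_mul, norm_I, one_mul, norm_real]
        rw [norm_of_nonneg (by positivity), norm_of_nonneg (by positivity)]
        simp only [mem_ball_zero_iff] at h
        gcongr
      · simp only [ha, h, not_false_eq_true, indicator_of_notMem, norm_zero]; positivity
    let P := mulL2 m hmm 1 hmb
    let A := mulL2 a ham _ hab
    have hPn : ∀ w, ‖P w‖ ≤ ‖w‖ := fun w => by simpa using norm_mulL2_le m hmm 1 hmb w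
    set Y : ℝ → L2 N := fun t => P (Fc (z 0)) + P (Fc (K t)) + A (Fc (Z t)) with hY
    have hYz : ∀ t ∈ Icc 0 T, Y t = P (Fc (z t)) := by
      intro t ht
      have e1 : (𝓕 (z t - z 0 - K t) : L2 N) = Fc (z t) - Fc (z 0) - Fc (K t) := by rw [← hFc, map_sub, map_sub]
      have e2 : (𝓕 (I • Z t) : L2 N) = I • Fc (Z t) := by rw [← hFc, map_smul]
      have h1 := hF t ht
      rw [e1, e2] at h1
      refine Lp.ext ?_
      filter_upwards [h1, coeFn_add (P (Fc (z 0)) + P (Fc (K t))) (A (Fc (Z t))),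
        coeFn_add (P (Fc (z 0))) (P (Fc (K t))), coeFn_mulL2 m hmm 1 hmb (Fc (z 0)),
        coeFn_mulL2 m hmm 1 hmb (Fc (K t)), coeFn_mulL2 m hmm 1 hmb (Fc (z t)),
        coeFn_mulL2 a ham _ hab (Fc (Z t)), coeFn_sub (Fc (z t) - Fc (z 0)) (Fc (K t)),
        coeFn_sub (Fc (z t)) (Fc (z 0)), coeFn_smul I (Fc (Z t))]
        with ξ h1 h2 h3 h4 h5 h6 h7 h8 h9 h10
      rw [h2, Pi.add_apply, h3, Pi.add_apply, h4, h5, h6, h7]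
      rw [h8, Pi.sub_apply, h9, Pi.sub_apply, h10, Pi.smul_apply, smul_eq_mul] at h1
      by_cases h : ξ ∈ Metric.ball (0 : Sp N) R
      · simp only [hm, ha, h, indicator_of_mem]
        linear_combination -h1
      · simp only [hm, ha, h, not_false_eq_true, indicator_of_notMem]
        ring
    have hYd : ∀ t, HasDerivAt Y (P (Fc (G t)) + A (Fc (z t))) t := by
      intro t
      have hK' : HasDerivAt K (G t) t := (hG.integral_hasStrictDerivAt 0 t).hasDerivAt
      have hZ' : HasDerivAt Z (z t) t := (hz.integral_hasStrictDerivAt 0 t).hasDerivAt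
      have d1 := ((P ∘L Fc).restrictScalars ℝ).hasFDerivAt.comp_hasDerivAt t hK'
      have d2 := ((A ∘L Fc).restrictScalars ℝ).hasFDerivAt.comp_hasDerivAt t hZ'
      have d3 := (d1.const_add (P (Fc (z 0)))).add d2
      exact d3
    have horth : ∀ w : L2 N, inner ℝ (P w) (A w) = 0 := by
      intro w
      rw [L2.inner_real_eq]
      rw [integral_eq_zero_of_ae]
      filter_upwards [coeFn_mulL2 m hmm 1 hmb w, coeFn_mulL2 a ham _ hab w] with ξ h1 h2
      rw [h1, h2]
      by_cases h : ξ ∈ Metric.ball (0 : Sp N) R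
      · simp only [hm, ha, h, indicator_of_mem, one_mul, Complex.inner, Pi.zero_apply]
        simp only [mul_re, Complex.conj_re, Complex.conj_im, neg_re, neg_im, mul_im, I_re,
          I_im, Complex.ofReal_re, Complex.ofReal_im]
        ring
      · simp [hm, h]
    intro t ht
    have hsq : ∀ ε : ℝ, 0 < ε → ∀ s ∈ Icc 0 t, sqrt (‖Y s‖ ^ 2 + ε)
        ≤ sqrt (‖Y 0‖ ^ 2 + ε) + ∫ r in (0 : ℝ)..s, ‖G r‖ := by
      intro ε hε
      have hpos : ∀ s, 0 < ‖Y s‖ ^ 2 + ε := fun s => by positivity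
      have hder : ∀ s, HasDerivAt (fun s => sqrt (‖Y s‖ ^ 2 + ε))
          ((2 * inner ℝ (Y s) (P (Fc (G s)) + A (Fc (z s)))) / (2 * sqrt (‖Y s‖ ^ 2 + ε))) s :=
        fun s => (((hYd s).norm_sq).add_const ε).sqrt (hpos s).ne'
      intro s hs
      refine image_le_of_deriv_right_le_deriv_boundary (f := fun s => sqrt (‖Y s‖ ^ 2 + ε)) (a := 0) (b := t)
        (fun s _ => (hder s).continuousAt.continuousWithinAt)
        (fun s _ => (hder s).hasDerivWithinAt)
        (B := fun s => sqrt (‖Y 0‖ ^ 2 + ε) + ∫ r in (0 : ℝ)..s, ‖G r‖) (by simp)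
        (B' := fun s => ‖G s‖) ?_ ?_ ?_ hs
      · intro s _
        exact ((hG.norm.integral_hasStrictDerivAt 0 s).hasDerivAt.const_add _).continuousAt.continuousWithinAt
      · intro s _
        exact ((hG.norm.integral_hasStrictDerivAt 0 s).hasDerivAt.const_add _).hasDerivWithinAt
      · intro s hs
        have hs' : s ∈ Icc 0 T := ⟨hs.1, hs.2.le.trans ht.2⟩
        rw [inner_add_right, hYz s hs', horth, add_zero, ← hYz s hs', div_le_iff₀ (by
          have := Real.sqrt_pos.2 (hpos s); positivity)]
        have c1 : inner ℝ (Y s) (P (Fc (G s))) ≤ ‖Y s‖ * ‖G s‖ := by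
          refine (real_inner_le_norm _ _).trans ?_
          refine mul_le_mul_of_nonneg_left ?_ (norm_nonneg _)
          exact (hPn _).trans (hFn _).le
        have c2 : ‖Y s‖ ≤ sqrt (‖Y s‖ ^ 2 + ε) := Real.le_sqrt_of_sq_le (by linarith)
        nlinarith [norm_nonneg (G s), mul_le_mul_of_nonneg_right c2 (norm_nonneg (G s))]
    have hI : 0 ≤ ∫ r in (0 : ℝ)..t, ‖G r‖ := intervalIntegral.integral_nonneg ht.1 fun _ _ => norm_nonneg _
    have hY0 : ‖Y 0‖ ≤ ‖z 0‖ := by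
      rw [hYz 0 ⟨le_rfl, ht.1.trans ht.2⟩]
      exact (hPn _).trans (hFn _).le
    have hfin : ‖Y t‖ ≤ ‖z 0‖ + ∫ r in (0 : ℝ)..t, ‖G r‖ := by
      refine le_of_forall_pos_le_add fun ε hε => ?_
      have h1 := hsq (ε ^ 2) (by positivity) t ⟨ht.1, le_rfl⟩
      have h2 : ‖Y t‖ ≤ sqrt (‖Y t‖ ^ 2 + ε ^ 2) := Real.le_sqrt_of_sq_le (by nlinarith)
      have h3 : sqrt (‖Y 0‖ ^ 2 + ε ^ 2) ≤ ‖Y 0‖ + ε := by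
        rw [Real.sqrt_le_left (by positivity)]
        nlinarith [norm_nonneg (Y 0)]
      linarith
    have hYsq : ‖Y t‖ ^ 2 = ∫ ξ, (Metric.ball (0 : Sp N) R).indicator (fun ξ => ‖(𝓕 (z t) : L2 N) ξ‖ ^ 2) ξ := by
      rw [hYz t ht, L2.norm_sq_eq]
      refine integral_congr_ae ?_
      filter_upwards [coeFn_mulL2 m hmm 1 hmb (Fc (z t))] with ξ h1
      rw [h1]
      by_cases h : ξ ∈ Metric.ball (0 : Sp N) R
      · simp [hm, h, hFc]
      · simp [hm, h]
    rw [← hYsq]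
    exact pow_le_pow_left₀ (norm_nonneg _) hfin 2
  -- remove the localization
  have hI : 0 ≤ ∫ r in (0 : ℝ)..t, ‖G r‖ := intervalIntegral.integral_nonneg ht.1 fun _ _ => norm_nonneg _
  refine le_of_sq_le_sq ?_ (by positivity)
  rw [← norm_fourier_eq (z t), L2.norm_sq_eq]
  have hlim : Tendsto (fun n : ℕ => ∫ ξ, (Metric.ball (0 : Sp N) ((n : ℝ) + 1)).indicator
      (fun ξ => ‖(𝓕 (z t) : L2 N) ξ‖ ^ 2) ξ) atTop (𝓝 (∫ ξ, ‖(𝓕 (z t) : L2 N) ξ‖ ^ 2)) := by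
    refine tendsto_integral_of_dominated_convergence _
      (fun n => ((L2.integrable_norm_sq _).1.indicator Metric.isOpen_ball.measurableSet))
      (L2.integrable_norm_sq (𝓕 (z t))) (fun n => of_forall fun ξ => ?_)
      (of_forall fun ξ => ?_)
    · refine (norm_indicator_le_norm_self _ _).trans ?_
      rw [norm_of_nonneg (by positivity)]
    · refine tendsto_const_nhds.congr' ?_
      obtain ⟨n0, hn0⟩ := exists_nat_gt ‖ξ‖
      filter_upwards [eventually_ge_atTop n0] with n hn
      rw [indicator_of_mem]
      rw [mem_ball_zero_iff]
      have : (n0 : ℝ) ≤ n := by exact_mod_cast hn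
      linarith
  exact le_of_tendsto' hlim fun n => main _ (by positivity) t ht

/-! ### Weighted Sobolev regularity -/

lemma one_le_bracket (x : Sp N) : 1 ≤ bracket x := Real.one_le_sqrt.2 (by nlinarith [sq_nonneg ‖x‖])

lemma bracket_pos (x : Sp N) : 0 < bracket x := one_pos.trans_le (one_le_bracket x)

lemma norm_le_bracket (x : Sp N) : ‖x‖ ≤ bracket x := Real.le_sqrt_of_sq_le (by linarith)

lemma continuous_bracket : Continuous (bracket : Sp N → ℝ) := by unfold bracket; fun_prop

lemma abs_coord_le_bracket (x : Sp N) (i : Fin N) : |x i| ≤ bracket x :=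
  (by simpa using PiLp.norm_apply_le x i : |x i| ≤ ‖x‖).trans (norm_le_bracket x)

lemma norm_le_sum_abs (x : Sp N) : ‖x‖ ≤ ∑ i, |x i| := by
  have : x = ∑ i, x i • stdVec i := by
    ext j
    simp [Finset.sum_apply, Pi.single_apply]
  conv_lhs => rw [this]
  refine (norm_sum_le _ _).trans (sum_le_sum fun i _ => ?_)
  rw [norm_smul]; simp

lemma bracket_le_sum (x : Sp N) : bracket x ≤ 1 + ∑ i, |x i| := by
  refine le_trans ?_ (add_le_add_right (norm_le_sum_abs x) 1)
  unfold bracket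
  rw [Real.sqrt_le_left (by positivity)]
  nlinarith [norm_nonneg x]

lemma bracket_pow_le (n : ℕ) (x : Sp N) : bracket x ^ n ≤ (N + 1 : ℝ) ^ n * (1 + ∑ i, |x i| ^ n) := by
  have hS : 0 ≤ ∑ i, |x i| ^ n := sum_nonneg fun i _ => by positivity
  by_cases h : ∀ i, |x i| ≤ 1
  · have h1 : bracket x ≤ N + 1 := by
      refine (bracket_le_sum x).trans ?_
      have := sum_le_sum fun i (_ : i ∈ Finset.univ) => h i
      simp at this
      linarith
    refine (pow_le_pow_left₀ (bracket_pos x).le h1 n).trans ?_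
    exact le_mul_of_one_le_right (by positivity) (by linarith)
  · push Not at h
    obtain ⟨i0, hi0⟩ := h
    obtain ⟨i, _, hi⟩ := Finset.exists_max_image Finset.univ (fun i => |x i|) ⟨i0, Finset.mem_univ _⟩
    have hi1 : 1 < |x i| := hi0.trans_le (hi i0 (Finset.mem_univ _))
    have h1 : bracket x ≤ (N + 1) * |x i| := by
      refine (bracket_le_sum x).trans ?_
      have := sum_le_sum fun j (hj : j ∈ Finset.univ) => hi j hj
      simp at this
      linarith
    refine (pow_le_pow_left₀ (bracket_pos x).le h1 n).trans ?_
    rw [mul_pow]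
    refine mul_le_mul_of_nonneg_left ?_ (by positivity)
    have := single_le_sum (f := fun i => |x i| ^ n) (fun i _ => by positivity) (Finset.mem_univ i)
    linarith [this]

/-- `⟨x⟩^a D^γ z` is bounded by `B` in `L²` for `|γ| ≤ l`. -/
def WReg (a : ℕ) : ℕ → (Sp N → ℂ) → ℝ → Prop
  | 0, z, B => AEStronglyMeasurable z ∧
      eLpNorm (fun x => bracket x ^ a • z x) 2 ≤ ofReal B
  | l + 1, z, B => (AEStronglyMeasurable z ∧
      eLpNorm (fun x => bracket x ^ a • z x) 2 ≤ ofReal B) ∧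
      ∀ i, ∃ g, WeakPartial i z g ∧ WReg a l g B

namespace WReg

variable {a l : ℕ} {z w : Sp N → ℂ} {B B' : ℝ}

lemma base (h : WReg a l z B) : AEStronglyMeasurable z ∧ eLpNorm (fun x => bracket x ^ a • z x) 2 ≤ ofReal B := by
  cases l with
  | zero => exact h
  | succ l => exact h.1

lemma pred (h : WReg a (l + 1) z B) : WReg a l z B := by
  induction l generalizing z with
  | zero => exact h.1
  | succ l ih =>
    refine ⟨h.1, fun i => ?_⟩
    obtain ⟨g, hg, hr⟩ := h.2 i
    exact ⟨g, hg, ih hr⟩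

lemma mono (h : WReg a l z B) (hB : B ≤ B') : WReg a l z B' := by
  induction l generalizing z with
  | zero => exact ⟨h.1, h.2.trans (ofReal_le_ofReal hB)⟩
  | succ l ih =>
    refine ⟨⟨h.1.1, h.1.2.trans (ofReal_le_ofReal hB)⟩, fun i => ?_⟩
    obtain ⟨g, hg, hr⟩ := h.2 i
    exact ⟨g, hg, ih hr⟩

lemma congr (h : WReg a l z B) (hzw : z =ᵐ[volume] w) : WReg a l w B := by
  have hb : AEStronglyMeasurable w ∧ eLpNorm (fun x => bracket x ^ a • w x) 2 ≤ ofReal B := by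
    refine ⟨h.base.1.congr hzw, ?_⟩
    rw [← eLpNorm_congr_ae (f := fun x => bracket x ^ a • z x)]
    · exact h.base.2
    · filter_upwards [hzw] with x hx using by rw [hx]
  cases l with
  | zero => exact hb
  | succ l =>
    refine ⟨hb, fun i => ?_⟩
    obtain ⟨g, hg, hr⟩ := h.2 i
    exact ⟨g, hg.congr hzw EventuallyEq.rfl, hr⟩

lemma add (h : WReg a l z B) (h' : WReg a l w B') (hB : 0 ≤ B) (hB' : 0 ≤ B') :
    WReg a l (fun x => z x + w x) (B + B') := by
  have hc : Continuous fun x : Sp N => bracket x ^ a := continuous_bracket.pow a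
  have hb : ∀ {z w : Sp N → ℂ}, (AEStronglyMeasurable z ∧ eLpNorm (fun x => bracket x ^ a • z x) 2 ≤ ofReal B) →
      (AEStronglyMeasurable w ∧
      eLpNorm (fun x => bracket x ^ a • w x) 2 ≤ ofReal B') →
      (AEStronglyMeasurable (fun x => z x + w x) ∧
      eLpNorm (fun x => bracket x ^ a • (z x + w x)) 2 ≤ ofReal (B + B')) := by
    intro z w h h'
    refine ⟨h.1.add h'.1, ?_⟩
    simp only [smul_add]
    rw [ofReal_add hB hB']
    exact (eLpNorm_add_le (hc.aestronglyMeasurable.smul h.1) (hc.aestronglyMeasurable.smul h'.1)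
      (by norm_num)).trans (add_le_add h.2 h'.2)
  induction l generalizing z w with
  | zero => exact hb h h'
  | succ l ih =>
    refine ⟨hb h.1 h'.1, fun i => ?_⟩
    obtain ⟨g, hg, hr⟩ := h.2 i
    obtain ⟨g', hg', hr'⟩ := h'.2 i
    exact ⟨_, hg.add hg', ih hr hr'⟩

lemma const_mul (h : WReg a l z B) (c : ℂ) : WReg a l (fun x => c * z x) (‖c‖ * B) := by
  have hb : ∀ {z : Sp N → ℂ}, (AEStronglyMeasurable z ∧ eLpNorm (fun x => bracket x ^ a • z x) 2 ≤ ofReal B) →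
      (AEStronglyMeasurable (fun x => c * z x) ∧
      eLpNorm (fun x => bracket x ^ a • (c * z x)) 2 ≤ ofReal (‖c‖ * B)) := by
    intro z h
    refine ⟨h.1.const_mul c, ?_⟩
    have e : (fun x => bracket x ^ a • (c * z x)) = c • fun x => bracket x ^ a • z x := by
      funext x; simp only [real_smul, Pi.smul_apply, smul_eq_mul]; ring
    rw [e, eLpNorm_const_smul, ofReal_mul (norm_nonneg _), ofReal_norm]
    exact mul_le_mul_right h.2 _
  induction l generalizing z with
  | zero => exact hb h
  | succ l ih =>
    refine ⟨hb h.1, fun i => ?_⟩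
    obtain ⟨g, hg, hr⟩ := h.2 i
    exact ⟨_, hg.const_mul c, ih hr⟩

end WReg

lemma IsJet.wReg {M a : ℕ} {d : 𝕄 → Sp N → ℂ} (H : IsJet M d) {B : ℝ} (l : ℕ) (β : 𝕄) (hM : order β + l ≤ M)
    (hB : ∀ γ, order γ ≤ l → eLpNorm (fun x => bracket x ^ a • d (β + γ) x) 2 ≤ ofReal B) :
    WReg a l (d β) B := by
  have hm : AEStronglyMeasurable (d β) := (H.locallyIntegrable β (by omega)).aestronglyMeasurable
  induction l generalizing β with
  | zero => exact ⟨hm, by simpa using hB 0 (by simp [order_zero])⟩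
  | succ l ih =>
    refine ⟨⟨hm, by simpa using hB 0 (by simp [order_zero])⟩, fun i => ?_⟩
    refine ⟨_, H.step β i (by omega), ih _ (by rw [order_add_single]; omega) (fun γ hγ => ?_)
      (H.locallyIntegrable _ (by rw [order_add_single]; omega)).aestronglyMeasurable⟩
    have := hB (γ + 𝐞 i) (by rw [order_add_single]; omega)
    rwa [show β + (γ + 𝐞 i) = β + 𝐞 i + γ by abel] at this

/-- Monomial weights can be moved inside. -/
lemma WReg.coord_pow {n l : ℕ} {z : Sp N → ℂ} {B : ℝ} (hB : 0 ≤ B) (h : WReg n l z B) (j : Fin N)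
    (p : ℕ) (hp : p ≤ n) : WReg 0 l (fun x => ((x j : ℂ)) ^ p * z x) ((1 + n : ℝ) ^ l * B) := by
  have hb : ∀ {z : Sp N → ℂ} {p : ℕ}, p ≤ n → (AEStronglyMeasurable z ∧
      eLpNorm (fun x => bracket x ^ n • z x) 2 ≤ ofReal B) →
      (AEStronglyMeasurable (fun x => ((x j : ℂ)) ^ p * z x) ∧
      eLpNorm (fun x => bracket x ^ 0 • (((x j : ℂ)) ^ p * z x)) 2 ≤ ofReal B) := by
    intro z p hp h
    refine ⟨(by fun_prop : Continuous fun x : Sp N => ((x j : ℂ)) ^ p).aestronglyMeasurable.mul h.1,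
      le_trans (eLpNorm_mono fun x => ?_) h.2⟩
    rw [pow_zero, one_smul, norm_mul, norm_smul, norm_pow, norm_pow, norm_real,
      norm_eq_abs, norm_of_nonneg (bracket_pos x).le]
    refine mul_le_mul_of_nonneg_right ?_ (norm_nonneg _)
    exact (pow_le_pow_left₀ (abs_nonneg _) (abs_coord_le_bracket x j) p).trans
      (pow_le_pow_right₀ (one_le_bracket x) hp)
  induction l generalizing z p with
  | zero =>
    have := hb hp h
    rw [pow_zero, one_mul]
    exact this
  | succ l ih =>
    have hge : B ≤ (1 + n : ℝ) ^ (l + 1) * B :=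
      le_mul_of_one_le_left hB (one_le_pow₀ (by linarith [(cast_nonneg n : (0 : ℝ) ≤ n)]))
    have h0 := hb hp h.1
    refine ⟨⟨h0.1, h0.2.trans (ofReal_le_ofReal hge)⟩, fun i => ?_⟩
    obtain ⟨g, hg, hr⟩ := h.2 i
    have hs : ContDiff ℝ 1 fun x : Sp N => ((x j : ℂ)) ^ p := by
      have : ContDiff ℝ 1 (ofRealCLM.comp (EuclideanSpace.proj j : Sp N →L[ℝ] ℝ)) := ContinuousLinearMap.contDiff _
      exact this.pow p
    have hder : ∀ x : Sp N, fderiv ℝ (fun x : Sp N => ((x j : ℂ)) ^ p) x (stdVec i)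
        = (p * if i = j then 1 else 0 : ℂ) * (x j : ℂ) ^ (p - 1) := by
      intro x
      have h1 := (ofRealCLM.comp (EuclideanSpace.proj j : Sp N →L[ℝ] ℝ)).hasFDerivAt (x := x)
      have h2 := (h1.pow p).fderiv
      change fderiv ℝ (fun x => (ofRealCLM.comp (EuclideanSpace.proj j : Sp N →L[ℝ] ℝ)) x ^ p) x _ = _
      rw [h2]
      by_cases hij : i = j
      · subst hij; simp
      · have : (Pi.single i (1 : ℝ) : Fin N → ℝ) j = 0 := by simp [Ne.symm hij]
        simp [hij, this]
    have hw := hg.mul hs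
    refine ⟨_, hw, ?_⟩
    have r1 := ih hr p hp
    have r2 := (ih h.pred (p - 1) (by omega)).const_mul (p * if i = j then 1 else 0 : ℂ)
    have hk : ‖(p * if i = j then 1 else 0 : ℂ)‖ ≤ n := by
      split_ifs
      · simpa using hp
      · simp
    have hnn : (0 : ℝ) ≤ (1 + n : ℝ) ^ l * B := by positivity
    have r3 := r1.add r2 hnn (by positivity)
    refine (r3.congr (of_forall fun x => ?_)).mono ?_
    · simp only [hder]; ring
    · rw [pow_succ]
      have := mul_le_mul_of_nonneg_right hk hnn
      nlinarith

/-! ### Sobolev embedding -/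

lemma eLpNorm_fourier_le {l : ℕ} {w : L2 N} {B : ℝ} (hB : 0 ≤ B) (h : WReg 0 l w B) :
    eLpNorm (fun ξ => ((1 + ‖ξ‖) ^ l) • (𝓕 w : L2 N) ξ) 2 ≤ ofReal ((N + 1 : ℝ) ^ l * B) := by
  have hbase : ∀ {w : L2 N} {l : ℕ}, WReg 0 l w B → eLpNorm (fun ξ => (𝓕 w : L2 N) ξ) 2 ≤ ofReal B := by
    intro w l h
    have h1 := h.base.2
    simp only [pow_zero, one_smul] at h1
    have h2 : ‖(𝓕 w : L2 N)‖ₑ = ‖w‖ₑ := by rw [← ofReal_norm, ← ofReal_norm, norm_fourier_eq]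
    rw [enorm_def, enorm_def] at h2
    exact h2.le.trans h1
  induction l generalizing w with
  | zero => simpa using hbase h
  | succ l ih =>
    choose g hg hr using h.2
    have hgm : ∀ i, MemLp (g i) 2 := fun i => by
      have := (hr i).base
      simp only [pow_zero, one_smul] at this
      exact ⟨this.1, this.2.trans_lt ofReal_lt_top⟩
    have hgL : ∀ i, WeakPartial i w ((hgm i).toLp (g i)) := fun i =>
      (hg i).congr EventuallyEq.rfl (hgm i).coeFn_toLp.symm
    have hF := fun i => weakPartial_iff_fourier.1 (hgL i)
    have ih0 := ih h.pred
    have ihg := fun i => ih ((hr i).congr (hgm i).coeFn_toLp.symm)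
    have hm : ∀ u : L2 N, AEStronglyMeasurable (fun ξ => ((1 + ‖ξ‖) ^ l) • u ξ) := fun u =>
      (by fun_prop : Continuous fun ξ : Sp N => (1 + ‖ξ‖) ^ l).aestronglyMeasurable.smul (Lp.aestronglyMeasurable u)
    have hle : eLpNorm (fun ξ => ((1 + ‖ξ‖) ^ (l + 1)) • (𝓕 w : L2 N) ξ) 2
        ≤ eLpNorm ((fun ξ => ‖((1 + ‖ξ‖) ^ l) • (𝓕 w : L2 N) ξ‖)
          + ∑ i, fun ξ => ‖((1 + ‖ξ‖) ^ l) • (𝓕 ((hgm i).toLp (g i)) : L2 N) ξ‖) 2 := by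
      refine eLpNorm_mono_ae ?_
      filter_upwards [ae_all_iff.2 hF] with ξ hξ
      have e1 : ∀ i, |ξ i| * ‖(𝓕 w : L2 N) ξ‖ ≤ ‖(𝓕 ((hgm i).toLp (g i)) : L2 N) ξ‖ := fun i => by
        rw [hξ i, norm_mul, norm_mul, norm_mul, norm_mul, norm_I, norm_real,
          norm_real, norm_ofNat, norm_eq_abs, norm_eq_abs,
          abs_of_pos Real.pi_pos]
        refine mul_le_mul_of_nonneg_right ?_ (norm_nonneg _)
        nlinarith [Real.pi_gt_three, abs_nonneg (ξ i)]
      have e2 : ‖ξ‖ * ‖(𝓕 w : L2 N) ξ‖ ≤ ∑ i, ‖(𝓕 ((hgm i).toLp (g i)) : L2 N) ξ‖ := by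
        refine (mul_le_mul_of_nonneg_right (norm_le_sum_abs ξ) (norm_nonneg _)).trans ?_
        rw [sum_mul]
        exact sum_le_sum fun i _ => e1 i
      rw [Pi.add_apply, Finset.sum_apply, norm_of_nonneg (by positivity)]
      simp only [norm_smul, norm_of_nonneg (pow_nonneg (by positivity : 0 ≤ 1 + ‖ξ‖) _)]
      rw [← mul_sum, pow_succ]
      have := mul_le_mul_of_nonneg_left e2 (pow_nonneg (by positivity : 0 ≤ 1 + ‖ξ‖) l)
      nlinarith
    refine hle.trans ((eLpNorm_add_le (hm _).norm ?_ (by norm_num)).trans ?_)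
    · exact Finset.aestronglyMeasurable_sum _ fun i _ => (hm _).norm
    refine (add_le_add le_rfl (eLpNorm_sum_le (fun i _ => (hm _).norm) (by norm_num))).trans ?_
    simp only [eLpNorm_norm]
    refine (add_le_add ih0 (sum_le_sum fun i _ => ihg i)).trans ?_
    rw [sum_const, card_univ, Fintype.card_fin, nsmul_eq_mul,
      ← ofReal_natCast, ← ofReal_mul (by positivity), ← ofReal_add
      (by positivity) (by positivity)]
    refine ofReal_le_ofReal (le_of_eq ?_)
    ring

/-- The inverse Fourier transform of an integrable `𝓕 w` is a continuous representative of `w`. -/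
lemma L2.ae_eq_fourierInv {w : L2 N} (h : Integrable (𝓕 w : L2 N)) :
    Continuous (𝓕⁻ (fun ξ => (𝓕 w : L2 N) ξ) : Sp N → ℂ) ∧
      w =ᵐ[volume] (𝓕⁻ (fun ξ => (𝓕 w : L2 N) ξ) : Sp N → ℂ) := by
  have hc : Continuous (𝓕⁻ (fun ξ => (𝓕 w : L2 N) ξ) : Sp N → ℂ) :=
    VectorFourier.fourierIntegral_continuous Real.continuous_fourierChar (by exact continuous_inner.neg) h
  refine ⟨hc, ae_eq_of_forall_test (L2.locallyIntegrable w) hc.locallyIntegrable fun φ hφ => ?_⟩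
  have hψ1 : ContDiff ℝ ∞ (fun x => (φ x : ℂ)) := ofRealCLM.contDiff.comp hφ.1
  have hψ2 : HasCompactSupport (fun x => (φ x : ℂ)) := hφ.2.comp_left (g := Complex.ofReal) rfl
  set ψ : 𝓢(Sp N, ℂ) := hψ2.toSchwartzMap hψ1 with hψ
  have hψa : ∀ x, ψ x = φ x := fun x => rfl
  have h1 : (w : 𝓢'(Sp N, ℂ)) = 𝓕⁻ ((𝓕 w : L2 N) : 𝓢'(Sp N, ℂ)) := by
    rw [Lp.fourierInv_toTemperedDistribution_eq]
    congr 1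
    exact ((Lp.fourierTransformₗᵢ (Sp N) ℂ).symm_apply_apply w).symm
  have h2 := congrArg (fun T : 𝓢'(Sp N, ℂ) => T ψ) h1
  simp only [fourierInv_apply, toTemperedDistribution_apply] at h2
  have h3 := VectorFourier.integral_fourierIntegral_smul_eq_flip (μ := (volume : Measure (Sp N)))
    (ν := (volume : Measure (Sp N))) (e := Real.fourierChar) (L := -innerₗ (Sp N)) (f := ψ)
    (g := fun ξ => (𝓕 w : L2 N) ξ) Real.continuous_fourierChar (by exact continuous_inner.neg)
    ψ.integrable h
  have hflip : (-innerₗ (Sp N)).flip = -innerₗ (Sp N) := by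
    ext x y
    simp [real_inner_comm]
  rw [hflip] at h3
  have e : ∀ x, (𝓕⁻ ψ) x = VectorFourier.fourierIntegral Real.fourierChar volume
      (-innerₗ (Sp N)) ψ x := fun x => by rw [SchwartzMap.fourierInv_coe]; rfl
  simp only [← e] at h3
  calc ∫ x, φ x • w x = ∫ x, ψ x • w x := by simp [hψa]
    _ = _ := h2
    _ = _ := h3
    _ = _ := by simp only [hψa, real_smul, smul_eq_mul]; rfl

lemma memLp_one_add_norm {k : ℕ} (hk : (N : ℝ) / 2 < k) : MemLp (fun ξ : Sp N => ((1 + ‖ξ‖) ^ k)⁻¹) 2 := by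
  rw [memLp_two_iff_integrable_sq (by apply Continuous.aestronglyMeasurable; fun_prop (disch := intro x; positivity))]
  have := integrable_one_add_norm (E := Sp N) (μ := volume) (r := 2 * k) (by simp [finrank_euclideanSpace]; linarith)
  refine this.congr (of_forall fun x => ?_)
  simp only []
  rw [rpow_neg (by positivity), inv_pow, ← pow_mul, ← rpow_natCast]
  congr 2
  push_cast; ring

/-- The Sobolev embedding `H^k ⊆ C ∩ L^∞` for `k > N / 2`. -/
lemma sobolev_embedding {k : ℕ} (hk : (N : ℝ) / 2 < k) :
    ∃ C : ℝ, 0 ≤ C ∧ ∀ (z : Sp N → ℂ) (B : ℝ), 0 ≤ B → WReg 0 k z B →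
      ∃ z' : Sp N → ℂ, Continuous z' ∧ z =ᵐ[volume] z' ∧ ∀ x, ‖z' x‖ ≤ C * B := by
  have hk2 := memLp_one_add_norm hk
  set A := (eLpNorm (fun ξ : Sp N => ((1 + ‖ξ‖) ^ k)⁻¹) 2 volume).toReal with hA
  refine ⟨A * (N + 1 : ℝ) ^ k, by positivity, fun z B hB h => ?_⟩
  have hz : MemLp z 2 := by
    have := h.base
    simp only [pow_zero, one_smul] at this
    exact ⟨this.1, this.2.trans_lt ofReal_lt_top⟩
  set w : L2 N := hz.toLp z with hw
  have h1 := eLpNorm_fourier_le hB (h.congr hz.coeFn_toLp.symm)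
  have h2 : eLpNorm (𝓕 w : L2 N) 1 ≤ ofReal (A * (N + 1 : ℝ) ^ k * B) := by
    have hm : AEStronglyMeasurable (fun ξ => ((1 + ‖ξ‖) ^ k) • (𝓕 w : L2 N) ξ) :=
      (by fun_prop : Continuous fun ξ : Sp N => (1 + ‖ξ‖) ^ k).aestronglyMeasurable.smul (Lp.aestronglyMeasurable _)
    have := eLpNorm_smul_le_mul_eLpNorm (p := 2) (q := 2) (r := 1) hm hk2.1
    have e : ((fun ξ : Sp N => ((1 + ‖ξ‖) ^ k)⁻¹) • fun ξ => ((1 + ‖ξ‖) ^ k) • (𝓕 w : L2 N) ξ) = (𝓕 w : L2 N) := by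
      funext ξ
      simp only [Pi.smul_apply']
      rw [inv_smul_smul₀ (by positivity)]
    rw [e] at this
    refine this.trans ((mul_le_mul_right h1 _).trans ?_)
    rw [mul_assoc, ofReal_mul (p := A) toReal_nonneg, hA, ofReal_toReal hk2.2.ne]
  have hint : Integrable (𝓕 w : L2 N) :=
    memLp_one_iff_integrable.1 ⟨Lp.aestronglyMeasurable _, h2.trans_lt ofReal_lt_top⟩
  obtain ⟨hc, hae⟩ := L2.ae_eq_fourierInv hint
  refine ⟨_, hc, hz.coeFn_toLp.symm.trans hae, fun x => ?_⟩
  refine (VectorFourier.norm_fourierIntegral_le_integral_norm _ _ _ _ _).trans ?_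
  rw [integral_norm_eq_lintegral_enorm hint.1, ← eLpNorm_one_eq_lintegral_enorm]
  exact toReal_le_of_le_ofReal (by positivity) h2

/-- Weighted Sobolev embedding. -/
lemma weighted_sobolev {k : ℕ} (hk : (N : ℝ) / 2 < k) (n : ℕ) :
    ∃ C : ℝ, 0 ≤ C ∧ ∀ (z : Sp N → ℂ) (B : ℝ), 0 ≤ B → WReg n k z B →
      ∃ z' : Sp N → ℂ, Continuous z' ∧ z =ᵐ[volume] z' ∧ ∀ x, bracket x ^ n * ‖z' x‖ ≤ C * B := by
  obtain ⟨C, hC, H⟩ := sobolev_embedding hk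
  refine ⟨(N + 1 : ℝ) ^ n * (N + 1) * (C * (1 + n : ℝ) ^ k), by positivity, fun z B hB h => ?_⟩
  have h0 : WReg 0 k z ((1 + n : ℝ) ^ k * B) ∧ ∀ j, WReg 0 k (fun x => ((x j : ℂ)) ^ n * z x)
      ((1 + n : ℝ) ^ k * B) := by
    refine ⟨?_, fun j => h.coord_pow hB j n le_rfl⟩
    rcases N.eq_zero_or_pos with h0 | h0
    · subst h0
      have hb : ∀ x : Sp 0, bracket x = 1 := fun x => by
        have : x = 0 := Subsingleton.elim _ _
        simp [bracket, this]
      have : ∀ {l : ℕ} {z : Sp 0 → ℂ}, WReg n l z B → WReg 0 l z B := by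
        intro l z h
        cases l with
        | zero => exact ⟨h.1, by simpa [hb] using h.2⟩
        | succ l => exact ⟨⟨h.1.1, by simpa [hb] using h.1.2⟩, fun i => i.elim0⟩
      exact (this h).mono (le_mul_of_one_le_left hB (one_le_pow₀ (by linarith [(cast_nonneg n : (0 : ℝ) ≤ n)])))
    · have := h.coord_pow hB ⟨0, h0⟩ 0 (Nat.zero_le _)
      exact this.congr (of_forall fun x => by simp)
  have hB' : 0 ≤ (1 + n : ℝ) ^ k * B := by positivity
  obtain ⟨z', hc, hz, hb⟩ := H z _ hB' h0.1
  choose y hyc hy hyb using fun j => H _ _ hB' (h0.2 j)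
  have hyz : ∀ j x, y j x = ((x j : ℂ)) ^ n * z' x := fun j x => by
    have hc' : Continuous fun x : Sp N => ((x j : ℂ)) ^ n * z' x := by fun_prop
    refine congrFun (((hyc j).ae_eq_iff_eq (μ := volume) hc').1 ?_) x
    filter_upwards [hz, hy j] with x h1 h2
    rw [← h2, h1]
  refine ⟨z', hc, hz, fun x => ?_⟩
  refine (mul_le_mul_of_nonneg_right (bracket_pow_le n x) (norm_nonneg _)).trans ?_
  have h2 : ∀ j, |x j| ^ n * ‖z' x‖ ≤ C * ((1 + n : ℝ) ^ k * B) := fun j => by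
    have := hyb j x
    rwa [hyz, norm_mul, norm_pow, norm_real, norm_eq_abs] at this
  have h3 : (∑ j, |x j| ^ n) * ‖z' x‖ ≤ N * (C * ((1 + n : ℝ) ^ k * B)) := by
    rw [sum_mul]
    refine (sum_le_sum fun j _ => h2 j).trans ?_
    simp
  calc (N + 1 : ℝ) ^ n * (1 + ∑ i, |x i| ^ n) * ‖z' x‖
      = (N + 1 : ℝ) ^ n * (‖z' x‖ + (∑ i, |x i| ^ n) * ‖z' x‖) := by ring
    _ ≤ (N + 1 : ℝ) ^ n * (C * ((1 + n : ℝ) ^ k * B) + N * (C * ((1 + n : ℝ) ^ k * B))) :=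
        mul_le_mul_of_nonneg_left (add_le_add (hb x) h3) (by positivity)
    _ = _ := by ring

/-! ### Elements of `𝓢` and their jets -/

/-- The admissible parameters. -/
structure Adm (N k m n : ℕ) : Prop where
  one_le : 1 ≤ N
  hk : (N : ℝ) / 2 < k
  hn : (N : ℝ) / 2 + 1 < n
  hn' : (N : ℝ) * (N + 1) / 4 < n
  hm : k + n + 1 ≤ 2 * m

variable (A : Adm N k m n)

lemma Adm.one_le_k (A : Adm N k m n) : 1 ≤ k := by
  have := A.hk
  by_contra! h
  have h0 : k = 0 := by omega
  rw [h0] at this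
  have h1 : (1 : ℝ) ≤ N := by exact_mod_cast A.one_le
  norm_num at this
  linarith

lemma Adm.two_le_n (A : Adm N k m n) : 2 ≤ n := by
  have := A.hn
  have h1 : (1 : ℝ) ≤ N := by exact_mod_cast A.one_le
  have : (1 : ℝ) < n := by linarith
  exact_mod_cast this

/-- The weight of the derivatives of order `l` of an element of `𝓢` in `L²`. -/
abbrev wt (k m n l : ℕ) : ℕ := min n (bigJ k m n - l)

/-- `d` consists of the derivatives of an element of `𝓢`, with bound `B`. -/
structure SJet (k m n : ℕ) (d : 𝕄 → Sp N → ℂ) (B : ℝ) : Prop where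
  jet : IsJet (bigJ k m n) d
  cont : ∀ β, order β ≤ 2 * m + 2 → Continuous (d β)
  low : ∀ β, order β ≤ 2 * m → ∀ x, bracket x ^ n * ‖d β x‖ ≤ B
  high : ∀ β, 2 * m + 1 ≤ order β → order β ≤ bigJ k m n →
    eLpNorm (fun x => (bracket x ^ wt k m n (order β)) • d β x) 2 ≤ ofReal B

lemma eLpNorm_top_le_iff {f : Sp N → ℂ} (hf : Continuous f) {B : ℝ} (hB : 0 ≤ B) :
    eLpNorm f ∞ ≤ ofReal B ↔ ∀ x, ‖f x‖ ≤ B := by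
  rw [eLpNorm_exponent_top]
  constructor
  · intro h
    have h1 : ∀ᵐ x, ‖f x‖ ≤ B := by
      filter_upwards [enorm_ae_le_eLpNormEssSup f volume] with x hx
      have := hx.trans h
      rwa [← ofReal_norm, ofReal_le_ofReal_iff hB] at this
    have ho : IsOpen {x | ¬ ‖f x‖ ≤ B} := by
      simp only [not_le]
      exact isOpen_lt continuous_const hf.norm
    have h2 := (ho.measure_eq_zero_iff volume).1 h1
    intro x
    by_contra hx
    have : x ∈ ({x | ¬ ‖f x‖ ≤ B} : Set (Sp N)) := hx
    rw [h2] at this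
    exact this
  · intro h
    refine eLpNormEssSup_le_of_ae_enorm_bound (of_forall fun x => ?_)
    rw [← ofReal_norm]
    exact ofReal_le_ofReal (h x)

lemma norm_wsmul (a : ℕ) (x : Sp N) (z : ℂ) : ‖bracket x ^ a • z‖ = bracket x ^ a * ‖z‖ := by
  rw [norm_smul, norm_of_nonneg (pow_nonneg (bracket_pos x).le _)]

lemma continuous_bracket_smul {f : Sp N → ℂ} (hf : Continuous f) (a : ℕ) :
    Continuous fun x => bracket x ^ a • f x := (continuous_bracket.pow a).smul hf

lemma memLp_bracket_rpow {s : ℝ} (hs : (N : ℝ) / 2 < s) : MemLp (fun x : Sp N => bracket x ^ (-s)) 2 := by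
  have hc : Continuous fun x : Sp N => bracket x ^ (-s) :=
    continuous_bracket.rpow_const fun x => Or.inl (bracket_pos x).ne'
  rw [memLp_two_iff_integrable_sq hc.aestronglyMeasurable]
  have := integrable_rpow_neg_one_add_norm_sq (E := Sp N) (μ := volume) (r := 2 * s)
    (by simp [finrank_euclideanSpace]; linarith)
  refine this.congr (of_forall fun x => ?_)
  simp only []
  have h0 : (0 : ℝ) ≤ 1 + ‖x‖ ^ 2 := by positivity
  rw [← rpow_natCast (bracket x ^ (-s)) 2, ← rpow_mul (bracket_pos x).le, bracket, Real.sqrt_eq_rpow, ← rpow_mul h0]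
  congr 1
  push_cast; ring

lemma memLp_bracket_pow (A : Adm N k m n) : MemLp (fun x : Sp N => (bracket x ^ n)⁻¹) 2 := by
  have := memLp_bracket_rpow (N := N) (s := n) (by linarith [A.hn])
  simpa [rpow_neg (bracket_pos _).le] using this

lemma finite_order_le (l : ℕ) : {β : 𝕄 | order β ≤ l}.Finite := by
  refine Set.Finite.subset (Set.finite_Iic (fun _ : Fin N => l)) fun β hβ i => ?_
  exact (single_le_sum (f := β) (fun _ _ => Nat.zero_le _) (Finset.mem_univ i)).trans hβ

lemma mem_piAntidiag_iff {l : ℕ} : β ∈ piAntidiag (Finset.univ : Finset (Fin N)) l ↔ order β = l := by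
  simp [order, Finset.mem_piAntidiag]

lemma exists_wt_eq (A : Adm N k m n) {l : ℕ} (h1 : 2 * m + 1 ≤ l) (h2 : l ≤ J) :
    ∃ ν ≤ k + 1, ∃ μ ≤ n, l = ν + μ + 2 * m + 1 ∧ wt k m n l = n - μ := by
  unfold bigJ at h2
  simp only [wt, bigJ]
  rcases le_or_gt l (2 * m + 2 + k) with h | h
  · exact ⟨l - 2 * m - 1, by omega, 0, by omega, by omega, by omega⟩
  · exact ⟨k + 1, by omega, l - 2 * m - 2 - k, by omega, by omega, by omega⟩

lemma le_wt {ν μ l : ℕ} (h1 : ν ≤ k + 1) (h2 : μ ≤ n) (h : l = ν + μ + 2 * m + 1) : n - μ ≤ wt k m n l := by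
  simp only [wt, bigJ]; omega

lemma wnorm_mono {p : ℝ≥0∞} {a b : ℕ} (h : a ≤ b) (β : 𝕄) (u : Sp N → ℂ) : wnorm p a β u ≤ wnorm p b β u := by
  unfold wnorm
  refine iInf₂_mono fun g _ => eLpNorm_mono fun x => ?_
  rw [norm_wsmul, norm_wsmul]
  exact mul_le_mul_of_nonneg_right (pow_le_pow_right₀ (one_le_bracket x) h) (norm_nonneg _)

lemma MemS.wnorm_wt_lt_top {u : Sp N → ℂ} (h : MemS N k m n u) (h1 : 2 * m + 1 ≤ order β) (h2 : order β ≤ J) :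
    wnorm 2 (wt k m n (order β)) β u < ⊤ := by
  rcases le_or_gt (order β) (2 * m + 2 + k) with h3 | h3
  · exact (wnorm_mono (min_le_left _ _) _ _).trans_lt (h.middle β h1 h3)
  · exact (wnorm_mono (min_le_right _ _) _ _).trans_lt (h.high β h3 h2)

lemma MemS.normS_lt_top {u : Sp N → ℂ} (h : MemS N k m n u) : normS N k m n u < ⊤ := by
  unfold normS
  refine add_lt_top.2 ⟨sum_lt_top.2 fun j hj => ?_, sum_lt_top.2
    fun ν hν => sum_lt_top.2 fun μ hμ => sum_lt_top.2 fun β hβ => ?_⟩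
  · have : (⨆ β : 𝕄, ⨆ _ : order β = j, wnorm ∞ n β u)
        = (piAntidiag (Finset.univ : Finset (Fin N)) j).sup fun β => wnorm ∞ n β u := by
      rw [Finset.sup_eq_iSup]; simp only [mem_piAntidiag_iff]
    rw [this, Finset.sup_lt_iff ENNReal.zero_lt_top]
    intro β hβ
    rw [mem_piAntidiag_iff] at hβ
    exact h.low β (by rw [Finset.mem_range] at hj; omega)
  · rw [mem_piAntidiag_iff] at hβ
    rw [Finset.mem_range] at hν hμ
    exact (wnorm_mono (le_wt (by omega) (by omega) hβ) _ _).trans_lt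
      (h.wnorm_wt_lt_top (by omega) (by unfold bigJ; omega))

lemma wnorm_low_le_normS {u : Sp N → ℂ} (h : order β ≤ 2 * m) : wnorm ∞ n β u ≤ normS N k m n u := by
  unfold normS
  refine le_trans ?_ le_self_add
  refine le_trans ?_ (single_le_sum (fun _ _ => zero_le) (Finset.mem_range.2 (Nat.lt_succ_of_le h)))
  exact le_iSup₂_of_le β rfl le_rfl

lemma wnorm_high_le_normS {u : Sp N → ℂ} {ν μ : ℕ} (h1 : ν ≤ k + 1) (h2 : μ ≤ n)
    (h : order β = ν + μ + 2 * m + 1) : wnorm 2 (n - μ) β u ≤ normS N k m n u := by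
  unfold normS
  refine le_trans ?_ le_add_self
  refine le_trans ?_ (single_le_sum (fun _ _ => zero_le) (Finset.mem_range.2 (Nat.lt_succ_of_le h1)))
  refine le_trans ?_ (single_le_sum (fun _ _ => zero_le) (Finset.mem_range.2 (Nat.lt_succ_of_le h2)))
  exact single_le_sum (f := fun β => wnorm 2 (n - μ) β u) (fun _ _ => zero_le) (mem_piAntidiag_iff.2 h)

lemma wnorm_wt_le_normS (A : Adm N k m n) {u : Sp N → ℂ} (h1 : 2 * m + 1 ≤ order β) (h2 : order β ≤ J) :
    wnorm 2 (wt k m n (order β)) β u ≤ normS N k m n u := by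
  obtain ⟨ν, hν, μ, hμ, h, hw⟩ := exists_wt_eq A h1 h2
  rw [hw]
  exact wnorm_high_le_normS hν hμ h

/-- The derivatives of order at most `2m + 2` have continuous representatives. -/
lemma IsJet.exists_continuous (A : Adm N k m n) {d : 𝕄 → Sp N → ℂ}
    (hd : IsJet J d) (h2 : ∀ β, order β ≤ J → eLpNorm (d β) 2 < ⊤)
    (β : 𝕄) (hβ : order β ≤ 2 * m + 2) : ∃ z, Continuous z ∧ d β =ᵐ[volume] z := by
  obtain ⟨C, hC, HS⟩ := sobolev_embedding A.hk
  obtain ⟨B, hB⟩ : ∃ B : ℝ, ∀ γ, order γ ≤ k → eLpNorm (fun x => bracket x ^ 0 • d (β + γ) x) 2 volume ≤ ofReal B := by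
    have hfin := finite_order_le (N := N) k
    refine ⟨∑ γ ∈ hfin.toFinset, (eLpNorm (d (β + γ)) 2 volume).toReal, fun γ hγ => ?_⟩
    have ho : order (β + γ) ≤ J := by rw [order_add]; unfold bigJ; omega
    simp only [pow_zero, one_smul]
    rw [← ofReal_toReal (h2 _ ho).ne]
    exact ofReal_le_ofReal (single_le_sum
      (f := fun γ => (eLpNorm (d (β + γ)) 2 volume).toReal) (fun _ _ => toReal_nonneg)
      (by simpa using hγ))
  have hw : WReg 0 k (d β) (max B 0) := hd.wReg k β (by unfold bigJ; omega)
    fun γ hγ => (hB γ hγ).trans (ofReal_le_ofReal (le_max_left _ _))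
  obtain ⟨z, hz, hdz, -⟩ := HS _ _ (le_max_right _ _) hw
  exact ⟨z, hz, hdz⟩

lemma exists_sJet (A : Adm N k m n) {u : Sp N → ℂ} (h : MemS N k m n u) :
    ∃ d, SJet k m n d (normS N k m n u).toReal ∧ d 0 = u := by
  classical
  obtain ⟨d, hd, hd0⟩ := exists_isJet (M := J) (u := u) fun β hβ => exists_isWeakDeriv_of_wnorm (h.sobolev β hβ)
  have hreg : ∀ β, order β ≤ 2 * m + 2 → ∃ z, Continuous z ∧ d β =ᵐ[volume] z :=
    hd.exists_continuous A fun β hβ => by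
      have := h.sobolev β hβ
      rw [← hd0, hd.wnorm_eq 2 0 β hβ] at this
      simpa using this
  choose! z hz hdz using hreg
  let e : 𝕄 → Sp N → ℂ := fun β => if β = 0 then u else
    if order β ≤ 2 * m + 2 then z β else d β
  have hde : ∀ β, d β =ᵐ[volume] e β := by
    intro β
    by_cases h0 : β = 0
    · subst h0; simp [e, hd0]
    · by_cases h1 : order β ≤ 2 * m + 2
      · simpa [e, h0, h1] using hdz β h1
      · simp [e, h0, h1]
  have he := hd.congr fun β _ => hde β
  have he0 : e 0 = u := by simp [e]
  have hec : ∀ β, order β ≤ 2 * m + 2 → Continuous (e β) := by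
    intro β hβ
    by_cases h0 : β = 0
    · subst h0; rw [he0]; exact h.continuous
    · simpa [e, h0, hβ] using hz β hβ
  have hN := ofReal_toReal h.normS_lt_top.ne
  refine ⟨e, ⟨he, hec, fun β hβ x => ?_, fun β h1 h2 => ?_⟩, he0⟩
  · have h3 := wnorm_low_le_normS (k := k) (n := n) (u := u) hβ
    rw [← he0, he.wnorm_eq _ _ _ (by unfold bigJ; omega), he0, ← hN,
      eLpNorm_top_le_iff (continuous_bracket_smul (hec β (by omega)) n) toReal_nonneg] at h3
    have h4 := h3 x
    rwa [norm_wsmul] at h4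
  · rw [hN, ← he.wnorm_eq _ _ _ h2, he0]
    exact wnorm_wt_le_normS A h1 h2

namespace SJet

variable {d e : (Fin N → ℕ) → Sp N → ℂ} {B B' : ℝ}

lemma mono (H : SJet k m n d B) (h : B ≤ B') : SJet k m n d B' :=
  ⟨H.jet, H.cont, fun β hβ x => (H.low β hβ x).trans h, fun β h1 h2 => (H.high β h1 h2).trans (ofReal_le_ofReal h)⟩

lemma nonneg (H : SJet k m n d B) : 0 ≤ B :=
  le_trans (mul_nonneg (pow_nonneg (bracket_pos 0).le _) (norm_nonneg _)) (H.low 0 (by simp [order_zero]) 0)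

lemma aesm (H : SJet k m n d B) (h : order β ≤ J) :
    AEStronglyMeasurable (d β) := (H.jet.locallyIntegrable β h).aestronglyMeasurable

lemma aesm_smul (H : SJet k m n d B) (h : order β ≤ J) (a : ℕ) :
    AEStronglyMeasurable (fun x => bracket x ^ a • d β x) :=
  (continuous_bracket.pow a).aestronglyMeasurable.smul (H.aesm h)

lemma add (H : SJet k m n d B) (H' : SJet k m n e B') : SJet k m n (fun β x => d β x + e β x) (B + B') := by
  refine ⟨H.jet.add H'.jet, fun β h => (H.cont β h).add (H'.cont β h), fun β h x => ?_, fun β h1 h2 => ?_⟩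
  · have := mul_le_mul_of_nonneg_left (norm_add_le (d β x) (e β x)) (pow_nonneg (bracket_pos x).le n)
    linarith [H.low β h x, H'.low β h x]
  · simp only [smul_add]
    rw [ofReal_add H.nonneg H'.nonneg]
    exact (eLpNorm_add_le (H.aesm_smul h2 _) (H'.aesm_smul h2 _) (by norm_num)).trans
      (add_le_add (H.high β h1 h2) (H'.high β h1 h2))

lemma const_mul (H : SJet k m n d B) (c : ℂ) : SJet k m n (fun β x => c * d β x) (‖c‖ * B) := by
  refine ⟨H.jet.const_mul c, fun β h => continuous_const.mul (H.cont β h), fun β h x => ?_, fun β h1 h2 => ?_⟩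
  · rw [norm_mul]
    nlinarith [mul_le_mul_of_nonneg_left (H.low β h x) (norm_nonneg c)]
  · have e : (fun x => (bracket x ^ wt k m n (order β)) • (c * d β x))
        = c • fun x => (bracket x ^ wt k m n (order β)) • d β x := by
      funext x; simp only [real_smul, Pi.smul_apply, smul_eq_mul]; ring
    rw [e, eLpNorm_const_smul, ofReal_mul (norm_nonneg _), ofReal_norm]
    exact mul_le_mul_right (H.high β h1 h2) _

lemma sub (H : SJet k m n d B) (H' : SJet k m n e B') : SJet k m n (fun β x => d β x - e β x) (B + B') := by
  have := H.add (H'.const_mul (-1))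
  simpa [sub_eq_add_neg] using this

lemma wnorm_low (H : SJet k m n d B) (h : order β ≤ 2 * m) : wnorm ∞ n β (d 0) ≤ ofReal B := by
  rw [H.jet.wnorm_eq _ _ _ (by unfold bigJ; omega),
    eLpNorm_top_le_iff (continuous_bracket_smul (H.cont β (by omega)) n) H.nonneg]
  intro x
  rw [norm_wsmul]
  exact H.low β h x

lemma wnorm_high (H : SJet k m n d B) (h1 : 2 * m + 1 ≤ order β)
    (h2 : order β ≤ J) {a : ℕ} (ha : a ≤ wt k m n (order β)) :
    wnorm 2 a β (d 0) ≤ ofReal B :=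
  (wnorm_mono ha _ _).trans (by rw [H.jet.wnorm_eq _ _ _ h2]; exact H.high β h1 h2)

/-- All derivatives are square integrable. -/
lemma eLpNorm_le (A : Adm N k m n) (H : SJet k m n d B) (h : order β ≤ J) : eLpNorm (d β) 2
      ≤ ofReal B * (1 + eLpNorm (fun x : Sp N => (bracket x ^ n)⁻¹) 2) := by
  rw [mul_add, mul_one]
  rcases le_or_gt (order β) (2 * m) with h1 | h1
  · refine le_trans ?_ le_add_self
    have := eLpNorm_le_mul_eLpNorm_of_ae_le_mul (μ := volume) (p := 2) (f := d β)
      (g := fun x : Sp N => (bracket x ^ n)⁻¹) (c := B) (of_forall fun x => ?_)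
    · exact this
    · have := pow_pos (bracket_pos x) n
      rw [norm_of_nonneg (by positivity), ← div_eq_mul_inv, le_div_iff₀ this, mul_comm]
      exact H.low β h1 x
  · refine le_trans ?_ le_self_add
    refine le_trans (eLpNorm_mono fun x => ?_) (H.high β h1 h)
    rw [norm_wsmul]
    exact le_mul_of_one_le_left (norm_nonneg _) (one_le_pow₀ (one_le_bracket x))

lemma memLp (A : Adm N k m n) (H : SJet k m n d B) (h : order β ≤ J) : MemLp (d β) 2 := by
  refine ⟨H.aesm h, (H.eLpNorm_le A h).trans_lt (mul_lt_top ofReal_lt_top ?_)⟩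
  exact add_lt_top.2 ⟨ENNReal.one_lt_top, (memLp_bracket_pow A).2⟩

lemma memS (A : Adm N k m n) (H : SJet k m n d B) : MemS N k m n (d 0) where
  continuous := H.cont 0 (by simp [order_zero])
  sobolev β h := by
    rw [H.jet.wnorm_eq _ _ _ h]
    simpa using (H.memLp A h).2
  low β h := (H.wnorm_low h).trans_lt ofReal_lt_top
  middle β h1 h2 := (H.wnorm_high h1 (by unfold bigJ; omega) (by simp only [wt, bigJ]; omega)).trans_lt ofReal_lt_top
  high β h1 h2 := (H.wnorm_high (by omega) h2 (by simp only [wt, bigJ]; omega)).trans_lt ofReal_lt_top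

/-- The number of seminorms in the norm of `𝓢`. -/
lemma _root_.DissipativeNLS.normS_le_of_wnorm {u : Sp N → ℂ} {c : ℝ≥0∞}
    (h1 : ∀ β, order β ≤ 2 * m → wnorm ∞ n β u ≤ c)
    (h2 : ∀ ν μ β, ν ≤ k + 1 → μ ≤ n → order β = ν + μ + 2 * m + 1 → wnorm 2 (n - μ) β u ≤ c) :
    normS N k m n u ≤ ((2 * m + 1 : ℕ) + ∑ ν ∈ Finset.range (k + 2), ∑ μ ∈ Finset.range (n + 1),
      (piAntidiag (Finset.univ : Finset (Fin N)) (ν + μ + 2 * m + 1)).card : ℕ) * c := by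
  unfold normS
  push_cast
  rw [add_mul, sum_mul]
  refine add_le_add ?_ (sum_le_sum fun ν hν => ?_)
  · refine (sum_le_card_nsmul _ _ c fun j hj => ?_).trans (le_of_eq ?_)
    · refine iSup₂_le fun β hβ => h1 β ?_
      rw [Finset.mem_range] at hj; omega
    · simp
  · rw [sum_mul]
    refine sum_le_sum fun μ hμ => ?_
    refine (sum_le_card_nsmul _ _ c fun β hβ => ?_).trans (le_of_eq ?_)
    · rw [mem_piAntidiag_iff] at hβ
      rw [Finset.mem_range] at hν hμ
      exact h2 ν μ β (by omega) (by omega) hβ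
    · simp

/-- The number of seminorms in the norm of `𝓢`. -/
def _root_.DissipativeNLS.cardS (N k m n : ℕ) : ℕ :=
  (2 * m + 1 : ℕ) + ∑ ν ∈ Finset.range (k + 2), ∑ μ ∈ Finset.range (n + 1),
      (piAntidiag (Finset.univ : Finset (Fin N)) (ν + μ + 2 * m + 1)).card

lemma normS_le (H : SJet k m n d B) : normS N k m n (d 0) ≤ cardS N k m n * ofReal B :=
  normS_le_of_wnorm (fun _ h => H.wnorm_low h) fun ν μ β h1 h2 h =>
    H.wnorm_high (by omega) (by unfold bigJ; omega) (le_wt h1 h2 h)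

lemma normS_le_ofReal (H : SJet k m n d B) : normS N k m n (d 0) ≤ ofReal (cardS N k m n * B) := by
  rw [ofReal_mul (by positivity), ofReal_natCast]
  exact H.normS_le

/-- Jets of the same function agree up to the order of continuity. -/
lemma eq_of_zero (H : SJet k m n d B) (H' : SJet k m n e B') (h0 : d 0 = e 0) (h : order β ≤ 2 * m + 2) : d β = e β :=
  ((H.cont β h).ae_eq_iff_eq (μ := volume) (H'.cont β h)).1
    (H.jet.ae_eq H'.jet (by rw [h0]) β (by unfold bigJ; omega))

lemma ae_eq_of_zero (H : SJet k m n d B) (H' : SJet k m n e B') (h0 : d 0 = e 0) (h : order β ≤ J) : d β =ᵐ[volume] e β :=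
  H.jet.ae_eq H'.jet (by rw [h0]) β h

/-- The bound of a jet can be replaced by the norm of the function. -/
lemma toReal_normS (A : Adm N k m n) (H : SJet k m n d B) : SJet k m n d (normS N k m n (d 0)).toReal := by
  obtain ⟨e, he, he0⟩ := exists_sJet A (H.memS A)
  refine ⟨H.jet, H.cont, fun β h => ?_, fun β h1 h2 => ?_⟩
  · rw [H.eq_of_zero he he0.symm (by omega)]
    exact he.low β h
  · rw [eLpNorm_congr_ae (g := fun x => (bracket x ^ wt k m n (order β)) • e β x)]
    · exact he.high β h1 h2
    · filter_upwards [H.ae_eq_of_zero he he0.symm h2] with x hx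
      rw [hx]

lemma wReg (H : SJet k m n d B) (h1 : 2 * m + 1 ≤ order β) (h2 : order β ≤ 2 * m + 2) : WReg n k (d β) B := by
  refine H.jet.wReg k β (by unfold bigJ; omega) fun γ hγ => ?_
  have := H.high (β + γ) (by rw [order_add]; omega) (by rw [order_add]; unfold bigJ; omega)
  rwa [show wt k m n (order (β + γ)) = n by rw [order_add]; simp only [wt, bigJ]; omega] at this

lemma hasFDerivAt (H : SJet k m n d B) (h : order β ≤ 2 * m + 1) (x : Sp N) :
    HasFDerivAt (d β) (gradForm fun i => d (β + 𝐞 i) x) x :=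
  hasFDerivAt_of_weakPartial (H.cont β (by omega)) (fun i => H.cont _ (by rw [order_add_single]; omega))
    (fun i => H.jet.step β i (by unfold bigJ; omega)) x

lemma contDiff_one (H : SJet k m n d B) (h : order β ≤ 2 * m + 1) : ContDiff ℝ 1 (d β) :=
  contDiff_one_of_weakPartial (H.cont β (by omega)) (fun i => H.cont _ (by rw [order_add_single]; omega))
    (fun i => H.jet.step β i (by unfold bigJ; omega))

lemma fderiv_stdVec (H : SJet k m n d B) (h : order β ≤ 2 * m + 1) (x : Sp N)
    (i : Fin N) : fderiv ℝ (d β) x (stdVec i) = d (β + 𝐞 i) x := by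
  rw [(H.hasFDerivAt h x).fderiv, gradForm_stdVec]

end SJet

lemma exists_sup_const (A : Adm N k m n) : ∃ C : ℝ, 1 ≤ C ∧ ∀ (d : 𝕄 → Sp N → ℂ) (B : ℝ),
    SJet k m n d B → ∀ β, order β ≤ 2 * m + 2 → ∀ x, bracket x ^ n * ‖d β x‖ ≤ C * B := by
  obtain ⟨C, hC, HS⟩ := weighted_sobolev A.hk n
  refine ⟨max C 1, le_max_right _ _, fun d B H β hβ x => ?_⟩
  have hB := H.nonneg
  rcases le_or_gt (order β) (2 * m) with h | h
  · exact (H.low β h x).trans (le_mul_of_one_le_left hB (le_max_right _ _))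
  · obtain ⟨z, hz, hdz, hb⟩ := HS _ _ hB (H.wReg h hβ)
    rw [((H.cont β hβ).ae_eq_iff_eq (μ := volume) hz).1 hdz]
    exact (hb x).trans (mul_le_mul_of_nonneg_right (le_max_left _ _) hB)

/-- The constant of the weighted Sobolev embedding of `𝓢`. -/
def supC : ℝ := (exists_sup_const A).choose

lemma one_le_supC : 1 ≤ supC A := (exists_sup_const A).choose_spec.1

lemma SJet.sup_le {d : 𝕄 → Sp N → ℂ} {B : ℝ} (H : SJet k m n d B) (h : order β ≤ 2 * m + 2) (x : Sp N) :
    bracket x ^ n * ‖d β x‖ ≤ supC A * B := (exists_sup_const A).choose_spec.2 d B H β h x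

/-- A function is an element of `𝓢` if it has weak derivatives with the appropriate bounds. -/
lemma exists_sJet_of_isWeakDeriv (A : Adm N k m n) {u : Sp N → ℂ} {B : ℝ} (hB : 0 ≤ B)
    (hu : Continuous u) (H : ∀ β, order β ≤ J → ∃ g, IsWeakDeriv β u g ∧
      (order β ≤ 2 * m → ∀ᵐ x, bracket x ^ n * ‖g x‖ ≤ B) ∧
      (2 * m + 1 ≤ order β → eLpNorm (fun x => (bracket x ^ wt k m n (order β)) • g x) 2 ≤ ofReal B)) :
    ∃ d, SJet k m n d B ∧ d 0 = u := by
  have hw : ∀ {β : 𝕄} {g : Sp N → ℂ} {p : ℝ≥0∞} {a : ℕ}, IsWeakDeriv β u g →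
      wnorm p a β u ≤ eLpNorm (fun x => bracket x ^ a • g x) p :=
    fun hg => iInf₂_le _ hg
  have hlow : ∀ β, order β ≤ 2 * m → wnorm ∞ n β u ≤ ofReal B := by
    intro β h
    obtain ⟨g, hg, h1, -⟩ := H β (by unfold bigJ; omega)
    refine (hw hg).trans ?_
    rw [eLpNorm_exponent_top]
    refine eLpNormEssSup_le_of_ae_enorm_bound ?_
    filter_upwards [h1 h] with x hx
    rw [← ofReal_norm, norm_wsmul]
    exact ofReal_le_ofReal hx
  have hhigh : ∀ β, 2 * m + 1 ≤ order β → order β ≤ J → wnorm 2 (wt k m n (order β)) β u ≤ ofReal B := by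
    intro β h1 h2
    obtain ⟨g, hg, -, h3⟩ := H β h2
    exact (hw hg).trans (h3 h1)
  have hS : MemS N k m n u := by
    refine ⟨hu, fun β h => ?_, fun β h => (hlow β h).trans_lt ofReal_lt_top, fun β h1 h2 => ?_, fun β h1 h2 => ?_⟩
    · rcases le_or_gt (order β) (2 * m) with h1 | h1
      · obtain ⟨g, hg, h2, -⟩ := H β h
        refine (hw hg).trans_lt ?_
        have h3 := eLpNorm_le_mul_eLpNorm_of_ae_le_mul (μ := volume) (p := 2) (f := fun x => bracket x ^ 0 • g x)
          (g := fun x : Sp N => (bracket x ^ n)⁻¹) (c := B) (by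
            filter_upwards [h2 h1] with x hx
            have := pow_pos (bracket_pos x) n
            rw [norm_of_nonneg (by positivity), ← div_eq_mul_inv, le_div_iff₀ this, mul_comm]
            simpa using hx)
        exact h3.trans_lt (mul_lt_top ofReal_lt_top (memLp_bracket_pow A).2)
      · exact ((wnorm_mono (Nat.zero_le _) _ _).trans (hhigh β h1 h)).trans_lt ofReal_lt_top
    · have := hhigh β h1 (by unfold bigJ; omega)
      rw [show wt k m n (order β) = n by simp only [wt, bigJ]; omega] at this
      exact this.trans_lt ofReal_lt_top
    · have := hhigh β (by omega) h2
      rw [show wt k m n (order β) = J - order β by simp only [wt, bigJ]; omega] at this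
      exact this.trans_lt ofReal_lt_top
  obtain ⟨d, hd, hd0⟩ := exists_sJet A hS
  refine ⟨d, ⟨hd.jet, hd.cont, fun β h x => ?_, fun β h1 h2 => ?_⟩, hd0⟩
  · have h3 := hlow β h
    rw [← hd0, hd.jet.wnorm_eq _ _ _ (by unfold bigJ; omega),
      eLpNorm_top_le_iff (continuous_bracket_smul (hd.cont β (by omega)) n) hB] at h3
    have h4 := h3 x
    rwa [norm_wsmul] at h4
  · rw [← hd.jet.wnorm_eq _ _ _ h2, hd0]
    exact hhigh β h1 h2

/-! ### `𝓢` as a Banach space -/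

/-- The exponent of the derivative `D^β u` in the norm of `𝓢`. -/
def pE (m : ℕ) (β : 𝕄) : ℝ≥0∞ := if order β ≤ 2 * m then ∞ else 2

/-- The weight of the derivative `D^β u` in the norm of `𝓢`. -/
def wE (k m n : ℕ) (β : 𝕄) : ℕ := if order β ≤ 2 * m then n else wt k m n (order β)

instance (m : ℕ) (β : 𝕄) : Fact (1 ≤ pE m β) := ⟨by unfold pE; split_ifs <;> norm_num⟩

/-- The multi-indices of order at most `M`. -/
abbrev Idx (N M : ℕ) : Type := {β : Fin N → ℕ // order β ≤ M}

instance (M : ℕ) : Finite (Idx N M) := finite_order_le M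

instance (M : ℕ) : Fintype (Idx N M) := Fintype.ofFinite _

/-- The space of families of weighted derivatives. -/
abbrev Fam (N k m n : ℕ) : Type := (β : Idx N (bigJ k m n)) → Lp ℂ (pE m β.1) (volume : Measure (Sp N))

/-- Testing an element of `L^p`. -/
def testLp (p : ℝ≥0∞) [hp : Fact (1 ≤ p)] (ψ : Sp N → ℝ) (h1 : Continuous ψ)
    (h2 : HasCompactSupport ψ) : Lp ℂ p (volume : Measure (Sp N)) →L[ℂ] ℂ :=
  haveI := ENNReal.HolderConjugate.inv_one_sub_inv' hp.out
  haveI : Fact (1 ≤ (1 - p⁻¹)⁻¹) := by simp [fact_iff]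
  ((lsmul ℂ ℂ (E := ℂ)).flip.lpPairing volume p (1 - p⁻¹)⁻¹).flip
    (((continuous_ofReal.comp h1).memLp_of_hasCompactSupport (h2.comp_left (g := Complex.ofReal) rfl)).toLp _)

lemma testLp_apply (p : ℝ≥0∞) [hp : Fact (1 ≤ p)] (ψ : Sp N → ℝ) (h1 : Continuous ψ)
    (h2 : HasCompactSupport ψ) (f : Lp ℂ p (volume : Measure (Sp N))) :
    testLp p ψ h1 h2 f = ∫ x, ψ x • f x := by
  haveI := ENNReal.HolderConjugate.inv_one_sub_inv' hp.out
  haveI : Fact (1 ≤ (1 - p⁻¹)⁻¹) := by simp [fact_iff]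
  unfold testLp
  rw [flip_apply, ContinuousLinearMap.lpPairing_eq_integral]
  refine integral_congr_ae ?_
  filter_upwards [MemLp.coeFn_toLp (p := (1 - p⁻¹)⁻¹) (μ := volume)
    ((continuous_ofReal.comp h1).memLp_of_hasCompactSupport (h2.comp_left (g := Complex.ofReal) rfl))] with x hx
  rw [hx]
  simp

/-- The function `⟨x⟩^{-w} f_β`. -/
def unW (f : Fam N k m n) (β : Idx N J) (x : Sp N) : ℂ := ((bracket x ^ wE k m n β.1)⁻¹ : ℝ) • f β x

lemma continuous_inv_bracket (a : ℕ) : Continuous fun x : Sp N => (bracket x ^ a)⁻¹ :=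
  (continuous_bracket.pow a).inv₀ fun x => (pow_pos (bracket_pos x) a).ne'

/-- The compatibility condition of a family of derivatives, tested by `φ`. -/
def compat (β : Idx N J) (i : Fin N) (h : order (β.1 + 𝐞 i) ≤ J)
    (φ : Sp N → ℝ) (hφ : IsTest φ) : Fam N k m n →L[ℂ] ℂ :=
  testLp (pE m β.1) (fun x => partialD i φ x * (bracket x ^ wE k m n β.1)⁻¹)
      ((hφ.partialD i).1.continuous.mul (continuous_inv_bracket _)) (hφ.partialD i).2.mul_right ∘L
      ContinuousLinearMap.proj β
    + testLp (pE m (β.1 + 𝐞 i)) (fun x => φ x * (bracket x ^ wE k m n (β.1 + 𝐞 i))⁻¹)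
      (hφ.1.continuous.mul (continuous_inv_bracket _)) hφ.2.mul_right ∘L
      ContinuousLinearMap.proj (R := ℂ) (φ := fun β : Idx N J => Lp ℂ (pE m β.1) (volume : Measure (Sp N)))
        (⟨β.1 + 𝐞 i, h⟩ : Idx N J)

lemma compat_apply (β : Idx N J) (i : Fin N) (h : order (β.1 + 𝐞 i) ≤ J)
    (φ : Sp N → ℝ) (hφ : IsTest φ) (f : Fam N k m n) :
    compat β i h φ hφ f = (∫ x, partialD i φ x • unW f β x) + ∫ x, φ x • unW f ⟨β.1 + 𝐞 i, h⟩ x := by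
  unfold compat
  rw [add_apply, ContinuousLinearMap.comp_apply, ContinuousLinearMap.comp_apply, testLp_apply, testLp_apply]
  simp only [unW, mul_smul]
  rfl

/-- The Banach space `𝓢`, realized by families of weighted derivatives. -/
def XS (N k m n : ℕ) : Submodule ℂ (Fam N k m n) :=
  ⨅ (β : Idx N (bigJ k m n)) (i : Fin N) (h : order (β.1 + 𝐞 i) ≤ bigJ k m n)
    (φ : Sp N → ℝ) (hφ : IsTest φ), LinearMap.ker (compat β i h φ hφ).toLinearMap

lemma mem_XS {f : Fam N k m n} : f ∈ XS N k m n ↔ ∀ (β : Idx N J) (i : Fin N)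
    (h : order (β.1 + 𝐞 i) ≤ J) (φ : Sp N → ℝ), IsTest φ →
    (∫ x, partialD i φ x • unW f β x) + ∫ x, φ x • unW f ⟨β.1 + 𝐞 i, h⟩ x = 0 := by
  simp only [XS, Submodule.mem_iInf, LinearMap.mem_ker, coe_coe, compat_apply]

instance : CompleteSpace (XS N k m n) := by
  have : IsClosed (XS N k m n : Set (Fam N k m n)) := by
    unfold XS
    simp only [Submodule.coe_iInf]
    exact isClosed_iInter fun β => isClosed_iInter fun i => isClosed_iInter fun h =>
      isClosed_iInter fun φ => isClosed_iInter fun hφ => (compat β i h φ hφ).isClosed_ker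
  exact this.completeSpace_coe

lemma eLpNorm_coe_le (f : XS N k m n) (β : Idx N J) : eLpNorm (f.1 β) (pE m β.1) ≤ ofReal ‖f‖ := by
  rw [← enorm_def, ← ofReal_norm]
  exact ofReal_le_ofReal (norm_le_pi_norm f.1 β)

lemma bracket_smul_unW (f : Fam N k m n) (β : Idx N J) (x : Sp N) : (bracket x ^ wE k m n β.1) • unW f β x = f β x :=
  smul_inv_smul₀ (pow_pos (bracket_pos x) _).ne' _

lemma unW_locallyIntegrable (f : Fam N k m n) (β : Idx N J) : LocallyIntegrable (unW f β) := by
  have h := (Lp.memLp (f β)).locallyIntegrable (Fact.out : 1 ≤ pE m β.1)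
  rw [← locallyIntegrableOn_univ] at h ⊢
  exact h.continuousOn_smul isOpen_univ.isLocallyClosed (continuous_inv_bracket _).continuousOn

/-- The jet of an element of `XS`. -/
lemma exists_jet_XS (A : Adm N k m n) (f : XS N k m n) :
    ∃ d, SJet k m n d ‖f‖ ∧ ∀ β : Idx N J, d β.1 =ᵐ[volume] unW f.1 β := by
  classical
  let d₀ : 𝕄 → Sp N → ℂ := fun β => if h : order β ≤ J then unW f.1 ⟨β, h⟩ else 0
  have hd₀ : ∀ β : Idx N J, d₀ β.1 = unW f.1 β := fun β => dif_pos β.2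
  have hjet : IsJet J d₀ := by
    refine ⟨?_, fun β i hβ => ?_⟩
    · exact (hd₀ ⟨0, by simp [order_zero]⟩) ▸ unW_locallyIntegrable _ _
    · have h1 : order (β + 𝐞 i) ≤ J := by rw [order_add_single]; omega
      rw [show d₀ β = _ from hd₀ ⟨β, hβ.le⟩, show d₀ (β + 𝐞 i) = _ from hd₀ ⟨_, h1⟩]
      exact ⟨unW_locallyIntegrable _ _, unW_locallyIntegrable _ _, fun φ hφ =>
        eq_neg_of_add_eq_zero_left (mem_XS.1 f.2 ⟨β, hβ.le⟩ i h1 φ hφ)⟩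
  have hw : ∀ β (h : order β ≤ J), eLpNorm (fun x => (bracket x ^ wE k m n β) • d₀ β x)
      (pE m β) volume ≤ ofReal ‖f‖ := fun β h => by
    rw [show d₀ β = _ from hd₀ ⟨β, h⟩]
    refine le_trans (le_of_eq (congrArg (fun g => eLpNorm g _ volume) ?_)) (eLpNorm_coe_le f ⟨β, h⟩)
    funext x
    exact bracket_smul_unW f.1 ⟨β, h⟩ x
  have hlow : ∀ β, order β ≤ 2 * m → ∀ᵐ x, bracket x ^ n * ‖d₀ β x‖ ≤ ‖f‖ := fun β h => by
    have h1 := hw β (by unfold bigJ; omega)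
    simp only [wE, pE, h, if_true] at h1
    rw [eLpNorm_exponent_top] at h1
    filter_upwards [enorm_ae_le_eLpNormEssSup (fun x => bracket x ^ n • d₀ β x) volume] with x hx
    have := hx.trans h1
    rwa [← ofReal_norm, ofReal_le_ofReal_iff (norm_nonneg _), norm_wsmul] at this
  have hhigh : ∀ β, 2 * m + 1 ≤ order β → order β ≤ J →
      eLpNorm (fun x => (bracket x ^ wt k m n (order β)) • d₀ β x) 2 volume ≤ ofReal ‖f‖ := fun β h1 h2 => by
    have := hw β h2
    simpa only [wE, pE, show ¬ order β ≤ 2 * m by omega, if_false] using this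
  have h2 : ∀ β, order β ≤ J → eLpNorm (d₀ β) 2 volume < ⊤ := fun β h => by
    rcases le_or_gt (order β) (2 * m) with h1 | h1
    · have h3 := eLpNorm_le_mul_eLpNorm_of_ae_le_mul (μ := volume) (p := 2) (f := d₀ β)
        (g := fun x : Sp N => (bracket x ^ n)⁻¹) (c := ‖f‖) (by
          filter_upwards [hlow β h1] with x hx
          have := pow_pos (bracket_pos x) n
          rwa [norm_of_nonneg (by positivity), ← div_eq_mul_inv, le_div_iff₀ this, mul_comm])
      exact h3.trans_lt (mul_lt_top ofReal_lt_top (memLp_bracket_pow A).2)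
    · refine lt_of_le_of_lt (le_trans (eLpNorm_mono fun x => ?_) (hhigh β h1 h)) ofReal_lt_top
      rw [norm_wsmul]
      exact le_mul_of_one_le_left (norm_nonneg _) (one_le_pow₀ (one_le_bracket x))
  obtain ⟨u, hu, hu0⟩ := hjet.exists_continuous A h2 0 (by simp [order_zero])
  have hjw := fun β h => (hjet.isWeakDeriv β h).congr hu0 (EventuallyEq.refl _ (d₀ β))
  obtain ⟨d, hd, hd0⟩ := exists_sJet_of_isWeakDeriv A (norm_nonneg f) hu fun β hβ =>
    ⟨d₀ β, hjw β hβ, hlow β, fun h => hhigh β h hβ⟩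
  refine ⟨d, hd, fun β => ?_⟩
  rw [← hd₀]
  exact (hd.jet.isWeakDeriv β.1 β.2).unique (hd0 ▸ hjw β.1 β.2)

/-- The continuous representatives of the derivatives of an element of `XS`. -/
def jetX (f : XS N k m n) : 𝕄 → Sp N → ℂ := (exists_jet_XS A f).choose

lemma sJet_jetX (f : XS N k m n) : SJet k m n (jetX A f) ‖f‖ := (exists_jet_XS A f).choose_spec.1

lemma jetX_ae (f : XS N k m n) (β : Idx N J) :
    jetX A f β.1 =ᵐ[volume] unW f.1 β := (exists_jet_XS A f).choose_spec.2 β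

lemma unW_add (f g : Fam N k m n) (β : Idx N J) : unW (f + g) β =ᵐ[volume] fun x => unW f β x + unW g β x := by
  filter_upwards [coeFn_add (f β) (g β)] with x hx
  simp only [unW, Pi.add_apply] at hx ⊢
  rw [hx, smul_add]

lemma unW_smul (c : ℂ) (f : Fam N k m n) (β : Idx N J) : unW (c • f) β =ᵐ[volume] fun x => c * unW f β x := by
  filter_upwards [coeFn_smul c (f β)] with x hx
  simp only [unW, Pi.smul_apply] at hx ⊢
  rw [hx, smul_eq_mul, real_smul, real_smul]
  ring

lemma jetX_add_ae (f g : XS N k m n) (h : order β ≤ J) :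
    jetX A (f + g) β =ᵐ[volume] fun x => jetX A f β x + jetX A g β x := by
  filter_upwards [jetX_ae A f ⟨β, h⟩, jetX_ae A g ⟨β, h⟩, jetX_ae A (f + g) ⟨β, h⟩,
    unW_add f.1 g.1 ⟨β, h⟩] with x h1 h2 h3 h4
  rw [h1, h2, h3, ← h4]; rfl

lemma jetX_smul_ae (c : ℂ) (f : XS N k m n) (h : order β ≤ J) :
    jetX A (c • f) β =ᵐ[volume] fun x => c * jetX A f β x := by
  filter_upwards [jetX_ae A f ⟨β, h⟩, jetX_ae A (c • f) ⟨β, h⟩, unW_smul c f.1 ⟨β, h⟩] with x h1 h2 h3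
  rw [h1, h2, ← h3]; rfl

lemma jetX_sub_ae (f g : XS N k m n) (h : order β ≤ J) :
    jetX A (f - g) β =ᵐ[volume] fun x => jetX A f β x - jetX A g β x := by
  rw [show f - g = f + (-1 : ℂ) • g from (sub_eq_add_neg f g).trans (congrArg (f + ·) (neg_one_smul ℂ g).symm)]
  filter_upwards [jetX_add_ae A f ((-1 : ℂ) • g) h, jetX_smul_ae A (-1) g h] with x h1 h2
  rw [h1, h2]; ring

lemma jetX_continuous (f : XS N k m n) (h : order β ≤ 2 * m + 2) : Continuous (jetX A f β) := (sJet_jetX A f).cont β h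

lemma order_le_bigJ {l : ℕ} (h : l ≤ 2 * m + 2) : l ≤ J := by unfold bigJ; omega

lemma jetX_add (f g : XS N k m n) (h : order β ≤ 2 * m + 2)
    (x : Sp N) : jetX A (f + g) β x = jetX A f β x + jetX A g β x :=
  congrFun (((jetX_continuous A _ h).ae_eq_iff_eq (μ := volume)
    ((jetX_continuous A f h).add (jetX_continuous A g h))).1 (jetX_add_ae A f g (order_le_bigJ h))) x

lemma jetX_sub (f g : XS N k m n) (h : order β ≤ 2 * m + 2)
    (x : Sp N) : jetX A (f - g) β x = jetX A f β x - jetX A g β x :=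
  congrFun (((jetX_continuous A _ h).ae_eq_iff_eq (μ := volume)
    ((jetX_continuous A f h).sub (jetX_continuous A g h))).1 (jetX_sub_ae A f g (order_le_bigJ h))) x

lemma jetX_smul (c : ℂ) (f : XS N k m n) (h : order β ≤ 2 * m + 2) (x : Sp N) : jetX A (c • f) β x = c * jetX A f β x :=
  congrFun (((jetX_continuous A _ h).ae_eq_iff_eq (μ := volume)
    (continuous_const.mul (jetX_continuous A f h))).1 (jetX_smul_ae A c f (order_le_bigJ h))) x

/-- The function of an element of `XS`. -/
def fnX (f : XS N k m n) : Sp N → ℂ := jetX A f 0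

lemma jetX_ae_of_fn {f : XS N k m n} {d : 𝕄 → Sp N → ℂ} {B : ℝ}
    (H : SJet k m n d B) (h0 : fnX A f = d 0) (h : order β ≤ J) :
    jetX A f β =ᵐ[volume] d β := (sJet_jetX A f).ae_eq_of_zero H h0 h

lemma norm_le_of_sJet {f : XS N k m n} {d : 𝕄 → Sp N → ℂ} {B : ℝ}
    (H : SJet k m n d B) (h0 : fnX A f = d 0) : ‖f‖ ≤ B := by
  refine (pi_norm_le_iff_of_nonneg H.nonneg).2 fun β => ?_
  rw [Lp.norm_def]
  refine toReal_le_of_le_ofReal H.nonneg ?_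
  have h1 : eLpNorm (f.1 β) (pE m β.1) = eLpNorm (fun x => (bracket x ^ wE k m n β.1) • d β.1 x) (pE m β.1) := by
    refine eLpNorm_congr_ae ?_
    filter_upwards [jetX_ae A f β, jetX_ae_of_fn A H h0 β.2] with x hx hx'
    rw [← hx', hx, bracket_smul_unW]
  refine h1.le.trans ?_
  by_cases h : order β.1 ≤ 2 * m
  · simp only [wE, pE, h, if_true]
    rw [eLpNorm_top_le_iff (continuous_bracket_smul (H.cont β.1 (by omega)) n) H.nonneg]
    intro x
    rw [norm_wsmul]
    exact H.low β.1 h x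
  · simp only [wE, pE, h, if_false]
    exact H.high β.1 (by omega) β.2

lemma exists_XS_of_sJet {d : 𝕄 → Sp N → ℂ} {B : ℝ} (H : SJet k m n d B) : ∃ f : XS N k m n, fnX A f = d 0 := by
  have hmem : ∀ β : Idx N J, MemLp (fun x => (bracket x ^ wE k m n β.1) • d β.1 x) (pE m β.1) := by
    intro β
    refine ⟨H.aesm_smul β.2 _, ?_⟩
    by_cases h : order β.1 ≤ 2 * m
    · simp only [wE, pE, h, if_true]
      refine lt_of_le_of_lt ((eLpNorm_top_le_iff (continuous_bracket_smul (H.cont β.1 (by omega)) n)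
        H.nonneg).2 fun x => ?_) ofReal_lt_top
      rw [norm_wsmul]
      exact H.low β.1 h x
    · simp only [wE, pE, h, if_false]
      exact (H.high β.1 (by omega) β.2).trans_lt ofReal_lt_top
  let F : Fam N k m n := fun β => (hmem β).toLp _
  have hF : ∀ β, unW F β =ᵐ[volume] d β.1 := fun β => by
    filter_upwards [(hmem β).coeFn_toLp] with x hx
    simp only [unW, F, hx]
    exact inv_smul_smul₀ (pow_pos (bracket_pos x) _).ne' _
  have hFX : F ∈ XS N k m n := by
    rw [mem_XS]
    intro β i h φ hφ
    have h1 := (H.jet.step β.1 i (by rw [order_add_single] at h; omega)).eq φ hφ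
    have e : ∀ (β : Idx N J) (ψ : Sp N → ℝ),
        ∫ x, ψ x • unW F β x = ∫ x, ψ x • d β.1 x := fun β ψ => integral_congr_ae (by
      filter_upwards [hF β] with x hx using by rw [hx])
    rw [e, e, h1, neg_add_cancel]
  refine ⟨⟨F, hFX⟩, ?_⟩
  have h0 : order (0 : 𝕄) ≤ 2 * m + 2 := by simp [order_zero]
  refine ((jetX_continuous A _ h0).ae_eq_iff_eq (μ := volume) (H.cont 0 h0)).1 ?_
  exact (jetX_ae A ⟨F, hFX⟩ ⟨0, order_le_bigJ h0⟩).trans (hF _)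

lemma fnX_sub (f g : XS N k m n) (x : Sp N) :
    fnX A (f - g) x = fnX A f x - fnX A g x := jetX_sub A f g (by simp [order_zero]) x

lemma fnX_smul (c : ℂ) (f : XS N k m n) (x : Sp N) :
    fnX A (c • f) x = c * fnX A f x := jetX_smul A c f (by simp [order_zero]) x

lemma fnX_injective : Function.Injective (fnX (N := N) (k := k) (m := m) (n := n) A) := by
  intro f g h
  have h1 : fnX A (f - g) = fun _ => 0 := by
    funext x; rw [fnX_sub, h, sub_self]
  have h2 : SJet k m n (fun (_ : 𝕄) (_ : Sp N) => (0 : ℂ)) 0 := by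
    have := (sJet_jetX A f).const_mul 0
    simpa using this
  have := norm_le_of_sJet A h2 h1
  rwa [norm_le_zero_iff, sub_eq_zero] at this

lemma memS_fnX (f : XS N k m n) : MemS N k m n (fnX A f) := (sJet_jetX A f).memS A

lemma exists_XS {u : Sp N → ℂ} (h : MemS N k m n u) : ∃ f : XS N k m n, fnX A f = u := by
  obtain ⟨d, hd, hd0⟩ := exists_sJet A h
  obtain ⟨f, hf⟩ := exists_XS_of_sJet A hd
  exact ⟨f, hf.trans hd0⟩

lemma norm_le_normS (f : XS N k m n) : ofReal ‖f‖ ≤ normS N k m n (fnX A f) := by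
  rw [ofReal_le_iff_le_toReal (memS_fnX A f).normS_lt_top.ne]
  exact norm_le_of_sJet A ((sJet_jetX A f).toReal_normS A) rfl

lemma normS_le_norm (f : XS N k m n) : normS N k m n (fnX A f) ≤ ofReal (cardS N k m n * ‖f‖) :=
  (sJet_jetX A f).normS_le_ofReal

/-- Continuity with values in `𝓢`. -/
lemma contInS_iff {I : Set ℝ} {v : ℝ → Sp N → ℂ} {f : ℝ → XS N k m n}
    (h : ∀ t ∈ I, fnX A (f t) = v t) : ContInS N k m n I v ↔ ContinuousOn f I := by
  have key : ∀ s ∈ I, ∀ t ∈ I, v s - v t = fnX A (f s - f t) := fun s hs t ht => by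
    funext x; rw [fnX_sub, h s hs, h t ht]; rfl
  constructor
  · intro H t ht
    rw [ContinuousWithinAt, tendsto_iff_norm_sub_tendsto_zero]
    have h1 := (H t ht).2
    have h2 : Tendsto (fun s => ofReal ‖f s - f t‖) (𝓝[I] t) (𝓝 0) := by
      refine tendsto_of_tendsto_of_tendsto_of_le_of_le' tendsto_const_nhds h1 (of_forall fun _ => zero_le) ?_
      filter_upwards [self_mem_nhdsWithin] with s hs
      rw [key s hs t ht]
      exact norm_le_normS A _
    have h3 := (ENNReal.tendsto_toReal ENNReal.zero_ne_top).comp h2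
    simpa [comp_def, ENNReal.toReal_ofReal (norm_nonneg _)] using h3
  · intro H t ht
    refine ⟨h t ht ▸ memS_fnX A _, ?_⟩
    have h1 := tendsto_iff_norm_sub_tendsto_zero.1 (H t ht)
    have h2 : Tendsto (fun s => ofReal (cardS N k m n * ‖f s - f t‖)) (𝓝[I] t) (𝓝 0) := by
      have := ENNReal.tendsto_ofReal (h1.const_mul (cardS N k m n : ℝ))
      simpa using this
    refine tendsto_of_tendsto_of_tendsto_of_le_of_le' tendsto_const_nhds h2 (of_forall fun _ => zero_le) ?_
    filter_upwards [self_mem_nhdsWithin] with s hs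
    rw [key s hs t ht]
    exact normS_le_norm A _

lemma ContInS.exists_XS {I : Set ℝ} {v : ℝ → Sp N → ℂ}
    (H : ContInS N k m n I v) : ∃ f : ℝ → XS N k m n, (∀ t ∈ I, fnX A (f t) = v t) ∧ ContinuousOn f I := by
  have : ∀ t ∈ I, ∃ f : XS N k m n, fnX A f = v t := fun t ht => DissipativeNLS.exists_XS A (H t ht).1
  choose! f hf using this
  exact ⟨f, hf, (contInS_iff A hf).1 H⟩

local notation "𝕏" => XS N k m n

/-! ### Weighted Sobolev spaces invariant under the Schrödinger group -/

/-- All products of at most `a` coordinate multiplications and derivatives of `w` are bounded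
by `B` in `L²`. -/
def Sig : ℕ → L2 N → ℝ → Prop
  | 0, w, B => ‖w‖ ≤ B
  | a + 1, w, B => ‖w‖ ≤ B ∧ ∀ j, ∃ g h : L2 N, (g =ᵐ[volume] fun x => (x j : ℂ) * w x) ∧
      WeakPartial j w h ∧ Sig a g B ∧ Sig a h B

namespace Sig

variable {a : ℕ} {w v : L2 N} {B B' : ℝ}

lemma base (h : Sig a w B) : ‖w‖ ≤ B := by
  cases a with
  | zero => exact h
  | succ a => exact h.1

lemma pred (h : Sig (a + 1) w B) : Sig a w B := by
  induction a generalizing w with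
  | zero => exact h.1
  | succ a ih =>
    refine ⟨h.1, fun j => ?_⟩
    obtain ⟨g, d, hg, hd, h1, h2⟩ := h.2 j
    exact ⟨g, d, hg, hd, ih h1, ih h2⟩

lemma mono (h : Sig a w B) (hB : B ≤ B') : Sig a w B' := by
  induction a generalizing w with
  | zero => exact h.trans hB
  | succ a ih =>
    refine ⟨h.1.trans hB, fun j => ?_⟩
    obtain ⟨g, d, hg, hd, h1, h2⟩ := h.2 j
    exact ⟨g, d, hg, hd, ih h1, ih h2⟩

lemma smul (h : Sig a w B) (c : ℂ) : Sig a (c • w) (‖c‖ * B) := by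
  have hb : ∀ {w : L2 N}, ‖w‖ ≤ B → ‖c • w‖ ≤ ‖c‖ * B := fun h => by
    rw [norm_smul]; exact mul_le_mul_of_nonneg_left h (norm_nonneg c)
  induction a generalizing w with
  | zero => exact hb h
  | succ a ih =>
    refine ⟨hb h.1, fun j => ?_⟩
    obtain ⟨g, d, hg, hd, h1, h2⟩ := h.2 j
    refine ⟨c • g, c • d, ?_, (hd.const_mul c).congr (coeFn_smul c w).symm (coeFn_smul c d).symm, ih h1, ih h2⟩
    filter_upwards [hg, coeFn_smul c w, coeFn_smul c g] with x e1 e2 e3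
    rw [e2, e3, Pi.smul_apply, Pi.smul_apply, e1, smul_eq_mul, smul_eq_mul]
    ring

lemma add (h : Sig a w B) (h' : Sig a v B') : Sig a (w + v) (B + B') := by
  have hb : ∀ {w v : L2 N}, ‖w‖ ≤ B → ‖v‖ ≤ B' → ‖w + v‖ ≤ B + B' := fun h h' =>
    (norm_add_le _ _).trans (add_le_add h h')
  induction a generalizing w v with
  | zero => exact hb h h'
  | succ a ih =>
    refine ⟨hb h.1 h'.1, fun j => ?_⟩
    obtain ⟨g, d, hg, hd, h1, h2⟩ := h.2 j
    obtain ⟨g', d', hg', hd', h1', h2'⟩ := h'.2 j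
    refine ⟨g + g', d + d', ?_, (hd.add hd').congr (coeFn_add w v).symm (coeFn_add d d').symm, ih h1 h1', ih h2 h2'⟩
    filter_upwards [hg, hg', coeFn_add w v, coeFn_add g g'] with x e1 e1' e2 e3
    rw [e2, e3, Pi.add_apply, Pi.add_apply, e1, e1']
    ring

lemma sub (h : Sig a w B) (h' : Sig a v B') : Sig a (w - v) (B + B') := by
  have := h.add (h'.smul (-1))
  rwa [norm_neg, norm_one, one_mul, neg_smul, one_smul, ← sub_eq_add_neg] at this

lemma evol (h : Sig a w B) (t : ℝ) : Sig a (schr t w) ((1 + 2 * |t|) ^ a * B) := by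
  have hB : 0 ≤ B := (norm_nonneg _).trans h.base
  induction a generalizing w with
  | zero =>
    rw [pow_zero, one_mul]
    exact (norm_schr t w).le.trans h
  | succ a ih =>
    refine ⟨(norm_schr t w).le.trans (h.base.trans (le_mul_of_one_le_left hB
      (one_le_pow₀ (by linarith [abs_nonneg t])))), fun j => ?_⟩
    obtain ⟨g, d, hg, hd, h1, h2⟩ := h.2 j
    refine ⟨_, _, coord_mul_schr hg hd t, hd.evol t, ?_, (ih h2).mono ?_⟩
    · refine ((ih h1).sub ((ih h2).smul (2 * t * I))).mono (le_of_eq ?_)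
      rw [norm_mul, norm_mul, norm_I, norm_ofNat, norm_real, norm_eq_abs]
      ring
    · rw [pow_succ]
      have : 0 ≤ (1 + 2 * |t|) ^ a * B := by positivity
      nlinarith [abs_nonneg t]

lemma schr_sub (h : Sig a w B) (t : ℝ) {ε : ℝ} (hε : 0 < ε) : ∀ᶠ s in 𝓝 t, Sig a (schr s w - schr t w) ε := by
  have hb : ∀ {w : L2 N} {ε : ℝ}, 0 < ε → ∀ᶠ s in 𝓝 t, ‖schr s w - schr t w‖ ≤ ε := by
    intro w ε hε
    have := tendsto_iff_norm_sub_tendsto_zero.1 ((continuous_schr w).tendsto t)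
    exact this.eventually_le_const hε
  induction a generalizing w ε with
  | zero => exact hb hε
  | succ a ih =>
    have hB : 0 ≤ B := (norm_nonneg _).trans h.base
    choose g d hg hd h1 h2 using h.2
    set L : ℝ := 2 * (|t| + 1) with hL
    set R : ℝ := (1 + 2 * |t|) ^ a * B with hR
    have hR0 : 0 ≤ R := by positivity
    have e0 : ∀ᶠ s in 𝓝 t, 2 * |s - t| * R ≤ ε / 4 ∧ |s| ≤ |t| + 1 := by
      have c1 : Continuous fun s : ℝ => 2 * |s - t| * R := by fun_prop
      have c2 : Continuous fun s : ℝ => |s| := by fun_prop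
      exact ((c1.tendsto' t 0 (by simp)).eventually_le_const (by positivity)).and
        ((c2.tendsto t).eventually_le_const (by linarith))
    have hε' : 0 < ε / (4 * L) := by positivity
    filter_upwards [hb (w := w) hε, e0, eventually_all.2 fun j => ih (h1 j) (by positivity : 0 < ε / 4),
      eventually_all.2 fun j => ih (h2 j) hε', eventually_all.2 fun j => ih (h2 j) hε]
      with s k0 k1 k2 k3 k4
    refine ⟨k0, fun j => ?_⟩
    refine ⟨(schr s (g j) - schr t (g j)) - ((2 * s * I : ℂ) • (schr s (d j) - schr t (d j))
        + (2 * (s - t) * I : ℂ) • schr t (d j)),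
      schr s (d j) - schr t (d j), ?_, ?_, ?_, k4 j⟩
    · have e1 : (schr s (g j) - schr t (g j)) - ((2 * s * I : ℂ) • (schr s (d j) - schr t (d j))
          + (2 * (s - t) * I : ℂ) • schr t (d j))
          = (schr s (g j) - (2 * s * I : ℂ) • schr s (d j))
          - (schr t (g j) - (2 * t * I : ℂ) • schr t (d j)) := by
        module
      rw [e1]
      filter_upwards [coord_mul_schr (hg j) (hd j) s, coord_mul_schr (hg j) (hd j) t, coeFn_sub (schr s w) (schr t w),
        coeFn_sub (schr s (g j) - (2 * s * I : ℂ) • schr s (d j)) (schr t (g j) - (2 * t * I : ℂ) • schr t (d j))]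
        with x q1 q2 q3 q4
      rw [q4, q3, Pi.sub_apply, Pi.sub_apply, q1, q2]
      ring
    · exact (((hd j).evol s).sub ((hd j).evol t)).congr (coeFn_sub _ _).symm (coeFn_sub _ _).symm
    · refine ((k2 j).sub (((k3 j).smul (2 * s * I)).add (((h2 j).evol t).smul (2 * (s - t) * I)))).mono ?_
      have n1 : ‖(2 * s * I : ℂ)‖ = 2 * |s| := by
        rw [norm_mul, norm_mul, norm_I, norm_ofNat, norm_real, norm_eq_abs, mul_one]
      have n2 : ‖(2 * (s - t) * I : ℂ)‖ = 2 * |s - t| := by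
        rw [norm_mul, norm_mul, norm_I, norm_ofNat, ← Complex.ofReal_sub, norm_real, norm_eq_abs, mul_one]
      rw [n1, n2]
      have : 2 * |s| * (ε / (4 * L)) ≤ ε / 4 := by
        have hL0 : L ≠ 0 := by positivity
        rw [show ε / 4 = L * (ε / (4 * L)) by field_simp]
        exact mul_le_mul_of_nonneg_right (by rw [hL]; linarith [k1.2]) hε'.le
      linarith [k1.1]

/-- Control of weights. -/
lemma weight (h : Sig a w B) : eLpNorm (fun x => bracket x ^ a • w x) 2 ≤ ofReal ((N + 1 : ℝ) ^ a * B) := by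
  have hB : 0 ≤ B := (norm_nonneg _).trans h.base
  induction a generalizing w with
  | zero =>
    simp only [pow_zero, one_smul, one_mul]
    rw [← enorm_def, ← ofReal_norm]
    exact ofReal_le_ofReal h
  | succ a ih =>
    choose g d hg hd h1 h2 using h.2
    have hm : ∀ u : L2 N, AEStronglyMeasurable (fun x => bracket x ^ a • u x) := fun u =>
      (continuous_bracket.pow a).aestronglyMeasurable.smul (Lp.aestronglyMeasurable u)
    have hle : eLpNorm (fun x => (bracket x ^ (a + 1)) • w x) 2
        ≤ eLpNorm ((fun x => ‖bracket x ^ a • w x‖) + ∑ j, fun x => ‖bracket x ^ a • g j x‖) 2 := by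
      refine eLpNorm_mono_ae ?_
      filter_upwards [ae_all_iff.2 hg] with x hx
      rw [Pi.add_apply, Finset.sum_apply, norm_of_nonneg (by positivity)]
      simp only [norm_wsmul, hx, norm_mul, norm_real, norm_eq_abs]
      have := mul_le_mul_of_nonneg_right (bracket_le_sum x)
        (mul_nonneg (pow_nonneg (bracket_pos x).le a) (norm_nonneg (w x)))
      rw [add_mul, sum_mul] at this
      rw [pow_succ]
      refine le_trans (le_of_eq (by ring)) (this.trans (le_of_eq ?_))
      rw [one_mul]
      congr 1
      exact sum_congr rfl fun i _ => by ring
    refine hle.trans ((eLpNorm_add_le (hm _).norm ?_ (by norm_num)).trans ?_)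
    · exact Finset.aestronglyMeasurable_sum _ fun i _ => (hm _).norm
    refine (add_le_add le_rfl (eLpNorm_sum_le (fun i _ => (hm _).norm) (by norm_num))).trans ?_
    simp only [eLpNorm_norm]
    refine (add_le_add (ih h.pred) (sum_le_sum fun j _ => ih (h1 j))).trans ?_
    rw [sum_const, card_univ, Fintype.card_fin, nsmul_eq_mul,
      ← ofReal_natCast, ← ofReal_mul (by positivity), ← ofReal_add
      (by positivity) (by positivity)]
    refine ofReal_le_ofReal (le_of_eq ?_)
    ring

end Sig

/-- The derivatives of `z` of order at most `a` are bounded in `L²` with decreasing weights. -/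
def DReg : ℕ → (Sp N → ℂ) → ℝ → Prop
  | 0, z, B => AEStronglyMeasurable z ∧
      eLpNorm (fun x => bracket x ^ 0 • z x) 2 ≤ ofReal B
  | a + 1, z, B => (AEStronglyMeasurable z ∧
      eLpNorm (fun x => (bracket x ^ (a + 1)) • z x) 2 ≤ ofReal B) ∧
      ∀ i, ∃ g, WeakPartial i z g ∧ DReg a g B

namespace DReg

variable {a : ℕ} {z w : Sp N → ℂ} {B B' : ℝ}

lemma base (h : DReg a z B) : AEStronglyMeasurable z ∧ eLpNorm (fun x => bracket x ^ a • z x) 2 ≤ ofReal B := by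
  cases a with
  | zero => exact h
  | succ a => exact h.1

lemma memLp (h : DReg a z B) : MemLp z 2 ∧ eLpNorm z 2 ≤ ofReal B := by
  have h1 : eLpNorm z 2 ≤ ofReal B :=
    (eLpNorm_mono fun x => by
      rw [norm_wsmul]
      exact le_mul_of_one_le_left (norm_nonneg _) (one_le_pow₀ (one_le_bracket x))).trans h.base.2
  exact ⟨⟨h.base.1, h1.trans_lt ofReal_lt_top⟩, h1⟩

lemma pred (h : DReg (a + 1) z B) : DReg a z B := by
  have hb : ∀ {a : ℕ} {z : Sp N → ℂ}, DReg (a + 1) z B → AEStronglyMeasurable z ∧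
      eLpNorm (fun x => bracket x ^ a • z x) 2 ≤ ofReal B := fun h =>
    ⟨h.1.1, (eLpNorm_mono fun x => by
      rw [norm_wsmul, norm_wsmul]
      exact mul_le_mul_of_nonneg_right (pow_le_pow_right₀ (one_le_bracket x) (le_succ _))
        (norm_nonneg _)).trans h.1.2⟩
  induction a generalizing z with
  | zero => exact hb h
  | succ a ih =>
    refine ⟨hb h, fun i => ?_⟩
    obtain ⟨g, hg, hr⟩ := h.2 i
    exact ⟨g, hg, ih hr⟩

lemma congr (h : DReg a z B) (hzw : z =ᵐ[volume] w) : DReg a w B := by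
  have hb : ∀ {a : ℕ}, (AEStronglyMeasurable z ∧ eLpNorm (fun x => bracket x ^ a • z x) 2 ≤ ofReal B) →
      AEStronglyMeasurable w ∧
      eLpNorm (fun x => bracket x ^ a • w x) 2 ≤ ofReal B := by
    intro a h
    refine ⟨h.1.congr hzw, ?_⟩
    rw [← eLpNorm_congr_ae (f := fun x => bracket x ^ a • z x)]
    · exact h.2
    · filter_upwards [hzw] with x hx using by rw [hx]
  cases a with
  | zero => exact hb h
  | succ a =>
    refine ⟨hb h.1, fun i => ?_⟩
    obtain ⟨g, hg, hr⟩ := h.2 i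
    exact ⟨g, hg.congr hzw EventuallyEq.rfl, hr⟩

lemma mono (h : DReg a z B) (hB : B ≤ B') : DReg a z B' := by
  induction a generalizing z with
  | zero => exact ⟨h.1, h.2.trans (ofReal_le_ofReal hB)⟩
  | succ a ih =>
    refine ⟨⟨h.1.1, h.1.2.trans (ofReal_le_ofReal hB)⟩, fun i => ?_⟩
    obtain ⟨g, hg, hr⟩ := h.2 i
    exact ⟨g, hg, ih hr⟩

lemma add (h : DReg a z B) (h' : DReg a w B') (hB : 0 ≤ B) (hB' : 0 ≤ B') : DReg a (fun x => z x + w x) (B + B') := by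
  have hb : ∀ {a : ℕ} {z w : Sp N → ℂ}, (AEStronglyMeasurable z ∧
      eLpNorm (fun x => bracket x ^ a • z x) 2 ≤ ofReal B) →
      (AEStronglyMeasurable w ∧
      eLpNorm (fun x => bracket x ^ a • w x) 2 ≤ ofReal B') →
      (AEStronglyMeasurable (fun x => z x + w x) ∧
      eLpNorm (fun x => bracket x ^ a • (z x + w x)) 2 ≤ ofReal (B + B')) := by
    intro a z w h h'
    refine ⟨h.1.add h'.1, ?_⟩
    have hc : Continuous fun x : Sp N => bracket x ^ a := continuous_bracket.pow a
    simp only [smul_add]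
    rw [ofReal_add hB hB']
    exact (eLpNorm_add_le (hc.aestronglyMeasurable.smul h.1) (hc.aestronglyMeasurable.smul h'.1)
      (by norm_num)).trans (add_le_add h.2 h'.2)
  induction a generalizing z w with
  | zero => exact hb h h'
  | succ a ih =>
    refine ⟨hb h.1 h'.1, fun i => ?_⟩
    obtain ⟨g, hg, hr⟩ := h.2 i
    obtain ⟨g', hg', hr'⟩ := h'.2 i
    exact ⟨_, hg.add hg', ih hr hr'⟩

lemma coord (hB : 0 ≤ B) (h : DReg (a + 1) z B) (j : Fin N) : DReg a (fun x => (x j : ℂ) * z x) ((a + 1) * B) := by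
  have hb : ∀ {a : ℕ} {z : Sp N → ℂ} {B' : ℝ}, B ≤ B' → DReg (a + 1) z B →
      AEStronglyMeasurable (fun x => (x j : ℂ) * z x) ∧
      eLpNorm (fun x => bracket x ^ a • ((x j : ℂ) * z x)) 2 ≤ ofReal B' := by
    intro a z B' hB' h
    refine ⟨(by fun_prop : Continuous fun x : Sp N => (x j : ℂ)).aestronglyMeasurable.mul h.1.1,
      (eLpNorm_mono fun x => ?_).trans (h.1.2.trans (ofReal_le_ofReal hB'))⟩
    rw [norm_wsmul, norm_wsmul, norm_mul, norm_real, norm_eq_abs, pow_succ, mul_assoc]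
    exact mul_le_mul_of_nonneg_left (mul_le_mul_of_nonneg_right (abs_coord_le_bracket x j)
      (norm_nonneg _)) (pow_nonneg (bracket_pos x).le _)
  have hs : ContDiff ℝ 1 fun x : Sp N => (x j : ℂ) := (ofRealCLM.comp (EuclideanSpace.proj j : Sp N →L[ℝ] ℝ)).contDiff
  have hder : ∀ (x : Sp N) (i : Fin N), fderiv ℝ (fun x : Sp N => (x j : ℂ)) x (stdVec i)
      = if i = j then 1 else 0 := by
    intro x i
    have := (ofRealCLM.comp (EuclideanSpace.proj j : Sp N →L[ℝ] ℝ)).hasFDerivAt (x := x)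
    have h2 := this.fderiv
    change fderiv ℝ (fun x => (ofRealCLM.comp (EuclideanSpace.proj j : Sp N →L[ℝ] ℝ)) x) x _ = _
    rw [h2]
    by_cases hij : i = j
    · subst hij; simp
    · have : (Pi.single i (1 : ℝ) : Fin N → ℝ) j = 0 := by simp [Ne.symm hij]
      simp [hij, this]
  induction a generalizing z with
  | zero =>
    have := hb (B' := (((0 : ℕ) : ℝ) + 1) * B) (by simp) h
    exact this
  | succ a ih =>
    refine ⟨hb (by push_cast; nlinarith) h, fun i => ?_⟩
    obtain ⟨g, hg, hr⟩ := h.2 i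
    refine ⟨_, hg.mul hs, ?_⟩
    by_cases hij : i = j
    · refine (((ih hr).add h.pred.pred (by positivity) hB).congr (of_forall fun x => ?_)).mono (le_of_eq ?_)
      · simp only [hder, hij, if_true, one_mul]
      · push_cast; ring
    · refine ((ih hr).congr (of_forall fun x => ?_)).mono ?_
      · simp only [hder, hij, if_false, zero_mul, add_zero]
      · push_cast; nlinarith

lemma sig (hB : 0 ≤ B) (h : DReg a z B) {w : L2 N} (hw : w =ᵐ[volume] z) : Sig a w (a.factorial * B) := by
  have hn : ∀ {a : ℕ} {z : Sp N → ℂ} {B : ℝ} {w : L2 N}, 0 ≤ B → DReg a z B → w =ᵐ[volume] z → ‖w‖ ≤ B := by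
    intro a z B w hB h hw
    rw [Lp.norm_def]
    refine toReal_le_of_le_ofReal hB ?_
    rw [eLpNorm_congr_ae hw]
    exact h.memLp.2
  induction a generalizing z B w with
  | zero => simpa [Sig] using hn hB h hw
  | succ a ih =>
    have h1 : (1 : ℝ) ≤ ((a + 1).factorial : ℝ) := by exact_mod_cast Nat.succ_le_of_lt (Nat.factorial_pos _)
    have h2 : (a.factorial : ℝ) ≤ ((a + 1).factorial : ℝ) := by exact_mod_cast Nat.factorial_le (le_succ a)
    refine ⟨(hn hB h hw).trans (le_mul_of_one_le_left hB h1), fun j => ?_⟩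
    obtain ⟨g, hg, hr⟩ := h.2 j
    have hc := h.coord hB j
    refine ⟨hc.memLp.1.toLp _, hr.memLp.1.toLp _, ?_, hg.congr hw.symm hr.memLp.1.coeFn_toLp.symm, ?_, ?_⟩
    · filter_upwards [hw, hc.memLp.1.coeFn_toLp] with x e1 e2
      rw [e2, e1]
    · refine (ih (by positivity) hc hc.memLp.1.coeFn_toLp).mono (le_of_eq ?_)
      rw [Nat.factorial_succ]; push_cast; ring
    · exact (ih hB hr hr.memLp.1.coeFn_toLp).mono (mul_le_mul_of_nonneg_right h2 hB)

end DReg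

lemma SJet.dReg {d : 𝕄 → Sp N → ℂ} {B : ℝ} (H : SJet k m n d B) {a : ℕ} (h1 : 2 * m + 1 ≤ order β) (h2 : order β ≤ J) (ha : a ≤ wt k m n (order β)) :
    DReg a (d β) B := by
  have hb : ∀ {a : ℕ} {β : 𝕄}, 2 * m + 1 ≤ order β → order β ≤ J →
      a ≤ wt k m n (order β) → AEStronglyMeasurable (d β) ∧
      eLpNorm (fun x => bracket x ^ a • d β x) 2 ≤ ofReal B :=
    fun h1 h2 ha => ⟨H.aesm h2, (eLpNorm_mono fun x => by
      rw [norm_wsmul, norm_wsmul]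
      exact mul_le_mul_of_nonneg_right (pow_le_pow_right₀ (one_le_bracket x) ha)
        (norm_nonneg _)).trans (H.high _ h1 h2)⟩
  induction a generalizing β with
  | zero => exact hb h1 h2 ha
  | succ a ih =>
    simp only [wt] at ha
    refine ⟨hb h1 h2 ha, fun i => ⟨_, H.jet.step β i (by omega), ih ?_ ?_ ?_⟩⟩ <;> rw [order_add_single]
    · omega
    · omega
    · simp only [wt]; omega

/-! ### The Schrödinger group on `𝓢` -/

/-- Pointwise bounds follow from bounds of the pairings with test functions. -/
lemma ae_norm_le_of_pairing {g : Sp N → ℂ} (hg : LocallyIntegrable g) {M : Sp N → ℝ} (hM : Continuous M)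
    (H : ∀ φ : Sp N → ℝ, IsTest φ → ‖∫ x, φ x • g x‖ ≤ ∫ x, |φ x| * M x) :
    ∀ᵐ x, ‖g x‖ ≤ M x := by
  have hρ : ∀ᶠ j in atTop, (mollifier (N := N) j).rOut ≤ 2 * (mollifier (N := N) j).rIn := of_forall fun j => by
    change 1 / ((j : ℝ) + 1) ≤ 2 * (1 / (j + 2))
    rw [mul_one_div, div_le_div_iff₀ (by positivity) (by positivity)]
    linarith
  have h1 := ContDiffBump.ae_convolution_tendsto_right_of_locallyIntegrable (μ := volume) tendsto_mollifier hρ hg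
  have h2 := ContDiffBump.ae_convolution_tendsto_right_of_locallyIntegrable (μ := volume) tendsto_mollifier hρ
    hM.locallyIntegrable
  filter_upwards [h1, h2] with x e1 e2
  refine le_of_tendsto_of_tendsto e1.norm e2 (of_forall fun j => ?_)
  simp only [convolution_eq_swap, lsmul_apply, smul_eq_mul]
  have ht : IsTest fun y => (mollifier j).normed volume (x - y) :=
    ⟨(mollifier j).contDiff_normed.comp (contDiff_const.sub contDiff_id),
      (mollifier j).hasCompactSupport_normed.comp_homeomorph (Homeomorph.subLeft x)⟩
  refine (H _ ht).trans (le_of_eq (integral_congr_ae (of_forall fun y => ?_)))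
  simp only [abs_of_nonneg ((mollifier j).nonneg_normed _)]

lemma integrable_abs_mul {φ : Sp N → ℝ} (hφ : IsTest φ) {M : Sp N → ℝ} (hM : Continuous M) :
    Integrable (fun x => |φ x| * M x) :=
  (hφ.1.continuous.abs.mul hM).integrable_of_hasCompactSupport
    (HasCompactSupport.mul_right (by exact hφ.2.comp_left (g := fun y : ℝ => |y|) (by simp)))

lemma norm_pairing_le {g : Sp N → ℂ} {c : ℝ} {w : Sp N → ℝ} (hw : Continuous w)
    (hw0 : ∀ x, 0 < w x) (h : ∀ᵐ x, w x * ‖g x‖ ≤ c) {φ : Sp N → ℝ} (hφ : IsTest φ) :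
    ‖∫ x, φ x • g x‖ ≤ c * ∫ x, |φ x| * (w x)⁻¹ := by
  rw [← integral_const_mul]
  refine norm_integral_le_of_norm_le ((integrable_abs_mul hφ (hw.inv₀ fun x => (hw0 x).ne')).const_mul c) ?_
  filter_upwards [h] with x hx
  rw [norm_smul, norm_eq_abs]
  have : ‖g x‖ ≤ c * (w x)⁻¹ := by
    rw [← div_eq_mul_inv, le_div_iff₀ (hw0 x), mul_comm]; exact hx
  calc |φ x| * ‖g x‖ ≤ |φ x| * (c * (w x)⁻¹) := mul_le_mul_of_nonneg_left this (abs_nonneg _)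
    _ = _ := by ring

lemma ae_weighted_le_of_pairing {g : Sp N → ℂ} (hg : LocallyIntegrable g) {c : ℝ}
    (H : ∀ φ : Sp N → ℝ, IsTest φ → ‖∫ x, φ x • g x‖ ≤ c * ∫ x, |φ x| * (bracket x ^ n)⁻¹) :
    ∀ᵐ x, bracket x ^ n * ‖g x‖ ≤ c := by
  have := ae_norm_le_of_pairing hg (M := fun x => c * (bracket x ^ n)⁻¹)
    (continuous_const.mul (continuous_inv_bracket n)) fun φ hφ => by
      refine (H φ hφ).trans (le_of_eq ?_)
      rw [← integral_const_mul]
      exact integral_congr_ae (of_forall fun x => by ring)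
  filter_upwards [this] with x hx
  rwa [← div_eq_mul_inv, le_div_iff₀ (pow_pos (bracket_pos x) n), mul_comm] at hx

/-- The variation in time of a free solution is controlled by its second derivatives. -/
lemma schr_sub_bound {u : L2 N} {g h : Fin N → L2 N} (H1 : ∀ i, WeakPartial i u (g i))
    (H2 : ∀ i, WeakPartial i (g i) (h i)) {s t M : ℝ}
    (H : ∀ r ∈ uIcc s t, ∀ i, ∀ᵐ x, bracket x ^ n * ‖(schr r (h i) : L2 N) x‖ ≤ M) :
    ∀ᵐ x, bracket x ^ n * ‖(schr t u : L2 N) x - (schr s u : L2 N) x‖ ≤ |t - s| * (N * M) := by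
  refine ae_weighted_le_of_pairing ((L2.locallyIntegrable _).sub (L2.locallyIntegrable _)) fun φ hφ => ?_
  simp only [smul_sub, Pi.sub_apply]
  rw [integral_sub (hφ.integrable_smul (L2.locallyIntegrable _))
    (hφ.integrable_smul (L2.locallyIntegrable _)), integral_schr_pairing hφ]
  refine (intervalIntegral.norm_integral_le_of_norm_le_const
    (C := N * M * ∫ x, |φ x| * (bracket x ^ n)⁻¹) fun r hr => ?_).trans (le_of_eq (by ring))
  rw [norm_mul, norm_I, one_mul, integral_lapT_smul (fun i => (H1 i).evol r) (fun i => (H2 i).evol r) hφ]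
  refine norm_pairing_le (continuous_bracket.pow n) (fun x => pow_pos (bracket_pos x) n) ?_ hφ
  filter_upwards [ae_all_iff.2 (H r (uIoc_subset_uIcc hr))] with x hx
  refine (mul_le_mul_of_nonneg_left (norm_sum_le _ _) (pow_nonneg (bracket_pos x).le n)).trans ?_
  rw [mul_sum]
  refine (sum_le_sum fun i _ => hx i).trans ?_
  simp

/-- The derivatives of an element of `XS` as elements of `L²`. -/
def jL (f : 𝕏) (β : 𝕄) : L2 N := if h : order β ≤ J then ((sJet_jetX A f).memLp A h).toLp _ else 0

lemma jL_ae (f : 𝕏) (h : order β ≤ J) : jL A f β =ᵐ[volume] jetX A f β := by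
  unfold jL; rw [dif_pos h]; exact MemLp.coeFn_toLp _

lemma jL_step (f : 𝕏) (i : Fin N) (h : order β < J) : WeakPartial i (jL A f β) (jL A f (β + 𝐞 i)) :=
  ((sJet_jetX A f).jet.step β i h).congr (jL_ae A f h.le).symm (jL_ae A f (by rw [order_add_single]; omega)).symm

lemma jL_add (f g : 𝕏) (h : order β ≤ J) : jL A (f + g) β = jL A f β + jL A g β := by
  refine Lp.ext ?_
  filter_upwards [jL_ae A (f + g) h, jL_ae A f h, jL_ae A g h, jetX_add_ae A f g h,
    coeFn_add (jL A f β) (jL A g β)] with x h1 h2 h3 h4 h5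
  rw [h1, h4, h5, Pi.add_apply, h2, h3]

lemma jL_smul (c : ℂ) (f : 𝕏) (h : order β ≤ J) : jL A (c • f) β = c • jL A f β := by
  refine Lp.ext ?_
  filter_upwards [jL_ae A (c • f) h, jL_ae A f h, jetX_smul_ae A c f h, coeFn_smul c (jL A f β)] with x h1 h2 h3 h4
  rw [h1, h3, h4, Pi.smul_apply, h2, smul_eq_mul]

lemma jL_sig (f : 𝕏) (h1 : 2 * m + 1 ≤ order β) (h2 : order β ≤ J) :
    Sig (wt k m n (order β)) (jL A f β) ((wt k m n (order β)).factorial * ‖f‖) :=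
  ((sJet_jetX A f).dReg h1 h2 le_rfl).sig (norm_nonneg f) (jL_ae A f h2)

/-- The bound of the weighted square norms of a free solution. -/
def highC (N n : ℕ) (T : ℝ) : ℝ := (N + 1 : ℝ) ^ n * ((1 + 2 * T) ^ n * n.factorial)

lemma schr_high (f : 𝕏) {T t : ℝ} (ht : |t| ≤ T) (h1 : 2 * m + 1 ≤ order β) (h2 : order β ≤ J) :
    eLpNorm (fun x => (bracket x ^ wt k m n (order β)) • (schr t (jL A f β) : L2 N) x) 2
      ≤ ofReal (highC N n T * ‖f‖) := by
  refine ((jL_sig A f h1 h2).evol t).weight.trans (ofReal_le_ofReal ?_)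
  have hT := (abs_nonneg t).trans ht
  have hw : wt k m n (order β) ≤ n := min_le_left _ _
  have e1 : (N + 1 : ℝ) ^ wt k m n (order β) ≤ (N + 1 : ℝ) ^ n :=
    pow_le_pow_right₀ (by linarith [(cast_nonneg N : (0 : ℝ) ≤ N)]) hw
  have e2 : (1 + 2 * |t|) ^ wt k m n (order β) ≤ (1 + 2 * T) ^ n :=
    (pow_le_pow_left₀ (by positivity) (by linarith) _).trans (pow_le_pow_right₀ (by linarith) hw)
  have e3 : ((wt k m n (order β)).factorial : ℝ) ≤ n.factorial := by exact_mod_cast Nat.factorial_le hw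
  unfold highC
  have : (1 + 2 * |t|) ^ wt k m n (order β) * ((wt k m n (order β)).factorial * ‖f‖)
      ≤ (1 + 2 * T) ^ n * (n.factorial * ‖f‖) := by gcongr
  calc _ ≤ (N + 1 : ℝ) ^ n * ((1 + 2 * T) ^ n * (n.factorial * ‖f‖)) := by gcongr
    _ = _ := by ring

lemma highC_nonneg {T : ℝ} (hT : 0 ≤ T) : 0 ≤ highC N n T := by unfold highC; positivity

lemma exists_schr_low {T : ℝ} (hT : 0 ≤ T) : ∃ K : ℝ, 0 ≤ K ∧ ∀ (f : 𝕏) (β : 𝕄), order β ≤ 2 * m + 2 →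
      (∀ t, |t| ≤ T → ∀ᵐ x, bracket x ^ n * ‖(schr t (jL A f β) : L2 N) x‖ ≤ K * ‖f‖) := by
  obtain ⟨C, hC, HS⟩ := weighted_sobolev A.hk n
  have hJ : 2 * m + 2 + k ≤ J := by unfold bigJ; omega
  have key : ∀ l ≤ 2 * m + 1, ∃ K : ℝ, 0 ≤ K ∧ ∀ (f : 𝕏) (β : 𝕄),
      2 * m + 1 ≤ order β + l → order β ≤ 2 * m + 2 → ∀ t, |t| ≤ T →
      ∀ᵐ x, bracket x ^ n * ‖(schr t (jL A f β) : L2 N) x‖ ≤ K * ‖f‖ := by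
    intro l
    induction l with
    | zero =>
      intro _
      refine ⟨C * highC N n T, mul_nonneg hC (highC_nonneg hT), fun f β h1 h2 t ht => ?_⟩
      have hj : IsJet (J - order β) fun γ => (schr t (jL A f (β + γ)) : L2 N) := by
        refine ⟨L2.locallyIntegrable _, fun γ i hγ => ?_⟩
        rw [← add_assoc]
        exact (jL_step A f i (by rw [order_add]; omega)).evol t
      have hw := hj.wReg (a := n) (B := highC N n T * ‖f‖) k 0 (by rw [order_zero]; omega)
        fun γ hγ => by
          have := schr_high A f ht (β := β + (0 + γ)) (by rw [order_add, zero_add]; omega)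
            (by rw [order_add, zero_add]; omega)
          rwa [show wt k m n (order (β + (0 + γ))) = n by
            rw [order_add, zero_add]; simp only [wt, bigJ]; omega] at this
      obtain ⟨z, hz, hwz, hb⟩ := HS _ _ (mul_nonneg (highC_nonneg hT) (norm_nonneg f)) hw
      rw [add_zero] at hwz
      filter_upwards [hwz] with x hx
      rw [hx, mul_assoc]
      exact hb x
    | succ l ih =>
      intro hl
      obtain ⟨K, hK, hKb⟩ := ih (by omega)
      refine ⟨1 + K + T * (N * K), by positivity, fun f β h1 h2 t ht => ?_⟩
      by_cases hβ : 2 * m + 1 ≤ order β + l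
      · filter_upwards [hKb f β hβ h2 t ht] with x hx
        refine hx.trans (mul_le_mul_of_nonneg_right ?_ (norm_nonneg f))
        nlinarith [mul_nonneg hT (mul_nonneg (cast_nonneg N : (0 : ℝ) ≤ N) hK)]
      · have hd := schr_sub_bound (n := n) (s := 0) (t := t) (M := K * ‖f‖)
          (fun i => jL_step A f (β := β) i (by omega))
          (fun i => jL_step A f (β := β + 𝐞 i) i (by rw [order_add_single]; omega))
          fun r hr i => hKb f _ (by rw [order_add_single, order_add_single]; omega)
            (by rw [order_add_single, order_add_single]; omega) r (by
              have h3 := abs_sub_left_of_mem_uIcc hr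
              simp only [sub_zero] at h3
              exact h3.trans ht)
        filter_upwards [hd, jL_ae A f (β := β) (by omega)] with x e1 e2
        rw [schr_zero, e2, sub_zero] at e1
        have e3 := (sJet_jetX A f).low β (by omega) x
        have e4 := mul_le_mul_of_nonneg_left (norm_sub_norm_le ((schr t (jL A f β) : L2 N) x)
          (jetX A f β x)) (pow_nonneg (bracket_pos x).le n)
        have e5 : |t| * (N * (K * ‖f‖)) ≤ T * (N * (K * ‖f‖)) := mul_le_mul_of_nonneg_right ht (by positivity)
        have e6 : 0 ≤ K * ‖f‖ := by positivity
        nlinarith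
  obtain ⟨K, hK, h⟩ := key (2 * m + 1) le_rfl
  exact ⟨K, hK, fun f β hβ t ht => h f β (by omega) hβ t ht⟩

/-- The bound of the weighted maximum norms of a free solution. -/
def lowC {T : ℝ} (hT : 0 ≤ T) : ℝ := (exists_schr_low A hT).choose

lemma lowC_nonneg {T : ℝ} (hT : 0 ≤ T) : 0 ≤ lowC A hT := (exists_schr_low A hT).choose_spec.1

lemma schr_low {T : ℝ} (hT : 0 ≤ T) (f : 𝕏) (h : order β ≤ 2 * m + 2) {t : ℝ} (ht : |t| ≤ T) :
    ∀ᵐ x, bracket x ^ n * ‖(schr t (jL A f β) : L2 N) x‖ ≤ lowC A hT * ‖f‖ :=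
  (exists_schr_low A hT).choose_spec.2 f β h t ht

lemma schr_low_sub {T : ℝ} (hT : 0 ≤ T) (f : 𝕏) (h : order β ≤ 2 * m) {s t : ℝ} (hs : |s| ≤ T) (ht : |t| ≤ T) :
    ∀ᵐ x, bracket x ^ n * ‖(schr t (jL A f β) : L2 N) x - (schr s (jL A f β) : L2 N) x‖
      ≤ |t - s| * (N * (lowC A hT * ‖f‖)) := by
  refine schr_sub_bound (fun i => jL_step A f (β := β) i (by unfold bigJ; omega))
    (fun i => jL_step A f (β := β + 𝐞 i) i (by rw [order_add_single]; unfold bigJ; omega))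
    fun r hr i => schr_low A hT f (by rw [order_add_single, order_add_single]; omega) ?_
  rcases mem_uIcc.1 hr with h | h <;> exact abs_le.2
    ⟨by linarith [(abs_le.1 hs).1, (abs_le.1 ht).1], by linarith [(abs_le.1 hs).2, (abs_le.1 ht).2]⟩

lemma exists_XS_of_L2 {w : 𝕄 → L2 N} {B : ℝ} (hB : 0 ≤ B)
    (hw : ∀ β i, order β < J → WeakPartial i (w β) (w (β + 𝐞 i)))
    (h1 : ∀ β, order β ≤ 2 * m → ∀ᵐ x, bracket x ^ n * ‖w β x‖ ≤ B)
    (h2 : ∀ β, 2 * m + 1 ≤ order β → order β ≤ J →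
      eLpNorm (fun x => (bracket x ^ wt k m n (order β)) • w β x) 2 ≤ ofReal B) :
    ∃ f : 𝕏, ‖f‖ ≤ B ∧ ∀ β, order β ≤ J → jL A f β = w β := by
  have hjet : IsJet J fun β => (w β : Sp N → ℂ) := ⟨L2.locallyIntegrable _, hw⟩
  obtain ⟨u, hu, hu0⟩ := hjet.exists_continuous A (fun β _ => (Lp.memLp (w β)).2) 0 (by simp [order_zero])
  have hjw := fun β h => (hjet.isWeakDeriv β h).congr hu0 (EventuallyEq.refl _ (w β))
  obtain ⟨d, hd, hd0⟩ := exists_sJet_of_isWeakDeriv A hB hu fun β hβ => ⟨w β, hjw β hβ, h1 β, fun h => h2 β h hβ⟩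
  obtain ⟨f, hf⟩ := exists_XS_of_sJet A hd
  refine ⟨f, norm_le_of_sJet A hd hf, fun β hβ => Lp.ext ?_⟩
  have e1 := jetX_ae_of_fn A hd hf hβ
  have e2 := (hd.jet.isWeakDeriv β hβ).unique (hd0 ▸ hjw β hβ)
  exact (jL_ae A f hβ).trans (e1.trans e2)

lemma exists_free (t : ℝ) (f : 𝕏) : ∃ g : 𝕏, ∀ β, order β ≤ J → jL A g β = schr t (jL A f β) := by
  have hT := abs_nonneg t
  obtain ⟨g, -, hg⟩ := exists_XS_of_L2 A (w := fun β => schr t (jL A f β))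
    (B := max (lowC A hT * ‖f‖) (highC N n |t| * ‖f‖))
    (le_max_of_le_left (mul_nonneg (lowC_nonneg A hT) (norm_nonneg f)))
    (fun β i h => (jL_step A f i h).evol t)
    (fun β h => by
      filter_upwards [schr_low A hT f (β := β) (by omega) le_rfl] with x hx
      exact hx.trans (le_max_left _ _))
    (fun β h1 h2 => (schr_high A f le_rfl h1 h2).trans (ofReal_le_ofReal (le_max_right _ _)))
  exact ⟨g, hg⟩

/-- The Schrödinger group on `XS`. -/
def free (t : ℝ) (f : 𝕏) : 𝕏 := (exists_free A t f).choose

lemma jL_free (t : ℝ) (f : 𝕏) (h : order β ≤ J) : jL A (free A t f) β = schr t (jL A f β) :=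
  (exists_free A t f).choose_spec β h

lemma ext_jL {f g : 𝕏} (h : jL A f 0 = jL A g 0) : f = g := by
  refine fnX_injective A ?_
  have h0 : order (0 : 𝕄) ≤ 2 * m + 2 := by simp [order_zero]
  refine ((jetX_continuous A f h0).ae_eq_iff_eq (μ := volume) (jetX_continuous A g h0)).1 ?_
  exact (jL_ae A f (order_le_bigJ h0)).symm.trans (h ▸ jL_ae A g (order_le_bigJ h0))

lemma order_zero_le (l : ℕ) : order (0 : 𝕄) ≤ l := by simp [order_zero]

lemma free_zero (f : 𝕏) : free A 0 f = f := ext_jL A (by rw [jL_free A 0 f (order_zero_le _), schr_zero])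

lemma free_add (s t : ℝ) (f : 𝕏) : free A (s + t) f = free A s (free A t f) :=
  ext_jL A (by rw [jL_free A _ _ (order_zero_le _), jL_free A _ _ (order_zero_le _),
    jL_free A _ _ (order_zero_le _), schr_add])

lemma free_map_add (t : ℝ) (f g : 𝕏) : free A t (f + g) = free A t f + free A t g :=
  ext_jL A (by rw [jL_free A _ _ (order_zero_le _), jL_add A _ _ (order_zero_le _),
    jL_add A _ _ (order_zero_le _), jL_free A _ _ (order_zero_le _), jL_free A _ _ (order_zero_le _),
    map_add])

lemma free_smul (t : ℝ) (c : ℂ) (f : 𝕏) : free A t (c • f) = c • free A t f :=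
  ext_jL A (by rw [jL_free A _ _ (order_zero_le _), jL_smul A _ _ (order_zero_le _),
    jL_smul A _ _ (order_zero_le _), jL_free A _ _ (order_zero_le _), map_smul])

/-- The Schrödinger group as linear maps. -/
def freeL (t : ℝ) : 𝕏 →ₗ[ℂ] 𝕏 where
  toFun := free A t
  map_add' := free_map_add A t
  map_smul' := free_smul A t

lemma free_sub (t : ℝ) (f g : 𝕏) : free A t (f - g) = free A t f - free A t g := (freeL A t).map_sub f g

/-- The bound of the Schrödinger group for times of size at most `T`. -/
def freeC {T : ℝ} (hT : 0 ≤ T) : ℝ := max (lowC A hT) (highC N n T)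

lemma freeC_nonneg {T : ℝ} (hT : 0 ≤ T) : 0 ≤ freeC A hT := le_max_of_le_left (lowC_nonneg A hT)

lemma norm_le_of_jL {f : 𝕏} {B : ℝ} (hB : 0 ≤ B) (h1 : ∀ β, order β ≤ 2 * m → ∀ᵐ x, bracket x ^ n * ‖jL A f β x‖ ≤ B)
    (h2 : ∀ β, 2 * m + 1 ≤ order β → order β ≤ J →
      eLpNorm (fun x => (bracket x ^ wt k m n (order β)) • jL A f β x) 2 ≤ ofReal B) : ‖f‖ ≤ B := by
  obtain ⟨g, hg, hgw⟩ := exists_XS_of_L2 A hB (fun β i h => jL_step A f i h) h1 h2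
  rwa [ext_jL A (hgw 0 (order_zero_le _))] at hg

lemma norm_free_le {T : ℝ} (hT : 0 ≤ T) {t : ℝ} (ht : |t| ≤ T) (f : 𝕏) : ‖free A t f‖ ≤ freeC A hT * ‖f‖ := by
  refine norm_le_of_jL A (mul_nonneg (freeC_nonneg A hT) (norm_nonneg f)) (fun β h => ?_) fun β h1 h2 => ?_
  · rw [jL_free A t f (by unfold bigJ; omega)]
    filter_upwards [schr_low A hT f (β := β) (by omega) ht] with x hx
    exact hx.trans (mul_le_mul_of_nonneg_right (le_max_left _ _) (norm_nonneg f))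
  · rw [jL_free A t f h2]
    exact (schr_high A f ht h1 h2).trans (ofReal_le_ofReal
      (mul_le_mul_of_nonneg_right (le_max_right _ _) (norm_nonneg f)))

lemma jL_sub (f g : 𝕏) (h : order β ≤ J) : jL A (f - g) β = jL A f β - jL A g β := by
  have := jL_add A (f - g) g h
  rw [sub_add_cancel] at this
  exact eq_sub_of_add_eq this.symm

lemma continuous_free (f : 𝕏) : Continuous fun t => free A t f := by
  rw [continuous_iff_continuousAt]
  intro t
  rw [ContinuousAt, Metric.tendsto_nhds]
  intro ε hε
  have hT : 0 ≤ |t| + 1 := by positivity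
  have hc : Continuous fun s : ℝ => |t - s| * (N * (lowC A hT * ‖f‖)) := by fun_prop
  have e1 := (hc.tendsto' t 0 (by simp)).eventually_le_const (half_pos hε)
  have e2 : ∀ᶠ s in 𝓝 t, |s| ≤ |t| + 1 := (continuous_abs.tendsto t).eventually_le_const (by linarith)
  have e3 : ∀ᶠ s in 𝓝 t, ∀ β : Idx N J, 2 * m + 1 ≤ order β.1 →
      Sig (wt k m n (order β.1)) (schr s (jL A f β.1) - schr t (jL A f β.1)) (ε / 2 / (N + 1 : ℝ) ^ n) := by
    refine eventually_all.2 fun β => ?_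
    by_cases h : 2 * m + 1 ≤ order β.1
    · filter_upwards [(jL_sig A f h β.2).schr_sub t (by positivity : 0 < ε / 2 / (N + 1 : ℝ) ^ n)]
        with s hs _ using hs
    · exact of_forall fun s h' => absurd h' h
  filter_upwards [e1, e2, e3] with s h1 h2 h3
  rw [dist_eq_norm]
  refine lt_of_le_of_lt (norm_le_of_jL A (B := ε / 2) (by positivity) (fun β h => ?_)
    fun β g1 g2 => ?_) (half_lt_self hε)
  · have ho : order β ≤ J := by unfold bigJ; omega
    rw [jL_sub A _ _ ho, jL_free A _ _ ho, jL_free A _ _ ho]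
    filter_upwards [schr_low_sub A hT f h h2 (by linarith : |t| ≤ |t| + 1),
      coeFn_sub (schr s (jL A f β)) (schr t (jL A f β))] with x hx hx'
    rw [hx', Pi.sub_apply, norm_sub_rev]
    exact hx.trans h1
  · rw [jL_sub A _ _ g2, jL_free A _ _ g2, jL_free A _ _ g2]
    refine (h3 ⟨β, g2⟩ g1).weight.trans (ofReal_le_ofReal ?_)
    calc (N + 1 : ℝ) ^ wt k m n (order β) * (ε / 2 / (N + 1 : ℝ) ^ n)
        ≤ (N + 1 : ℝ) ^ n * (ε / 2 / (N + 1 : ℝ) ^ n) := by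
          refine mul_le_mul_of_nonneg_right (pow_le_pow_right₀ ?_ (min_le_left _ _)) (by positivity)
          linarith [(cast_nonneg N : (0 : ℝ) ≤ N)]
      _ = ε / 2 := by field_simp

/-- The Laplacian of an element of `𝓢`. -/
def lapX (f : 𝕏) (x : Sp N) : ℂ := ∑ i, jetX A f (0 + 𝐞 i + 𝐞 i) x

lemma SJet.laplacian_eq {d : 𝕄 → Sp N → ℂ} {B : ℝ} (H : SJet k m n d B) (x : Sp N) :
    Δ (d 0) x = ∑ i, d (0 + 𝐞 i + 𝐞 i) x := by
  rw [InnerProductSpace.laplacian_eq_iteratedFDeriv_orthonormalBasis (d 0) (basisFun (Fin N) ℝ)]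
  refine sum_congr rfl fun i _ => ?_
  rw [iteratedFDeriv_two_apply]
  have h1 : fderiv ℝ (d 0) = fun x => gradForm fun i => d (0 + 𝐞 i) x :=
    funext fun x => (H.hasFDerivAt (order_zero_le _) x).fderiv
  have h2 : HasFDerivAt (fun x => gradForm fun i => d (0 + 𝐞 i) x)
      (∑ j, (smulRightL ℝ (Sp N) ℂ (EuclideanSpace.proj j : Sp N →L[ℝ] ℝ)).comp
        (gradForm fun l => d (0 + Pi.single j 1 + Pi.single l 1) x)) x := by
    unfold gradForm
    refine HasFDerivAt.fun_sum fun j _ => ?_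
    exact ((smulRightL ℝ (Sp N) ℂ (EuclideanSpace.proj j : Sp N →L[ℝ] ℝ)).hasFDerivAt).comp x
      (H.hasFDerivAt (β := 0 + Pi.single j 1) (by rw [order_add_single, order_zero]; omega) x)
  rw [h1, h2.fderiv]
  simp only [Matrix.cons_val_zero, Matrix.cons_val_one, basisFun_apply]
  rw [ContinuousLinearMap.sum_apply, ContinuousLinearMap.sum_apply, Finset.sum_eq_single i]
  · simp [gradForm_stdVec]
  · intro j _ hj
    simp [hj]
  · simp

lemma laplacian_fnX (f : 𝕏) (x : Sp N) : Δ (fnX A f) x = lapX A f x := (sJet_jetX A f).laplacian_eq x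

/-! ### Local existence -/

lemma forall_le_of_ae {f g : Sp N → ℝ} (hf : Continuous f) (hg : Continuous g)
    (h : ∀ᵐ x, f x ≤ g x) (x : Sp N) : f x ≤ g x := by
  have ho : IsOpen {x | ¬ f x ≤ g x} := by
    simp only [not_le]
    exact isOpen_lt hg hf
  have h2 := (ho.measure_eq_zero_iff volume).1 h
  by_contra hx
  have : x ∈ ({x | ¬ f x ≤ g x} : Set (Sp N)) := hx
  rw [h2] at this
  exact this

/-- Evaluation of a derivative. -/
def evalX (h : order β ≤ 2 * m + 2) (x : Sp N) : 𝕏 →L[ℂ] ℂ := LinearMap.mkContinuous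
    { toFun := fun f => jetX A f β x
      map_add' := fun f g => jetX_add A f g h x
      map_smul' := fun c f => jetX_smul A c f h x } (supC A) fun f => by
    have h1 := (sJet_jetX A f).sup_le A h x
    exact (le_mul_of_one_le_left (norm_nonneg _) (one_le_pow₀ (one_le_bracket x))).trans h1

lemma evalX_apply (h : order β ≤ 2 * m + 2) (x : Sp N) (f : 𝕏) : evalX A h x f = jetX A f β x := rfl

lemma continuous_jetX (h : order β ≤ 2 * m + 2) (x : Sp N) :
    Continuous fun f => jetX A f β x := (evalX A h x).continuous

lemma order_two_le (i : Fin N) : order (0 + 𝐞 i + 𝐞 i : 𝕄) ≤ 2 * m + 2 := by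
  rw [order_add_single, order_add_single, order_zero]; omega

lemma order_two_le' (A : Adm N k m n) (i : Fin N) : order (0 + 𝐞 i + 𝐞 i : 𝕄) ≤ 2 * m := by
  rw [order_add_single, order_add_single, order_zero]
  have := A.two_le_n
  have := A.hm
  omega

lemma continuous_lapX (x : Sp N) : Continuous fun f => lapX A f x :=
  continuous_finset_sum _ fun i _ => continuous_jetX A (order_two_le i) x

lemma free_sub_low {T : ℝ} (hT : 0 ≤ T) (f : 𝕏) (h : order β ≤ 2 * m) {s t : ℝ} (hs : |s| ≤ T) (ht : |t| ≤ T) (x : Sp N) :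
    bracket x ^ n * ‖jetX A (free A t f) β x - jetX A (free A s f) β x‖ ≤ |t - s| * (N * (lowC A hT * ‖f‖)) := by
  have ho : order β ≤ J := by unfold bigJ; omega
  refine forall_le_of_ae ((continuous_bracket.pow n).mul ((jetX_continuous A _ (by omega)).sub
    (jetX_continuous A _ (by omega))).norm) continuous_const ?_ x
  filter_upwards [schr_low_sub A hT f h hs ht, jL_ae A (free A t f) ho, jL_ae A (free A s f) ho] with y h1 h2 h3
  rw [jL_free A _ _ ho] at h2 h3
  rw [h2, h3] at h1
  exact h1

lemma hasDerivAt_free (f : 𝕏) (t : ℝ) (x : Sp N) :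
    HasDerivAt (fun s => fnX A (free A s f) x) (I * lapX A (free A t f) x) t := by
  have hT : 0 ≤ |t| + 1 := by positivity
  set C : ℝ := N * (N * (lowC A hT * ‖f‖)) with hC
  have hC0 : 0 ≤ C := by have := lowC_nonneg A hT; positivity
  have hJ0 : order (0 : 𝕄) ≤ J := order_zero_le _
  have hlapc : ∀ g : 𝕏, Continuous (lapX A g) := fun g =>
    continuous_finset_sum _ fun i _ => jetX_continuous A g (order_two_le i)
  have key : ∀ s, |s| ≤ |t| + 1 → ∀ x, bracket x ^ n * ‖fnX A (free A s f) x - fnX A (free A t f) x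
      - (s - t) • (I * lapX A (free A t f) x)‖ ≤ |s - t| * (|s - t| * C) := by
    intro s hs
    have hc : Continuous fun x => fnX A (free A s f) x - fnX A (free A t f) x
        - (s - t) • (I * lapX A (free A t f) x) := by
      have c1 : Continuous (fnX A (free A s f)) := jetX_continuous A _ (order_zero_le _)
      have c2 : Continuous (fnX A (free A t f)) := jetX_continuous A _ (order_zero_le _)
      have c3 := hlapc (free A t f)
      fun_prop
    refine forall_le_of_ae ((continuous_bracket.pow n).mul hc.norm) continuous_const ?_
    refine ae_weighted_le_of_pairing hc.locallyIntegrable fun φ hφ => ?_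
    have pair : ∀ (r : ℝ), ∫ x, φ x • fnX A (free A r f) x = ∫ x, φ x • (schr r (jL A f 0) : L2 N) x := by
      intro r
      refine integral_congr_ae ?_
      filter_upwards [jL_ae A (free A r f) hJ0] with x hx
      rw [jL_free A _ _ hJ0] at hx
      rw [hx]; rfl
    have hlap : ∀ r, ∫ x, lapT φ x • (schr r (jL A f 0) : L2 N) x = ∫ x, φ x • lapX A (free A r f) x := by
      intro r
      rw [integral_lapT_smul (fun i => (jL_step A f (β := 0) i (by rw [order_zero]; unfold bigJ; omega)).evol r)
        (fun i => (jL_step A f (β := 0 + 𝐞 i) i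
          (by rw [order_add_single, order_zero]; unfold bigJ; omega)).evol r) hφ]
      refine integral_congr_ae ?_
      filter_upwards [ae_all_iff.2 fun i => jL_ae A (free A r f)
        (order_le_bigJ (k := k) (n := n) (order_two_le (m := m) i))] with x hx
      congr 1
      refine sum_congr rfl fun i _ => ?_
      rw [← hx i, jL_free A _ _ (order_le_bigJ (order_two_le i))]
    have e1 : ∫ x, φ x • (fnX A (free A s f) x - fnX A (free A t f) x - (s - t) • (I * lapX A (free A t f) x))
        = ∫ r in t..s, I * ∫ x, φ x • (lapX A (free A r f) x - lapX A (free A t f) x) := by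
      have i1 : ∀ r, Integrable (fun x => φ x • fnX A (free A r f) x) := fun r =>
        hφ.integrable_smul (jetX_continuous A (free A r f) (order_zero_le _)).locallyIntegrable
      have i2 : Integrable (fun x => φ x • fnX A (free A s f) x - φ x • fnX A (free A t f) x) := (i1 s).sub (i1 t)
      have i3 : ∀ r, Integrable (fun x => φ x • lapX A (free A r f) x) := fun r =>
        hφ.integrable_smul (hlapc _).locallyIntegrable
      have i4 : IntervalIntegrable (fun r => I * ∫ x, φ x • lapX A (free A r f) x) volume t s := by
        simp only [← hlap]
        exact (continuous_const.mul (continuous_pairing (isTest_lapT hφ) (continuous_schr _))).intervalIntegrable _ _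
      have e2 : ∀ r, I * ∫ x, φ x • (lapX A (free A r f) x - lapX A (free A t f) x)
          = (I * ∫ x, φ x • lapX A (free A r f) x) - I * ∫ x, φ x • lapX A (free A t f) x := fun r => by
        simp only [smul_sub]
        rw [integral_sub (i3 r) (i3 t), mul_sub]
      simp only [e2]
      rw [intervalIntegral.integral_sub i4 intervalIntegrable_const, intervalIntegral.integral_const]
      simp only [← hlap]
      rw [← integral_schr_pairing hφ, ← pair, ← pair, hlap]
      have e3 : ∀ x, φ x • (fnX A (free A s f) x - fnX A (free A t f) x - (s - t) • (I * lapX A (free A t f) x))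
          = (φ x • fnX A (free A s f) x - φ x • fnX A (free A t f) x)
            - ((s - t : ℝ) * I : ℂ) * (φ x • lapX A (free A t f) x) := fun x => by
        simp only [real_smul]; ring
      simp only [e3]
      rw [integral_sub i2 ((i3 t).const_mul _), integral_sub (i1 s) (i1 t), integral_const_mul]
      simp only [real_smul]
      ring
    rw [e1]
    refine (intervalIntegral.norm_integral_le_of_norm_le_const
      (C := |s - t| * C * ∫ x, |φ x| * (bracket x ^ n)⁻¹) fun r hr => ?_).trans
      (le_of_eq (by ring))
    rw [norm_mul, norm_I, one_mul]
    refine norm_pairing_le (continuous_bracket.pow n) (fun x => pow_pos (bracket_pos x) n) (of_forall fun x => ?_) hφ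
    have hrt : |r - t| ≤ |s - t| := abs_sub_left_of_mem_uIcc (uIoc_subset_uIcc hr)
    have hr' : |r| ≤ |t| + 1 := by
      rcases mem_uIcc.1 (uIoc_subset_uIcc hr) with h | h <;> exact abs_le.2
        ⟨by linarith [(abs_le.1 hs).1, neg_abs_le t], by linarith [(abs_le.1 hs).2, le_abs_self t]⟩
    unfold lapX
    rw [← sum_sub_distrib]
    refine (mul_le_mul_of_nonneg_left (norm_sum_le _ _) (pow_nonneg (bracket_pos x).le n)).trans ?_
    rw [mul_sum]
    refine (sum_le_sum fun i _ => free_sub_low A hT f (order_two_le' A i)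
      (by linarith : |t| ≤ |t| + 1) hr' x).trans ?_
    rw [sum_const, card_univ, Fintype.card_fin, nsmul_eq_mul, hC]
    have : 0 ≤ (N : ℝ) * (N * (lowC A hT * ‖f‖)) := hC0
    nlinarith
  rw [hasDerivAt_iff_tendsto]
  have hc : Continuous fun s : ℝ => |s - t| * C := by fun_prop
  refine squeeze_zero' (of_forall fun s => by positivity) ?_ (hc.tendsto' t 0 (by simp))
  have e2 : ∀ᶠ s in 𝓝 t, |s| ≤ |t| + 1 := (continuous_abs.tendsto t).eventually_le_const (by linarith)
  filter_upwards [e2] with s hs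
  have h1 := key s hs x
  have h2 := (le_mul_of_one_le_left (norm_nonneg _) (one_le_pow₀ (one_le_bracket x))).trans h1
  rcases eq_or_ne s t with rfl | hst
  · simp
  · have : 0 < ‖s - t‖ := norm_pos_iff.2 (sub_ne_zero.2 hst)
    rw [inv_mul_le_iff₀ this]
    exact h2

/-- Elements of `𝓢` with norm at most `R` and lower bound at least `c`. -/
def Reg (R c : ℝ) : Set (𝕏) := {f | ‖f‖ ≤ R ∧ ∀ x, c ≤ bracket x ^ n * ‖fnX A f x‖}

/-- `F` is Lipschitz continuous on the sets `Reg R c`. -/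
def RegLip (F : 𝕏 → 𝕏) : Prop := ∀ R c : ℝ, 0 < c → ∃ M : ℝ, 0 ≤ M ∧ ∀ f ∈ Reg A R c, ‖F f‖ ≤ M ∧
    ∀ g ∈ Reg A R c, ‖F f - F g‖ ≤ M * ‖f - g‖

lemma RegLip.continuousOn {A : Adm N k m n} {F : 𝕏 → 𝕏} (hF : RegLip A F)
    {R c : ℝ} (hc : 0 < c) : ContinuousOn F (Reg A R c) := by
  obtain ⟨M, hM, h⟩ := hF R c hc
  have : LipschitzOnWith ⟨M, hM⟩ F (Reg A R c) := LipschitzOnWith.of_dist_le_mul fun f hf g hg => by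
    rw [dist_eq_norm, dist_eq_norm]; exact (h f hf).2 g hg
  exact this.continuousOn

lemma tendsto_free {l : Filter ℝ} {τ : ℝ → ℝ} {τ₀ : ℝ} (hτ : Tendsto τ l (𝓝 τ₀))
    {w : ℝ → 𝕏} {w₀ : 𝕏} (hw : Tendsto w l (𝓝 w₀)) :
    Tendsto (fun s => free A (τ s) (w s)) l (𝓝 (free A τ₀ w₀)) := by
  have hT : 0 ≤ |τ₀| + 1 := by positivity
  have e2 : ∀ᶠ s in l, |τ s| ≤ |τ₀| + 1 := hτ.abs.eventually_le_const (by linarith)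
  rw [tendsto_iff_norm_sub_tendsto_zero]
  have h1 := tendsto_iff_norm_sub_tendsto_zero.1 hw
  have h2 := tendsto_iff_norm_sub_tendsto_zero.1 (((continuous_free A w₀).tendsto τ₀).comp hτ)
  have h3 := (h1.const_mul (freeC A hT)).add h2
  rw [mul_zero, add_zero] at h3
  refine squeeze_zero' (of_forall fun _ => norm_nonneg _) ?_ h3
  filter_upwards [e2] with s hs
  have : free A (τ s) (w s) - free A τ₀ w₀ = free A (τ s) (w s - w₀) + (free A (τ s) w₀ - free A τ₀ w₀) := by
    rw [free_sub]; abel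
  rw [this]
  exact (norm_add_le _ _).trans (add_le_add (norm_free_le A hT hs _) le_rfl)

lemma continuousOn_free {U : Set ℝ} {τ : ℝ → ℝ} (hτ : Continuous τ) {w : ℝ → 𝕏} (hw : ContinuousOn w U) :
    ContinuousOn (fun t => free A (τ t) (w t)) U := fun t ht =>
  tendsto_free A ((hτ.tendsto t).mono_left nhdsWithin_le_nhds) (hw t ht)

/-- Variation of constants. -/
lemma hasDerivWithinAt_free {w : ℝ → 𝕏} {u : 𝕏} {t₀ t : ℝ}
    {U : Set ℝ} (hw : HasDerivWithinAt w (free A (-(t - t₀)) u) U t) (ht : t ∈ U) (x : Sp N) :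
    HasDerivWithinAt (fun s => fnX A (free A (s - t₀) (w s)) x)
      (I * lapX A (free A (t - t₀) (w t)) x + fnX A u x) U t := by
  have h0 : order (0 : 𝕄) ≤ 2 * m + 2 := order_zero_le _
  have d1 : HasDerivWithinAt (fun s => fnX A (free A (s - t₀) (w t)) x) (I * lapX A (free A (t - t₀) (w t)) x) U t :=
    ((hasDerivAt_free A (w t) (t - t₀) x).comp_sub_const t t₀).hasDerivWithinAt
  have d2 : HasDerivWithinAt (fun s => fnX A (free A (s - t₀) (w s - w t)) x) (fnX A u x) U t := by
    rw [hasDerivWithinAt_iff_tendsto_slope]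
    have e1 := hasDerivWithinAt_iff_tendsto_slope.1 hw
    have hc : Continuous fun s : ℝ => s - t₀ := by fun_prop
    have e2 := tendsto_free A ((hc.tendsto t).mono_left nhdsWithin_le_nhds) e1
    have e3 := ((continuous_jetX A h0 x).tendsto _).comp e2
    rw [← free_add, add_neg_cancel, free_zero] at e3
    refine e3.congr fun s => ?_
    simp only [Function.comp_apply, slope_def_module, sub_self]
    have e5 : fnX A (free A (t - t₀) (0 : 𝕏)) x = 0 := by
      have := free_smul A (t - t₀) 0 (0 : 𝕏)
      rw [zero_smul, zero_smul] at this
      rw [this]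
      have := fnX_smul A 0 (0 : 𝕏) x
      rwa [zero_smul, zero_mul] at this
    rw [e5, sub_zero]
    change jetX A (free A (s - t₀) ((s - t)⁻¹ • (w s - w t))) 0 x = (s - t)⁻¹ • jetX A _ 0 x
    have e6 : (s - t)⁻¹ • (w s - w t) = (((s - t)⁻¹ : ℝ) : ℂ) • (w s - w t) := rfl
    rw [e6, free_smul, jetX_smul A _ _ h0, real_smul]
  refine (d1.add d2).congr_of_mem (fun s hs => ?_) ht
  rw [Pi.add_apply, free_sub, fnX_sub]
  ring

/-- Free evolution for short times stays in a set `Reg R c`. -/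
lemma free_mem_reg {R₀ c a τ : ℝ} {f w : 𝕏} (hf : f ∈ Reg A R₀ c) (hw : ‖w - f‖ ≤ a) (ha : a ≤ 1) (hτ1 : |τ| ≤ 1)
    (haD : freeC A zero_le_one * a ≤ c / 4) (hτ : |τ| * (N * (lowC A zero_le_one * R₀)) ≤ c / 4) :
    free A τ w ∈ Reg A (freeC A zero_le_one * (R₀ + 1)) (c / 2) := by
  have hD0 : 0 ≤ freeC A zero_le_one := freeC_nonneg A zero_le_one
  constructor
  · refine (norm_free_le A zero_le_one hτ1 w).trans (mul_le_mul_of_nonneg_left ?_ hD0)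
    have : ‖w‖ ≤ ‖f‖ + ‖w - f‖ := by
      have := norm_add_le f (w - f); rwa [add_sub_cancel] at this
    linarith [hf.1]
  · intro x
    have e1 := hf.2 x
    have e2 := free_sub_low A zero_le_one f (β := 0) (order_zero_le _) (s := 0) (by simp) hτ1 x
    rw [free_zero, sub_zero] at e2
    have e3 := (sJet_jetX A (free A τ (w - f))).low 0 (order_zero_le _) x
    have e4 := (e3.trans (norm_free_le A zero_le_one hτ1 (w - f))).trans (mul_le_mul_of_nonneg_left hw hD0)
    have e5 : fnX A f x = fnX A (free A τ w) x
        - (jetX A (free A τ f) 0 x - jetX A f 0 x) - jetX A (free A τ (w - f)) 0 x := by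
      rw [free_sub]
      have := fnX_sub A (free A τ w) (free A τ f) x
      unfold fnX at this ⊢
      rw [this]; ring
    have e6 : ‖fnX A f x‖ ≤ ‖fnX A (free A τ w) x‖
        + ‖jetX A (free A τ f) 0 x - jetX A f 0 x‖ + ‖jetX A (free A τ (w - f)) 0 x‖ := by
      conv_lhs => rw [e5]
      exact (norm_sub_le _ _).trans (add_le_add_left (norm_sub_le _ _) _)
    have e7 := mul_le_mul_of_nonneg_left e6 (pow_nonneg (bracket_pos x).le n)
    have e8 : |τ| * (N * (lowC A zero_le_one * ‖f‖)) ≤ |τ| * (N * (lowC A zero_le_one * R₀)) := by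
      have := lowC_nonneg A (zero_le_one (α := ℝ))
      gcongr
      exact hf.1
    linarith

/-- A classical solution of `∂ₜ v = i Δ v + h F(v)` with values in `XS`. -/
structure SolX (F : 𝕏 → 𝕏) (h : ℝ → ℂ) (U : Set ℝ)
    (v : ℝ → 𝕏) : Prop where
  cont : ContinuousOn v U
  eqn : ∀ t ∈ U, ∀ x, HasDerivWithinAt (fun s => fnX A (v s) x) (I * lapX A (v t) x + h t * fnX A (F (v t)) x) U t
  lower : ∃ c > 0, ∀ t ∈ U, ∀ x, c ≤ bracket x ^ n * ‖fnX A (v t) x‖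

set_option maxHeartbeats 800000 in
/-- Local existence, uniformly for initial values in `Reg R c` and initial times in `[0, T]`. -/
lemma exists_local {F : 𝕏 → 𝕏} (hF : RegLip A F) {T : ℝ}
    {h : ℝ → ℂ} (hh : ContinuousOn h (Icc 0 T)) (R : ℝ) {c : ℝ} (hc : 0 < c) :
    ∃ ε > 0, ∀ t₀ ∈ Icc 0 T, ∀ f ∈ Reg A R c, ∃ v : ℝ → 𝕏, v t₀ = f ∧ SolX A F h (Icc t₀ (min (t₀ + ε) T)) v := by
  obtain ⟨H, hH⟩ := isCompact_Icc.exists_bound_of_continuousOn hh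
  set D := freeC A zero_le_one with hD
  have hD0 : 0 ≤ D := freeC_nonneg A zero_le_one
  set R₀ := max R 0 with hR0
  set Q : ℝ := N * (lowC A zero_le_one * R₀) with hQ
  have hQ0 : 0 ≤ Q := by
    have := lowC_nonneg A (zero_le_one (α := ℝ)); have := le_max_right R 0; positivity
  set a : ℝ := min 1 (c / (4 * (D + 1))) with ha
  have ha0 : 0 < a := by positivity
  obtain ⟨M, hM0, hM⟩ := hF (D * (R₀ + 1)) (c / 2) (by positivity)
  set H₀ := max H 0 with hH0
  have hH00 : 0 ≤ H₀ := le_max_right _ _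
  set Λ : ℝ := D * (H₀ * M) with hΛ
  have hΛ0 : 0 ≤ Λ := by positivity
  set ε := min 1 (min (c / (4 * (Q + 1))) (a / (Λ + 1))) with hε
  have hε0 : 0 < ε := by positivity
  have hε1 : ε ≤ 1 := min_le_left _ _
  have hεQ : ε * Q ≤ c / 4 := by
    have : ε ≤ c / (4 * (Q + 1)) := (min_le_right _ _).trans (min_le_left _ _)
    rw [le_div_iff₀ (by positivity)] at this
    nlinarith
  have hεΛ : Λ * ε ≤ a := by
    have : ε ≤ a / (Λ + 1) := (min_le_right _ _).trans (min_le_right _ _)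
    rw [le_div_iff₀ (by positivity)] at this
    nlinarith
  have haD : D * a ≤ c / 4 := by
    have : a ≤ c / (4 * (D + 1)) := min_le_right _ _
    rw [le_div_iff₀ (by positivity)] at this
    nlinarith
  clear_value ε a Q R₀ H₀ D
  refine ⟨ε, hε0, fun t₀ ht₀ f hf => ?_⟩
  have hf' : f ∈ Reg A R₀ c := ⟨hf.1.trans (hR0 ▸ le_max_left R 0), hf.2⟩
  set U := Icc t₀ (min (t₀ + ε) T) with hI
  have hle : t₀ ≤ min (t₀ + ε) T := le_min (by linarith) ht₀.2
  have hIτ : ∀ t ∈ U, |t - t₀| ≤ ε := fun t ht => by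
    rw [abs_of_nonneg (by linarith [ht.1])]
    linarith [ht.2.trans (min_le_left _ _)]
  have hIT : ∀ t ∈ U, t ∈ Icc 0 T := fun t ht => ⟨ht₀.1.trans ht.1, ht.2.trans (min_le_right _ _)⟩
  have hreg : ∀ t ∈ U, ∀ w ∈ Metric.closedBall f a, free A (t - t₀) w ∈ Reg A (D * (R₀ + 1)) (c / 2) := by
    intro t ht w hw
    rw [mem_closedBall_iff_norm] at hw
    subst hD
    refine free_mem_reg A hf' hw (ha ▸ min_le_left _ _) ((hIτ t ht).trans hε1) haD ?_
    rw [← hQ]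
    exact (mul_le_mul_of_nonneg_right (hIτ t ht) hQ0).trans hεQ
  set G : ℝ → 𝕏 → 𝕏 := fun t w => free A (-(t - t₀)) (h t • F (free A (t - t₀) w)) with hG
  have hGb : ∀ t ∈ U, ∀ u : 𝕏, ‖free A (-(t - t₀)) (h t • u)‖ ≤ D * (H₀ * ‖u‖) := by
    intro t ht u
    rw [hD]
    refine (norm_free_le A zero_le_one (by rw [abs_neg]; exact (hIτ t ht).trans hε1) _).trans
      (mul_le_mul_of_nonneg_left ?_ (freeC_nonneg A zero_le_one))
    rw [norm_smul]
    exact mul_le_mul_of_nonneg_right ((hH t (hIT t ht)).trans (hH0 ▸ le_max_left _ _)) (norm_nonneg _)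
  have hPL : IsPicardLindelof G (tmin := t₀) (tmax := min (t₀ + ε) T) ⟨t₀, le_rfl, hle⟩ f
      ⟨a, ha0.le⟩ 0 ⟨Λ, hΛ0⟩ ⟨D * (H₀ * (M * D)), by positivity⟩ := by
    refine ⟨fun t ht => LipschitzOnWith.of_dist_le_mul fun w hw w' hw' => ?_, fun w hw => ?_, fun t ht w hw => ?_, ?_⟩
    · rw [dist_eq_norm, dist_eq_norm]
      have : G t w - G t w' = free A (-(t - t₀)) (h t • (F (free A (t - t₀) w) - F (free A (t - t₀) w'))) := by
        rw [smul_sub, free_sub]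
      rw [this]
      refine (hGb t ht _).trans ?_
      have e1 := (hM _ (hreg t ht w hw)).2 _ (hreg t ht w' hw')
      have e2 := norm_free_le A zero_le_one ((hIτ t ht).trans hε1) (w - w')
      rw [free_sub, ← hD] at e2
      have e3 := e1.trans (mul_le_mul_of_nonneg_left e2 hM0)
      calc D * (H₀ * _) ≤ D * (H₀ * (M * (D * ‖w - w'‖))) :=
            mul_le_mul_of_nonneg_left (mul_le_mul_of_nonneg_left e3 hH00) hD0
        _ = D * (H₀ * (M * D)) * ‖w - w'‖ := by ring
    · refine continuousOn_free A (by fun_prop) ?_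
      refine (hh.mono hIT).smul ?_
      exact (hF.continuousOn (R := D * (R₀ + 1)) (c := c / 2) (by positivity)).comp
        (continuousOn_free A (by fun_prop) continuousOn_const) fun t ht => hreg t ht w hw
    · exact (hGb t ht _).trans (mul_le_mul_of_nonneg_left (mul_le_mul_of_nonneg_left
        (hM _ (hreg t ht w hw)).1 hH00) hD0)
    · simp only [NNReal.coe_mk, NNReal.coe_zero, sub_zero, sub_self]
      rw [max_eq_left (by linarith)]
      refine le_trans (mul_le_mul_of_nonneg_left ?_ hΛ0) hεΛ
      linarith [min_le_left (t₀ + ε) T]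
  obtain ⟨α, hα⟩ := ODE.FunSpace.exists_isFixedPt_next hPL (Metric.mem_closedBall_self le_rfl)
  have hw0 : α.compProj t₀ = f := by
    have := ODE.FunSpace.next_apply₀ hPL (Metric.mem_closedBall_self le_rfl) α
    rw [hα] at this
    exact (ODE.FunSpace.compProj_val (α := α) (t := ⟨t₀, le_rfl, hle⟩)).trans this
  have hwb : ∀ t, α.compProj t ∈ Metric.closedBall f a := fun t => α.compProj_mem_closedBall hPL.mul_max_le
  have hwd : ∀ t ∈ U, HasDerivWithinAt α.compProj (G t (α.compProj t)) U t := fun t ht => by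
    have hd := ODE.hasDerivWithinAt_picard_Icc (t₀ := t₀) ⟨le_rfl, hle⟩ hPL.continuousOn_uncurry
      α.continuous_compProj.continuousOn (fun t _ => hwb t) f ht
    refine hd.congr_of_mem (fun s hs => ?_) ht
    have e2 := congrArg (fun γ => ODE.FunSpace.toFun γ ⟨s, hs⟩) hα
    exact (ODE.FunSpace.compProj_of_mem (α := α) hs).trans e2.symm
  have hwc : ContinuousOn α.compProj U := fun t ht => (hwd t ht).continuousWithinAt
  refine ⟨fun t => free A (t - t₀) (α.compProj t), by simp only [sub_self, free_zero, hw0],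
    continuousOn_free A (by fun_prop) hwc, fun t ht x => ?_, c / 2, by positivity,
    fun t ht x => (hreg t ht _ (hwb t)).2 x⟩
  have := hasDerivWithinAt_free A (hwd t ht) ht x
  rwa [fnX_smul] at this

/-! ### Derivatives of the nonlinearity -/

lemma IsWeakDeriv.step {i : Fin N} {u g h : Sp N → ℂ} (H : IsWeakDeriv β u g)
    (H' : WeakPartial i g h) : IsWeakDeriv (β + 𝐞 i) u h := by
  refine ⟨H.1, H'.right, fun φ h1 h2 => ?_⟩
  rw [multiD_add_single β h1, H.2.2 _ (partialD_contDiff h1 i) (IsTest.partialD ⟨h1, h2⟩ i).2,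
    H'.eq φ ⟨h1, h2⟩, order_add_single, pow_succ]
  simp

lemma WeakPartial.mul' {i : Fin N} {f g u h : Sp N → ℂ} (hf : ContDiff ℝ 1 f)
    (Hf : WeakPartial i f g) (Hu : WeakPartial i u h) :
    WeakPartial i (fun x => f x * u x) (fun x => f x * h x + g x * u x) := by
  refine (Hu.mul hf).congr EventuallyEq.rfl ?_
  filter_upwards [(weakPartial_of_contDiff hf i).unique Hf] with x hx
  rw [hx]

/-- A factor `p γ` or its conjugate. -/
def val (p : 𝕄 → ℂ) (e : Bool × (𝕄)) : ℂ := if e.1 then conj (p e.2) else p e.2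

lemma norm_val (p : 𝕄 → ℂ) (e : Bool × (𝕄)) : ‖val p e‖ = ‖p e.2‖ := by
  unfold val; split_ifs <;> simp

/-- A product of factors. -/
def prodl (p : 𝕄 → ℂ) (l : List (Bool × (𝕄))) : ℂ := (l.map (val p)).prod

lemma prodl_cons (p : 𝕄 → ℂ) (e : Bool × (𝕄)) (l : List (Bool × (𝕄))) :
    prodl p (e :: l) = val p e * prodl p l := by simp [prodl]

/-- The factor differentiated in direction `i`. -/
def incr (i : Fin N) (e : Bool × (𝕄)) : Bool × (𝕄) := (e.1, e.2 + 𝐞 i)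

/-- The products in the derivative of a product. -/
def dlist (i : Fin N) : List (Bool × (𝕄)) → List (List (Bool × (𝕄)))
  | [] => []
  | e :: l => (incr i e :: l) :: (dlist i l).map (e :: ·)

lemma dlist_spec (i : Fin N) (l : List (Bool × (𝕄))) : ∀ l' ∈ dlist i l,
    l'.length = l.length ∧ (l'.map Prod.snd).sum = (l.map Prod.snd).sum + 𝐞 i := by
  induction l with
  | nil => simp [dlist]
  | cons e l ih =>
    intro l' hl'
    simp only [dlist, List.mem_cons, List.mem_map] at hl'
    rcases hl' with rfl | ⟨l'', h, rfl⟩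
    · simp [incr]; abel
    · simp [(ih _ h).1, (ih _ h).2, add_assoc]

lemma order_sum (l : List (Bool × (𝕄))) : order (l.map Prod.snd).sum = (l.map fun e => order e.2).sum := by
  induction l with
  | nil => simp [order_zero]
  | cons e l ih => simp [order_add, ih]

section jets

variable {d : (Fin N → ℕ) → Sp N → ℂ} {B : ℝ}

lemma SJet.contDiff_val (H : SJet k m n d B) {e : Bool × (𝕄)} (h : order e.2 ≤ 2 * m + 1) :
    ContDiff ℝ 1 fun x => val (fun γ => d γ x) e := by
  unfold val
  split_ifs
  · exact conjCLE.contDiff.comp (H.contDiff_one h)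
  · exact H.contDiff_one h

lemma SJet.weakPartial_val (H : SJet k m n d B) {e : Bool × (𝕄)} (i : Fin N)
    (h : order e.2 < J) : WeakPartial i (fun x => val (fun γ => d γ x) e)
      (fun x => val (fun γ => d γ x) (incr i e)) := by
  unfold val incr
  cases e.1
  · exact H.jet.step _ i h
  · exact (H.jet.step _ i h).conj

lemma SJet.contDiff_prodl (H : SJet k m n d B) (l : List (Bool × (𝕄)))
    (h : ∀ e ∈ l, order e.2 ≤ 2 * m + 1) : ContDiff ℝ 1 fun x => prodl (fun γ => d γ x) l := by
  induction l with
  | nil => exact contDiff_const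
  | cons e l ih =>
    simp only [prodl_cons]
    exact (H.contDiff_val (h e (by simp))).mul (ih fun e he => h e (by simp [he]))

lemma SJet.weakPartial_prodl (A : Adm N k m n) (H : SJet k m n d B) (i : Fin N)
    (l : List (Bool × (𝕄))) (h : (l.map fun e => order e.2).sum < J) :
    WeakPartial i (fun x => prodl (fun γ => d γ x) l) (fun x => ((dlist i l).map (prodl fun γ => d γ x)).sum) := by
  induction l with
  | nil => simpa [prodl, dlist] using weakPartial_const (N := N) i
  | cons e l ih =>
    simp only [List.map_cons, List.sum_cons] at h
    have h1 := ih (by omega)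
    have h2 := H.weakPartial_val (e := e) i (by omega)
    have e1 : ∀ x, ((dlist i (e :: l)).map (prodl fun γ => d γ x)).sum
        = val (fun γ => d γ x) e * ((dlist i l).map (prodl fun γ => d γ x)).sum
          + val (fun γ => d γ x) (incr i e) * prodl (fun γ => d γ x) l := fun x => by
      simp only [dlist, List.map_cons, List.sum_cons, prodl_cons, List.map_map, ← List.sum_map_mul_left]
      rw [add_comm]
      rfl
    simp only [e1, prodl_cons]
    rcases le_or_gt (order e.2) (2 * m + 1) with h3 | h3
    · exact WeakPartial.mul' (H.contDiff_val h3) h2 h1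
    · have h4 : ∀ e' ∈ l, order e'.2 ≤ 2 * m + 1 := fun e' he' => by
        have h5 : order e'.2 ≤ (l.map fun e => order e.2).sum :=
          List.single_le_sum (by simp) _ (List.mem_map_of_mem he')
        have := A.hm
        unfold bigJ at h
        omega
      refine (WeakPartial.mul' (H.contDiff_prodl l h4) h1 h2).congr
        (of_forall fun x => mul_comm _ _) (of_forall fun x => ?_)
      simp only
      ring

lemma contDiff_norm_rpow {u : Sp N → ℂ} (hu : ContDiff ℝ 1 u) (h0 : ∀ x, u x ≠ 0) (s : ℝ) :
    ContDiff ℝ 1 fun x => ((‖u x‖ ^ s : ℝ) : ℂ) :=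
  ofRealCLM.contDiff.comp ((hu.norm ℝ h0).rpow_const_of_ne fun x => norm_ne_zero_iff.2 (h0 x))

lemma fderiv_norm_rpow {u : Sp N → ℂ} (hu : ContDiff ℝ 1 u) (h0 : ∀ x, u x ≠ 0) (s : ℝ) (x w : Sp N) :
    fderiv ℝ (fun x => ((‖u x‖ ^ s : ℝ) : ℂ)) x w = ((s / 2 : ℝ) : ℂ) * ((‖u x‖ ^ (s - 2) : ℝ) : ℂ)
      * (conj (u x) * fderiv ℝ u x w + u x * conj (fderiv ℝ u x w)) := by
  have h1 : HasFDerivAt u (fderiv ℝ u x) x := (hu.differentiable (by simp) x).hasFDerivAt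
  have h2 := h1.norm_sq.rpow_const (p := s / 2) (Or.inl (pow_ne_zero 2 (norm_ne_zero_iff.2 (h0 x))))
  have h3 := ofRealCLM.hasFDerivAt.comp x h2
  have e1 : ∀ (y : Sp N) (r : ℝ), (‖u y‖ ^ 2) ^ (r / 2) = ‖u y‖ ^ r := fun y r => by
    rw [← rpow_natCast, ← rpow_mul (norm_nonneg _)]
    congr 1
    push_cast
    ring
  have e2 : (fun x => ((‖u x‖ ^ s : ℝ) : ℂ)) = ofRealCLM ∘ fun x => (‖u x‖ ^ 2) ^ (s / 2) := by
    funext y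
    simp only [Function.comp_apply, ofRealCLM_apply, e1]
  rw [e2, h3.fderiv]
  have e3 : s / 2 - 1 = (s - 2) / 2 := by ring
  have e4 : conj (u x) * fderiv ℝ u x w + u x * conj (fderiv ℝ u x w)
      = ((2 * inner ℝ (u x) (fderiv ℝ u x w) : ℝ) : ℂ) := by
    apply Complex.ext <;> simp [Complex.inner, mul_re, mul_im] <;> ring
  rw [e4, e3, e1]
  simp only [ContinuousLinearMap.comp_apply, smul_apply, ofRealCLM_apply,
    smul_eq_mul, innerSL_apply_apply, nsmul_eq_mul]
  push_cast
  ring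

end jets

/-- A term `c(α) |p₀|^{α - 2a} ∏ p_γ` (some of the factors being conjugated) of a derivative of
`|v|^α v`. -/
structure Term (N : ℕ) where
  cf : ℝ → ℝ
  a : ℕ
  l : List (Bool × (Fin N → ℕ))

namespace Term

/-- The value of a term. -/
def ev (t : Term N) (α : ℝ) (p : 𝕄 → ℂ) : ℂ := ((t.cf α : ℝ) : ℂ) * (((‖p 0‖ ^ (α - 2 * t.a) : ℝ) : ℂ) * prodl p t.l)

/-- `t` is a term of `D^β (|v|^α v)`. -/
structure Good (β : 𝕄) (t : Term N) : Prop where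
  length : t.l.length = 2 * t.a + 1
  sum : (t.l.map Prod.snd).sum = β
  a_le : t.a ≤ order β
  bdd : ∃ M, ∀ α ∈ Icc (0 : ℝ) 2, |t.cf α| ≤ M

/-- The terms of the derivative of a term. -/
def deriv (i : Fin N) (t : Term N) : List (Term N) :=
  ((dlist i t.l).map fun l => ⟨t.cf, t.a, l⟩) ++
    [⟨fun α => t.cf α * ((α - 2 * t.a) / 2), t.a + 1, (true, 0) :: (false, 𝐞 i) :: t.l⟩,
      ⟨fun α => t.cf α * ((α - 2 * t.a) / 2), t.a + 1, (false, 0) :: (true, 𝐞 i) :: t.l⟩]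

lemma Good.deriv {t : Term N} (h : t.Good β) (i : Fin N) : ∀ t' ∈ t.deriv i, t'.Good (β + 𝐞 i) := by
  have hb : ∃ M, ∀ α ∈ Icc (0 : ℝ) 2, |t.cf α * ((α - 2 * t.a) / 2)| ≤ M := by
    obtain ⟨M, hM⟩ := h.bdd
    refine ⟨M * (1 + t.a), fun α hα => ?_⟩
    rw [abs_mul]
    refine mul_le_mul (hM α hα) ?_ (abs_nonneg _) ((abs_nonneg _).trans (hM α hα))
    have := t.a.cast_nonneg (α := ℝ)
    rw [abs_le]; constructor <;> linarith [hα.1, hα.2]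
  intro t' ht'
  simp only [Term.deriv, List.mem_append, List.mem_map, List.mem_cons, List.not_mem_nil, or_false] at ht'
  rcases ht' with ⟨l, hl, rfl⟩ | rfl | rfl
  · exact ⟨(dlist_spec i _ _ hl).1.trans h.length, by rw [(dlist_spec i _ _ hl).2, h.sum],
      by rw [order_add_single]; exact h.a_le.trans (le_succ _), h.bdd⟩
  all_goals
    refine ⟨by simp [h.length]; ring, by simp [h.sum, add_comm], ?_, hb⟩
    rw [order_add_single]
    exact Nat.succ_le_succ h.a_le

lemma weakPartial_ev (A : Adm N k m n) {t : Term N} (h : t.Good β)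
    (hβ : order β < J) {d : 𝕄 → Sp N → ℂ} {B : ℝ} (H : SJet k m n d B)
    (h0 : ∀ x, d 0 x ≠ 0) (α : ℝ) (i : Fin N) : WeakPartial i (fun x => t.ev α fun γ => d γ x)
      (fun x => ((t.deriv i).map fun s => s.ev α fun γ => d γ x).sum) := by
  have hc : ContDiff ℝ 1 (d 0) := H.contDiff_one (by rw [order_zero]; omega)
  have h1 := H.weakPartial_prodl A i t.l (by rw [← order_sum, h.sum]; exact hβ)
  have h2 := ((h1.mul (contDiff_norm_rpow hc h0 (α - 2 * t.a))).const_mul (t.cf α))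
  refine h2.congr EventuallyEq.rfl (of_forall fun x => ?_)
  simp only [Term.deriv, List.map_append, List.sum_append, List.map_map, List.map_cons, List.map_nil,
    List.sum_cons, List.sum_nil, ev, comp_def, prodl_cons, val]
  rw [fderiv_norm_rpow hc h0, H.fderiv_stdVec (by rw [order_zero]; omega), List.sum_map_mul_left,
    List.sum_map_mul_left, zero_add]
  have e1 : α - 2 * ((t.a + 1 : ℕ) : ℝ) = α - 2 * t.a - 2 := by push_cast; ring
  rw [e1]
  simp
  ring

end Term

/-- The derivatives of `|v|^α v` are sums of terms. -/
lemma exists_terms (A : Adm N k m n) (β : 𝕄) (hβ : order β ≤ J) : ∃ L : List (Term N), (∀ t ∈ L, t.Good β) ∧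
      ∀ (α : ℝ) (d : 𝕄 → Sp N → ℂ) (B : ℝ), SJet k m n d B → (∀ x, d 0 x ≠ 0) →
        IsWeakDeriv β (powNL α (d 0)) (fun x => (L.map fun t => t.ev α fun γ => d γ x).sum) := by
  induction β using multiIndex_induction with
  | h0 =>
    refine ⟨[⟨fun _ => 1, 0, [(false, 0)]⟩], ?_, fun α d B H h0 => ?_⟩
    · simp only [List.mem_singleton, forall_eq]
      exact ⟨rfl, by simp, by simp, 1, by simp⟩
    · have hc : Continuous (powNL α (d 0)) :=
        (contDiff_norm_rpow (H.contDiff_one (by rw [order_zero]; omega)) h0 α).continuous.mul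
          (H.cont 0 (by rw [order_zero]; omega))
      have e : (fun x => ([(⟨fun _ => 1, 0, [(false, 0)]⟩ : Term N)].map fun t =>
          t.ev α fun γ => d γ x).sum) = powNL α (d 0) := by
        funext x
        simp [Term.ev, prodl, val, powNL]
      rw [e]
      exact ⟨hc.locallyIntegrable, hc.locallyIntegrable, fun φ _ _ => by simp [multiD_zero, order_zero]⟩
  | hs β i ih =>
    rw [order_add_single] at hβ
    obtain ⟨L, h1, h2⟩ := ih (by omega)
    refine ⟨L.flatMap (Term.deriv i), fun t ht => ?_, fun α d B H h0 => (h2 α d B H h0).step ?_⟩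
    · obtain ⟨s, hs, ht⟩ := List.mem_flatMap.1 ht
      exact (h1 s hs).deriv i t ht
    · clear h2
      induction L with
      | nil => simpa using WeakPartial.zero (N := N)
      | cons t L ihL =>
        simp only [List.map_cons, List.sum_cons, List.flatMap_cons, List.map_append, List.sum_append]
        exact (Term.weakPartial_ev A (h1 t (by simp)) hβ H h0 α i).add (ihL fun s hs => h1 s (by simp [hs]))

/-! ### Pointwise bounds of the terms -/

lemma norm_prodl_le {p : 𝕄 → ℂ} {D : ℝ} (l : List (Bool × (𝕄)))
    (h : ∀ e ∈ l, ‖p e.2‖ ≤ D) : ‖prodl p l‖ ≤ D ^ l.length := by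
  induction l with
  | nil => simp [prodl]
  | cons e l ih =>
    have h1 := h e (by simp)
    have hD := (norm_nonneg _).trans h1
    rw [prodl_cons, norm_mul, norm_val, List.length_cons, pow_succ']
    exact mul_le_mul h1 (ih fun e he => h e (by simp [he])) (norm_nonneg _) hD

lemma norm_prodl_sub_le {p q : 𝕄 → ℂ} {D δ : ℝ} (hD : 1 ≤ D)
    (l : List (Bool × (𝕄))) (h : ∀ e ∈ l, ‖p e.2‖ ≤ D) (h' : ∀ e ∈ l, ‖q e.2‖ ≤ D)
    (hd : ∀ e ∈ l, ‖p e.2 - q e.2‖ ≤ δ) :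
    ‖prodl p l - prodl q l‖ ≤ l.length * D ^ l.length * δ := by
  induction l with
  | nil => simp [prodl]
  | cons e l ih =>
    have i1 := ih (fun e he => h e (by simp [he])) (fun e he => h' e (by simp [he])) (fun e he => hd e (by simp [he]))
    have i2 := norm_prodl_le l fun e he => h e (by simp [he])
    have i3 := h' e (by simp)
    have i4 := hd e (by simp)
    have hδ := (norm_nonneg _).trans i4
    have e1 : prodl p (e :: l) - prodl q (e :: l)
        = (val p e - val q e) * prodl p l + val q e * (prodl p l - prodl q l) := by
      rw [prodl_cons, prodl_cons]; ring
    have e2 : ‖val p e - val q e‖ = ‖p e.2 - q e.2‖ := by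
      unfold val; split_ifs
      · rw [← map_sub, RCLike.norm_conj]
      · rfl
    have i5 : ‖p e.2 - q e.2‖ * ‖prodl p l‖ ≤ δ * (D * D ^ l.length) := by
      refine mul_le_mul i4 (i2.trans (le_mul_of_one_le_left (by positivity) hD)) (norm_nonneg _) hδ
    have i6 : ‖q e.2‖ * ‖prodl p l - prodl q l‖ ≤ D * (l.length * D ^ l.length * δ) :=
      mul_le_mul i3 i1 (norm_nonneg _) (by linarith)
    rw [e1]
    refine (norm_add_le _ _).trans ?_
    rw [norm_mul, norm_mul, e2, norm_val, List.length_cons, pow_succ']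
    push_cast
    linarith

namespace Term

/-- A factor of maximal order. -/
lemma Good.split {t : Term N} (h : t.Good β) :
    ∃ e l', l'.length = 2 * t.a ∧ (∀ e' ∈ l', 2 * order e'.2 ≤ order β) ∧ order e.2 ≤ order β ∧
      (order e.2 = order β → e.2 = β ∧ ∀ e' ∈ l', e'.2 = 0) ∧ (order e.2 = 0 → order β = 0) ∧
      (∀ p, prodl p t.l = val p e * prodl p l') ∧
      ∀ w : 𝕄 → ℕ, (t.l.map fun e => w e.2).sum = w e.2 + (l'.map fun e => w e.2).sum := by
  classical
  have hne : t.l.toFinset.Nonempty := by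
    rw [List.toFinset_nonempty_iff]
    intro h0
    have := h.length
    simp [h0] at this
  obtain ⟨e, he, hmax⟩ := Finset.exists_max_image t.l.toFinset (fun e => order e.2) hne
  rw [List.mem_toFinset] at he
  have hmax' : ∀ e' ∈ t.l, order e'.2 ≤ order e.2 := fun e' he' => hmax e' (List.mem_toFinset.2 he')
  obtain ⟨l', hp⟩ : ∃ l', t.l.Perm (e :: l') := ⟨_, List.perm_cons_erase he⟩
  have hw : ∀ w : 𝕄 → ℕ, (t.l.map fun e => w e.2).sum = w e.2 + (l'.map fun e => w e.2).sum := fun w => by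
    rw [(hp.map _).sum_eq, List.map_cons, List.sum_cons]
  have hmem : ∀ e' ∈ l', e' ∈ t.l := fun e' he' => hp.mem_iff.2 (by simp [he'])
  have hs := hw order
  rw [← order_sum, h.sum] at hs
  have hle : ∀ e' ∈ l', order e'.2 ≤ (l'.map fun e => order e.2).sum :=
    fun e' he' => List.single_le_sum (by simp) _ (List.mem_map_of_mem (f := fun e => order e.2) he')
  refine ⟨e, l', ?_, fun e' he' => ?_, by omega, fun h1 => ⟨?_, fun e' he' => ?_⟩, fun h1 => ?_, fun p => ?_, hw⟩
  · have := hp.length_eq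
    rw [h.length, List.length_cons] at this
    omega
  · have := hmax' e' (hmem e' he')
    have := hle e' he'
    omega
  · have h2 : (t.l.map Prod.snd).sum = e.2 + (l'.map Prod.snd).sum := by
      rw [(hp.map _).sum_eq, List.map_cons, List.sum_cons]
    have h3 : (l'.map Prod.snd).sum = 0 := by
      rw [← order_eq_zero, order_sum]; omega
    rw [h.sum, h3, add_zero] at h2
    exact h2.symm
  · have := hle e' he'
    exact order_eq_zero.1 (by omega)
  · rw [hs, h1, zero_add]
    refine List.sum_eq_zero fun r hr => ?_
    obtain ⟨e', he', rfl⟩ := List.mem_map.1 hr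
    have := hmax' e' (hmem e' he')
    omega
  · unfold prodl
    rw [(hp.map _).prod_eq, List.map_cons, List.prod_cons]

lemma Good.norm_ev_le {t : Term N} (h : t.Good β) {α : ℝ} {p : 𝕄 → ℂ}
    (hp : p 0 ≠ 0) {D S : ℝ} (hD1 : 1 ≤ D) (hD : ∀ δ, 2 * order δ ≤ order β → ‖p δ‖ ≤ D * ‖p 0‖)
    (hS0 : 0 ≤ S) (hS : ∀ γ, 1 ≤ order γ → order γ < order β → ‖p γ‖ ≤ S) :
    ‖t.ev α p‖ ≤ |t.cf α| * (‖p 0‖ ^ α * (‖p β‖ + D ^ (2 * order β) * S)) := by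
  obtain ⟨e, l', hl, h1, h2, h3, h4, h5, -⟩ := h.split
  have hp0 : 0 < ‖p 0‖ := norm_pos_iff.2 hp
  have hpow : ‖p 0‖ ^ (α - 2 * t.a) * ‖p 0‖ ^ (2 * t.a) = ‖p 0‖ ^ α := by
    rw [← rpow_natCast, ← rpow_add hp0]; congr 1; push_cast; ring
  have hkey : ∀ D' : ℝ, 0 ≤ D' → (∀ e' ∈ l', ‖p e'.2‖ ≤ D' * ‖p 0‖) →
      ‖t.ev α p‖ ≤ |t.cf α| * (‖p 0‖ ^ α * (D' ^ (2 * t.a) * ‖p e.2‖)) := fun D' hD' H => by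
    have h6 := norm_prodl_le l' H
    rw [hl, mul_pow] at h6
    unfold ev
    rw [norm_mul, norm_mul, h5, norm_mul, norm_val, norm_real, norm_real,
      norm_eq_abs, norm_eq_abs, abs_of_nonneg (rpow_nonneg (norm_nonneg (p 0)) _), ← hpow]
    refine mul_le_mul_of_nonneg_left ?_ (abs_nonneg _)
    calc _ ≤ ‖p 0‖ ^ (α - 2 * t.a) * (‖p e.2‖ * (D' ^ (2 * t.a) * ‖p 0‖ ^ (2 * t.a))) := by gcongr
      _ = _ := by ring
  rcases eq_or_ne (order e.2) (order β) with h6 | h6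
  · obtain ⟨h7, h8⟩ := h3 h6
    refine (hkey 1 zero_le_one fun e' he' => by rw [h8 e' he', one_mul]).trans ?_
    rw [one_pow, one_mul, h7]
    have : 0 ≤ D ^ (2 * order β) * S := by positivity
    gcongr
    linarith
  · refine (hkey D (by linarith) fun e' he' => hD _ (h1 e' he')).trans ?_
    have h7 : ‖p e.2‖ ≤ S := hS _ (by omega) (by omega)
    have h8 : D ^ (2 * t.a) ≤ D ^ (2 * order β) := pow_le_pow_right₀ hD1 (by have := h.a_le; omega)
    have h9 : D ^ (2 * t.a) * ‖p e.2‖ ≤ D ^ (2 * order β) * S := mul_le_mul h8 h7 (norm_nonneg _) (by positivity)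
    gcongr
    linarith [norm_nonneg (p β)]

lemma exists_rpow_bound {c R : ℝ} (hc : 0 < c) (s : ℝ) : ∃ K ≥ 0, ∀ x ∈ Icc c R, ∀ y ∈ Icc c R,
    |x ^ s| ≤ K ∧ |x ^ s - y ^ s| ≤ K * |x - y| := by
  have h1 : ∀ r : ℝ, ContinuousOn (fun x : ℝ => x ^ r) (Icc c R) := fun r =>
    continuousOn_id.rpow_const fun x hx => Or.inl (hc.trans_le hx.1).ne'
  obtain ⟨K₁, hK₁⟩ := isCompact_Icc.exists_bound_of_continuousOn (h1 s)
  obtain ⟨K₂, hK₂⟩ := isCompact_Icc.exists_bound_of_continuousOn (continuousOn_const (c := s).mul (h1 (s - 1)))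
  refine ⟨max (max K₁ K₂) 0, le_max_right _ _, fun x hx y hy =>
    ⟨(hK₁ x hx).trans ((le_max_left _ _).trans (le_max_left _ _)), ?_⟩⟩
  have := (convex_Icc c R).norm_image_sub_le_of_norm_hasDerivWithin_le (f := fun x : ℝ => x ^ s)
    (f' := fun x => s * x ^ (s - 1)) (C := max (max K₁ K₂) 0) (fun z hz =>
      (Real.hasDerivAt_rpow_const (Or.inl (hc.trans_le hz.1).ne')).hasDerivWithinAt)
    (fun z hz => (hK₂ z hz).trans ((le_max_right _ _).trans (le_max_left _ _))) hy hx
  exact this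

lemma Good.exists_lipschitz (A : Adm N k m n) {t : Term N} (h : t.Good β)
    (hβ : order β ≤ J) (α : ℝ) {c R : ℝ} (hc : 0 < c) (hR : 1 ≤ R) :
    ∃ K ≥ 0, ∀ (p q : 𝕄 → ℂ) (δ S E : ℝ), c ≤ ‖p 0‖ → c ≤ ‖q 0‖ →
      (∀ γ, order γ ≤ 2 * m → ‖p γ‖ ≤ R ∧ ‖q γ‖ ≤ R ∧ ‖p γ - q γ‖ ≤ δ) → 0 ≤ S → 0 ≤ E →
      (∀ γ, 2 * m + 1 ≤ order γ → order γ ≤ order β → ‖q γ‖ ≤ S ∧ ‖p γ‖ ≤ S ∧ ‖p γ - q γ‖ ≤ E) →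
      ‖t.ev α p - t.ev α q‖ ≤ K * (δ * (1 + S) + E) := by
  obtain ⟨e, l', hl, h1, h2, -, -, h5, -⟩ := h.split
  obtain ⟨X, hX0, hX⟩ := exists_rpow_bound (R := R) hc (α - 2 * t.a)
  refine ⟨|t.cf α| * (X * R ^ (2 * t.a) * (R + 1 + 2 * t.a * R)), by positivity,
    fun p q δ S E hp hq hlow hS hE hhigh => ?_⟩
  obtain ⟨p1, q1, d1⟩ := hlow 0 (by rw [order_zero]; omega)
  have hδ := (norm_nonneg _).trans d1
  have hlow' : ∀ e' ∈ l', order e'.2 ≤ 2 * m := fun e' he' => by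
    have := h1 e' he'; have := A.hm; unfold bigJ at hβ; omega
  have b1 := norm_prodl_le l' fun e' he' => (hlow _ (hlow' e' he')).1
  have b2 := norm_prodl_sub_le hR l' (fun e' he' => (hlow _ (hlow' e' he')).1)
    (fun e' he' => (hlow _ (hlow' e' he')).2.1) (fun e' he' => (hlow _ (hlow' e' he')).2.2)
  rw [hl] at b1 b2
  push_cast at b2
  obtain ⟨b3, b3', b4⟩ : ‖p e.2‖ ≤ R + S ∧ ‖q e.2‖ ≤ R + S ∧ ‖p e.2 - q e.2‖ ≤ δ + E := by
    rcases le_or_gt (order e.2) (2 * m) with h6 | h6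
    · obtain ⟨x1, x2, x3⟩ := hlow _ h6
      exact ⟨by linarith, by linarith, by linarith⟩
    · obtain ⟨x1, x2, x3⟩ := hhigh _ h6 h2
      exact ⟨by linarith, by linarith, by linarith⟩
  obtain ⟨b5, b6⟩ := hX _ ⟨hp, p1⟩ _ ⟨hq, q1⟩
  have b7 := (hX _ ⟨hq, q1⟩ _ ⟨hq, q1⟩).1
  replace b6 := b6.trans (mul_le_mul_of_nonneg_left ((abs_norm_sub_norm_le _ _).trans d1) hX0)
  have e2 : ‖val p e - val q e‖ = ‖p e.2 - q e.2‖ := by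
    unfold val; split_ifs
    · rw [← map_sub, RCLike.norm_conj]
    · rfl
  have e1 : t.ev α p - t.ev α q = ((t.cf α : ℝ) : ℂ) *
      (((‖p 0‖ ^ (α - 2 * t.a) - ‖q 0‖ ^ (α - 2 * t.a) : ℝ) : ℂ) * (val p e * prodl p l')
        + ((‖q 0‖ ^ (α - 2 * t.a) : ℝ) : ℂ) * ((val p e - val q e) * prodl p l'
          + val q e * (prodl p l' - prodl q l'))) := by
    unfold ev
    rw [h5, h5]
    push_cast
    ring
  have hR0 : 0 ≤ R := by linarith
  have c1 : ‖((‖p 0‖ ^ (α - 2 * t.a) - ‖q 0‖ ^ (α - 2 * t.a) : ℝ) : ℂ) * (val p e * prodl p l')‖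
      ≤ X * δ * ((R + S) * R ^ (2 * t.a)) := by
    rw [norm_mul, norm_mul, norm_val, norm_real]
    exact mul_le_mul b6 (mul_le_mul b3 b1 (norm_nonneg _) (by positivity)) (by positivity) (by positivity)
  have c2 : ‖((‖q 0‖ ^ (α - 2 * t.a) : ℝ) : ℂ) * ((val p e - val q e) * prodl p l'
      + val q e * (prodl p l' - prodl q l'))‖
      ≤ X * ((δ + E) * R ^ (2 * t.a) + (R + S) * (2 * t.a * R ^ (2 * t.a) * δ)) := by
    rw [norm_mul, norm_real]
    refine mul_le_mul b7 ((norm_add_le _ _).trans (add_le_add ?_ ?_)) (norm_nonneg _) hX0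
    · rw [norm_mul, e2]; exact mul_le_mul b4 b1 (norm_nonneg _) (by positivity)
    · rw [norm_mul, norm_val]; exact mul_le_mul b3' b2 (norm_nonneg _) (by positivity)
  rw [e1, norm_mul, norm_real, mul_assoc]
  refine mul_le_mul_of_nonneg_left ((norm_add_le _ _).trans ((add_le_add c1 c2).trans ?_)) (abs_nonneg _)
  have c3 : R + S ≤ R * (1 + S) := by nlinarith
  have c4 : δ ≤ δ * (1 + S) := by nlinarith [mul_nonneg hδ hS]
  have c5 : δ * (R + S) ≤ R * (δ * (1 + S) + E) := by nlinarith [mul_le_mul_of_nonneg_left c3 hδ, mul_nonneg hR0 hE]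
  have hXR : 0 ≤ X * R ^ (2 * t.a) := by positivity
  have c6 : δ * (R + S) + ((δ + E) + 2 * t.a * (δ * (R + S))) ≤ (R + 1 + 2 * t.a * R) * (δ * (1 + S) + E) := by
    have := mul_le_mul_of_nonneg_left c5 (by positivity : (0 : ℝ) ≤ 2 * t.a)
    nlinarith
  calc _ = X * R ^ (2 * t.a) * (δ * (R + S) + ((δ + E) + 2 * t.a * (δ * (R + S)))) := by ring
    _ ≤ X * R ^ (2 * t.a) * ((R + 1 + 2 * t.a * R) * (δ * (1 + S) + E)) := mul_le_mul_of_nonneg_left c6 hXR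
    _ = _ := by ring

lemma prodl_scale (b : ℝ) (w : 𝕄 → ℕ) (d : 𝕄 → ℂ)
    (l : List (Bool × (𝕄))) : prodl (fun γ => (b ^ w γ) • d γ) l = (b ^ (l.map fun e => w e.2).sum) • prodl d l := by
  induction l with
  | nil => simp [prodl]
  | cons e l ih =>
    have e1 : val (fun γ => (b ^ w γ) • d γ) e = (b ^ w e.2) • val d e := by
      unfold val; split_ifs <;> simp
    rw [prodl_cons, prodl_cons, ih, e1, List.map_cons, List.sum_cons, pow_add]
    simp only [real_smul]
    push_cast
    ring

lemma Good.weight_le {t : Term N} (h : t.Good β) {b : ℝ} (hb : 1 ≤ b)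
    {w : 𝕄 → ℕ} (hw : ∀ γ, 2 * order γ ≤ order β → w γ = n)
    (hw' : ∀ γ, order γ ≤ order β → w β ≤ w γ) (α : ℝ) (d e : 𝕄 → ℂ) :
    b ^ (n * α) * (b ^ w β * ‖t.ev α d - t.ev α e‖)
      ≤ ‖t.ev α (fun γ => (b ^ w γ) • d γ) - t.ev α fun γ => (b ^ w γ) • e γ‖ := by
  have hb0 : 0 < b := by linarith
  have e1 : ∀ d : 𝕄 → ℂ, t.ev α (fun γ => (b ^ w γ) • d γ)
      = ((b ^ (n * (α - 2 * t.a)) * b ^ (t.l.map fun e => w e.2).sum : ℝ) : ℂ) * t.ev α d := by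
    intro d
    unfold ev
    rw [prodl_scale, norm_smul, norm_of_nonneg (by positivity), hw 0 (by simp [order_zero]),
      mul_rpow (by positivity) (norm_nonneg _), ← rpow_natCast, ← rpow_mul hb0.le,
      real_smul]
    push_cast
    ring
  rw [e1, e1, ← mul_sub, norm_mul, norm_real, norm_of_nonneg (by positivity), ← mul_assoc]
  refine mul_le_mul_of_nonneg_right ?_ (norm_nonneg _)
  obtain ⟨f, l', hl, h1, h2, -, -, -, h7⟩ := h.split
  have e2 : (l'.map fun e => w e.2).sum = 2 * t.a * n := by
    rw [List.map_congr_left fun e' he' => hw _ (h1 e' he')]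
    simp [hl]
  rw [h7, e2, ← rpow_natCast b (w β), ← rpow_natCast b (w f.2 + _), ← rpow_add hb0, ← rpow_add hb0]
  refine Real.rpow_le_rpow_of_exponent_le hb ?_
  have : (w β : ℝ) ≤ w f.2 := by exact_mod_cast hw' _ h2
  push_cast
  linarith

end Term

/-! ### The nonlinearity as a map of `𝓢` -/

/-- The multi-indices of the derivatives that are measured in `L²`. -/
def highIdx (N k m n : ℕ) : Finset (Fin N → ℕ) :=
  (finite_order_le (bigJ k m n)).toFinset.filter fun γ => 2 * m + 1 ≤ order γ

lemma mem_highIdx {γ : 𝕄} : γ ∈ highIdx N k m n ↔ 2 * m + 1 ≤ order γ ∧ order γ ≤ J := by simp [highIdx, and_comm]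

lemma eLpNorm_le_three {ι : Type*} {g h : Sp N → ℂ} {r : Sp N → ℝ} (s : Finset ι)
    {z : ι → Sp N → ℂ} {c₁ c₂ c₃ : ℝ} (h1 : 0 ≤ c₁) (h2 : 0 ≤ c₂) (h3 : 0 ≤ c₃)
    (hh : AEStronglyMeasurable h) (hr : AEStronglyMeasurable r)
    (hz : ∀ i ∈ s, AEStronglyMeasurable (z i)) (hr0 : ∀ x, 0 ≤ r x)
    (H : ∀ x, ‖g x‖ ≤ c₁ * ‖h x‖ + c₂ * r x + c₃ * ∑ i ∈ s, ‖z i x‖) :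
    eLpNorm g 2 ≤ ofReal c₁ * eLpNorm h 2 + ofReal c₂ * eLpNorm r 2 + ofReal c₃ * ∑ i ∈ s, eLpNorm (z i) 2 := by
  have m3 : ∀ i ∈ s, AEStronglyMeasurable (fun x => ‖z i x‖) := fun i hi => (hz i hi).norm
  have m4 : AEStronglyMeasurable (∑ i ∈ s, fun x => ‖z i x‖) := Finset.aestronglyMeasurable_sum s m3
  have e1 : eLpNorm g 2 ≤ eLpNorm ((c₁ • fun x => ‖h x‖) + c₂ • r + c₃ • ∑ i ∈ s, fun x => ‖z i x‖) 2 :=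
    eLpNorm_mono_real fun x => by simpa [Finset.sum_apply] using H x
  refine e1.trans ((eLpNorm_add_le ((hh.norm.const_smul c₁).add (hr.const_smul c₂))
    (m4.const_smul c₃) one_le_two).trans (add_le_add ((eLpNorm_add_le (hh.norm.const_smul c₁)
    (hr.const_smul c₂) one_le_two).trans (add_le_add ?_ ?_)) ?_))
  · rw [eLpNorm_const_smul, eLpNorm_norm, Real.enorm_eq_ofReal h1]
  · rw [eLpNorm_const_smul, Real.enorm_eq_ofReal h2]
  · rw [eLpNorm_const_smul, Real.enorm_eq_ofReal h3]
    refine mul_le_mul_right ((eLpNorm_sum_le m3 one_le_two).trans (le_of_eq ?_)) _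
    exact sum_congr rfl fun i _ => eLpNorm_norm _

lemma wE_low {γ : 𝕄} (h : order γ ≤ 2 * m) : wE k m n γ = n := if_pos h

lemma wE_high {γ : 𝕄} (h : 2 * m + 1 ≤ order γ) : wE k m n γ = wt k m n (order γ) := if_neg (by omega)

lemma wE_anti {γ β : 𝕄} (h : order γ ≤ order β) : wE k m n β ≤ wE k m n γ := by
  unfold wE wt
  split_ifs <;> omega

lemma Adm.half_lt (A : Adm N k m n) {α : ℝ} (hα : alphaMin N ≤ α) : (N : ℝ) / 2 < n * α := by
  have h0 : (1 : ℝ) ≤ N := by exact_mod_cast A.one_le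
  have h1 : 2 / ((N : ℝ) + 1) ≤ α := (le_max_right _ _).trans hα
  have h2 := A.hn'
  have h3 : (0 : ℝ) < n := by have := A.two_le_n; positivity
  have h4 : (n : ℝ) * (2 / ((N : ℝ) + 1)) ≤ n * α := by gcongr
  refine lt_of_lt_of_le ?_ h4
  rw [mul_div_assoc', div_lt_div_iff₀ (by norm_num) (by linarith)]
  linarith

lemma alphaMin_pos (A : Adm N k m n) : 0 < alphaMin N := by
  have h0 : (1 : ℝ) ≤ N := by exact_mod_cast A.one_le
  exact lt_of_lt_of_le (by positivity) (le_max_right _ _)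

lemma exists_sum_lipschitz (A : Adm N k m n) {L : List (Term N)}
    (hL : ∀ t ∈ L, t.Good β) (hβ : order β ≤ J) (α : ℝ) {c R : ℝ} (hc : 0 < c) (hR : 1 ≤ R) :
    ∃ K ≥ 0, ∀ (b : ℝ) (d e p q : 𝕄 → ℂ) (δ S E : ℝ), 1 ≤ b →
      (p = fun γ => (b ^ wE k m n γ) • d γ) → (q = fun γ => (b ^ wE k m n γ) • e γ) →
      c ≤ ‖p 0‖ → c ≤ ‖q 0‖ →
      (∀ γ, order γ ≤ 2 * m → ‖p γ‖ ≤ R ∧ ‖q γ‖ ≤ R ∧ ‖p γ - q γ‖ ≤ δ) → 0 ≤ S → 0 ≤ E →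
      (∀ γ, 2 * m + 1 ≤ order γ → order γ ≤ order β → ‖q γ‖ ≤ S ∧ ‖p γ‖ ≤ S ∧ ‖p γ - q γ‖ ≤ E) →
      b ^ (n * α) * (b ^ wE k m n β * ‖(L.map fun t => t.ev α d).sum - (L.map fun t => t.ev α e).sum‖)
        ≤ K * (δ * (1 + S) + E) := by
  induction L with
  | nil =>
    exact ⟨0, le_rfl, fun b d e p q δ S E _ _ _ _ _ _ _ _ _ => by simp⟩
  | cons t L ih =>
    obtain ⟨K, hK, H⟩ := ih fun t ht => hL t (by simp [ht])
    obtain ⟨K', hK', H'⟩ := (hL t (by simp)).exists_lipschitz A hβ α hc hR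
    refine ⟨K' + K, by positivity, fun b d e p q δ S E hb hp hq p0 q0 h1 h2 h3 h4 => ?_⟩
    have i1 := H b d e p q δ S E hb hp hq p0 q0 h1 h2 h3 h4
    have i2 := H' p q δ S E p0 q0 h1 h2 h3 h4
    have i3 := (hL t (by simp)).weight_le hb (n := n) (w := wE k m n)
      (fun γ hγ => wE_low (by have := A.hm; unfold bigJ at hβ; omega)) (fun γ hγ => wE_anti hγ) α d e
    rw [← hp, ← hq] at i3
    have hb0 : 0 < b := by linarith
    have e1 : ∀ d : 𝕄 → ℂ, ((t :: L).map fun t => t.ev α d).sum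
        = t.ev α d + (L.map fun t => t.ev α d).sum := fun d => by simp
    rw [e1, e1, add_sub_add_comm, add_mul]
    refine le_trans ?_ (add_le_add (i3.trans i2) i1)
    rw [← mul_add, ← mul_add]
    gcongr
    exact norm_add_le _ _

lemma IsWeakDeriv.sub {u v g h : Sp N → ℂ} (H : IsWeakDeriv β u g)
    (H' : IsWeakDeriv β v h) : IsWeakDeriv β (fun x => u x - v x) (fun x => g x - h x) := by
  refine ⟨H.1.sub H'.1, H.2.1.sub H'.2.1, fun φ h1 h2 => ?_⟩
  have ht : IsTest φ := ⟨h1, h2⟩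
  simp only [smul_sub]
  rw [integral_sub ((ht.multiD β).integrable_smul H.1) ((ht.multiD β).integrable_smul H'.1),
    integral_sub (ht.integrable_smul H.2.1) (ht.integrable_smul H'.2.1), smul_sub, H.2.2 φ h1 h2,
    H'.2.2 φ h1 h2]

lemma Reg.ne_zero {A : Adm N k m n} {R c : ℝ} (hc : 0 < c) {f : 𝕏} (hf : f ∈ Reg A R c)
    (x : Sp N) : jetX A f 0 x ≠ 0 := fun h => by
  have := hf.2 x
  unfold fnX at this
  rw [h, norm_zero, mul_zero] at this
  linarith

lemma continuous_powNL {α : ℝ} (hα : 0 < α) {u : Sp N → ℂ} (hu : Continuous u) : Continuous (powNL α u) :=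
  (continuous_ofReal.comp (hu.norm.rpow_const fun _ => Or.inr hα.le)).mul hu

set_option maxHeartbeats 1000000 in
/-- Lipschitz continuity of the nonlinearity in `𝓢`. -/
lemma exists_sJet_powNL_sub {α : ℝ} (hα : alphaMin N ≤ α) (R : ℝ) {c : ℝ}
    (hc : 0 < c) : ∃ M ≥ 0, ∀ f ∈ Reg A R c, ∀ g ∈ Reg A R c, ∃ d, SJet k m n d (M * ‖f - g‖) ∧
      d 0 = fun x => powNL α (fnX A f) x - powNL α (fnX A g) x := by
  choose! L hL hD using exists_terms A
  have hR1 : 1 ≤ max R 1 := le_max_right _ _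
  choose! K hK0 hK using fun (β : 𝕄) (hβ : order β ≤ J) => exists_sum_lipschitz A (hL β hβ) hβ α hc hR1
  set Kt : ℝ := ∑ β ∈ (finite_order_le (N := N) J).toFinset, K β with hKt
  have hKt0 : 0 ≤ Kt := sum_nonneg fun β hβ => hK0 β (by simpa using hβ)
  have hKle : ∀ β, order β ≤ J → K β ≤ Kt := fun β hβ =>
    single_le_sum (f := K) (fun β hβ => hK0 β (by simpa using hβ)) (by simpa using hβ)
  set r : Sp N → ℝ := fun x => bracket x ^ (-(n * α)) with hr
  have hrL : MemLp r 2 := memLp_bracket_rpow (A.half_lt hα)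
  set s := highIdx N k m n
  obtain ⟨κ, hκ⟩ : ∃ κ : ℝ, κ = s.card := ⟨_, rfl⟩
  have hκ0 : 0 ≤ κ := hκ ▸ cast_nonneg _
  have hα0 := (alphaMin_pos A).trans_le hα
  set R' := max R 1
  set M : ℝ := Kt * (1 + (eLpNorm r 2 volume).toReal + κ * (2 * R' + 1)) with hM
  have hM0 : 0 ≤ M := by positivity
  refine ⟨M, hM0, fun f hf g hg => ?_⟩
  have Hf : SJet k m n (jetX A f) R' := (sJet_jetX A f).mono (hf.1.trans (le_max_left R 1))
  have Hg : SJet k m n (jetX A g) R' := (sJet_jetX A g).mono (hg.1.trans (le_max_left R 1))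
  have H0 := sJet_jetX A (f - g)
  have hδ : 0 ≤ ‖f - g‖ := norm_nonneg _
  generalize ‖f - g‖ = δ at *
  clear_value r
  have hs : ∀ γ, γ ∈ s ↔ 2 * m + 1 ≤ order γ ∧ order γ ≤ J := fun γ => mem_highIdx
  clear_value s M R'
  have hcont : Continuous fun x => powNL α (fnX A f) x - powNL α (fnX A g) x :=
    (continuous_powNL hα0 (jetX_continuous A f (order_zero_le _))).sub
      (continuous_powNL hα0 (jetX_continuous A g (order_zero_le _)))
  refine exists_sJet_of_isWeakDeriv A (mul_nonneg hM0 hδ) hcont fun β hβ => ?_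
  have Wf := hD β hβ α _ _ Hf (Reg.ne_zero hc hf)
  have Wg := hD β hβ α _ _ Hg (Reg.ne_zero hc hg)
  refine ⟨_, Wf.sub Wg, fun hlo => of_forall fun x => ?_, fun hhi => ?_⟩
  all_goals
    have hpt := fun x : Sp N => hK β hβ (bracket x) (fun γ => jetX A f γ x) (fun γ => jetX A g γ x)
      (fun γ => (bracket x ^ wE k m n γ) • jetX A f γ x) (fun γ => (bracket x ^ wE k m n γ) • jetX A g γ x)
      δ
    have hc' : ∀ h ∈ Reg A R c, ∀ x, c ≤ ‖(bracket x ^ wE k m n (0 : 𝕄)) • jetX A h 0 x‖ :=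
      fun h hh x => by
        rw [norm_wsmul, wE_low (by rw [order_zero]; omega)]; exact hh.2 x
    have hlow : ∀ x, ∀ γ : 𝕄, order γ ≤ 2 * m →
        ‖(bracket x ^ wE k m n γ) • jetX A f γ x‖ ≤ R' ∧ ‖(bracket x ^ wE k m n γ) • jetX A g γ x‖ ≤ R' ∧
        ‖(bracket x ^ wE k m n γ) • jetX A f γ x - (bracket x ^ wE k m n γ) • jetX A g γ x‖ ≤ δ :=
      fun x γ hγ => by
        rw [← smul_sub, ← jetX_sub A f g (by omega), norm_wsmul, norm_wsmul, norm_wsmul, wE_low hγ]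
        exact ⟨Hf.low γ hγ x, Hg.low γ hγ x, H0.low γ hγ x⟩
  · have h1 := hpt x 0 0 (one_le_bracket x) rfl rfl (hc' f hf x) (hc' g hg x) (hlow x) le_rfl le_rfl
      (fun γ _ _ => by omega)
    rw [wE_low hlo] at h1
    have h2 : 1 ≤ bracket x ^ (n * α) := Real.one_le_rpow (one_le_bracket x) (by positivity)
    refine ((le_mul_of_one_le_left (by have := bracket_pos x; positivity) h2).trans h1).trans ?_
    rw [add_zero, add_zero, mul_one]
    rw [hM]
    refine mul_le_mul_of_nonneg_right ((hKle β hβ).trans (le_mul_of_one_le_right hKt0 ?_)) hδ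
    have : 0 ≤ (eLpNorm r 2 volume).toReal + κ * (2 * R' + 1) := by positivity
    linarith
  · set z : (𝕄) × Fin 3 → Sp N → ℂ := fun i x => (bracket x ^ wt k m n (order i.1)) •
      (![fun x => (δ : ℂ) * jetX A f i.1 x, fun x => (δ : ℂ) * jetX A g i.1 x, jetX A (f - g) i.1] i.2) x with hz
    have hzb : ∀ i ∈ s ×ˢ (Finset.univ : Finset (Fin 3)), AEStronglyMeasurable (z i) ∧
        eLpNorm (z i) 2 ≤ ofReal (![δ * R', δ * R', δ] i.2) := by
      rintro ⟨γ, j⟩ hi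
      obtain ⟨h1, h2⟩ := (hs _).1 (Finset.mem_product.1 hi).1
      have Hf' := Hf.const_mul (δ : ℂ)
      have Hg' := Hg.const_mul (δ : ℂ)
      rw [norm_real, norm_of_nonneg hδ] at Hf' Hg'
      fin_cases j
      · exact ⟨Hf'.aesm_smul h2 _, Hf'.high γ h1 h2⟩
      · exact ⟨Hg'.aesm_smul h2 _, Hg'.high γ h1 h2⟩
      · exact ⟨H0.aesm_smul h2 _, H0.high γ h1 h2⟩
    have hae : ∀ᵐ x, ∀ γ ∈ s, jetX A (f - g) γ x = jetX A f γ x - jetX A g γ x :=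
      (Finset.eventually_all s).2 fun γ hγ => jetX_sub_ae A f g ((hs _).1 hγ).2
    have hzae : ∀ᵐ x, bracket x ^ wt k m n (order β) * ‖((L β).map fun t => t.ev α fun γ => jetX A f γ x).sum
        - ((L β).map fun t => t.ev α fun γ => jetX A g γ x).sum‖ ≤ 0 * ‖(0 : ℂ)‖ + Kt * δ * r x
          + Kt * ∑ i ∈ s ×ˢ (Finset.univ : Finset (Fin 3)), ‖z i x‖ := by
      filter_upwards [hae] with x hx
      have hzs : ∑ i ∈ s ×ˢ (Finset.univ : Finset (Fin 3)), ‖z i x‖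
          = δ * (∑ γ ∈ s, (‖(bracket x ^ wE k m n γ) • jetX A f γ x‖ + ‖(bracket x ^ wE k m n γ) • jetX A g γ x‖))
            + ∑ γ ∈ s, ‖(bracket x ^ wE k m n γ) • jetX A f γ x - (bracket x ^ wE k m n γ) • jetX A g γ x‖ := by
        rw [sum_product, mul_sum, ← sum_add_distrib]
        refine sum_congr rfl fun γ hγ => ?_
        rw [Fin.sum_univ_three]
        simp only [hz, Matrix.cons_val, norm_smul, norm_mul, norm_real, ← smul_sub,
          ← hx γ hγ, wE_high ((hs _).1 hγ).1, norm_of_nonneg hδ]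
        ring
      have hsum0 : ∀ h : 𝕄 → ℝ, (∀ γ, 0 ≤ h γ) → ∀ γ ∈ s, h γ ≤ ∑ γ ∈ s, h γ :=
        fun h hh γ hγ => single_le_sum (f := h) (fun γ _ => hh γ) hγ
      have h1 := hpt x _ _ (one_le_bracket x) rfl rfl (hc' f hf x) (hc' g hg x) (hlow x)
        (sum_nonneg fun γ (_ : γ ∈ s) => add_nonneg (norm_nonneg ((bracket x ^ wE k m n γ) • jetX A f γ x))
          (norm_nonneg ((bracket x ^ wE k m n γ) • jetX A g γ x)))
        (sum_nonneg fun γ (_ : γ ∈ s) => norm_nonneg ((bracket x ^ wE k m n γ) • jetX A f γ x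
          - (bracket x ^ wE k m n γ) • jetX A g γ x))
        (fun γ h1 h2 => by
          have hγ : γ ∈ s := (hs _).2 ⟨h1, h2.trans hβ⟩
          have := hsum0 (fun γ => ‖(bracket x ^ wE k m n γ) • jetX A f γ x‖
              + ‖(bracket x ^ wE k m n γ) • jetX A g γ x‖) (fun γ => by positivity) γ hγ
          refine ⟨le_trans ?_ this, le_trans ?_ this, hsum0 (fun γ =>
            ‖(bracket x ^ wE k m n γ) • jetX A f γ x - (bracket x ^ wE k m n γ) • jetX A g γ x‖)
            (fun γ => norm_nonneg _) γ hγ⟩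
          · exact le_add_of_nonneg_left (norm_nonneg _)
          · exact le_add_of_nonneg_right (norm_nonneg _))
      rw [wE_high hhi] at h1
      have hbp : 0 < bracket x ^ (n * α) := rpow_pos_of_pos (bracket_pos x) _
      have hr1 : r x = (bracket x ^ (n * α))⁻¹ := by rw [hr]; exact rpow_neg (bracket_pos x).le _
      have hr2 : r x ≤ 1 := by
        rw [hr1]; exact inv_le_one_of_one_le₀ (Real.one_le_rpow (one_le_bracket x) (by positivity))
      have hr3 : 0 < r x := by rw [hr1]; positivity
      rw [mul_comm, ← le_div_iff₀ hbp, div_eq_mul_inv, ← hr1] at h1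
      refine h1.trans ?_
      rw [hzs]
      set S := ∑ γ ∈ s, (‖(bracket x ^ wE k m n γ) • jetX A f γ x‖ + ‖(bracket x ^ wE k m n γ) • jetX A g γ x‖)
      set E := ∑ γ ∈ s, ‖(bracket x ^ wE k m n γ) • jetX A f γ x - (bracket x ^ wE k m n γ) • jetX A g γ x‖
      have hS0 : 0 ≤ S := sum_nonneg fun γ _ => by positivity
      have hE0 : 0 ≤ E := sum_nonneg fun γ _ => by positivity
      calc K β * (δ * (1 + S) + E) * r x ≤ Kt * (δ * (1 + S) + E) * r x := by
            gcongr; exact hKle β hβ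
        _ = Kt * (δ * r x + (δ * S + E) * r x) := by ring
        _ ≤ Kt * (δ * r x + (δ * S + E) * 1) := by gcongr
        _ = _ := by ring
    have h2 : eLpNorm (fun x => (bracket x ^ wt k m n (order β)) •
        (((L β).map fun t => t.ev α fun γ => jetX A f γ x).sum
          - ((L β).map fun t => t.ev α fun γ => jetX A g γ x).sum)) 2
        ≤ eLpNorm (fun x => Kt * δ * r x + Kt * ∑ i ∈ s ×ˢ (Finset.univ : Finset (Fin 3)), ‖z i x‖) 2 := by
      refine eLpNorm_mono_ae_real ?_
      filter_upwards [hzae] with x hx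
      rw [norm_wsmul]
      linarith
    have hr0 : ∀ x, 0 ≤ r x := fun x => by rw [hr]; exact rpow_nonneg (bracket_pos x).le _
    have h3 := eLpNorm_le_three (g := fun x => ((Kt * δ * r x
          + Kt * ∑ i ∈ s ×ˢ (Finset.univ : Finset (Fin 3)), ‖z i x‖ : ℝ) : ℂ)) (h := fun _ => (0 : ℂ))
      (r := r) (s ×ˢ (Finset.univ : Finset (Fin 3))) (z := z) (c₁ := 0) (c₂ := Kt * δ) (c₃ := Kt)
      le_rfl (by positivity) hKt0 aestronglyMeasurable_const hrL.1 (fun i hi => (hzb i hi).1) hr0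
      (fun x => by
        rw [norm_real, norm_of_nonneg]
        · simp
        · have := hr0 x
          positivity)
    have h4 : eLpNorm (fun x => Kt * δ * r x + Kt * ∑ i ∈ s ×ˢ (Finset.univ : Finset (Fin 3)), ‖z i x‖) 2
        = eLpNorm (fun x => ((Kt * δ * r x + Kt * ∑ i ∈ s ×ˢ (Finset.univ : Finset (Fin 3)), ‖z i x‖ : ℝ) : ℂ)) 2 :=
      eLpNorm_congr_norm_ae (of_forall fun x => (norm_real _).symm)
    have h5 : ∑ i ∈ s ×ˢ (Finset.univ : Finset (Fin 3)), eLpNorm (z i) 2 ≤ ofReal (κ * (δ * R' + δ * R' + δ)) := by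
      refine (sum_le_sum fun i hi => (hzb i hi).2).trans (le_of_eq ?_)
      rw [← ENNReal.ofReal_sum_of_nonneg, sum_product]
      · simp only [Fin.sum_univ_three, Matrix.cons_val, sum_const, nsmul_eq_mul, hκ]
      · rintro ⟨γ, j⟩ _
        fin_cases j <;> simp <;> positivity
    rw [← h4] at h3
    have h6 : 0 ≤ Kt * δ := by positivity
    have h7 : 0 ≤ κ * (δ * R' + δ * R' + δ) := by positivity
    have h8 : eLpNorm r 2 volume = ofReal (eLpNorm r 2 volume).toReal := (ofReal_toReal hrL.2.ne).symm
    have h9 : 0 ≤ (eLpNorm r 2 volume).toReal := toReal_nonneg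
    generalize (eLpNorm r 2 volume).toReal = ρ at *
    refine h2.trans (h3.trans ?_)
    rw [ofReal_zero, zero_mul, zero_add, h8]
    refine (add_le_add (le_of_eq (ofReal_mul h6).symm) ((mul_le_mul_right h5 _).trans
      (le_of_eq (ofReal_mul hKt0).symm))).trans ?_
    rw [← ofReal_add (mul_nonneg h6 h9) (mul_nonneg hKt0 h7)]
    refine ofReal_le_ofReal ?_
    rw [hM]
    linarith

open Classical in
/-- The nonlinearity `|u|^α u` on `XS`. -/
def nlX (α : ℝ) (f : 𝕏) : 𝕏 := if h : ∃ g, fnX A g = powNL α (fnX A f) then h.choose else 0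

lemma exists_powNL {α : ℝ} (hα : alphaMin N ≤ α) (R : ℝ) {c : ℝ} (hc : 0 < c) :
    ∃ M ≥ 0, ∀ f ∈ Reg A R c, fnX A (nlX A α f) = powNL α (fnX A f) ∧ ‖nlX A α f‖ ≤ M := by
  have hα0 := (alphaMin_pos A).trans_le hα
  obtain ⟨M, hM0, hM⟩ := exists_sJet_powNL_sub A hα R (half_pos hc)
  set θ : ℝ := (1 / 2 : ℝ) ^ α * (1 / 2) with hθ
  have hθ0 : 0 < θ := by positivity
  have hθ1 : θ < 1 := by
    have : (1 / 2 : ℝ) ^ α ≤ 1 := rpow_le_one (by norm_num) (by norm_num) hα0.le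
    linarith
  have hθ2 : 0 < 1 - θ := by linarith
  refine ⟨(1 - θ)⁻¹ * (M * |R|), by positivity, fun f hf => ?_⟩
  have h1 : f ∈ Reg A R (c / 2) := ⟨hf.1, fun x => (by linarith : c / 2 ≤ c).trans (hf.2 x)⟩
  have hg : ∀ x, fnX A (((1 / 2 : ℝ) : ℂ) • f) x = ((1 / 2 : ℝ) : ℂ) * fnX A f x := fun x => fnX_smul A _ f x
  have hgn : ‖((1 / 2 : ℝ) : ℂ) • f‖ = 1 / 2 * ‖f‖ := by
    rw [norm_smul, norm_real]; norm_num
  have h2 : ((1 / 2 : ℝ) : ℂ) • f ∈ Reg A R (c / 2) := by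
    refine ⟨by rw [hgn]; linarith [hf.1, norm_nonneg f], fun x => ?_⟩
    rw [hg, norm_mul, norm_real, norm_of_nonneg (by norm_num)]
    linarith [hf.2 x]
  obtain ⟨d, hd, hd0⟩ := hM f h1 _ h2
  have hd' : d 0 = fun x => ((1 - θ : ℝ) : ℂ) * powNL α (fnX A f) x := by
    rw [hd0]
    funext x
    unfold powNL
    rw [hg, norm_mul, norm_real, norm_of_nonneg (by norm_num : (0 : ℝ) ≤ 1 / 2),
      mul_rpow (by norm_num) (norm_nonneg _), hθ]
    push_cast
    ring
  have hd2 := hd.const_mul (((1 - θ : ℝ) : ℂ)⁻¹)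
  have e1 : (fun x => ((1 - θ : ℝ) : ℂ)⁻¹ * d 0 x) = powNL α (fnX A f) := by
    funext x
    rw [hd']
    simp only
    rw [inv_mul_cancel_left₀]
    exact_mod_cast hθ2.ne'
  obtain ⟨g, hg'⟩ := exists_XS_of_sJet A hd2
  have hex : ∃ g, fnX A g = powNL α (fnX A f) := ⟨g, hg'.trans e1⟩
  have h3 : fnX A (nlX A α f) = powNL α (fnX A f) := by
    unfold nlX; rw [dif_pos hex]; exact hex.choose_spec
  refine ⟨h3, (norm_le_of_sJet A hd2 (h3.trans e1.symm)).trans ?_⟩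
  rw [norm_inv, norm_real, norm_of_nonneg hθ2.le]
  have h4 : ‖f - ((1 / 2 : ℝ) : ℂ) • f‖ ≤ |R| := by
    have h5 := norm_sub_le f (((1 / 2 : ℝ) : ℂ) • f)
    have h6 : f - ((1 / 2 : ℝ) : ℂ) • f = ((1 / 2 : ℝ) : ℂ) • f := by
      rw [sub_eq_iff_eq_add, ← add_smul]
      norm_num
    rw [h6, hgn]
    linarith [hf.1, norm_nonneg f, le_abs_self R]
  gcongr

lemma fnX_nlX {α : ℝ} (hα : alphaMin N ≤ α) {f : 𝕏} {c : ℝ} (hc : 0 < c)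
    (h : ∀ x, c ≤ bracket x ^ n * ‖fnX A f x‖) : fnX A (nlX A α f) = powNL α (fnX A f) := by
  obtain ⟨M, -, hM⟩ := exists_powNL A hα ‖f‖ hc
  exact (hM f ⟨le_rfl, h⟩).1

lemma regLip_nlX {α : ℝ} (hα : alphaMin N ≤ α) : RegLip A (nlX A α) := by
  intro R c hc
  obtain ⟨M, hM0, hM⟩ := exists_powNL A hα R hc
  obtain ⟨M', hM0', hM'⟩ := exists_sJet_powNL_sub A hα R hc
  refine ⟨max M M', le_max_of_le_left hM0, fun f hf => ⟨(hM f hf).2.trans (le_max_left _ _), fun g hg => ?_⟩⟩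
  obtain ⟨d, hd, hd0⟩ := hM' f hf g hg
  refine (norm_le_of_sJet A hd ?_).trans (by gcongr; exact le_max_right _ _)
  rw [hd0]
  funext x
  rw [fnX_sub, (hM f hf).1, (hM g hg).1]

/-! ### The estimates of the nonlinearity -/

lemma exists_sum_bound {L : List (Term N)} (hL : ∀ t ∈ L, t.Good β) :
    ∃ M ≥ 0, ∀ α ∈ Icc (0 : ℝ) 2, ∀ (p : 𝕄 → ℂ) (D S : ℝ), p 0 ≠ 0 → 1 ≤ D →
      (∀ δ, 2 * order δ ≤ order β → ‖p δ‖ ≤ D * ‖p 0‖) → 0 ≤ S →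
      (∀ γ, 1 ≤ order γ → order γ < order β → ‖p γ‖ ≤ S) →
      ‖(L.map fun t => t.ev α p).sum‖ ≤ M * (‖p 0‖ ^ α * (‖p β‖ + D ^ (2 * order β) * S)) := by
  induction L with
  | nil => exact ⟨0, le_rfl, fun _ _ _ _ _ _ _ _ _ _ => by simp⟩
  | cons t L ih =>
    obtain ⟨M, hM, H⟩ := ih fun t ht => hL t (by simp [ht])
    obtain ⟨M', hM'⟩ := (hL t (by simp)).bdd
    refine ⟨M' + M, add_nonneg ((abs_nonneg _).trans (hM' 0 (by simp))) hM, fun α hα p D S h0 h1 h2 h3 h4 => ?_⟩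
    rw [List.map_cons, List.sum_cons, add_mul]
    refine (norm_add_le _ _).trans (add_le_add (((hL t (by simp)).norm_ev_le h0 h1 h2 h3 h4).trans
      (mul_le_mul_of_nonneg_right (hM' α hα) (by positivity))) (H α hα p D S h0 h1 h2 h3 h4))

namespace SJet

variable {d : (Fin N → ℕ) → Sp N → ℂ} {B : ℝ}

/-- The supremum bounds of derivatives of low order. -/
lemma exists_low_eq (H : SJet k m n d B) (h : order β ≤ 2 * m) :
    ∃ a ≥ 0, wnorm ∞ n β (d 0) = ofReal a ∧ ∀ x, bracket x ^ n * ‖d β x‖ ≤ a := by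
  have h1 : wnorm ∞ n β (d 0) ≠ ⊤ := ((H.wnorm_low h).trans_lt ofReal_lt_top).ne
  refine ⟨_, toReal_nonneg, (ofReal_toReal h1).symm, fun x => ?_⟩
  rw [← norm_wsmul]
  refine (eLpNorm_top_le_iff (continuous_bracket_smul (H.cont β (by omega)) n) toReal_nonneg).1 ?_ x
  rw [ofReal_toReal h1, H.jet.wnorm_eq _ _ _ (by unfold bigJ; omega)]

lemma exists_norm1_eq (H : SJet k m n d B) {l : ℕ} (h : l ≤ 2 * m) : ∃ a ≥ 0, norm1 n l (d 0) = ofReal a ∧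
      ∀ β, order β ≤ l → ∀ x, bracket x ^ n * ‖d β x‖ ≤ a := by
  have h1 : norm1 n l (d 0) ≠ ⊤ := ((iSup₂_le fun β hβ => H.wnorm_low (hβ.trans h)).trans_lt ofReal_lt_top).ne
  refine ⟨_, toReal_nonneg, (ofReal_toReal h1).symm, fun β hβ x => ?_⟩
  obtain ⟨a, ha, ha1, ha2⟩ := H.exists_low_eq (hβ.trans h)
  refine (ha2 x).trans ?_
  rw [← ofReal_le_iff_le_toReal h1, ← ha1]
  exact le_iSup₂_of_le β hβ le_rfl

lemma exists_sup_eq (H : SJet k m n d B) : ∃ V ≥ 0, eLpNorm (d 0) ∞ = ofReal V ∧ ∀ x, ‖d 0 x‖ ≤ V := by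
  have hc := H.cont 0 (order_zero_le _)
  have h1 : eLpNorm (d 0) ∞ ≤ ofReal B := (eLpNorm_top_le_iff hc H.nonneg).2
    fun x => (le_mul_of_one_le_left (norm_nonneg _) (one_le_pow₀ (one_le_bracket x))).trans
      (H.low 0 (order_zero_le _) x)
  have h2 := (h1.trans_lt ofReal_lt_top).ne
  refine ⟨_, toReal_nonneg, (ofReal_toReal h2).symm, ?_⟩
  exact (eLpNorm_top_le_iff hc toReal_nonneg).1 (ofReal_toReal h2).symm.le

end SJet

lemma wnorm_top_le {u g : Sp N → ℂ} (h : IsWeakDeriv β u g) {c : ℝ}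
    (hc : ∀ x, bracket x ^ n * ‖g x‖ ≤ c) : wnorm ∞ n β u ≤ ofReal c := by
  refine (iInf₂_le g h).trans ?_
  rw [eLpNorm_exponent_top]
  refine eLpNormEssSup_le_of_ae_bound (of_forall fun x => ?_)
  rw [norm_wsmul]
  exact hc x

lemma ENNReal_lower {v : Sp N → ℂ} {η : ℝ} (hη : 1 ≤ η) (h : 1 ≤ ofReal η * lowerS n v)
    (x : Sp N) : 1 ≤ η * (bracket x ^ n * ‖v x‖) := by
  rw [← one_le_ofReal, ofReal_mul (by linarith)]
  exact h.trans (mul_le_mul_right (iInf_le _ x) _)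

lemma alpha_mem (A : Adm N k m n) {α : ℝ} (hα : α ∈ 𝕀) : α ∈ Icc (0 : ℝ) 2 := by
  have h0 : (1 : ℝ) ≤ N := by exact_mod_cast A.one_le
  refine ⟨(alphaMin_pos A).le.trans hα.1, hα.2.trans ?_⟩
  rw [div_le_iff₀ (by linarith)]
  linarith

/-- The constants in the estimates of one derivative of the nonlinearity. -/
lemma exists_nonlinear_bounds (A : Adm N k m n) (hβ : order β ≤ J) :
    ∃ C : ℝ, 1 ≤ C ∧ ∀ α ∈ 𝕀, ∀ v : Sp N → ℂ, MemS N k m n v → ∀ η : ℝ, 1 ≤ η → 1 ≤ ofReal η * lowerS n v →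
      (order β ≤ 1 → wnorm ∞ n β (powNL α v) ≤ ofReal C * eLpNorm v ∞ ^ α * wnorm ∞ n β v) ∧
      (2 ≤ order β → order β ≤ 2 * m → wnorm ∞ n β (powNL α v) ≤ ofReal C * eLpNorm v ∞ ^ α * wnorm ∞ n β v
          + ofReal C * eLpNorm v ∞ ^ α * (ofReal η * norm1 n (order β - 1) v) ^ (2 * order β)
            * norm1 n (order β - 1) v) ∧
      (2 * m + 1 ≤ order β → ∀ (w : ℕ) (X : ℝ≥0∞), w ≤ n → (∀ γ : 𝕄, 2 * m + 1 ≤ order γ →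
          order γ < order β → wnorm 2 w γ v ≤ X) → wnorm 2 w β (powNL α v) ≤
          ofReal C * eLpNorm v ∞ ^ α * wnorm 2 w β v
          + ofReal C * (ofReal η * norm1 n (2 * m) v) ^ (2 * (J : ℝ) + α) * norm1 n (2 * m) v
          + ofReal C * eLpNorm v ∞ ^ α * (ofReal η * norm1 n (2 * m) v) ^ (2 * J) * X) := by
  obtain ⟨L, hL, hD⟩ := exists_terms A β hβ
  obtain ⟨M, hM0, hM⟩ := exists_sum_bound hL
  set r : Sp N → ℝ := fun x => bracket x ^ (-(n * alphaMin N)) with hr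
  have hrL : MemLp r 2 := memLp_bracket_rpow (A.half_lt le_rfl)
  obtain ⟨ρ, hρ⟩ : ∃ ρ : ℝ, ρ = (eLpNorm r 2 volume).toReal := ⟨_, rfl⟩
  have hρ0 : 0 ≤ ρ := hρ ▸ toReal_nonneg
  have hρ' : eLpNorm r 2 = ofReal ρ := by rw [hρ, ofReal_toReal hrL.2.ne]
  obtain ⟨κ, hκ⟩ : ∃ κ : ℝ, κ = (highIdx N k m n).card := ⟨_, rfl⟩
  have hκ0 : 0 ≤ κ := hκ ▸ cast_nonneg _
  have hC1 : M ≤ 1 + M * (1 + ρ + κ) := by nlinarith [mul_nonneg hM0 hρ0, mul_nonneg hM0 hκ0]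
  have hC2 : M * ρ ≤ 1 + M * (1 + ρ + κ) := by nlinarith [mul_nonneg hM0 hρ0, mul_nonneg hM0 hκ0]
  have hC3 : M * κ ≤ 1 + M * (1 + ρ + κ) := by nlinarith [mul_nonneg hM0 hρ0, mul_nonneg hM0 hκ0]
  have hC4 : 1 ≤ 1 + M * (1 + ρ + κ) := by nlinarith [mul_nonneg hM0 hρ0, mul_nonneg hM0 hκ0]
  generalize 1 + M * (1 + ρ + κ) = C at *
  refine ⟨C, hC4, fun α hα v hv η hη hlow => ?_⟩
  have hα2 := alpha_mem A hα
  obtain ⟨d, H, rfl⟩ := exists_sJet A hv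
  have hx1 := ENNReal_lower hη hlow
  have hne : ∀ x, d 0 x ≠ 0 := fun x hx => by
    have := hx1 x
    rw [hx, norm_zero, mul_zero, mul_zero] at this
    linarith
  have hW := hD α d _ H hne
  obtain ⟨V, hV0, hV, hVx⟩ := H.exists_sup_eq
  have hVα : ∀ x, ‖d 0 x‖ ^ α ≤ V ^ α := fun x => rpow_le_rpow (norm_nonneg _) (hVx x) hα2.1
  have hVE : eLpNorm (d 0) ∞ ^ α = ofReal (V ^ α) := by rw [hV, ofReal_rpow_of_nonneg hV0 hα2.1]
  have hVα0 : 0 ≤ V ^ α := rpow_nonneg hV0 _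
  have hC0 : 0 ≤ C := by linarith
  have hb : ∀ x : Sp N, 0 < bracket x ^ n := fun x => pow_pos (bracket_pos x) n
  have hratio : ∀ (b : ℝ), 0 ≤ b → ∀ γ x, bracket x ^ n * ‖d γ x‖ ≤ b → ‖d γ x‖ ≤ η * b * ‖d 0 x‖ := by
    intro b hb0 γ x h
    refine le_of_mul_le_mul_left ?_ (hb x)
    calc bracket x ^ n * ‖d γ x‖ ≤ b * 1 := by rwa [mul_one]
      _ ≤ b * (η * (bracket x ^ n * ‖d 0 x‖)) := mul_le_mul_of_nonneg_left (hx1 x) hb0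
      _ = _ := by ring
  rw [hVE]
  refine ⟨fun h1 => ?_, fun h1 h2 => ?_, fun h1 w X hw hX => ?_⟩
  · obtain ⟨a, ha0, ha, hax⟩ := H.exists_low_eq (β := β) (by have := A.two_le_n; have := A.hm; omega)
    rw [ha, ← ofReal_mul hC0, ← ofReal_mul (mul_nonneg hC0 hVα0)]
    refine wnorm_top_le hW fun x => ?_
    have h3 := hM α hα2 (fun γ => d γ x) 1 0 (hne x) le_rfl (fun δ hδ => by
      rw [order_eq_zero.1 (by omega : order δ = 0), one_mul]) le_rfl (fun γ _ _ => by omega)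
    rw [mul_zero, add_zero] at h3
    have hv1 := hVα x
    have hv2 : 0 ≤ ‖d 0 x‖ ^ α := by positivity
    generalize ‖d 0 x‖ ^ α = y at *
    calc _ ≤ bracket x ^ n * (M * (y * ‖d β x‖)) := by have := hb x; gcongr
      _ = M * y * (bracket x ^ n * ‖d β x‖) := by ring
      _ ≤ C * V ^ α * a := by
        have := hb x
        gcongr
        exact hax x
  · obtain ⟨a, ha0, ha, hax⟩ := H.exists_low_eq h2
    obtain ⟨b, hb0, hb1, hbx⟩ := H.exists_norm1_eq (l := order β - 1) (by omega)
    have hD1 : 1 ≤ η * b := (hx1 0).trans (mul_le_mul_of_nonneg_left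
      (hbx 0 (by rw [order_zero]; omega) 0) (by linarith))
    rw [ha, hb1, ← ofReal_mul (p := η) (by linarith), ← ofReal_pow (by linarith),
      ← ofReal_mul hC0, ← ofReal_mul (mul_nonneg hC0 hVα0),
      ← ofReal_mul (mul_nonneg hC0 hVα0), ← ofReal_mul (by positivity),
      ← ofReal_add (by positivity) (by positivity)]
    refine wnorm_top_le hW fun x => ?_
    have h3 := hM α hα2 (fun γ => d γ x) (η * b) ((bracket x ^ n)⁻¹ * b) (hne x) hD1 (fun δ hδ =>
      hratio b hb0 δ x (hbx δ (by omega) x)) (by have := hb x; positivity) (fun γ _ h => by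
        rw [← div_eq_inv_mul, le_div_iff₀ (hb x), mul_comm]; exact hbx γ (by omega) x)
    have hv1 := hVα x
    have hv2 : 0 ≤ ‖d 0 x‖ ^ α := by positivity
    generalize ‖d 0 x‖ ^ α = y at *
    calc _ ≤ bracket x ^ n * (M * (y * (‖d β x‖ + (η * b) ^ (2 * order β)
          * ((bracket x ^ n)⁻¹ * b)))) := by have := hb x; gcongr
      _ = M * y * (bracket x ^ n * ‖d β x‖ + (η * b) ^ (2 * order β) * b) := by
        have := (hb x).ne'; field_simp
      _ ≤ C * V ^ α * (a + (η * b) ^ (2 * order β) * b) := by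
        have := hb x
        gcongr
        exact hax x
      _ = _ := by ring
  · obtain ⟨b, hb0, hb1, hbx⟩ := H.exists_norm1_eq (l := 2 * m) le_rfl
    have hD1 : 1 ≤ η * b := (hx1 0).trans (mul_le_mul_of_nonneg_left
      (hbx 0 (by rw [order_zero]; omega) 0) (by linarith))
    have hbA : b ≤ η * b := le_mul_of_one_le_left hb0 hη
    have hA0 : 0 ≤ η * b := by linarith
    set s := (highIdx N k m n).filter fun γ => order γ < order β with hs
    have hsmem : ∀ γ ∈ s, 2 * m + 1 ≤ order γ ∧ order γ ≤ J ∧ order γ < order β := fun γ hγ => by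
      rw [hs, mem_filter, mem_highIdx] at hγ
      exact ⟨hγ.1.1, hγ.1.2, hγ.2⟩
    have hscard : (s.card : ℝ≥0∞) ≤ ofReal κ := by
      rw [hκ, ofReal_natCast]
      exact_mod_cast Finset.card_filter_le _ _
    have hpt : ∀ x, ‖bracket x ^ w • (L.map fun t => t.ev α fun γ => d γ x).sum‖
        ≤ (M * V ^ α) * ‖bracket x ^ w • d β x‖ + (M * (η * b) ^ (2 * (J : ℝ) + α) * b) * r x
          + (M * V ^ α * (η * b) ^ (2 * J)) * ∑ γ ∈ s, ‖bracket x ^ w • d γ x‖ := by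
      intro x
      have hbx0 := hb x
      have hbw : 0 < bracket x ^ w := pow_pos (bracket_pos x) w
      have hinv : ∀ γ, order γ ≤ 2 * m → ‖d γ x‖ ≤ (bracket x ^ n)⁻¹ * b := fun γ hγ => by
        rw [← div_eq_inv_mul, le_div_iff₀ (hb x), mul_comm]; exact hbx γ hγ x
      have h3 := hM α hα2 (fun γ => d γ x) (η * b) ((bracket x ^ n)⁻¹ * b + ∑ γ ∈ s, ‖d γ x‖)
        (hne x) hD1 (fun δ hδ => hratio b hb0 δ x (hbx δ (by have := A.hm; unfold bigJ at hβ; omega) x))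
        (by positivity) (fun γ _ h => by
          rcases le_or_gt (order γ) (2 * m) with h5 | h5
          · exact (hinv γ h5).trans (le_add_of_nonneg_right (by positivity))
          · refine (single_le_sum (f := fun γ => ‖d γ x‖) (fun _ _ => norm_nonneg _) ?_).trans
              (le_add_of_nonneg_left (by positivity))
            rw [hs, mem_filter, mem_highIdx]
            exact ⟨⟨h5, by omega⟩, h⟩)
      have h4 : (η * b) ^ (2 * order β) ≤ (η * b) ^ (2 * J) := pow_le_pow_right₀ hD1 (by omega)
      have h5 : ‖d 0 x‖ ^ α ≤ (η * b) ^ α * r x := by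
        have h6 : ‖d 0 x‖ ≤ (bracket x ^ n)⁻¹ * (η * b) := (hinv 0 (order_zero_le _)).trans (by gcongr)
        refine (rpow_le_rpow (norm_nonneg _) h6 hα2.1).trans ?_
        rw [mul_rpow (by positivity) hA0, mul_comm]
        refine mul_le_mul_of_nonneg_left ?_ (by positivity)
        rw [← rpow_natCast, ← rpow_neg (bracket_pos x).le, ← rpow_mul (bracket_pos x).le]
        refine Real.rpow_le_rpow_of_exponent_le (one_le_bracket x) ?_
        have := hα.1
        rw [neg_mul, neg_le_neg_iff]
        gcongr
      have h7 : (η * b) ^ (2 * (J : ℝ) + α) = (η * b) ^ (2 * J) * (η * b) ^ α := by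
        rw [rpow_add (by linarith), ← rpow_natCast]; push_cast; rfl
      have h8 : bracket x ^ w * (bracket x ^ n)⁻¹ ≤ 1 := by
        rw [← div_eq_mul_inv, div_le_one hbx0]
        exact pow_le_pow_right₀ (one_le_bracket x) hw
      have h9 : ∑ γ ∈ s, ‖bracket x ^ w • d γ x‖ = bracket x ^ w * ∑ γ ∈ s, ‖d γ x‖ := by
        rw [mul_sum]
        exact sum_congr rfl fun γ _ => norm_wsmul _ _ _
      rw [norm_wsmul, norm_wsmul, h9, h7]
      set Q := (η * b) ^ (2 * J)
      set Z := ∑ γ ∈ s, ‖d γ x‖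
      have hZ0 : 0 ≤ Z := by positivity
      have hQ0 : 0 ≤ Q := by positivity
      have hv1 := hVα x
      have hv2 : 0 ≤ ‖d 0 x‖ ^ α := by positivity
      generalize ‖d 0 x‖ ^ α = y at *
      calc _ ≤ bracket x ^ w * (M * (y * (‖d β x‖ + Q * ((bracket x ^ n)⁻¹ * b + Z)))) := by
            gcongr
            exact h3.trans (by gcongr)
        _ = M * y * (bracket x ^ w * ‖d β x‖) + M * Q * b * (y * (bracket x ^ w * (bracket x ^ n)⁻¹))
            + M * y * Q * (bracket x ^ w * Z) := by ring
        _ ≤ M * V ^ α * (bracket x ^ w * ‖d β x‖) + M * Q * b * ((η * b) ^ α * r x * 1)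
            + M * V ^ α * Q * (bracket x ^ w * Z) := by
          have h11 : 0 ≤ (η * b) ^ α * r x := le_trans (by positivity) h5
          gcongr
        _ = _ := by ring
    have hm1 : ∀ γ, order γ ≤ J → AEStronglyMeasurable (fun x => bracket x ^ w • d γ x)
      := fun γ hγ => H.aesm_smul hγ w
    have h3 := eLpNorm_le_three s (z := fun γ x => bracket x ^ w • d γ x) (by positivity)
      (by positivity) (by positivity) (hm1 β hβ) hrL.1 (fun γ hγ => hm1 γ (hsmem γ hγ).2.1)
      (fun x => rpow_nonneg (bracket_pos x).le _) hpt
    refine (iInf₂_le _ hW).trans (h3.trans ?_)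
    rw [← H.jet.wnorm_eq 2 w β hβ]
    have hZ : ∑ γ ∈ s, eLpNorm (fun x => bracket x ^ w • d γ x) 2 ≤ ofReal κ * X := by
      refine (sum_le_card_nsmul s _ X fun γ hγ => ?_).trans ?_
      · rw [← H.jet.wnorm_eq 2 w γ (hsmem γ hγ).2.1]
        exact hX γ (hsmem γ hγ).1 (hsmem γ hγ).2.2
      · rw [nsmul_eq_mul]; gcongr
    rw [hb1, ← ofReal_mul (p := η) (by linarith), ← ofReal_pow hA0,
      ofReal_rpow_of_nonneg hA0 (by have := hα2.1; positivity)]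
    refine add_le_add (add_le_add ?_ ?_) ?_
    · rw [← ofReal_mul hC0]
      gcongr
    · rw [hρ', ← ofReal_mul (by positivity), ← ofReal_mul hC0, ← ofReal_mul (by positivity)]
      refine ofReal_le_ofReal ?_
      calc _ = (M * ρ) * (η * b) ^ (2 * (J : ℝ) + α) * b := by ring
        _ ≤ _ := by gcongr
    · refine (mul_le_mul_right hZ _).trans ?_
      rw [← mul_assoc, ← ofReal_mul (by positivity), ← ofReal_mul hC0, ← ofReal_mul (by positivity)]
      refine mul_le_mul_left (ofReal_le_ofReal ?_) X
      calc _ = (M * κ) * (V ^ α * (η * b) ^ (2 * J)) := by ring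
        _ ≤ C * (V ^ α * (η * b) ^ (2 * J)) := mul_le_mul_of_nonneg_right hC3 (by positivity)
        _ = _ := by ring

lemma exists_isNonlinearConst (A : Adm N k m n) : ∃ C : ℝ, 1 ≤ C ∧ IsNonlinearConst N k m n C := by
  choose! C hC1 hC using fun (β : 𝕄) (hβ : order β ≤ J) => exists_nonlinear_bounds A hβ
  set Ct : ℝ := ∑ β ∈ (finite_order_le (N := N) J).toFinset, C β with hCt
  have hle : ∀ β, order β ≤ J → ofReal (C β) ≤ ofReal Ct := fun β hβ =>
    ofReal_le_ofReal (single_le_sum (f := C)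
      (fun β hβ => by linarith [hC1 β (by simpa using hβ)]) (by simpa using hβ))
  have h1 : 1 ≤ Ct := by
    rw [← one_le_ofReal]
    exact (one_le_ofReal.2 (hC1 0 (order_zero_le _))).trans (hle 0 (order_zero_le _))
  refine ⟨Ct, h1, fun α hα v hv η hη hlow => ⟨fun β hβ => ?_, fun β h2 h3 => ?_, fun β h2 h3 => ?_,
    fun β h2 h3 => ?_⟩⟩
  · have hβ' : order β ≤ J := by unfold bigJ; omega
    refine ((hC β hβ' α hα v hv η hη hlow).1 hβ).trans ?_
    have := hle β hβ'
    gcongr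
  · have hβ' : order β ≤ J := by unfold bigJ; omega
    refine ((hC β hβ' α hα v hv η hη hlow).2.1 h2 h3).trans ?_
    have := hle β hβ'
    gcongr
  · have hβ' : order β ≤ J := by unfold bigJ; omega
    refine ((hC β hβ' α hα v hv η hη hlow).2.2 h2 n (norm2 m n (order β - 1) v) le_rfl fun γ h4 h5 => ?_).trans ?_
    · exact le_iSup₂_of_le (f := fun (β : 𝕄) (_ : 2 * m + 1 ≤ order β ∧ order β ≤ _) =>
        wnorm 2 n β v) γ ⟨h4, by omega⟩ le_rfl
    · have := hle β hβ'
      gcongr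
  · refine ((hC β h3 α hα v hv η hη hlow).2.2 (by omega) (J - order β)
      (norm2 m n (2 * m + 2 + k) v + norm3 k m n (order β - 1) v)
      (by unfold bigJ; omega) fun γ h4 h5 => ?_).trans ?_
    · rcases le_or_gt (order γ) (2 * m + 2 + k) with h6 | h6
      · refine le_trans ((wnorm_mono (b := n) (by unfold bigJ; omega) _ _).trans ?_) le_self_add
        exact le_iSup₂_of_le (f := fun (β : 𝕄) (_ : 2 * m + 1 ≤ order β ∧ order β ≤ _) =>
          wnorm 2 n β v) γ ⟨h4, h6⟩ le_rfl
      · refine le_trans ((wnorm_mono (b := J - (order β - 1)) (by omega) _ _).trans ?_) le_add_self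
        exact le_iSup₂_of_le (f := fun (β : 𝕄) (_ : 2 * m + 3 + k ≤ order β ∧ order β ≤ _) =>
          wnorm 2 _ β v) γ ⟨by omega, by omega⟩ le_rfl
    · have := hle β h3
      gcongr

/-! ### Weights -/

lemma contDiff_bracket {l : WithTop ℕ∞} : ContDiff ℝ l (bracket : Sp N → ℝ) := by
  unfold bracket
  exact (contDiff_const.add (contDiff_norm_sq ℝ)).sqrt fun x => by positivity

lemma fderiv_bracket (x : Sp N) (i : Fin N) : fderiv ℝ bracket x (stdVec i) = x i / bracket x := by
  have h1 : HasFDerivAt (fun x : Sp N => 1 + ‖x‖ ^ 2) (2 • innerSL ℝ x) x :=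
    (hasStrictFDerivAt_norm_sq x).hasFDerivAt.const_add 1
  have h2 := h1.sqrt (by positivity)
  have h3 : fderiv ℝ bracket x = _ := h2.fderiv
  rw [h3]
  change (1 / (2 * bracket x)) • ((2 : ℕ) • innerSL ℝ x (stdVec i)) = _
  rw [innerSL_apply_apply, inner_stdVec, nsmul_eq_mul, smul_eq_mul]
  have := (bracket_pos x).ne'
  push_cast
  field_simp

/-- The derivative of `⟨x⟩`. -/
def dirB (i : Fin N) (x : Sp N) : ℝ := x i / bracket x

lemma contDiff_dirB {l : WithTop ℕ∞} (i : Fin N) : ContDiff ℝ l (dirB i) :=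
  (contDiff_piLp_apply (p := 2) (i := i)).div contDiff_bracket fun x => (bracket_pos x).ne'

lemma sq_dirB_le (i : Fin N) (x : Sp N) : dirB i x ^ 2 ≤ 1 := by
  rw [sq_le_one_iff_abs_le_one, dirB, abs_div, abs_of_pos (bracket_pos x), div_le_one (bracket_pos x)]
  exact abs_coord_le_bracket x i

lemma fderiv_dirB (x : Sp N) (i : Fin N) : fderiv ℝ (dirB i) x (stdVec i) = (1 - dirB i x ^ 2) / bracket x := by
  have h1 : (fun x : Sp N => dirB i x * bracket x) = fun x => x i := by
    funext y
    exact div_mul_cancel₀ _ (bracket_pos y).ne'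
  have h2 := fderiv_fun_mul ((contDiff_dirB (l := 1) i).differentiable (by simp) x)
    ((contDiff_bracket (N := N) (l := 1)).differentiable (by simp) x)
  rw [h1] at h2
  have h3 : fderiv ℝ (fun x : Sp N => x i) x (stdVec i) = 1 := by
    have : HasFDerivAt (fun x : Sp N => x i) (EuclideanSpace.proj i : Sp N →L[ℝ] ℝ) x :=
      (EuclideanSpace.proj i : Sp N →L[ℝ] ℝ).hasFDerivAt
    rw [this.fderiv]
    simp
  rw [h2] at h3
  simp only [add_apply, smul_apply, smul_eq_mul, fderiv_bracket] at h3
  rw [eq_div_iff (bracket_pos x).ne', sq]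
  change _ = 1 - dirB i x * (x i / bracket x)
  linarith

lemma fderiv_bracket_pow (c : ℕ) (x : Sp N) (i : Fin N) :
    fderiv ℝ (fun x => bracket x ^ c) x (stdVec i) = c * bracket x ^ (c - 1) * dirB i x := by
  have h := ((contDiff_bracket (N := N) (l := 1)).differentiable (by simp) x).hasFDerivAt.pow c
  rw [h.fderiv, smul_apply, fderiv_bracket, nsmul_eq_mul, smul_eq_mul]
  rfl

lemma IsTest.mul_bracket {φ : Sp N → ℝ} (h : IsTest φ) (a : ℕ) :
    IsTest fun x => φ x * bracket x ^ a := ⟨h.1.mul (contDiff_bracket.pow a), h.2.mul_right⟩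

lemma eLpNorm_wL_le (u : 𝕏) {a : ℕ} (h1 : 2 * m + 1 ≤ order β) (h2 : order β ≤ J) (ha : a ≤ wt k m n (order β)) :
    eLpNorm (fun x => bracket x ^ a • jetX A u β x) 2 ≤ ofReal ‖u‖ :=
  (eLpNorm_mono fun x => by
    rw [norm_wsmul, norm_wsmul]
    exact mul_le_mul_of_nonneg_right (pow_le_pow_right₀ (one_le_bracket x) ha) (norm_nonneg _)).trans
    ((sJet_jetX A u).high β h1 h2)

lemma memLp_wL (u : 𝕏) {a : ℕ} (h1 : 2 * m + 1 ≤ order β) (h2 : order β ≤ J) (ha : a ≤ wt k m n (order β)) :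
    MemLp (fun x => bracket x ^ a • jetX A u β x) 2 :=
  ⟨(sJet_jetX A u).aesm_smul h2 a, (eLpNorm_wL_le A u h1 h2 ha).trans_lt ofReal_lt_top⟩

/-- The weighted derivatives as elements of `L²`. -/
def wL (β : 𝕄) (a : ℕ) (h1 : 2 * m + 1 ≤ order β) (h2 : order β ≤ J) (ha : a ≤ wt k m n (order β)) : 𝕏 →L[ℂ] L2 N :=
  have hm := fun u => memLp_wL A u h1 h2 ha
  LinearMap.mkContinuous
    { toFun := fun u => (hm u).toLp _
      map_add' := fun u v => by
        rw [← MemLp.toLp_add]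
        apply MemLp.toLp_congr
        filter_upwards [jetX_add_ae A u v h2] with x hx
        rw [hx, smul_add]; rfl
      map_smul' := fun c u => by
        rw [RingHom.id_apply, ← MemLp.toLp_const_smul]
        apply MemLp.toLp_congr
        filter_upwards [jetX_smul_ae A c u h2] with x hx
        simp only [hx, Pi.smul_apply, smul_eq_mul, real_smul]
        ring } 1 fun u => by
    change ‖(hm u).toLp _‖ ≤ _
    rw [one_mul, Lp.norm_toLp]
    exact toReal_le_of_le_ofReal (norm_nonneg _) (eLpNorm_wL_le A u h1 h2 ha)

section wL

variable (A : Adm N k m n) {β : Fin N → ℕ} {a : ℕ} (h1 : 2 * m + 1 ≤ order β)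
  (h2 : order β ≤ bigJ k m n) (ha : a ≤ wt k m n (order β))

lemma wL_ae (u : 𝕏) : wL A β a h1 h2 ha u =ᵐ[volume] fun x => bracket x ^ a • jetX A u β x :=
  (memLp_wL A u h1 h2 ha).coeFn_toLp

lemma norm_wL_le (u : 𝕏) : ‖wL A β a h1 h2 ha u‖ ≤ ‖u‖ := by
  change ‖(memLp_wL A u h1 h2 ha).toLp _‖ ≤ _
  rw [Lp.norm_toLp]
  exact toReal_le_of_le_ofReal (norm_nonneg _) (eLpNorm_wL_le A u h1 h2 ha)

lemma ofReal_norm_wL (u : 𝕏) : ofReal ‖wL A β a h1 h2 ha u‖ = wnorm 2 a β (fnX A u) := by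
  rw [ofReal_norm_eq_enorm, enorm_def, eLpNorm_congr_ae (wL_ae A h1 h2 ha u)]
  exact ((sJet_jetX A u).jet.wnorm_eq 2 a β h2).symm

set_option maxHeartbeats 400000 in
include h1 h2 ha in
/-- The commutator of the Laplacian and the weight. -/
lemma exists_commutator : ∃ K : 𝕏 →L[ℂ] L2 N, (∀ u, ‖K u‖ ≤ N * (2 * n + n ^ 2) * ‖u‖) ∧
    ∀ u φ, IsTest φ → ∫ x, lapT (fun x => φ x * bracket x ^ a) x • jetX A u β x
      = (∫ x, lapT φ x • wL A β a h1 h2 ha u x) - ∫ x, φ x • K u x := by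
  rcases a with _ | c
  · refine ⟨0, fun u => by
      rw [zero_apply, norm_zero]; positivity, fun u φ hφ => ?_⟩
    have e1 : ∫ x, φ x • ((0 : 𝕏 →L[ℂ] L2 N) u) x = 0 := by
      refine integral_eq_zero_of_ae ?_
      filter_upwards [Lp.coeFn_zero ℂ 2 (volume : Measure (Sp N))] with x hx
      rw [zero_apply, hx]; simp
    rw [e1, sub_zero]
    refine integral_congr_ae ?_
    filter_upwards [wL_ae A h1 h2 ha u] with x hx
    rw [hx]
    simp
  · have hlt : order β < J := by
      have := ha.trans (min_le_right _ _); omega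
    have hcn : c + 1 ≤ n := ha.trans (min_le_left _ _)
    have o1 : ∀ i, 2 * m + 1 ≤ order (β + 𝐞 i) := fun i => by rw [order_add_single]; omega
    have o2 : ∀ i, order (β + 𝐞 i) ≤ J := fun i => by rw [order_add_single]; omega
    have o3 : ∀ i, c ≤ wt k m n (order (β + 𝐞 i)) := fun i => by
      rw [order_add_single]; have := ha.trans (min_le_right _ _); unfold wt; omega
    have hcR : (c : ℝ) + 1 ≤ n := by exact_mod_cast hcn
    set m1 : Fin N → Sp N → ℝ := fun i x => (c + 1) * dirB i x with hm1
    set m2 : Fin N → Sp N → ℝ := fun i x => (c + 1) * (c * dirB i x ^ 2 + (1 - dirB i x ^ 2)) / bracket x ^ 2 with hm2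
    have c0 : ∀ i, Continuous (dirB i : Sp N → ℝ) := fun i => (contDiff_dirB (l := 0) i).continuous
    have c1 : ∀ i, Measurable fun x => (m1 i x : ℂ) := fun i => by
      have := c0 i; exact Continuous.measurable (by fun_prop)
    have c2 : ∀ i, Measurable fun x => (m2 i x : ℂ) := fun i => by
      have h3 : Continuous (m2 i) := Continuous.div (by have := c0 i; fun_prop)
        (continuous_bracket.pow 2) fun x => (pow_pos (bracket_pos x) 2).ne'
      exact (continuous_ofReal.comp h3).measurable
    have b1 : ∀ i x, ‖(m1 i x : ℂ)‖ ≤ n := fun i x => by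
      rw [norm_real, norm_eq_abs, hm1, abs_mul, abs_of_nonneg (by positivity)]
      have := (sq_le_one_iff_abs_le_one _).1 (sq_dirB_le i x)
      nlinarith [abs_nonneg (dirB i x)]
    have b2 : ∀ i x, ‖(m2 i x : ℂ)‖ ≤ (n : ℝ) ^ 2 := fun i x => by
      have h3 := sq_dirB_le i x
      have h4 := sq_nonneg (dirB i x)
      have h5 : 1 ≤ bracket x ^ 2 := one_le_pow₀ (one_le_bracket x)
      have h6 : 0 ≤ (c : ℝ) * dirB i x ^ 2 + (1 - dirB i x ^ 2) := by
        have : 0 ≤ (c : ℝ) * dirB i x ^ 2 := by positivity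
        linarith
      have h7 : (c : ℝ) * dirB i x ^ 2 + (1 - dirB i x ^ 2) ≤ c + 1 := by
        have : 0 ≤ (c : ℝ) := by positivity
        nlinarith
      rw [norm_real, norm_eq_abs, hm2, abs_of_nonneg (by positivity)]
      refine (div_le_self (by positivity) h5).trans ?_
      nlinarith
    have q1 : ∀ i x, fderiv ℝ (fun x => bracket x ^ (c + 1)) x (stdVec i) = m1 i x * bracket x ^ c :=
      fun i x => by
        rw [fderiv_bracket_pow, hm1, Nat.add_sub_cancel]; push_cast; ring
    have d1 : ∀ i, ContDiff ℝ 1 fun x => m1 i x * bracket x ^ c := fun i =>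
      (contDiff_const.mul (contDiff_dirB i)).mul (contDiff_bracket.pow c)
    have q2 : ∀ i x, fderiv ℝ (fun x => m1 i x * bracket x ^ c) x (stdVec i)
        = m2 i x * bracket x ^ (c + 1) := fun i x => by
      have e1 := fderiv_fun_mul (((contDiff_dirB (l := 1) i).differentiable (by simp) x).const_mul
        ((c : ℝ) + 1)) (((contDiff_bracket (N := N) (l := 1)).pow c).differentiable (by simp) x)
      rw [hm1]
      rw [e1, fderiv_const_mul ((contDiff_dirB (l := 1) i).differentiable (by simp) x)]
      simp only [add_apply, smul_apply, smul_eq_mul, fderiv_bracket_pow, fderiv_dirB, hm2]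
      have := (bracket_pos x).ne'
      rcases c with _ | c
      · field_simp; simp [mul_comm]
      · rw [Nat.add_sub_cancel]; push_cast; field_simp; ring
    set M₁ := fun i => mulL2 (fun x => (m1 i x : ℂ)) (c1 i) n (b1 i)
    set M₂ := fun i => mulL2 (fun x => (m2 i x : ℂ)) (c2 i) (n ^ 2) (b2 i)
    set W₁ := fun i => wL A (β + 𝐞 i) c (o1 i) (o2 i) (o3 i)
    set W₀ := wL A β (c + 1) h1 h2 ha
    set K : 𝕏 →L[ℂ] L2 N := ∑ i, ((2 : ℂ) • M₁ i ∘L W₁ i + M₂ i ∘L W₀) with hK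
    have hKa : ∀ u, K u = ∑ i, ((2 : ℂ) • M₁ i (W₁ i u) + M₂ i (W₀ u)) := fun u => by
      rw [hK, sum_apply]; rfl
    refine ⟨K, fun u => ?_, fun u φ hφ => ?_⟩
    · rw [hKa]
      refine (norm_sum_le _ _).trans ((sum_le_sum (g := fun _ => (2 * n + (n : ℝ) ^ 2) * ‖u‖) fun i _ => ?_).trans ?_)
      · refine (norm_add_le _ _).trans ?_
        rw [norm_smul, norm_ofNat]
        have e1 := norm_mulL2_le (fun x => (m1 i x : ℂ)) (c1 i) n (b1 i) (W₁ i u)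
        have e2 := norm_mulL2_le (fun x => (m2 i x : ℂ)) (c2 i) (n ^ 2) (b2 i) (W₀ u)
        have e3 := mul_le_mul_of_nonneg_left (norm_wL_le A (o1 i) (o2 i) (o3 i) u) n.cast_nonneg (α := ℝ)
        have e4 := mul_le_mul_of_nonneg_left (norm_wL_le A h1 h2 ha u) (by positivity : 0 ≤ (n : ℝ) ^ 2)
        linarith
      · rw [sum_const, card_univ, Fintype.card_fin, nsmul_eq_mul]; linarith
    · have hu := sJet_jetX A u
      have W := fun i => hu.jet.step β i hlt
      have W1 := fun i => (W i).mul_real ((contDiff_bracket (N := N) (l := 1)).pow (c + 1))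
      have W2 := fun i => (W i).mul_real (d1 i)
      have hΨ := hφ.mul_bracket (c + 1)
      have hpd : ∀ i x, partialD i (fun x => φ x * bracket x ^ (c + 1)) x
          = partialD i φ x * bracket x ^ (c + 1) + φ x * (m1 i x * bracket x ^ c) := fun i x => by
        rw [partialD_mul hφ.1 (contDiff_bracket.pow _), ← q1 i x]
        rfl
      have lap : ∀ (ψ : Sp N → ℝ) (w : Sp N → ℂ), IsTest ψ → LocallyIntegrable w →
          ∫ x, lapT ψ x • w x = ∑ i, ∫ x, partialD i (partialD i ψ) x • w x :=
        fun ψ w hψ hw => by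
          simp only [lapT, sum_smul]
          exact integral_finset_sum _ fun i _ => ((hψ.partialD i).partialD i).integrable_smul hw
      have hWL : ∫ x, lapT φ x • W₀ u x
          = ∫ x, lapT φ x • (bracket x ^ (c + 1) • jetX A u β x) := integral_congr_ae (by
        filter_upwards [wL_ae A h1 h2 ha u] with x hx
        rw [hx])
      have hKi : ∫ x, φ x • K u x = ∑ i, ∫ x, φ x • ((2 : ℝ) • ((m1 i x * bracket x ^ c) •
          jetX A u (β + 𝐞 i) x) + (m2 i x * bracket x ^ (c + 1)) • jetX A u β x) := by
        rw [← inner_testL2 hφ, hKa, inner_sum]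
        refine sum_congr rfl fun i _ => ?_
        rw [inner_testL2 hφ]
        refine integral_congr_ae ?_
        filter_upwards [coeFn_add ((2 : ℂ) • M₁ i (W₁ i u)) (M₂ i (W₀ u)), coeFn_smul (2 : ℂ) (M₁ i (W₁ i u)),
          coeFn_mulL2 (fun x => (m1 i x : ℂ)) (c1 i) n (b1 i) (W₁ i u),
          coeFn_mulL2 (fun x => (m2 i x : ℂ)) (c2 i) (n ^ 2) (b2 i) (W₀ u),
          wL_ae A (o1 i) (o2 i) (o3 i) u, wL_ae A h1 h2 ha u] with x x1 x2 x3 x4 x5 x6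
        rw [x1, Pi.add_apply, x2, Pi.smul_apply, x3, x4, x5, x6]
        simp only [real_smul, smul_eq_mul]
        push_cast
        ring
      have cb : Continuous fun x : Sp N => bracket x ^ (c + 1) := continuous_bracket.pow _
      rw [hWL, hKi, lap _ _ hΨ (hu.jet.locallyIntegrable β h2),
        lap φ _ hφ ((hu.jet.locallyIntegrable β h2).continuous_smul cb),
        ← sum_sub_distrib]
      refine sum_congr rfl fun i _ => ?_
      rw [(W i).eq _ (hΨ.partialD i), (W1 i).eq _ (hφ.partialD i)]
      have e3 := (W2 i).eq _ hφ
      simp only [hpd, q1, q2] at e3 ⊢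
      have lU := hu.jet.locallyIntegrable β h2
      have lV := hu.jet.locallyIntegrable _ (o2 i)
      have cm1 : Continuous fun x => m1 i x * bracket x ^ c := (d1 i).continuous
      have i1 := (hφ.partialD i).integrable_smul (lV.continuous_smul cb)
      have i2 := (hφ.partialD i).integrable_smul (lU.continuous_smul cm1)
      have i3 := hφ.integrable_smul (lV.continuous_smul cm1)
      have i4 : Integrable (fun x => φ x • ((m2 i x * bracket x ^ (c + 1)) • jetX A u β x)) := by
        have := hφ.integrable_smul (W2 i).right
        simp only [q2] at this
        exact (this.sub i3).congr (of_forall fun x => by simp [smul_add])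
      have s1 : ∀ x, (partialD i φ x * bracket x ^ (c + 1) + φ x * (m1 i x * bracket x ^ c))
          • jetX A u (β + 𝐞 i) x = partialD i φ x • (bracket x ^ (c + 1) •
            jetX A u (β + 𝐞 i) x) + φ x • ((m1 i x * bracket x ^ c) •
            jetX A u (β + 𝐞 i) x) := fun x => by
        simp only [add_smul, mul_smul]
      have s2 : ∀ x, φ x • ((2 : ℝ) • ((m1 i x * bracket x ^ c) •
          jetX A u (β + 𝐞 i) x) + (m2 i x * bracket x ^ (c + 1)) • jetX A u β x)
          = (2 : ℝ) • (φ x • ((m1 i x * bracket x ^ c) • jetX A u (β + 𝐞 i) x))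
            + φ x • ((m2 i x * bracket x ^ (c + 1)) • jetX A u β x) := fun x => by
        rw [smul_add, smul_comm (φ x) (2 : ℝ)]
      simp only [smul_add (partialD i φ _)]
      rw [integral_add i1 i2, e3]
      simp only [s1, s2, smul_add (φ _)]
      have i5 : Integrable (fun x => (2 : ℝ) • (φ x • ((m1 i x * bracket x ^ c) •
          jetX A u (β + 𝐞 i) x))) := i3.smul (2 : ℝ)
      rw [integral_add i1 i3, integral_add i3 i4, integral_add i5 i4, integral_smul, two_smul]
      ring

end wL

/-! ### Estimates of the solutions of the linear equation -/

lemma lapT_partialD {φ : Sp N → ℝ} (hφ : IsTest φ) (i : Fin N) : lapT (partialD i φ) = partialD i (lapT φ) := by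
  funext x
  have h : ∀ j, partialD j (partialD j (partialD i φ)) = partialD i (partialD j (partialD j φ)) := fun j => by
    rw [partialD_comm hφ.1 j i, partialD_comm (hφ.partialD j).1 j i]
  unfold lapT
  simp only [h]
  change _ = fderiv ℝ (fun x => ∑ j, partialD j (partialD j φ) x) x (EuclideanSpace.single i 1)
  rw [fderiv_fun_sum fun j _ => ((hφ.partialD j).partialD j).1.differentiable (by simp) x, sum_apply]
  rfl

lemma pairing_of_eq {u w : 𝕏} (h : ∀ x, fnX A w x = I * lapX A u x) (β : 𝕄) : order β ≤ J → ∀ φ : Sp N → ℝ, IsTest φ →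
      ∫ x, φ x • jetX A w β x = I * ∫ x, lapT φ x • jetX A u β x := by
  have hs := fun f : 𝕏 => (sJet_jetX A f).jet.step
  induction β using multiIndex_induction with
  | h0 =>
    intro _ φ hφ
    rw [integral_lapT_smul (fun i => hs u 0 i (by rw [order_zero]; unfold bigJ; omega))
      (fun i => hs u _ i (by rw [order_add_single, order_zero]; unfold bigJ; omega)) hφ,
      ← integral_const_mul]
    refine integral_congr_ae (of_forall fun x => ?_)
    have := h x
    simp only [fnX, lapX] at this
    simp only [this, real_smul]
    ring
  | hs β i ih =>
    intro hβ φ hφ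
    rw [order_add_single] at hβ
    have e1 := (hs w β i (by omega)).eq φ hφ
    have e2 := (hs u β i (by omega)).eq _ (isTest_lapT hφ)
    rw [ih (by omega) _ (hφ.partialD i), lapT_partialD hφ i, e2] at e1
    linear_combination e1

lemma order_add_two (hβ : order β ≤ 2 * m) (i : Fin N) : order (β + 𝐞 i + 𝐞 i) ≤ 2 * m + 2 := by
  rw [order_add_single, order_add_single]; omega

lemma jetX_of_eq {u w : 𝕏} (h : ∀ x, fnX A w x = I * lapX A u x) (hβ : order β ≤ 2 * m) (x : Sp N) :
    jetX A w β x = I * ∑ i, jetX A u (β + 𝐞 i + 𝐞 i) x := by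
  have hs := (sJet_jetX A u).jet.step
  have hc : Continuous fun x => I * ∑ i, jetX A u (β + 𝐞 i + 𝐞 i) x :=
    continuous_const.mul (continuous_finset_sum _ fun i _ => jetX_continuous A u (order_add_two hβ i))
  have hw := jetX_continuous A w (β := β) (by omega)
  refine congrFun ((Continuous.ae_eq_iff_eq volume hw hc).1
    (ae_eq_of_forall_test hw.locallyIntegrable hc.locallyIntegrable fun φ hφ => ?_)) x
  rw [pairing_of_eq A h β (order_le_bigJ (by omega)) φ hφ,
    integral_lapT_smul (fun i => hs β i (by unfold bigJ; omega))
      (fun i => hs _ i (by rw [order_add_single]; unfold bigJ; omega)) hφ, ← integral_const_mul]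
  refine integral_congr_ae (of_forall fun x => ?_)
  simp only [real_smul]
  ring

/-- The integrated equation. -/
lemma integrated_equation {v f : ℝ → 𝕏} (hv : Continuous v) (hf : Continuous f)
    {T : ℝ} (H : ∀ t ∈ Icc 0 T, ∀ x, HasDerivWithinAt (fun s => fnX A (v s) x)
      (I * lapX A (v t) x + fnX A (f t) x) (Icc 0 T) t) {t : ℝ} (ht : t ∈ Icc 0 T) (x : Sp N) :
    fnX A (v t - v 0 - ∫ s in (0 : ℝ)..t, f s) x = I * lapX A (∫ s in (0 : ℝ)..t, v s) x := by
  have h0 : order (0 : 𝕄) ≤ 2 * m + 2 := by rw [order_zero]; omega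
  have c1 : Continuous fun s => lapX A (v s) x := (continuous_lapX A x).comp hv
  have c2 : Continuous fun s => fnX A (f s) x := (continuous_jetX A h0 x).comp hf
  have e1 := intervalIntegral.integral_eq_sub_of_hasDerivAt_of_le ht.1
    (f := fun s => fnX A (v s) x) (f' := fun s => I * lapX A (v s) x + fnX A (f s) x)
    ((continuous_jetX A h0 x).comp hv).continuousOn
    (fun s hs => (H s ⟨hs.1.le, hs.2.le.trans ht.2⟩ x).hasDerivAt (Icc_mem_nhds hs.1 (hs.2.trans_le ht.2)))
    (Continuous.intervalIntegrable (by fun_prop) _ _)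
  rw [intervalIntegral.integral_add (Continuous.intervalIntegrable (by fun_prop) _ _)
    (c2.intervalIntegrable _ _), intervalIntegral.integral_const_mul] at e1
  have e2 : ∫ s in (0 : ℝ)..t, fnX A (f s) x = fnX A (∫ s in (0 : ℝ)..t, f s) x :=
    (evalX A h0 x).intervalIntegral_comp_comm (hf.intervalIntegrable _ _)
  have e3 : ∫ s in (0 : ℝ)..t, lapX A (v s) x = lapX A (∫ s in (0 : ℝ)..t, v s) x := by
    have := (∑ i, evalX A (order_two_le (m := m) i) x).intervalIntegral_comp_comm
      (hv.intervalIntegrable (μ := volume) 0 t)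
    simp only [sum_apply, evalX_apply] at this
    exact this
  rw [fnX_sub, fnX_sub, ← e2, ← e3]
  linear_combination -e1

lemma enorm_integral_le {E : Type*} [NormedAddCommGroup E] [NormedSpace ℝ E] {g : ℝ → E} {t C : ℝ}
    (ht : 0 ≤ t) {B : ℝ → ℝ≥0∞} (h : ∀ s ∈ Icc 0 t, ‖g s‖ₑ ≤ ofReal C * B s) :
    ‖∫ s in (0 : ℝ)..t, g s‖ₑ ≤ ofReal C * ∫⁻ s in Icc 0 t, B s := by
  rw [intervalIntegral.integral_of_le ht, ← lintegral_const_mul' _ _ ofReal_ne_top]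
  refine (enorm_integral_le_lintegral_enorm _).trans ((lintegral_mono_set Ioc_subset_Icc_self).trans
    (setLIntegral_mono' measurableSet_Icc h))

lemma enorm_le_wnorm_top (f : 𝕏) (hβ : order β ≤ 2 * m) (x : Sp N) :
    ‖bracket x ^ n • jetX A f β x‖ₑ ≤ wnorm ∞ n β (fnX A f) := by
  have hf : wnorm ∞ n β (fnX A f) < ⊤ := (memS_fnX A f).low β hβ
  have e := (sJet_jetX A f).jet.wnorm_eq ∞ n β (order_le_bigJ (by omega))
  have h1 := (eLpNorm_top_le_iff (continuous_bracket_smul (jetX_continuous A f (β := β) (by omega)) n)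
    toReal_nonneg).1 (e.symm.le.trans (ofReal_toReal hf.ne).ge) x
  rw [← ofReal_norm_eq_enorm]
  exact (ofReal_le_ofReal h1).trans (ofReal_toReal hf.ne).le

/-- The constant in the estimates of the linear equation. -/
def linC : ℝ := 1 + N * supC A + N * (2 * n + n ^ 2)

lemma one_le_linC : 1 ≤ linC A := by
  have := one_le_supC A
  unfold linC
  have : 0 ≤ N * supC A := by positivity
  have : (0 : ℝ) ≤ N * (2 * n + n ^ 2) := by positivity
  linarith

lemma ofReal_add_le (u f : 𝕏) {r M : ℝ} {F : ℝ≥0∞} (hr : ofReal r ≤ F)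
    (hM : M ≤ linC A - 1) : ofReal (M * ‖u‖ + r) ≤ ofReal (linC A) * (normS N k m n (fnX A u) + F) := by
  have h1 := one_le_linC A
  refine ENNReal.ofReal_add_le.trans ?_
  rw [mul_add]
  refine add_le_add ?_ (hr.trans (le_mul_of_one_le_left zero_le (by simpa using h1)))
  refine (ofReal_le_ofReal (mul_le_mul_of_nonneg_right (by linarith : M ≤ linC A) (norm_nonneg _))).trans ?_
  rw [ofReal_mul (by linarith)]
  exact mul_le_mul_right (norm_le_normS A u) _

section linear

variable (A : Adm N k m n) {v f : ℝ → XS N k m n} (hv : Continuous v) (hf : Continuous f) {T : ℝ}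
  (H : ∀ t ∈ Icc 0 T, ∀ x, HasDerivWithinAt (fun s => fnX A (v s) x)
    (I * lapX A (v t) x + fnX A (f t) x) (Icc 0 T) t) {t : ℝ} (ht : t ∈ Icc 0 T)

include hv hf H ht

lemma linear_low (hβ : order β ≤ 2 * m) : wnorm ∞ n β (fnX A (v t)) ≤ normS N k m n (fnX A (v 0)) + ofReal (linC A) *
      ∫⁻ s in Icc 0 t, (normS N k m n (fnX A (v s)) + wnorm ∞ n β (fnX A (f s))) := by
  have ho : order β ≤ 2 * m + 2 := by omega
  rw [show fnX A (v t) = jetX A (v t) 0 from rfl, (sJet_jetX A (v t)).jet.wnorm_eq ∞ n β (order_le_bigJ ho)]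
  refine eLpNormEssSup_le_of_ae_enorm_bound (of_forall fun x => ?_)
  have e1 := jetX_of_eq A (integrated_equation A hv hf H ht) hβ x
  have e2 : ∫ s in (0 : ℝ)..t, jetX A (f s) β x = jetX A (∫ s in (0 : ℝ)..t, f s) β x :=
    (evalX A ho x).intervalIntegral_comp_comm (hf.intervalIntegrable _ _)
  have e3 : ∫ s in (0 : ℝ)..t, ∑ i, jetX A (v s) (β + 𝐞 i + 𝐞 i) x
      = ∑ i, jetX A (∫ s in (0 : ℝ)..t, v s) (β + 𝐞 i + 𝐞 i) x := by
    have := (∑ i, evalX A (order_add_two hβ i) x).intervalIntegral_comp_comm (hv.intervalIntegrable (μ := volume) 0 t)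
    simpa only [sum_apply, evalX_apply] using this
  have c1 : Continuous fun s => ∑ i, jetX A (v s) (β + 𝐞 i + 𝐞 i) x :=
    continuous_finset_sum _ fun i _ => (continuous_jetX A (order_add_two hβ i) x).comp hv
  have c2 : Continuous fun s => jetX A (f s) β x := (continuous_jetX A ho x).comp hf
  rw [jetX_sub A _ _ ho, jetX_sub A _ _ ho, ← e2, ← e3, ← intervalIntegral.integral_const_mul] at e1
  have e4 : bracket x ^ n • jetX A (v t) β x = bracket x ^ n • jetX A (v 0) β x + ∫ s in (0 : ℝ)..t, bracket x ^ n •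
        (I * (∑ i, jetX A (v s) (β + 𝐞 i + 𝐞 i) x) + jetX A (f s) β x) := by
    rw [intervalIntegral.integral_smul, intervalIntegral.integral_add
      (Continuous.intervalIntegrable (by fun_prop) _ _) (c2.intervalIntegrable _ _), ← e1, ← smul_add]
    congr 1
    ring
  rw [e4]
  refine (enorm_add_le _ _).trans (add_le_add ((enorm_le_wnorm_top A _ hβ x).trans
    (wnorm_low_le_normS hβ)) (enorm_integral_le ht.1 fun s hs => ?_))
  have hb := pow_nonneg (bracket_pos x).le n
  rw [← ofReal_norm_eq_enorm, norm_wsmul]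
  refine (ofReal_le_ofReal (?_ : _ ≤ N * supC A * ‖v s‖ + bracket x ^ n * ‖jetX A (f s) β x‖)).trans
    (ofReal_add_le A (v s) (f s) ?_ ?_)
  · refine (mul_le_mul_of_nonneg_left (norm_add_le _ _) hb).trans ?_
    rw [mul_add, norm_mul, norm_I, one_mul]
    refine add_le_add_left ((mul_le_mul_of_nonneg_left (norm_sum_le _ _) hb).trans ?_) _
    rw [mul_sum]
    refine (sum_le_sum fun i _ => (sJet_jetX A (v s)).sup_le A (order_add_two hβ i) x).trans ?_
    rw [sum_const, card_univ, Fintype.card_fin, nsmul_eq_mul, mul_assoc]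
  · rw [← norm_wsmul, ofReal_norm_eq_enorm]
    exact enorm_le_wnorm_top A _ hβ x
  · unfold linC
    have : (0 : ℝ) ≤ N * (2 * n + n ^ 2) := by positivity
    linarith

lemma linear_high {a : ℕ} (h1 : 2 * m + 1 ≤ order β) (h2 : order β ≤ J) (ha : a ≤ wt k m n (order β)) :
    wnorm 2 a β (fnX A (v t)) ≤ normS N k m n (fnX A (v 0)) + ofReal (linC A) *
      ∫⁻ s in Icc 0 t, (normS N k m n (fnX A (v s)) + wnorm 2 a β (fnX A (f s))) := by
  obtain ⟨K, hK, hcom⟩ := exists_commutator A h1 h2 ha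
  set W := wL A β a h1 h2 ha with hW
  have key := norm_le_of_weak_schrodinger (z := fun s => W (v s))
    (G := fun s => W (f s) - I • K (v s)) (by fun_prop) (by fun_prop) (T := T)
    (fun φ hφ τ hτ => ?_) ht
  · simp only [hW] at key
    rw [← ofReal_norm_wL A h1 h2 ha]
    refine (ofReal_le_ofReal key).trans (ENNReal.ofReal_add_le.trans (add_le_add ?_ ?_))
    · rw [ofReal_norm_wL A h1 h2 ha]
      exact (wnorm_mono ha _ _).trans (wnorm_wt_le_normS A h1 h2)
    · refine (Real.ofReal_le_enorm _).trans (enorm_integral_le ht.1 fun s hs => ?_)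
      rw [enorm_norm, ← ofReal_norm_eq_enorm]
      refine (ofReal_le_ofReal ((norm_sub_le _ _).trans ?_)).trans (ofReal_add_le A (v s) (f s)
        (M := N * (2 * n + n ^ 2)) (r := ‖wL A β a h1 h2 ha (f s)‖) (ofReal_norm_wL A h1 h2 ha _).le ?_)
      · rw [norm_smul, norm_I, one_mul, add_comm]
        exact add_le_add_left (hK _) _
      · have : 0 ≤ N * supC A := by have := one_le_supC A; positivity
        unfold linC
        linarith
  · set P : 𝕏 →L[ℂ] ℂ := I • (innerSL ℂ (testL2 (isTest_lapT hφ)) ∘L W) - I • (innerSL ℂ (testL2 hφ) ∘L K) with hP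
    set Q : 𝕏 →L[ℂ] ℂ := innerSL ℂ (testL2 hφ) ∘L W with hQ
    have e1 : ∀ s, I * (∫ x, lapT φ x • W (v s) x) + ∫ x, φ x • (W (f s) - I • K (v s) : L2 N) x
        = P (v s) + Q (f s) := fun s => by
      rw [← inner_testL2 (isTest_lapT hφ), ← inner_testL2 hφ, inner_sub_right, inner_smul_right]
      simp only [hP, hQ, sub_apply, smul_apply, ContinuousLinearMap.comp_apply, innerSL_apply_apply, smul_eq_mul]
      ring
    have e2 := pairing_of_eq A (integrated_equation A hv hf H hτ) β h2 _ (hφ.mul_bracket a)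
    rw [hcom _ _ hφ] at e2
    have e3 : ∀ g : 𝕏, ∫ x, (φ x * bracket x ^ a) • jetX A g β x = Q g := fun g => by
      simp only [hQ, ContinuousLinearMap.comp_apply, innerSL_apply_apply, inner_testL2]
      refine integral_congr_ae ?_
      filter_upwards [wL_ae A h1 h2 ha g] with x hx
      rw [hW, hx, smul_smul]
    have e4 : ∀ g : 𝕏, ∫ x, φ x • W g x = Q g := fun g => by
      simp only [hQ, ContinuousLinearMap.comp_apply, innerSL_apply_apply, inner_testL2]
    simp only [e1, e4]
    rw [intervalIntegral.integral_add (Continuous.intervalIntegrable (by fun_prop) _ _)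
      (Continuous.intervalIntegrable (by fun_prop) _ _),
      P.intervalIntegral_comp_comm (hv.intervalIntegrable _ _),
      Q.intervalIntegral_comp_comm (hf.intervalIntegrable _ _)]
    rw [e3, ← inner_testL2 (isTest_lapT hφ), ← inner_testL2 hφ, map_sub, map_sub] at e2
    simp only [hP, sub_apply, smul_apply, ContinuousLinearMap.comp_apply, innerSL_apply_apply, smul_eq_mul]
    linear_combination e2

end linear

/-- Functions that are continuous on an interval extend to the line. -/
lemma exists_continuous_extension {E : Type*} [TopologicalSpace E] {T : ℝ} (hT : 0 ≤ T) {v : ℝ → E}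
    (hv : ContinuousOn v (Icc 0 T)) : ∃ w : ℝ → E, Continuous w ∧ ∀ t ∈ Icc 0 T, w t = v t :=
  ⟨IccExtend hT ((Icc 0 T).restrict v), hv.restrict.Icc_extend', fun t ht => IccExtend_of_mem hT _ ht⟩

lemma linear_bounds {v f : ℝ → 𝕏} {T : ℝ} (hv : ContinuousOn v (Icc 0 T)) (hf : ContinuousOn f (Icc 0 T))
    (H : ∀ t ∈ Icc 0 T, ∀ x, HasDerivWithinAt (fun s => fnX A (v s) x)
      (I * lapX A (v t) x + fnX A (f t) x) (Icc 0 T) t) {t : ℝ} (ht : t ∈ Icc 0 T) :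
    let E := fun p a β => wnorm p a β (fnX A (v t)) ≤ normS N k m n (fnX A (v 0)) + ofReal (linC A) *
      ∫⁻ s in Icc 0 t, (normS N k m n (fnX A (v s)) + wnorm p a β (fnX A (f s)))
    (∀ β, order β ≤ 2 * m → E ∞ n β) ∧
      ∀ β a, 2 * m + 1 ≤ order β → order β ≤ J → a ≤ wt k m n (order β) → E 2 a β := by
  have hT : 0 ≤ T := ht.1.trans ht.2
  obtain ⟨v2, cv2, hv2⟩ := exists_continuous_extension hT hv
  obtain ⟨f2, cf2, hf2⟩ := exists_continuous_extension hT hf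
  have H' : ∀ s ∈ Icc 0 T, ∀ x, HasDerivWithinAt (fun r => fnX A (v2 r) x)
      (I * lapX A (v2 s) x + fnX A (f2 s) x) (Icc 0 T) s := fun s hs x => by
    rw [hv2 s hs, hf2 s hs]
    exact (H s hs x).congr (fun r hr => by rw [hv2 r hr]) (by rw [hv2 s hs])
  have hi : ∀ (p : ℝ≥0∞) (a : ℕ) (β : 𝕄), ∫⁻ s in Icc 0 t, (normS N k m n (fnX A (v s)) + wnorm p a β (fnX A (f s)))
      = ∫⁻ s in Icc 0 t, (normS N k m n (fnX A (v2 s)) + wnorm p a β (fnX A (f2 s))) := fun p a β =>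
    setLIntegral_congr_fun measurableSet_Icc fun s hs => by
      have hs' : s ∈ Icc 0 T := ⟨hs.1, hs.2.trans ht.2⟩
      simp only [hv2 s hs', hf2 s hs']
  simp only [hi, ← hv2 t ht, ← hv2 0 ⟨le_rfl, hT⟩]
  exact ⟨fun β hβ => linear_low A cv2 cf2 H' ht hβ, fun β a h1 h2 ha => linear_high A cv2 cf2 H' ht h1 h2 ha⟩

lemma isLinearConst_linC : IsLinearConst N k m n (linC A) := by
  intro T hT f v hf hv H t ht
  obtain ⟨v1, hv1, cv1⟩ := hv.exists_XS A
  obtain ⟨f1, hf1, cf1⟩ := hf.exists_XS A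
  have h := linear_bounds A cv1 cf1 (fun s hs x => by
    have := H s hs x
    rw [← hv1 s hs, ← hf1 s hs, laplacian_fnX] at this
    exact this.congr (fun r hr => by rw [hv1 r hr]) (by rw [hv1 s hs])) ht
  have hi : ∀ (p : ℝ≥0∞) (a : ℕ) (β : 𝕄), ∫⁻ s in Icc 0 t, (normS N k m n (v s) + wnorm p a β (f s))
      = ∫⁻ s in Icc 0 t, (normS N k m n (fnX A (v1 s)) + wnorm p a β (fnX A (f1 s))) := fun p a β =>
    setLIntegral_congr_fun measurableSet_Icc fun s hs => by
      have hs' : s ∈ Icc 0 T := ⟨hs.1, hs.2.trans ht.2⟩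
      simp only [hv1 s hs', hf1 s hs']
  simp only [hi, ← hv1 t ht, ← hv1 0 ⟨le_rfl, hT⟩]
  exact ⟨h.1, fun ν μ hν hμ β hβ => h.2 β _ (by omega) (by unfold bigJ; omega) (le_wt hν hμ hβ)⟩

/-! ### The exponents and the growth of the norm -/

lemma Adm.four_le (A : Adm N k m n) : 4 ≤ 2 * m := by
  have := A.one_le_k
  have := A.two_le_n
  have := A.hm
  omega

lemma bigJ_cast : (J : ℝ) = 2 * m + 2 + k + n := by unfold bigJ; push_cast; ring

lemma sigma_top (A : Adm N k m n) : (8 * (m : ℝ) + 1) ^ (2 * m) * σ₁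
    = 1 / (4 * (4 * (J : ℝ) * ((J : ℝ) - 2 * m - 1) + 4 * (J : ℝ) + 4 / (N : ℝ) + 1)) := by
  unfold sigmaOne
  have h1 : ((8 * (m : ℝ) + 1) ^ (2 * m)) ≠ 0 := by positivity
  have h2 : 4 * (4 * (J : ℝ) * ((J : ℝ) - 2 * m - 1) + 4 * (J : ℝ) + 4 / (N : ℝ) + 1) ≠ 0 := by
    rw [bigJ_cast, show 2 * (m : ℝ) + 2 + k + n - 2 * m - 1 = 1 + k + n by ring]
    positivity
  field_simp

section

variable {α : ℝ}

lemma sigmaOne_pos (A : Adm N k m n) : 0 < σ₁ := by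
  unfold sigmaOne
  rw [bigJ_cast, show 2 * (m : ℝ) + 2 + k + n - 2 * m - 1 = 1 + k + n by ring]
  positivity

lemma sigma_zero : 𝔰 α 0 = 0 := if_pos rfl

lemma sigma_one : 𝔰 α 1 = σ₁ := by simp [sigma]

lemma sigma_low {j : ℕ} (h1 : 1 ≤ j) (h2 : j + 1 ≤ 2 * m) : 𝔰 α (j + 1) = (8 * (m : ℝ) + 1) ^ (j + 1) * σ₁ := by
  unfold sigma
  rw [if_neg (by omega), if_neg (by omega), if_pos h2]

include A

lemma sigma_two_m : 𝔰 α (2 * m) = (8 * (m : ℝ) + 1) ^ (2 * m) * σ₁ := by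
  have h := A.four_le
  have := sigma_low (N := N) (k := k) (n := n) (α := α) (j := 2 * m - 1) (m := m) (by omega) (by omega)
  rwa [show 2 * m - 1 + 1 = 2 * m by omega] at this

lemma sigma_high {j : ℕ} (h : 2 * m + 1 ≤ j) : 𝔰 α j = 4 * (J : ℝ) * 𝔰 α (2 * m) * ((j : ℝ) - 2 * m - 1)
      + ((2 - N * α) / 2 + (4 * (J : ℝ) + 2 * α + 1) * 𝔰 α (2 * m)) := by
  rw [sigma_two_m A]
  have := A.four_le
  have h1 : ¬ j = 0 := by omega
  have h2 : ¬ j = 1 := by omega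
  have h3 : ¬ j ≤ 2 * m := by omega
  simp only [sigma, h1, h2, h3, if_false]

lemma delta_mem (hα : α ∈ 𝕀) : (2 - N * α) / 2 ∈ Icc (0 : ℝ) (1 / 4) := by
  have h0 : (1 : ℝ) ≤ N := by exact_mod_cast A.one_le
  have h1 := (le_max_left _ _).trans hα.1
  have h2 := hα.2
  rw [div_le_iff₀ (by positivity)] at h1
  rw [le_div_iff₀ (by positivity)] at h2
  constructor <;> linarith

lemma sigma_step {j : ℕ} (h1 : 1 ≤ j) (h2 : j + 1 ≤ 2 * m) : (8 * (m : ℝ) + 1) * 𝔰 α j ≤ 𝔰 α (j + 1) := by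
  have hs := (sigmaOne_pos A).le
  rw [sigma_low h1 h2]
  rcases Nat.lt_or_ge j 2 with h | h
  · obtain rfl : j = 1 := by omega
    rw [sigma_one, pow_succ, pow_one, mul_assoc]
    refine le_mul_of_one_le_left (by positivity) ?_
    have : (0 : ℝ) ≤ m := m.cast_nonneg
    linarith
  · obtain ⟨i, rfl⟩ : ∃ i, j = i + 1 := ⟨j - 1, by omega⟩
    rw [sigma_low (by omega) (by omega), ← mul_assoc, ← pow_succ']

lemma sigma_mono (hα : α ∈ 𝕀) : Monotone (𝔰 α) := by
  have hs := (sigmaOne_pos A).le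
  have h4 := A.four_le
  have hα0 := (alpha_mem A hα).1
  have hδ := (delta_mem A hα).1
  have hS : 0 ≤ 𝔰 α (2 * m) := by rw [sigma_two_m A]; positivity
  have key : ∀ j, 0 ≤ 𝔰 α j ∧ 𝔰 α j ≤ 𝔰 α (j + 1) := by
    intro j
    induction j with
    | zero => rw [zero_add, sigma_zero, sigma_one]; exact ⟨le_rfl, hs⟩
    | succ j ih =>
      have h0 := ih.1.trans ih.2
      refine ⟨h0, ?_⟩
      rcases Nat.lt_or_ge (2 * m) (j + 1 + 1) with h | h
      · rcases Nat.lt_or_ge (2 * m) (j + 1) with h' | h'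
        · rw [sigma_high A h', sigma_high A h]
          push_cast
          have : 0 ≤ 4 * (J : ℝ) * 𝔰 α (2 * m) := by positivity
          linarith
        · obtain h3 : j + 1 = 2 * m := by omega
          rw [h3, sigma_high A le_rfl]
          push_cast
          have : 0 ≤ (4 * (J : ℝ) + 2 * α) * 𝔰 α (2 * m) := by positivity
          linarith
      · refine le_trans (le_mul_of_one_le_left h0 ?_) (sigma_step A (by omega) h)
        have : (0 : ℝ) ≤ m := m.cast_nonneg
        linarith
  exact monotone_nat_of_le_succ fun j => (key j).2

lemma sigma_nonneg (hα : α ∈ 𝕀) (j : ℕ) : 0 ≤ 𝔰 α j := sigma_zero.symm.le.trans (sigma_mono A hα j.zero_le)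

lemma sigma_bigJ_le (hα : α ∈ 𝕀) {j : ℕ} (hj : j ≤ J) : 𝔰 α j ≤ 1 / 2 := by
  refine (sigma_mono A hα hj).trans ?_
  have hδ := (delta_mem A hα).2
  have h0 : (1 : ℝ) ≤ N := by exact_mod_cast A.one_le
  rw [sigma_high A (by unfold bigJ; omega), sigma_two_m A, sigma_top A]
  have h2 : 0 < 4 * (J : ℝ) * ((J : ℝ) - 2 * m - 1) + 4 * (J : ℝ) + 4 / (N : ℝ) + 1 := by
    rw [bigJ_cast, show 2 * (m : ℝ) + 2 + k + n - 2 * m - 1 = 1 + k + n by ring]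
    positivity
  have h3 : 2 * α ≤ 4 / N := by
    have := hα.2
    calc 2 * α ≤ 2 * (2 / N) := by linarith
      _ = 4 / N := by ring
  set D := 4 * (J : ℝ) * ((J : ℝ) - 2 * m - 1) + 4 * (J : ℝ) + 4 / (N : ℝ) + 1
  have h4 : 4 * (J : ℝ) * (1 / (4 * D)) * ((J : ℝ) - 2 * m - 1)
      + (4 * (J : ℝ) + 2 * α + 1) * (1 / (4 * D)) = (D - 4 / N + 2 * α) / (4 * D) := by
    simp only [D]; ring
  have h5 : (D - 4 / N + 2 * α) / (4 * D) ≤ 1 / 4 := by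
    rw [div_le_div_iff₀ (by linarith) (by norm_num)]; linarith
  linarith

lemma sigma_gap_low (hα : α ∈ 𝕀) {j : ℕ} (h1 : 2 ≤ j)
    (h2 : j ≤ 2 * m) : (2 * j : ℕ) * (σ₁ + 𝔰 α (j - 1)) + 𝔰 α (j - 1) ≤ 𝔰 α j := by
  obtain ⟨i, rfl⟩ : ∃ i, j = i + 1 := ⟨j - 1, by omega⟩
  refine le_trans ?_ (sigma_step A (by omega) h2)
  rw [Nat.add_sub_cancel]
  have h3 : σ₁ ≤ 𝔰 α i := sigma_one.symm.le.trans (sigma_mono A hα (by omega))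
  have h4 : ((2 * (i + 1) : ℕ) : ℝ) ≤ 4 * m := by exact_mod_cast (by omega : 2 * (i + 1) ≤ 4 * m)
  have h5 := sigma_nonneg A hα i
  have h6 := add_nonneg (sigmaOne_pos A).le h5
  calc _ ≤ (4 * (m : ℝ)) * (𝔰 α i + 𝔰 α i) + 𝔰 α i := by gcongr
    _ = _ := by ring

lemma sigma_gap_mid (hα : α ∈ 𝕀) {j : ℕ}
    (h : 2 * m + 1 ≤ j) : (2 - N * α) / 2 + (2 * (J : ℝ) + α) * (σ₁ + 𝔰 α (2 * m)) + 𝔰 α (2 * m) ≤ 𝔰 α j := by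
  refine le_trans ?_ (sigma_mono A hα h)
  have h4 := A.four_le
  rw [sigma_high A le_rfl]
  have h3 : σ₁ ≤ 𝔰 α (2 * m) := sigma_one.symm.le.trans (sigma_mono A hα (by omega))
  have := mul_le_mul_of_nonneg_left h3 (add_nonneg (by positivity : 0 ≤ 2 * (J : ℝ)) (alpha_mem A hα).1)
  push_cast
  linarith

lemma sigma_gap_high (hα : α ∈ 𝕀) {j : ℕ}
    (h : 2 * m + 2 ≤ j) : (2 * J : ℕ) * (σ₁ + 𝔰 α (2 * m)) + 𝔰 α (j - 1) ≤ 𝔰 α j := by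
  obtain ⟨i, rfl⟩ : ∃ i, j = i + 1 := ⟨j - 1, by omega⟩
  have h4 := A.four_le
  rw [Nat.add_sub_cancel, sigma_high A (show 2 * m + 1 ≤ i + 1 by omega), sigma_high A (show 2 * m + 1 ≤ i by omega)]
  have h3 : σ₁ ≤ 𝔰 α (2 * m) := sigma_one.symm.le.trans (sigma_mono A hα (by omega))
  have := mul_le_mul_of_nonneg_left h3 (by positivity : 0 ≤ 2 * (J : ℝ))
  push_cast
  linarith

lemma wnorm_eq_norm (f : 𝕏) (β : Idx N J) : wnorm (pE m β.1) (wE k m n β.1) β.1 (fnX A f) = ofReal ‖f.1 β‖ := by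
  rw [show fnX A f = jetX A f 0 from rfl, (sJet_jetX A f).jet.wnorm_eq _ _ _ β.2, ofReal_norm, enorm_def]
  refine eLpNorm_congr_ae ?_
  filter_upwards [jetX_ae A f β] with x hx
  rw [hx, bracket_smul_unW]

end

lemma le_of_decay {s r τ τ' : ℝ} (h0 : 0 < τ') (h1 : τ' ≤ τ) (h2 : τ ≤ 1) (hs : 0 ≤ s) (hr : s ≤ r)
    {w B : ℝ≥0∞} (h : ofReal (τ ^ s) * w ≤ B) : w ≤ ofReal (τ' ^ (-r)) * B := by
  have hτ := h0.trans_le h1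
  have e : ofReal (τ ^ (-s)) * ofReal (τ ^ s) = 1 := by
    rw [← ofReal_mul (by positivity), ← rpow_add hτ, neg_add_cancel, rpow_zero, ofReal_one]
  rw [← one_mul w, ← e, mul_assoc]
  refine mul_le_mul' (ofReal_le_ofReal ?_) h
  exact (Real.rpow_le_rpow_of_nonpos h0 h1 (by linarith)).trans
    (rpow_le_rpow_of_exponent_ge h0 (h1.trans h2) (by linarith))

lemma isGrowthConst (A : Adm N k m n) {C : ℝ} (hC : (cardS N k m n : ℝ) ≤ C) : IsGrowthConst N k m n C := by
  intro α hα b hb T hT v hv _ t ht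
  refine iSup₂_le fun s hs => ?_
  have hbT : b * T < 1 := by have := hT.2; rwa [lt_div_iff₀ hb, mul_comm] at this
  have hbt : b * t ≤ b * T := mul_le_mul_of_nonneg_left ht.2 hb.le
  have hbs : b * s ≤ b * t := mul_le_mul_of_nonneg_left hs.2.le hb.le
  have hb0 : 0 ≤ b * s := mul_nonneg hb.le hs.1.le
  have hsT : s ∈ Icc 0 T := ⟨hs.1.le, hs.2.le.trans ht.2⟩
  have key : ∀ {j : ℕ} {w : ℝ≥0∞}, j ≤ J → decayFactor N k m n α b j s * w ≤ bigPsi N k m n α b T v →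
      w ≤ ofReal ((1 - b * t) ^ (-𝔰 α J)) * bigPsi N k m n α b T v :=
    fun hj h => le_of_decay (by linarith) (by linarith) (by linarith) (sigma_nonneg A hα _) (sigma_mono A hα hj) h
  have hC' : (cardS N k m n : ℝ≥0∞) ≤ ofReal C := (ofReal_natCast _).symm.le.trans (ofReal_le_ofReal hC)
  rw [ofReal_mul (by linarith [(cardS N k m n).cast_nonneg (α := ℝ)]), mul_assoc]
  refine (normS_le_of_wnorm (fun β hβ => key (j := order β) (by unfold bigJ; omega) ?_)
    fun ν μ β h1 h2 h3 => ?_).trans (mul_le_mul_left hC' _)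
  · refine le_trans ?_ ((le_max_left _ _).trans ((le_max_left _ _).trans (le_max_left _ _)))
    unfold phi1
    refine le_iSup₂_of_le s hsT (le_iSup₂_of_le (order β) ⟨Nat.zero_le _, hβ⟩ (mul_le_mul_right ?_ _))
    exact le_iSup₂_of_le (f := fun γ (_ : order γ ≤ order β) => wnorm ∞ n γ (v s)) β le_rfl le_rfl
  · have hw := wnorm_mono (p := 2) (le_wt h1 h2 h3) β (v s)
    have hJ : order β ≤ J := by unfold bigJ; omega
    refine hw.trans (key (j := order β) hJ ?_)
    rcases Nat.lt_or_ge (2 * m + 2 + k) (order β) with h | h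
    · refine le_trans ?_ ((le_max_right _ _).trans (le_max_left _ _))
      unfold phi3
      refine le_iSup₂_of_le s hsT (le_iSup₂_of_le (order β) ⟨by omega, hJ⟩
        (mul_le_mul_right ((wnorm_mono (min_le_right _ _) _ _).trans ?_) _))
      unfold norm3
      exact le_iSup₂_of_le β ⟨by omega, le_rfl⟩ le_rfl
    · refine le_trans ?_ ((le_max_right _ _).trans ((le_max_left _ _).trans (le_max_left _ _)))
      unfold phi2
      refine le_iSup₂_of_le s hsT (le_iSup₂_of_le (order β) ⟨by omega, h⟩
        (mul_le_mul_right ((wnorm_mono (min_le_left _ _) _ _).trans ?_) _))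
      unfold norm2
      exact le_iSup₂_of_le β ⟨by omega, le_rfl⟩ le_rfl

/-! ### The nonlinearity under the bootstrap hypothesis -/

/-- The bounds of the bootstrap argument at the time at which `1 - b t = τ`. -/
structure Cond (α κ τ : ℝ) (f : 𝕏) : Prop where
  upper : ∀ β : Idx N J, ‖f.1 β‖ * τ ^ 𝔰 α (order β.1) ≤ κ
  lower : ∀ x, τ ^ σ₁ ≤ κ * (bracket x ^ n * ‖fnX A f x‖)

section Cond

variable {A : Adm N k m n} {α κ τ : ℝ} {f : XS N k m n} (h : Cond A α κ τ f) (h0 : 0 < τ) (h1 : τ ≤ 1)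
  (hα : α ∈ Icc (alphaMin N) (2 / (N : ℝ)))

include h h0

lemma Cond.norm_le (β : Idx N J) : ‖f.1 β‖ ≤ κ * τ ^ (-𝔰 α (order β.1)) := by
  have := h.upper β
  rw [rpow_neg h0.le, ← div_eq_mul_inv, le_div_iff₀ (by positivity)]
  exact this

include h1 hα

lemma Cond.norm_le_of_le (hκ : 0 ≤ κ) (β : Idx N J) {l : ℕ} (hl : order β.1 ≤ l) : ‖f.1 β‖ ≤ κ * τ ^ (-𝔰 α l) :=
  (h.norm_le h0 β).trans (mul_le_mul_of_nonneg_left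
    (rpow_le_rpow_of_exponent_ge h0 h1 (neg_le_neg (sigma_mono A hα hl))) hκ)

lemma Cond.norm_le_half (hκ : 0 ≤ κ) : ‖f‖ ≤ κ * τ ^ (-(1 / 2) : ℝ) :=
  (pi_norm_le_iff_of_nonneg (by positivity)).2 fun β => (h.norm_le h0 β).trans
    (mul_le_mul_of_nonneg_left (rpow_le_rpow_of_exponent_ge h0 h1 (neg_le_neg (sigma_bigJ_le A hα β.2))) hκ)

lemma Cond.wnorm_low (hκ : 0 ≤ κ) {l : ℕ} (hl : order β ≤ l) (hβ : order β ≤ 2 * m) :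
    wnorm ∞ n β (fnX A f) ≤ ofReal (κ * τ ^ (-𝔰 α l)) := by
  have hJ : order β ≤ J := by unfold bigJ; omega
  have := wnorm_eq_norm A f ⟨β, hJ⟩
  simp only [pE, wE, hβ, if_true] at this
  exact this.le.trans (ofReal_le_ofReal (h.norm_le_of_le h0 h1 hα hκ _ hl))

lemma Cond.wnorm_high (hκ : 0 ≤ κ) {l a : ℕ} (hl : order β ≤ l) (hβ : 2 * m + 1 ≤ order β)
    (hJ : order β ≤ J) (ha : a ≤ wt k m n (order β)) :
    wnorm 2 a β (fnX A f) ≤ ofReal (κ * τ ^ (-𝔰 α l)) := by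
  have := wnorm_eq_norm A f ⟨β, hJ⟩
  simp only [pE, wE, show ¬ order β ≤ 2 * m by omega, if_false] at this
  exact (wnorm_mono ha _ _).trans (this.le.trans (ofReal_le_ofReal (h.norm_le_of_le h0 h1 hα hκ _ hl)))

lemma Cond.norm1_le (hκ : 0 ≤ κ) {l : ℕ} (hl : l ≤ 2 * m) : norm1 n l (fnX A f) ≤ ofReal (κ * τ ^ (-𝔰 α l)) :=
  iSup₂_le fun _ hβ => h.wnorm_low h0 h1 hα hκ hβ (hβ.trans hl)

lemma Cond.norm2_le (hκ : 0 ≤ κ) {l : ℕ} (hl : l ≤ 2 * m + 2 + k) :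
    norm2 m n l (fnX A f) ≤ ofReal (κ * τ ^ (-𝔰 α l)) :=
  iSup₂_le fun β hβ => h.wnorm_high h0 h1 hα hκ hβ.2 hβ.1 (by unfold bigJ; omega) (by simp only [wt, bigJ]; omega)

lemma Cond.norm3_le (hκ : 0 ≤ κ) {l : ℕ} (hl : l ≤ J) : norm3 k m n l (fnX A f) ≤ ofReal (κ * τ ^ (-𝔰 α l)) :=
  iSup₂_le fun β hβ => h.wnorm_high h0 h1 hα hκ hβ.2 (by omega) (hβ.2.trans hl)
    (by unfold bigJ at hl; simp only [wt, bigJ]; omega)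

end Cond

lemma ofReal_term_le {τ X C Θ δ d s₁ s r σ p M : ℝ} (h0 : 0 < τ) (h1 : τ ≤ 1) (hX : 1 ≤ X) (hC : 0 ≤ C)
    (hΘ : 0 ≤ Θ) (hp : 0 ≤ p) (hM : 2 * p + 1 ≤ M) (hσ : p * (s₁ + s) + r + δ ≤ σ + d) {V B w : ℝ≥0∞}
    (hV : V ≤ ofReal (Θ * τ ^ d)) (hB : B ≤ ofReal (X * τ ^ (-s₁) * (X * τ ^ (-s))))
    (hw : w ≤ ofReal (X * τ ^ (-r))) :
    ofReal (τ ^ (-(1 + δ))) * (ofReal C * V * B ^ p * w) ≤ ofReal (C * (Θ * X ^ M) * τ ^ (-(1 + σ))) := by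
  have hX0 : 0 < X := by linarith
  refine (mul_le_mul_right (mul_le_mul' (mul_le_mul' (mul_le_mul_right hV _)
    (ENNReal.rpow_le_rpow hB hp)) hw) _).trans ?_
  rw [ofReal_rpow_of_nonneg (by positivity) hp, ← ofReal_mul hC,
    ← ofReal_mul (by positivity), ← ofReal_mul (by positivity),
    ← ofReal_mul (by positivity)]
  refine ofReal_le_ofReal ?_
  have e1 : (X * τ ^ (-s₁) * (X * τ ^ (-s))) ^ p = X ^ (2 * p) * τ ^ (-(p * (s₁ + s))) := by
    rw [show X * τ ^ (-s₁) * (X * τ ^ (-s)) = X ^ (2 : ℝ) * τ ^ (-(s₁ + s)) by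
      rw [neg_add, rpow_add h0, rpow_two]; ring, mul_rpow (by positivity) (by positivity),
      ← rpow_mul hX0.le, ← rpow_mul h0.le]
    ring_nf
  rw [e1]
  calc _ = C * (Θ * (X ^ (2 * p) * X ^ (1 : ℝ))) * (τ ^ (-(1 + δ)) * τ ^ d * τ ^ (-(p * (s₁ + s))) * τ ^ (-r)) := by
        rw [Real.rpow_one]; ring
    _ = C * (Θ * X ^ (2 * p + 1)) * τ ^ (-(1 + δ) + d + -(p * (s₁ + s)) + -r) := by
        rw [← rpow_add hX0, ← rpow_add h0, ← rpow_add h0, ← rpow_add h0]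
    _ ≤ _ := by
        refine mul_le_mul (mul_le_mul_of_nonneg_left (mul_le_mul_of_nonneg_left
          (Real.rpow_le_rpow_of_exponent_le hX hM) hΘ) hC)
          (rpow_le_rpow_of_exponent_ge h0 h1 (by linarith)) (by positivity) (by positivity)

lemma Cond.nonlinear_le {A : Adm N k m n} {α X τ C Θ : ℝ} {f : 𝕏} (h : Cond A α X τ f)
    (h0 : 0 < τ) (h1 : τ ≤ 1) (hα : α ∈ 𝕀) (hX : 1 ≤ X) (hC : 0 ≤ C)
    (hNL : IsNonlinearConst N k m n C) (hΘ0 : 0 ≤ Θ)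
    (hΘ : ∀ x, ‖fnX A f x‖ ^ α ≤ Θ * τ ^ ((2 - N * α) / 2)) (β : Idx N J) (hβ : 1 ≤ order β.1) :
    ofReal (τ ^ (-(1 + (2 - N * α) / 2))) * wnorm (pE m β.1) (wE k m n β.1) β.1 (powNL α (fnX A f))
      ≤ ofReal (C * (3 * (Θ * X ^ (4 * J + 1 : ℝ)) + X ^ (4 * J + 5 : ℝ)) * τ ^ (-(1 + 𝔰 α (order β.1)))) := by
  have hX0 : 0 < X := by linarith
  have hα2 := alpha_mem A hα
  have hα0 := (alphaMin_pos A).trans_le hα.1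
  have hs := (sigmaOne_pos A).le
  set δ := (2 - N * α) / 2 with hδ
  set η := X * τ ^ (-σ₁) with hη
  have hη1 : 1 ≤ η := one_le_mul_of_one_le_of_one_le hX
    (Real.one_le_rpow_of_pos_of_le_one_of_nonpos h0 h1 (by linarith))
  have hlow : 1 ≤ ofReal η * lowerS n (fnX A f) := by
    have : ofReal η⁻¹ ≤ lowerS n (fnX A f) := le_iInf fun x => ofReal_le_ofReal (by
      have := h.lower x
      rw [hη, mul_inv, ← rpow_neg h0.le, neg_neg, inv_mul_le_iff₀ hX0]
      exact this)
    refine le_trans ?_ (mul_le_mul_right this _)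
    rw [← ofReal_mul (by linarith), mul_inv_cancel₀ (by linarith), ofReal_one]
  have hV : eLpNorm (fnX A f) ∞ ^ α ≤ ofReal (Θ * τ ^ δ) := by
    have hT : 0 ≤ Θ * τ ^ δ := by positivity
    have h2 : eLpNorm (fnX A f) ∞ ≤ ofReal ((Θ * τ ^ δ) ^ α⁻¹) :=
      (eLpNorm_top_le_iff (memS_fnX A f).continuous (by positivity)).2 fun x => by
        have := rpow_le_rpow (by positivity) (hΘ x) (inv_nonneg.2 hα0.le)
        rwa [Real.rpow_rpow_inv (norm_nonneg _) hα0.ne'] at this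
    refine (ENNReal.rpow_le_rpow h2 hα0.le).trans (le_of_eq ?_)
    rw [ofReal_rpow_of_nonneg (by positivity) hα0.le, Real.rpow_inv_rpow hT hα0.ne']
  obtain ⟨H1, H2, H3, H4⟩ := hNL α hα (fnX A f) (memS_fnX A f) η hη1 hlow
  set σ := 𝔰 α (order β.1) with hσ
  have hB : ∀ l ≤ 2 * m, ofReal η * norm1 n l (fnX A f)
      ≤ ofReal (X * τ ^ (-σ₁) * (X * τ ^ (-𝔰 α l))) := fun l hl => by
    rw [ofReal_mul (p := X * τ ^ (-σ₁)) (by positivity)]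
    exact mul_le_mul_right (h.norm1_le h0 h1 hα hX0.le hl) _
  have hM : (1 : ℝ) ≤ 4 * J + 1 := by linarith [(J).cast_nonneg (α := ℝ)]
  have P1 : 0 ≤ C * (Θ * X ^ (4 * J + 1 : ℝ)) * τ ^ (-(1 + σ)) := by positivity
  have P2 : 0 ≤ C * (1 * X ^ (4 * J + 5 : ℝ)) * τ ^ (-(1 + σ)) := by positivity
  have T1 : ∀ {w}, w ≤ ofReal (X * τ ^ (-σ)) → ofReal (τ ^ (-(1 + δ))) * (ofReal C * eLpNorm (fnX A f) ∞ ^ α * w)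
        ≤ ofReal (C * (Θ * X ^ (4 * J + 1 : ℝ)) * τ ^ (-(1 + σ))) := fun {w} hw => by
    have := ofReal_term_le (M := 4 * J + 1) (δ := δ) (σ := σ) (r := σ) h0 h1 hX hC hΘ0
      le_rfl (by linarith) (by linarith) hV
      (hB 0 (Nat.zero_le _)) hw
    rwa [ENNReal.rpow_zero, mul_one] at this
  have T3 : ∀ {j : ℕ}, 2 * m + 2 ≤ order β.1 → j = order β.1 - 1 → ∀ {w},
      w ≤ ofReal (X * τ ^ (-𝔰 α j)) → ofReal (τ ^ (-(1 + δ))) * (ofReal C * eLpNorm (fnX A f) ∞ ^ α *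
          (ofReal η * norm1 n (2 * m) (fnX A f)) ^ (2 * J) * w)
        ≤ ofReal (C * (Θ * X ^ (4 * J + 1 : ℝ)) * τ ^ (-(1 + σ))) := fun {j} hj e {w} hw => by
    have g := sigma_gap_high A hα hj
    rw [← hσ, ← e] at g
    have := ofReal_term_le (M := 4 * J + 1) (δ := δ) (σ := σ) h0 h1 hX hC hΘ0
      (cast_nonneg (2 * J)) (by push_cast; linarith) (by linarith) hV (hB _ le_rfl) hw
    rwa [ENNReal.rpow_natCast] at this
  have T2 : 2 * m + 1 ≤ order β.1 → ofReal (τ ^ (-(1 + δ))) *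
      (ofReal C * (ofReal η * norm1 n (2 * m) (fnX A f)) ^ (2 * (J : ℝ) + α) * norm1 n (2 * m) (fnX A f))
        ≤ ofReal (C * (1 * X ^ (4 * J + 5 : ℝ)) * τ ^ (-(1 + σ))) := fun hj => by
    have g := sigma_gap_mid A hα hj
    rw [← hσ, ← hδ] at g
    have := ofReal_term_le (M := 4 * J + 5) (δ := δ) (σ := σ) (Θ := 1) (d := 0) (V := 1) h0 h1 hX hC zero_le_one
      (by have := hα2.1; positivity : 0 ≤ 2 * (J : ℝ) + α)
      (by linarith [hα2.2]) (by linarith) (by simp) (hB _ le_rfl) (h.norm1_le h0 h1 hα hX0.le le_rfl)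
    rwa [mul_one] at this
  have P3 : C * (3 * (Θ * X ^ (4 * J + 1 : ℝ)) + X ^ (4 * J + 5 : ℝ)) * τ ^ (-(1 + σ))
      = C * (Θ * X ^ (4 * J + 1 : ℝ)) * τ ^ (-(1 + σ)) + C * (1 * X ^ (4 * J + 5 : ℝ)) * τ ^ (-(1 + σ))
        + C * (Θ * X ^ (4 * J + 1 : ℝ)) * τ ^ (-(1 + σ))
        + C * (Θ * X ^ (4 * J + 1 : ℝ)) * τ ^ (-(1 + σ)) := by ring
  rw [P3, ofReal_add (by linarith) P1, ofReal_add (by linarith) P1, ofReal_add P1 P2]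
  rcases Nat.lt_or_ge (2 * m) (order β.1) with hm | hm
  · simp only [pE, wE, show ¬ order β.1 ≤ 2 * m by omega, if_false]
    have t1 := T1 (h.wnorm_high h0 h1 hα hX0.le le_rfl hm β.2 le_rfl)
    rcases Nat.lt_or_ge (2 * m + 2 + k) (order β.1) with hk | hk
    · have e : wt k m n (order β.1) = J - order β.1 := by unfold wt bigJ; omega
      rw [e] at t1 ⊢
      refine (mul_le_mul_right (H4 β.1 (by omega) β.2) _).trans ?_
      rw [mul_add, mul_add, mul_add (ofReal C * _ * _), mul_add, ← add_assoc]
      refine add_le_add (add_le_add (add_le_add t1 (T2 hm)) (T3 (by omega) rfl ?_))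
        (T3 (by omega) rfl (h.norm3_le h0 h1 hα hX0.le ((Nat.sub_le _ _).trans β.2)))
      refine (h.norm2_le h0 h1 hα hX0.le le_rfl).trans (ofReal_le_ofReal
        (mul_le_mul_of_nonneg_left (rpow_le_rpow_of_exponent_ge h0 h1
          (neg_le_neg (sigma_mono A hα (by omega)))) hX0.le))
    · have e : wt k m n (order β.1) = n := by unfold wt bigJ; omega
      rw [e] at t1 ⊢
      refine (mul_le_mul_right (H3 β.1 (by omega) hk) _).trans ?_
      rw [mul_add, mul_add]
      refine (add_le_add (add_le_add t1 (T2 hm)) ?_).trans le_self_add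
      rcases Nat.lt_or_ge (2 * m + 1) (order β.1) with hj | hj
      · exact T3 hj rfl (h.norm2_le h0 h1 hα hX0.le (by omega))
      · have : norm2 m n (order β.1 - 1) (fnX A f) = 0 := by
          simp only [norm2, ENNReal.iSup_eq_zero]
          intro γ hγ; omega
        rw [this, mul_zero, mul_zero]
        exact zero_le
  · simp only [pE, wE, hm, if_true]
    have t1 := T1 (h.wnorm_low h0 h1 hα hX0.le le_rfl hm)
    rcases Nat.lt_or_ge 1 (order β.1) with hj | hj
    · refine (mul_le_mul_right (H2 β.1 hj hm) _).trans ?_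
      rw [mul_add]
      refine add_le_add (t1.trans (le_self_add.trans le_self_add)) ?_
      have g := sigma_gap_low A hα hj hm
      rw [← hσ] at g
      have := ofReal_term_le (M := 4 * J + 1) (δ := δ) (σ := σ) h0 h1 hX hC hΘ0
        (cast_nonneg (2 * order β.1)) (by have : (order β.1 : ℝ) ≤ J := (by exact_mod_cast β.2); push_cast; linarith)
        (by linarith) hV (hB _ (by omega)) (h.norm1_le h0 h1 hα hX0.le (l := order β.1 - 1) (by omega))
      rwa [ENNReal.rpow_natCast] at this
    · exact (mul_le_mul_right (H1 β.1 (by omega)) _).trans (t1.trans (le_self_add.trans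
        (le_self_add.trans le_self_add)))

/-! ### Pointwise estimates of solutions -/

/-- The coefficient of the nonlinearity. -/
def coefNL (N : ℕ) (lam : ℂ) (α b t : ℝ) : ℂ := lam * (((1 - b * t) ^ (-((4 - N * α) / 2)) : ℝ) : ℂ)

lemma coefNL_eq (lam : ℂ) (α b t : ℝ) :
    coefNL N lam α b t = lam * (((1 - b * t) ^ (-(1 + (2 - N * α) / 2)) : ℝ) : ℂ) := by
  unfold coefNL
  ring_nf

lemma hasDerivAt_tau {b s : ℝ} (p : ℝ) (h : 0 < 1 - b * s) :
    HasDerivAt (fun r => (1 - b * r) ^ p) (-(b * p) * (1 - b * s) ^ (p - 1)) s := by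
  have : HasDerivAt (fun r => (1 - b * r) ^ p) (-(b * 1) * p * (1 - b * s) ^ (p - 1)) s :=
    (((hasDerivAt_id s).const_mul b).const_sub 1).rpow_const (Or.inl h.ne')
  rwa [mul_one, neg_mul] at this

lemma le_of_hasDerivAt_nonneg {g : ℝ → ℝ} {t : ℝ} (ht : 0 ≤ t) (hc : ContinuousOn g (Icc 0 t))
    (h : ∀ s ∈ Ioo 0 t, ∃ d, HasDerivAt g d s ∧ 0 ≤ d) : g 0 ≤ g t := by
  refine monotoneOn_of_deriv_nonneg (convex_Icc 0 t) hc ?_ ?_ ⟨le_rfl, ht⟩ ⟨ht, le_rfl⟩ ht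
  all_goals
    rw [interior_Icc]
    intro s hs
    obtain ⟨d, h1, h2⟩ := h s hs
  · exact h1.differentiableAt.differentiableWithinAt
  · rw [h1.deriv]; exact h2

section

variable {A : Adm N k m n} {α b X t : ℝ} {lam : ℂ} {v : ℝ → XS N k m n}
  (hα : α ∈ Icc (alphaMin N) (2 / (N : ℝ))) (hb : 0 < b) (hbt : b * t < 1) (hX : 1 ≤ X)
  (hsol : SolX A (nlX A α) (coefNL N lam α b) (Icc 0 t) v)
  (hC : ∀ s ∈ Icc 0 t, Cond A α X (1 - b * s) (v s)) (x : Sp N)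

lemma Cond.jet_le {κ τ : ℝ} {f : 𝕏} (h : Cond A α κ τ f) (h0 : 0 < τ) (h1 : τ ≤ 1)
    (hα : α ∈ 𝕀) (hκ : 0 ≤ κ) (hβ : order β ≤ 2 * m)
    (x : Sp N) : bracket x ^ n * ‖jetX A f β x‖ ≤ κ * τ ^ (-𝔰 α (order β)) := by
  have := (enorm_le_wnorm_top A f hβ x).trans (h.wnorm_low h0 h1 hα hκ le_rfl hβ)
  rwa [← ofReal_norm_eq_enorm, ofReal_le_ofReal_iff (by positivity), norm_wsmul] at this

include hα hb hbt hX hsol hC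

lemma exists_log_deriv {s : ℝ} (hs : s ∈ Ioo 0 t) :
    ∃ ρ, HasDerivAt (fun r => log ‖fnX A (v r) x‖) ρ s ∧
      |ρ - lam.re * ((1 - b * s) ^ (-(1 + (2 - N * α) / 2)) * ‖fnX A (v s) x‖ ^ α)|
        ≤ N * X ^ 2 * (1 - b * s) ^ (-(1 / 2) : ℝ) := by
  have hsI : s ∈ Icc 0 t := ⟨hs.1.le, hs.2.le⟩
  obtain ⟨c, hc, hlow⟩ := hsol.lower
  have hu := (hsol.eqn s hsI x).hasDerivAt (Icc_mem_nhds hs.1 hs.2)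
  rw [fnX_nlX A hα.1 hc (hlow s hsI), coefNL_eq] at hu
  have hτ1 : 1 - b * s ≤ 1 := by have := mul_pos hb hs.1; linarith
  have hτ : 0 < 1 - b * s := by have := mul_lt_mul_of_pos_left hs.2 hb; linarith
  have hlo := (hC s hsI).lower x
  have hJ := fun i => (hC s hsI).jet_le hτ hτ1 hα (by linarith) (order_two_le' A i) x
  set τ := 1 - b * s
  set hh := τ ^ (-(1 + (2 - N * α) / 2))
  have hbr := pow_pos (bracket_pos x) n
  have hu0 : 0 < ‖fnX A (v s) x‖ := by
    have := hc.trans_le (hlow s hsI x)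
    exact pos_of_mul_pos_right this hbr.le
  have e1 := (hu.norm_sq.log (by positivity)).div_const 2
  refine ⟨_, e1.congr_of_eventuallyEq (of_forall fun r => ?_), ?_⟩
  · simp only [Real.log_pow]; push_cast; ring
  simp only [powNL]
  set u := fnX A (v s) x
  have e2 : inner ℝ u (lam * (hh : ℂ) * (((‖u‖ ^ α : ℝ) : ℂ) * u)) = lam.re * (hh * ‖u‖ ^ α) * ‖u‖ ^ 2 := by
    rw [Complex.inner, show lam * (hh : ℂ) * (((‖u‖ ^ α : ℝ) : ℂ) * u) * conj u
      = lam * (hh * ‖u‖ ^ α : ℝ) * (u * conj u) by push_cast; ring, Complex.mul_conj, Complex.normSq_eq_norm_sq,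
      mul_assoc, ← Complex.ofReal_mul, Complex.re_mul_ofReal]
    ring
  rw [inner_add_right, e2]
  set L := lapX A (v s) x with hL
  have e3 : 2 * (inner ℝ u (I * L) + lam.re * (hh * ‖u‖ ^ α) * ‖u‖ ^ 2) / ‖u‖ ^ 2 / 2
      - lam.re * (hh * ‖u‖ ^ α) = inner ℝ u (I * L) / ‖u‖ ^ 2 := by field_simp; ring
  rw [e3, abs_div, abs_of_pos (by positivity : 0 < ‖u‖ ^ 2), div_le_iff₀ (by positivity)]
  refine (abs_real_inner_le_norm _ _).trans ?_
  rw [norm_mul, norm_I, one_mul]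
  have e4 : bracket x ^ n * ‖L‖ ≤ N * (X * τ ^ (-𝔰 α 2)) := by
    refine (mul_le_mul_of_nonneg_left (norm_sum_le _ _) hbr.le).trans ?_
    rw [mul_sum]
    refine (sum_le_card_nsmul _ _ (X * τ ^ (-𝔰 α 2)) fun i _ => (hJ i).trans (le_of_eq ?_)).trans (le_of_eq (by simp))
    rw [order_add_single, order_add_single, order_zero]
  have hg := sigma_gap_mid A hα le_rfl
  have h3 := (sigma_bigJ_le A hα (show 2 * m + 1 ≤ J by unfold bigJ; omega))
  have h4 : 𝔰 α 2 ≤ _ := sigma_mono A hα (by have := A.four_le; omega : 2 ≤ 2 * m)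
  have h5 := (delta_mem A hα).1
  have h6 := sigma_nonneg A hα (2 * m)
  have h7 := (sigmaOne_pos A).le
  have h8 : (1 : ℝ) ≤ 2 * J + α := by
    rw [bigJ_cast]
    linarith [(alpha_mem A hα).1, m.cast_nonneg (α := ℝ), k.cast_nonneg (α := ℝ), n.cast_nonneg (α := ℝ)]
  have h9 := le_mul_of_one_le_left (add_nonneg h7 h6) h8
  have e5 : X * τ ^ (-𝔰 α 2) ≤ X ^ 2 * τ ^ (-(1 / 2) : ℝ) * (bracket x ^ n * ‖u‖) := by
    calc _ ≤ X * (τ ^ (-(1 / 2) : ℝ) * τ ^ σ₁) := by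
          rw [← rpow_add hτ]
          exact mul_le_mul_of_nonneg_left (rpow_le_rpow_of_exponent_ge hτ hτ1 (by linarith)) (by linarith)
      _ ≤ X * (τ ^ (-(1 / 2) : ℝ) * (X * (bracket x ^ n * ‖u‖))) := by gcongr
      _ = _ := by ring
  have e6 : bracket x ^ n * ‖L‖ ≤ bracket x ^ n * (N * X ^ 2 * τ ^ (-(1 / 2) : ℝ) * ‖u‖) := by
    refine e4.trans ((mul_le_mul_of_nonneg_left e5 N.cast_nonneg).trans (le_of_eq (by ring)))
  have e7 := mul_le_mul_of_nonneg_left (le_of_mul_le_mul_left e6 hbr) hu0.le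
  linarith

omit hX hC in
lemma continuousOn_log : ContinuousOn (fun r => log ‖fnX A (v r) x‖) (Icc 0 t) := by
  obtain ⟨c, hc, hlow⟩ := hsol.lower
  refine ContinuousOn.log (((continuous_jetX A (by rw [order_zero]; omega) x).comp_continuousOn
    hsol.cont).norm) fun s hs h => ?_
  have := hlow s hs x
  change bracket x ^ n * ‖fnX A (v s) x‖ ≥ c at this
  rw [h, mul_zero] at this
  linarith

/-- Upper and lower bounds of solutions under the bootstrap hypothesis. -/
lemma exp_bounds (ht : 0 ≤ t) (hlam : lam.re < 0) (hα' : α < 2 / N) {c : ℝ} (hc : c = 2 * N * X ^ 2 / b) :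
    ‖fnX A (v t) x‖ ≤ exp c * ‖fnX A (v 0) x‖ ∧
    (∀ M, ‖fnX A (v 0) x‖ ^ α ≤ M → b * ((2 - N * α) / 2) / (α * |lam.re|) ≤ M →
      ‖fnX A (v t) x‖ ^ α ≤ exp (α * c) * M * (1 - b * t) ^ ((2 - N * α) / 2)) ∧
    ∀ Θ, |lam.re| * Θ ≤ b * σ₁ → (∀ s ∈ Icc 0 t, ‖fnX A (v s) x‖ ^ α ≤ Θ * (1 - b * s) ^ ((2 - N * α) / 2)) →
      (1 - b * t) ^ σ₁ * ‖fnX A (v 0) x‖ ≤ exp c * ‖fnX A (v t) x‖ := by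
  have hN : (1 : ℝ) ≤ N := by exact_mod_cast A.one_le
  have hα0 := (alphaMin_pos A).trans_le hα.1
  have hδ : 0 < (2 - N * α) / 2 := by
    rw [lt_div_iff₀ (by linarith)] at hα'; linarith
  have hR : 0 < |lam.re| := abs_pos.2 hlam.ne
  have hRe : lam.re = -|lam.re| := by rw [abs_of_neg hlam, neg_neg]
  have hc0 : 0 ≤ c := by rw [hc]; positivity
  have hder := fun s hs => exists_log_deriv hα hb hbt hX hsol hC x (s := s) hs
  have hcl := continuousOn_log hα hb hbt hsol x
  have hτ : ∀ s ∈ Icc 0 t, 0 < 1 - b * s := fun s hs => by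
    have := mul_le_mul_of_nonneg_left hs.2 hb.le; linarith
  obtain ⟨c₀, hc₀, hlow⟩ := hsol.lower
  have hpos : ∀ s ∈ Icc 0 t, 0 < ‖fnX A (v s) x‖ := fun s hs =>
    pos_of_mul_pos_right (hc₀.trans_le (hlow s hs x)) (pow_pos (bracket_pos x) n).le
  have hp0 := hpos 0 ⟨le_rfl, ht⟩
  have hpt := hpos t ⟨ht, le_rfl⟩
  have hcp : ∀ p : ℝ, ContinuousOn (fun s => (1 - b * s) ^ p) (Icc 0 t) := fun p s hs =>
    (hasDerivAt_tau p (hτ s hs)).continuousAt.continuousWithinAt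
  set l := fun s => log ‖fnX A (v s) x‖ with hl
  have hle : ∀ s ∈ Icc 0 t, exp (l s) = ‖fnX A (v s) x‖ := fun s hs => Real.exp_log (hpos s hs)
  set E := fun s => c * (1 - (1 - b * s) ^ (1 / 2 : ℝ)) with hE
  have hEd : ∀ s ∈ Ioo 0 t, HasDerivAt E (N * X ^ 2 * (1 - b * s) ^ (-(1 / 2) : ℝ)) s := fun s hs => by
    have := ((hasDerivAt_tau (1 / 2) (hτ s ⟨hs.1.le, hs.2.le⟩)).const_sub 1).const_mul c
    rwa [show c * -(-(b * (1 / 2)) * (1 - b * s) ^ ((1 / 2 : ℝ) - 1))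
      = N * X ^ 2 * (1 - b * s) ^ (-(1 / 2) : ℝ) by rw [hc]; norm_num; field_simp] at this
  have hcE : ContinuousOn E (Icc 0 t) := (continuousOn_const.sub (hcp _)).const_mul c
  have hE0 : E 0 = 0 := by simp [hE]
  have hEt : E t ≤ c := by
    have := rpow_nonneg (hτ t ⟨ht, le_rfl⟩).le (1 / 2)
    simp only [hE]; nlinarith
  refine ⟨?_, fun M hM1 hM2 => ?_, fun Θ hΘ hy => ?_⟩
  · have := le_of_hasDerivAt_nonneg ht (hcE.sub hcl) fun s hs => by
      obtain ⟨ρ, h1, h2⟩ := hder s hs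
      refine ⟨_, (hEd s hs).sub h1, ?_⟩
      have h3 := (abs_le.1 h2).2
      have h4 : 0 ≤ |lam.re| * ((1 - b * s) ^ (-(1 + (2 - N * α) / 2)) * ‖fnX A (v s) x‖ ^ α) := by
        have := (hτ s ⟨hs.1.le, hs.2.le⟩).le; positivity
      rw [hRe] at h3
      linarith
    simp only [Pi.sub_apply, hE0] at this
    rw [← hle t ⟨ht, le_rfl⟩, ← hle 0 ⟨le_rfl, ht⟩, ← exp_add, exp_le_exp]
    linarith
  · set δ := (2 - N * α) / 2
    set κ := α * |lam.re| / (b * δ) with hκ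
    have hτt := hτ t ⟨ht, le_rfl⟩
    have hτt1 : 1 - b * t ≤ 1 := by have := mul_nonneg hb.le ht; linarith
    have hα1 : ∀ s ∈ Icc 0 t, exp (α * l s) = ‖fnX A (v s) x‖ ^ α := fun s hs => by
      rw [Real.rpow_def_of_pos (hpos s hs), mul_comm]
    have := le_of_hasDerivAt_nonneg (g := fun s => exp (α * (E s - l s)) - κ * (1 - b * s) ^ (-δ)) ht
      (((hcE.sub hcl).const_mul α).rexp.sub ((hcp _).const_mul κ)) fun s hs => by
        have hsI : s ∈ Icc 0 t := ⟨hs.1.le, hs.2.le⟩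
        obtain ⟨ρ, h1, h2⟩ := hder s hs
        refine ⟨_, ((((hEd s hs).sub h1).const_mul α).exp).sub ((hasDerivAt_tau (-δ) (hτ s hsI)).const_mul κ), ?_⟩
        have h3 := (abs_le.1 h2).2
        simp only [Pi.sub_apply]
        have hh := (rpow_pos_of_pos (hτ s hsI) (-(1 + δ)))
        have e1 : κ * (-(b * -δ) * (1 - b * s) ^ (-δ - 1)) = α * |lam.re| * (1 - b * s) ^ (-(1 + δ)) := by
          rw [hκ, show -δ - 1 = -(1 + δ) by ring]; field_simp
        have e2 : exp (α * (E s - l s)) * ‖fnX A (v s) x‖ ^ α = exp (α * E s) := by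
          rw [← hα1 s hsI, ← exp_add]; ring_nf
        have e3 : 1 ≤ exp (α * E s) := Real.one_le_exp (mul_nonneg hα0.le (mul_nonneg hc0
          (sub_nonneg.2 (rpow_le_one (hτ s hsI).le (by nlinarith [hs.1]) (by norm_num)))))
        rw [e1]
        have h5 : |lam.re| * ((1 - b * s) ^ (-(1 + δ)) * ‖fnX A (v s) x‖ ^ α)
          ≤ N * X ^ 2 * (1 - b * s) ^ (-(1 / 2) : ℝ) - ρ := by rw [hRe] at h3; linarith
        have h6 := mul_le_mul_of_nonneg_left h5 (mul_pos (exp_pos (α * (E s - l s))) hα0).le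
        have h7 := mul_le_mul_of_nonneg_left e3 (by positivity : 0 ≤ α * |lam.re| * (1 - b * s) ^ (-(1 + δ)))
        rw [← e2] at h7
        linarith
    simp only [hE0, mul_zero, sub_zero, one_rpow, zero_sub, mul_one] at this
    have hM0 : 0 < M := (rpow_pos_of_pos hp0 α).trans_le hM1
    have e4 : exp (α * -l 0) = (‖fnX A (v 0) x‖ ^ α)⁻¹ := by rw [← hα1 0 ⟨le_rfl, ht⟩, mul_neg, exp_neg]
    have e5 : exp (α * (E t - l t)) = exp (α * E t) * (‖fnX A (v t) x‖ ^ α)⁻¹ := by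
      rw [← hα1 t ⟨ht, le_rfl⟩, ← exp_neg, ← exp_add]; ring_nf
    have e6 : M⁻¹ ≤ (‖fnX A (v 0) x‖ ^ α)⁻¹ := inv_anti₀ (by positivity) hM1
    have e7 : M⁻¹ ≤ κ := by rw [hκ, ← inv_div]; exact inv_anti₀ (by positivity) hM2
    have e8 : 1 ≤ (1 - b * t) ^ (-δ) := Real.one_le_rpow_of_pos_of_le_one_of_nonpos hτt hτt1 (by linarith)
    rw [e4, e5] at this
    have e9 : M⁻¹ * (1 - b * t) ^ (-δ) ≤ exp (α * E t) * (‖fnX A (v t) x‖ ^ α)⁻¹ := by nlinarith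
    rw [rpow_neg hτt.le, ← mul_inv, ← div_eq_mul_inv, le_div_iff₀ (by positivity),
      inv_mul_le_iff₀ (by positivity)] at e9
    refine e9.trans ?_
    have : exp (α * E t) ≤ exp (α * c) := exp_le_exp.2 (mul_le_mul_of_nonneg_left hEt hα0.le)
    calc _ ≤ M * (1 - b * t) ^ δ * exp (α * c) := by gcongr
      _ = _ := by ring
  · have := le_of_hasDerivAt_nonneg ht ((hcl.add hcE).sub (((continuousOn_const.sub
      (continuousOn_id.const_mul b)).log fun s hs => (hτ s hs).ne').const_mul (σ₁)))
      fun s hs => by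
        have hsI : s ∈ Icc 0 t := ⟨hs.1.le, hs.2.le⟩
        obtain ⟨ρ, h1, h2⟩ := hder s hs
        have hs0 := hτ s hsI
        refine ⟨_, (h1.add (hEd s hs)).sub (((((hasDerivAt_id s).const_mul b).const_sub 1).log
          hs0.ne').const_mul (σ₁)), ?_⟩
        have h3 := (abs_le.1 h2).1
        have h4 := mul_le_mul_of_nonneg_left (hy s hsI)
          (mul_nonneg hR.le (rpow_nonneg hs0.le (-(1 + (2 - N * α) / 2))))
        have e1 : (1 - b * s) ^ (-(1 + (2 - N * α) / 2)) * (1 - b * s) ^ ((2 - N * α) / 2) = (1 - b * s)⁻¹ := by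
          rw [← rpow_add hs0, ← Real.rpow_neg_one]; ring_nf
        have h5 := mul_le_mul_of_nonneg_right hΘ (inv_pos.2 hs0).le
        rw [hRe] at h3
        have h6 : |lam.re| * ((1 - b * s) ^ (-(1 + (2 - N * α) / 2)) * ‖fnX A (v s) x‖ ^ α)
            ≤ b * σ₁ * (1 - b * s)⁻¹ := by
          refine le_trans ?_ h5
          rw [← e1]
          linarith
        rw [id_eq, mul_one, neg_div, div_eq_mul_inv b]
        linarith
    simp only [Pi.sub_apply, Pi.add_apply, hE0, mul_zero, sub_zero, Real.log_one, add_zero, id_eq] at this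
    rw [← hle t ⟨ht, le_rfl⟩, ← hle 0 ⟨le_rfl, ht⟩, Real.rpow_def_of_pos (hτ t ⟨ht, le_rfl⟩),
      ← exp_add, ← exp_add, exp_le_exp]
    linarith

end

/-! ### The bootstrap argument -/

lemma linear_est {v f : ℝ → 𝕏} {T : ℝ} (hv : ContinuousOn v (Icc 0 T))
    (hf : ContinuousOn f (Icc 0 T)) (H : ∀ t ∈ Icc 0 T, ∀ x, HasDerivWithinAt (fun s => fnX A (v s) x)
      (I * lapX A (v t) x + fnX A (f t) x) (Icc 0 T) t) {t : ℝ} (ht : t ∈ Icc 0 T)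
    (β : Idx N J) :
    ofReal ‖(v t).1 β‖ ≤ normS N k m n (fnX A (v 0)) + ofReal (linC A) *
      ∫⁻ s in Icc 0 t, (normS N k m n (fnX A (v s)) + ofReal ‖(f s).1 β‖) := by
  have h := linear_bounds A hv hf H ht
  simp only [← wnorm_eq_norm A]
  by_cases hβ : order β.1 ≤ 2 * m
  · simp only [pE, wE, hβ, if_true]
    exact h.1 _ hβ
  · simp only [pE, wE, hβ, if_false]
    exact h.2 _ _ (by omega) β.2 le_rfl

lemma SolX.mono {A : Adm N k m n} {F : 𝕏 → 𝕏} {h : ℝ → ℂ} {I I' : Set ℝ}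
    {v : ℝ → 𝕏} (H : SolX A F h I v) (hI : I' ⊆ I) : SolX A F h I' v :=
  ⟨H.cont.mono hI, fun r hr x => (H.eqn r (hI hr) x).mono hI,
    H.lower.imp fun _ hc => ⟨hc.1, fun r hr => hc.2 r (hI hr)⟩⟩

lemma setLIntegral_tau_le {b t a c σ : ℝ} (hb : 0 < b) (ht : 0 ≤ t) (hbt : b * t < 1) (hσ : 0 < σ)
    (ha : 0 ≤ a) (hc : 0 ≤ c) : ∫⁻ s in Icc 0 t,
      ofReal (a * (1 - b * s) ^ (-(1 / 2) : ℝ) + c * (1 - b * s) ^ (-(1 + σ)))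
      ≤ ofReal (2 * a / b + c / (b * σ) * (1 - b * t) ^ (-σ)) := by
  have hτ : ∀ s ∈ uIcc 0 t, 0 < 1 - b * s := fun s hs => by
    rw [uIcc_of_le ht] at hs
    have := mul_le_mul_of_nonneg_left hs.2 hb.le; linarith
  have hcont : ContinuousOn (fun s => a * (1 - b * s) ^ (-(1 / 2) : ℝ) + c * (1 - b * s) ^ (-(1 + σ)))
      (uIcc 0 t) := fun s hs => by
    have h := fun p : ℝ => (hasDerivAt_tau p (hτ s hs)).continuousAt
    exact (((h _).const_mul a).add ((h _).const_mul c)).continuousWithinAt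
  have hd : ∀ s ∈ uIcc 0 t, HasDerivAt
      (fun s => c / (b * σ) * (1 - b * s) ^ (-σ) - 2 * a / b * (1 - b * s) ^ (1 / 2 : ℝ))
      (a * (1 - b * s) ^ (-(1 / 2) : ℝ) + c * (1 - b * s) ^ (-(1 + σ))) s := fun s hs => by
    have := ((hasDerivAt_tau (-σ) (hτ s hs)).const_mul (c / (b * σ))).sub
      ((hasDerivAt_tau (1 / 2) (hτ s hs)).const_mul (2 * a / b))
    refine this.congr_deriv ?_
    rw [show -σ - 1 = -(1 + σ) by ring, show (1 / 2 : ℝ) - 1 = -(1 / 2) by norm_num]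
    field_simp
    ring
  rw [setLIntegral_congr Ioc_ae_eq_Icc.symm, ← ofReal_integral_eq_lintegral_ofReal,
    ← intervalIntegral.integral_of_le ht,
    intervalIntegral.integral_eq_sub_of_hasDerivAt hd hcont.intervalIntegrable]
  · refine ofReal_le_ofReal ?_
    have h1 := rpow_nonneg (hτ t right_mem_uIcc).le (1 / 2)
    have h2 : 0 ≤ 2 * a / b := by positivity
    have h3 : 0 ≤ c / (b * σ) := by positivity
    simp only [mul_zero, sub_zero, one_rpow, mul_one]
    nlinarith [mul_nonneg h2 h1]
  · exact (intervalIntegrable_iff_integrableOn_Ioc_of_le ht).1 hcont.intervalIntegrable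
  · refine ae_restrict_of_forall_mem measurableSet_Ioc fun s hs => ?_
    have := hτ s (by rw [uIcc_of_le ht]; exact ⟨hs.1.le, hs.2⟩)
    positivity

/-- The conditions on the initial value. -/
structure Init (K : ℝ) (f : 𝕏) : Prop where
  upper : normS N k m n (fnX A f) ≤ ofReal K
  lower : ∀ x, 1 ≤ K * (bracket x ^ n * ‖fnX A f x‖)

/-- The conditions on the parameters that are used in the bootstrap argument. -/
structure Small (lam : ℂ) (α b K C M : ℝ) : Prop where
  hα : α ∈ 𝕀
  hα' : α < 2 / N
  hb : 0 < b
  hK : 1 ≤ K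
  hC : 0 ≤ C
  hNL : IsNonlinearConst N k m n C
  hlam : lam.re < 0
  exp_le : exp (2 * N * (4 * K) ^ 2 / b) ≤ 2
  le_M : K ^ α ≤ M
  le_M' : b * ((2 - N * α) / 2) / (α * |lam.re|) ≤ M
  sigma_le : |lam.re| * (exp (α * (2 * N * (4 * K) ^ 2 / b)) * M) ≤ b * σ₁
  norm_le : linC A * (2 * (cardS N k m n * (4 * K)) / b) ≤ K
  nl_le : linC A * (‖lam‖ * (C * (3 * ((exp (α * (2 * N * (4 * K) ^ 2 / b)) * M)
    * (4 * K) ^ (4 * J + 1 : ℝ)) + (4 * K) ^ (4 * J + 5 : ℝ)))) ≤ K * (b * σ₁)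

section

variable {A : Adm N k m n} {α b K C M t : ℝ} {lam : ℂ} {v : ℝ → XS N k m n} (S : Small A lam α b K C M)
include S

lemma Small.continuousOn_coefNL {T : ℝ} (hbT : b * T < 1) : ContinuousOn (coefNL N lam α b) (Icc 0 T) :=
  fun s hs => by
    have : 0 < 1 - b * s := by have := mul_le_mul_of_nonneg_left hs.2 S.hb.le; linarith
    exact (continuousAt_const.mul (continuous_ofReal.continuousAt.comp
      (hasDerivAt_tau _ this).continuousAt)).continuousWithinAt

lemma SolX.continuousOn_nl {T : ℝ} (hbT : b * T < 1) (hsol : SolX A (nlX A α) (coefNL N lam α b) (Icc 0 T) v) :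
    ContinuousOn (fun t => coefNL N lam α b t • nlX A α (v t)) (Icc 0 T) := by
  obtain ⟨c, hc, hl⟩ := hsol.lower
  obtain ⟨R, hR⟩ := isCompact_Icc.exists_bound_of_continuousOn hsol.cont
  have hc : ContinuousOn (fun t => nlX A α (v t)) (Icc 0 T) :=
    ((regLip_nlX A S.hα.1).continuousOn (R := R) hc).comp hsol.cont fun s hs => ⟨hR s hs, hl s hs⟩
  exact (S.continuousOn_coefNL hbT).smul hc

lemma Cond.improve (ht : 0 ≤ t) (hbt : b * t < 1)
    (hsol : SolX A (nlX A α) (coefNL N lam α b) (Icc 0 t) v) (h0 : Init A K (v 0))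
    (hC : ∀ s ∈ Icc 0 t, Cond A α (4 * K) (1 - b * s) (v s)) : Cond A α (3 * K) (1 - b * t) (v t) := by
  have hK := S.hK
  have hX : 1 ≤ 4 * K := by linarith
  have hτ : ∀ s ∈ Icc 0 t, 0 < 1 - b * s := fun s hs => by
    have := mul_le_mul_of_nonneg_left hs.2 S.hb.le; linarith
  have hτ1 : ∀ s ∈ Icc 0 t, 1 - b * s ≤ 1 := fun s hs => by
    have := mul_nonneg S.hb.le hs.1; linarith
  have htt : t ∈ Icc 0 t := ⟨ht, le_rfl⟩
  have hα0 := (alphaMin_pos A).trans_le S.hα.1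
  have hsub : ∀ s ∈ Icc 0 t, Icc 0 s ⊆ Icc 0 t := fun s hs => Icc_subset_Icc_right hs.2
  have hbnd := fun s (hs : s ∈ Icc 0 t) x => exp_bounds (t := s) S.hα S.hb (by linarith [hτ s hs]) hX
    (hsol.mono (hsub s hs))
    (fun r hr => hC r (hsub s hs hr)) x hs.1 S.hlam S.hα' rfl
  have hv0 : ∀ x, bracket x ^ n * ‖fnX A (v 0) x‖ ≤ K := fun x => by
    have := (enorm_le_wnorm_top A (v 0) (β := 0) (by simp [order_zero]) x).trans
      ((wnorm_low_le_normS (by simp [order_zero])).trans h0.upper)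
    rwa [← ofReal_norm_eq_enorm, ofReal_le_ofReal_iff (by linarith), norm_wsmul] at this
  set e := exp (2 * N * (4 * K) ^ 2 / b)
  set Θ := exp (α * (2 * N * (4 * K) ^ 2 / b)) * M with hΘ
  have hM : 0 ≤ M := (rpow_nonneg (by linarith) _).trans S.le_M
  have hΘ0 : 0 ≤ Θ := by positivity
  have hpw : ∀ s ∈ Icc 0 t, ∀ x, ‖fnX A (v s) x‖ ^ α ≤ Θ * (1 - b * s) ^ ((2 - N * α) / 2) := fun s hs x =>
    (hbnd s hs x).2.1 M ((rpow_le_rpow (norm_nonneg _) ((le_mul_of_one_le_left (norm_nonneg _)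
      (one_le_pow₀ (one_le_bracket x))).trans (hv0 x)) hα0.le).trans S.le_M) S.le_M'
  have hbr := fun x : Sp N => pow_pos (bracket_pos x) n
  have he := S.exp_le
  refine ⟨fun β => ?_, fun x => ?_⟩
  · rcases Nat.eq_zero_or_pos (order β.1) with hβ | hβ
    · rw [hβ, sigma_zero, rpow_zero, mul_one, ← ofReal_le_ofReal_iff (by linarith), ← wnorm_eq_norm A]
      have h2 : order β.1 ≤ 2 * m := by omega
      have h3 : β.1 = 0 := order_eq_zero.1 hβ
      simp only [pE, wE, h2, if_true]
      refine ((sJet_jetX A (v t)).jet.wnorm_eq _ _ _ β.2).le.trans ?_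
      rw [h3]
      refine (eLpNorm_top_le_iff (continuous_bracket_smul (jetX_continuous A (v t) (by simp [order_zero])) n)
        (by linarith)).2 fun x => ?_
      rw [norm_wsmul]
      refine (mul_le_mul_of_nonneg_left (hbnd t htt x).1 (hbr x).le).trans ?_
      calc bracket x ^ n * (e * ‖fnX A (v 0) x‖) = e * (bracket x ^ n * ‖fnX A (v 0) x‖) := by ring
        _ ≤ 2 * K := mul_le_mul he (hv0 x) (mul_nonneg (hbr x).le (norm_nonneg _)) (by norm_num)
        _ ≤ 3 * K := by linarith
    · have hσ1 := sigmaOne_pos A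
      have hσ : σ₁ ≤ 𝔰 α (order β.1) := sigma_one.symm.le.trans (sigma_mono A S.hα hβ)
      have h1 := linear_est A hsol.cont (hsol.continuousOn_nl S hbt) (fun s hs x => by
        rw [fnX_smul]; exact hsol.eqn s hs x) htt β
      set σ := 𝔰 α (order β.1)
      set Y := ‖lam‖ * (C * (3 * (Θ * (4 * K) ^ (4 * J + 1 : ℝ)) + (4 * K) ^ (4 * J + 5 : ℝ))) with hY
      have hC0 := S.hC
      have hL := one_le_linC A
      have hb := S.hb
      have hY0 : 0 ≤ Y := by positivity
      have hcard : (0 : ℝ) ≤ cardS N k m n := cast_nonneg _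
      have h2 : ∀ s ∈ Icc 0 t, normS N k m n (fnX A (v s)) + ofReal ‖(coefNL N lam α b s • nlX A α (v s)).1 β‖
          ≤ ofReal (cardS N k m n * (4 * K) * (1 - b * s) ^ (-(1 / 2) : ℝ) + Y * (1 - b * s) ^ (-(1 + σ))) := by
        intro s hs
        have hτs := hτ s hs
        obtain ⟨c, hc, hl⟩ := hsol.lower
        rw [ofReal_add (by positivity) (by positivity)]
        refine add_le_add ((normS_le_norm A _).trans (ofReal_le_ofReal ?_)) ?_
        · rw [mul_assoc]
          exact mul_le_mul_of_nonneg_left ((hC s hs).norm_le_half hτs (hτ1 s hs) S.hα (by linarith)) hcard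
        · have := (hC s hs).nonlinear_le hτs (hτ1 s hs) S.hα hX hC0 S.hNL hΘ0 (hpw s hs) β hβ
          rw [← fnX_nlX A S.hα.1 hc (hl s hs), wnorm_eq_norm] at this
          rw [show (coefNL N lam α b s • nlX A α (v s)).1 β = coefNL N lam α b s • (nlX A α (v s)).1 β from rfl,
            norm_smul, coefNL_eq, norm_mul, norm_real, norm_of_nonneg (by positivity), hY, mul_assoc,
            mul_assoc ‖lam‖, ofReal_mul (norm_nonneg _), ofReal_mul (norm_nonneg _),
            ofReal_mul (by positivity)]
          exact mul_le_mul_right this _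
      have h3 := h1.trans (add_le_add h0.upper (mul_le_mul_right ((setLIntegral_mono' measurableSet_Icc h2).trans
        (setLIntegral_tau_le hb ht hbt (hσ1.trans_le hσ) (by positivity) hY0)) _))
      have hτt := hτ t htt
      have hσ0 := hσ1.trans_le hσ
      rw [← ofReal_mul (by linarith), ← ofReal_add (by linarith) (by positivity),
        ofReal_le_ofReal_iff (by positivity)] at h3
      have hp : 0 < (1 - b * t) ^ σ := by positivity
      have hp1 : (1 - b * t) ^ σ ≤ 1 := rpow_le_one hτt.le (hτ1 t htt) hσ0.le
      have h4 : linC A * (Y / (b * σ)) ≤ K := by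
        rw [← mul_div_assoc, div_le_iff₀ (by positivity)]
        exact S.nl_le.trans (by gcongr)
      refine (mul_le_mul_of_nonneg_right h3 hp.le).trans ?_
      have h5 : (1 - b * t) ^ (-σ) * (1 - b * t) ^ σ = 1 := by rw [← rpow_add hτt, neg_add_cancel, rpow_zero]
      have h6 := S.norm_le
      calc _ = (K + linC A * (2 * (cardS N k m n * (4 * K)) / b)) * (1 - b * t) ^ σ
            + linC A * (Y / (b * σ)) * ((1 - b * t) ^ (-σ) * (1 - b * t) ^ σ) := by ring
        _ ≤ (K + linC A * (2 * (cardS N k m n * (4 * K)) / b)) * 1 + K * 1 := by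
          rw [h5]
          refine add_le_add (mul_le_mul_of_nonneg_left hp1 (by positivity)) (by linarith)
        _ ≤ 3 * K := by linarith
  · have h1 := (hbnd t htt x).2.2 Θ S.sigma_le fun s hs => hpw s hs x
    have h2 := h0.lower x
    have hp := rpow_nonneg (hτ t htt).le (σ₁)
    calc (1 - b * t) ^ σ₁ ≤ (1 - b * t) ^ σ₁ * (K * (bracket x ^ n * ‖fnX A (v 0) x‖)) :=
          le_mul_of_one_le_right hp h2
      _ = K * bracket x ^ n * ((1 - b * t) ^ σ₁ * ‖fnX A (v 0) x‖) := by ring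
      _ ≤ K * bracket x ^ n * (2 * ‖fnX A (v t) x‖) := mul_le_mul_of_nonneg_left
          (h1.trans (mul_le_mul_of_nonneg_right he (norm_nonneg _))) (mul_nonneg (by linarith) (hbr x).le)
      _ = 2 * (K * (bracket x ^ n * ‖fnX A (v t) x‖)) := by ring
      _ ≤ 3 * K * (bracket x ^ n * ‖fnX A (v t) x‖) := by
        have : 0 ≤ K * (bracket x ^ n * ‖fnX A (v t) x‖) :=
          mul_nonneg (by linarith) (mul_nonneg (hbr x).le (norm_nonneg _))
        linarith

end

lemma Icc_subset_of_bootstrap {T : ℝ} {P : Set ℝ} (hP : IsClosed P) (h0 : (0 : ℝ) ∈ P)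
    (h : ∀ t ∈ Ico 0 T, Icc 0 t ⊆ P → P ∈ 𝓝[>] t) : Icc 0 T ⊆ P := by
  have : Icc 0 T ⊆ {t | Icc 0 t ⊆ P} := by
    refine IsClosed.Icc_subset_of_forall_mem_nhdsWithin (isClosed_of_closure_subset fun t ht => ?_)
      (by simpa using h0) fun t ht => ?_
    · have htI : t ∈ Icc 0 T := isClosed_Icc.closure_subset (closure_mono inter_subset_right ht)
      refine ⟨fun r hr => ?_, htI⟩
      rcases hr.2.lt_or_eq with h1 | rfl
      · obtain ⟨s, hs, hs2⟩ := mem_closure_iff.1 ht _ isOpen_Ioi h1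
        exact hs2.1 ⟨hr.1, (le_of_lt hs : r ≤ s)⟩
      · exact hP.closure_subset (closure_mono (fun s hs => hs.1 ⟨hs.2.1, le_rfl⟩) ht)
    · obtain ⟨u, hu, hu2⟩ := mem_nhdsGT_iff_exists_Ioo_subset.1 (h t ht.2 ht.1)
      filter_upwards [Ioo_mem_nhdsGT hu] with s hs r hr
      rcases le_or_gt r t with h1 | h1
      · exact ht.1 ⟨hr.1, h1⟩
      · exact hu2 ⟨h1, hr.2.trans_lt hs.2⟩
  exact fun t ht => this ht ⟨ht.1, le_rfl⟩

section

variable {A : Adm N k m n} {α b K C M T : ℝ} {lam : ℂ} {v : ℝ → XS N k m n} (S : Small A lam α b K C M)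

lemma Init.cond (hK : 1 ≤ K) {f : 𝕏} (h : Init A K f) : Cond A α K 1 f := by
  refine ⟨fun β => ?_, fun x => ?_⟩
  · rw [one_rpow, mul_one]
    refine ((norm_le_pi_norm (f.1 : Fam N k m n) β).trans ?_ : _ ≤ K)
    exact (ofReal_le_ofReal_iff (by linarith)).1 ((norm_le_normS A f).trans h.upper)
  · rw [one_rpow]
    exact h.lower x

lemma Cond.mono {κ κ' τ : ℝ} {f : 𝕏} (h : Cond A α κ τ f) (hκ : κ ≤ κ') : Cond A α κ' τ f :=
  ⟨fun β => (h.upper β).trans hκ, fun x => (h.lower x).trans (mul_le_mul_of_nonneg_right hκ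
    (mul_nonneg (pow_pos (bracket_pos x) n).le (norm_nonneg _)))⟩

lemma continuousOn_coord {I : Set ℝ} (hv : ContinuousOn v I) (β : Idx N J) : ContinuousOn (fun t => ‖(v t).1 β‖) I :=
  ((continuous_apply β).comp_continuousOn (continuous_subtype_val.comp_continuousOn hv)).norm

lemma sub_le_bracket_mul_norm (f g : 𝕏) (x : Sp N) :
    bracket x ^ n * ‖fnX A f x‖ - supC A * ‖f - g‖ ≤ bracket x ^ n * ‖fnX A g x‖ := by
  have h1 := (sJet_jetX A (f - g)).sup_le A (β := 0) (by simp [order_zero]) x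
  have h2 : ‖fnX A f x‖ ≤ ‖fnX A g x‖ + ‖jetX A (f - g) 0 x‖ := by
    rw [show jetX A (f - g) 0 x = fnX A f x - fnX A g x from fnX_sub A f g x]
    exact norm_le_norm_add_norm_sub' _ _
  have h3 := mul_le_mul_of_nonneg_left h2 (pow_pos (bracket_pos x) n).le
  rw [mul_add] at h3
  linarith

include S

theorem SolX.cond (hbT : b * T < 1) (hsol : SolX A (nlX A α) (coefNL N lam α b) (Icc 0 T) v)
    (h0 : Init A K (v 0)) : ∀ t ∈ Icc 0 T, Cond A α (4 * K) (1 - b * t) (v t) := by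
  rcases lt_or_ge T 0 with hT | hT
  · exact fun t ht => absurd (ht.1.trans ht.2) hT.not_ge
  have hK := S.hK
  have hτ : ∀ s ∈ Icc 0 T, 0 < 1 - b * s := fun s hs => by
    have := mul_le_mul_of_nonneg_left hs.2 S.hb.le; linarith
  have hτc : ∀ p : ℝ, ContinuousOn (fun s => (1 - b * s) ^ p) (Icc 0 T) := fun p s hs =>
    (hasDerivAt_tau p (hτ s hs)).continuousAt.continuousWithinAt
  have hu := fun β : Idx N J => (continuousOn_coord hsol.cont β).mul (hτc (𝔰 α (order β.1)))
  have hl := fun x : Sp N => (continuous_jetX A (β := 0) (by simp [order_zero]) x).norm.comp_continuousOn hsol.cont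
  have hP : IsClosed {t | t ∈ Icc 0 T ∧ Cond A α (4 * K) (1 - b * t) (v t)} := by
    have h1 := fun β => isClosed_Icc.isClosed_le (hu β) (continuousOn_const (c := 4 * K))
    have h2 := fun x => isClosed_Icc.isClosed_le (hτc (σ₁)) (((hl x).const_mul (bracket x ^ n)).const_mul (4 * K))
    convert (isClosed_iInter h1).inter ((isClosed_iInter h2).inter (isClosed_Icc (a := (0 : ℝ)) (b := T))) using 1
    ext t
    simp only [mem_setOf_eq, mem_inter_iff, mem_iInter]
    exact ⟨fun h => ⟨fun β => ⟨h.1, h.2.upper β⟩, fun x => ⟨h.1, h.2.lower x⟩, h.1⟩,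
      fun h => ⟨h.2.2, fun β => (h.1 β).2, fun x => (h.2.1 x).2⟩⟩
  refine fun t ht => (Icc_subset_of_bootstrap hP ⟨⟨le_rfl, hT⟩, ?_⟩ (fun t ht hC => ?_) ht).2
  · rw [mul_zero, sub_zero]
    exact (h0.cond hK).mono (by linarith)
  have htT : t ∈ Icc 0 T := ⟨ht.1, ht.2.le⟩
  have hsub : Icc 0 t ⊆ Icc 0 T := Icc_subset_Icc_right ht.2.le
  have h3 := Cond.improve S ht.1 (by linarith [hτ t htT]) (hsol.mono hsub) h0 fun s hs => (hC hs).2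
  have hn : 𝓝[>] t ≤ 𝓝[Icc 0 T] t := by
    rw [← nhdsWithin_Ioo_eq_nhdsGT ht.2]
    exact nhdsWithin_mono _ fun s hs => ⟨ht.1.trans hs.1.le, hs.2.le⟩
  have hp : 0 < (1 - b * t) ^ σ₁ := rpow_pos_of_pos (hτ t htT) _
  have e1 : ∀ᶠ s in 𝓝[>] t, ∀ β, ‖(v s).1 β‖ * (1 - b * s) ^ 𝔰 α (order β.1) < 4 * K :=
    eventually_all.2 fun β => ((hu β t htT).mono_left hn).eventually_lt_const ((h3.upper β).trans_lt (by linarith))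
  have e2 : ∀ᶠ s in 𝓝[>] t, 4 * K * (supC A * ‖v t - v s‖) < (1 - b * t) ^ σ₁ / 3 := by
    refine Tendsto.eventually_lt_const (v := 0) (div_pos hp three_pos) ?_
    have := (((hsol.cont t htT).mono_left hn).const_sub (v t)).norm.const_mul (supC A) |>.const_mul (4 * K)
    simpa only [sub_self, norm_zero, mul_zero] using this
  filter_upwards [e1, e2, Ioo_mem_nhdsGT ht.2] with s h1 h2 hs
  have hsT : s ∈ Icc 0 T := ⟨ht.1.trans hs.1.le, hs.2.le⟩
  refine ⟨hsT, fun β => (h1 β).le, fun x => ?_⟩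
  have h4 := h3.lower x
  have h5 := mul_le_mul_of_nonneg_left (sub_le_bracket_mul_norm (A := A) (v t) (v s) x)
    (by linarith : (0 : ℝ) ≤ 4 * K)
  have h6 : (1 - b * s) ^ σ₁ ≤ (1 - b * t) ^ σ₁ :=
    rpow_le_rpow (hτ s hsT).le (by have := mul_lt_mul_of_pos_left hs.1 S.hb; linarith) (sigmaOne_pos A).le
  rw [mul_sub] at h5
  linarith

end

/-! ### Uniqueness and existence -/

section

variable {A : Adm N k m n} {α b K C M T : ℝ} {lam : ℂ} {v w : ℝ → XS N k m n} (S : Small A lam α b K C M)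

lemma norm_le_lintegral {d f : ℝ → 𝕏} (hd : ContinuousOn d (Icc 0 T))
    (hf : ContinuousOn f (Icc 0 T)) (H : ∀ t ∈ Icc 0 T, ∀ x, HasDerivWithinAt (fun s => fnX A (d s) x)
      (I * lapX A (d t) x + fnX A (f t) x) (Icc 0 T) t) (h0 : d 0 = 0) {B : ℝ} (hB : 0 ≤ B)
    (hfd : ∀ t ∈ Icc 0 T, ‖f t‖ ≤ B * ‖d t‖) {t : ℝ} (ht : t ∈ Icc 0 T) :
    ofReal ‖d t‖ ≤ ofReal (linC A * (cardS N k m n + B)) * ∫⁻ s in Icc 0 t, ofReal ‖d s‖ := by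
  have hL := one_le_linC A
  have hc : (0 : ℝ) ≤ cardS N k m n := cast_nonneg _
  have key : ∀ β, ofReal ‖(d t).1 β‖ ≤ ofReal (linC A * (cardS N k m n + B)) *
      ∫⁻ s in Icc 0 t, ofReal ‖d s‖ := fun β => by
    have h1 := linear_est A hd hf H ht β
    have h2 : normS N k m n (fnX A (d 0)) = 0 := by
      have := normS_le_norm A (d 0)
      rwa [h0, norm_zero, mul_zero, ofReal_zero, nonpos_iff_eq_zero, ← h0] at this
    rw [h2, zero_add] at h1
    refine h1.trans ?_
    rw [ofReal_mul (by linarith), mul_assoc, ← lintegral_const_mul' (ofReal (cardS N k m n + B)) _ ofReal_ne_top]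
    refine mul_le_mul_right (setLIntegral_mono' measurableSet_Icc fun s hs => ?_) _
    rw [← ofReal_mul (by positivity), add_mul, ofReal_add (by positivity) (by positivity)]
    refine add_le_add (normS_le_norm A _) (ofReal_le_ofReal ?_)
    exact (norm_le_pi_norm ((f s).1 : Fam N k m n) β).trans (hfd s ⟨hs.1, hs.2.trans ht.2⟩)
  by_cases hI : ofReal (linC A * (cardS N k m n + B)) * ∫⁻ s in Icc 0 t, ofReal ‖d s‖ = ⊤
  · rw [hI]; exact le_top
  rw [ofReal_le_iff_le_toReal hI]
  refine (pi_norm_le_iff_of_nonneg (x := ((d t).1 : Fam N k m n)) toReal_nonneg).2 fun β => ?_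
  exact (ofReal_le_iff_le_toReal hI).1 (key β)

lemma eq_zero_of_le_lintegral {d : ℝ → 𝕏} (hd : ContinuousOn d (Icc 0 T)) {L : ℝ} (hL : 0 ≤ L)
    (h : ∀ t ∈ Icc 0 T, ofReal ‖d t‖ ≤ ofReal L * ∫⁻ s in Icc 0 t, ofReal ‖d s‖) :
    ∀ t ∈ Icc 0 T, d t = 0 := by
  intro t₀ ht₀
  obtain ⟨e, he, hed⟩ := exists_continuous_extension (ht₀.1.trans ht₀.2) hd
  have hG := fun t => (he.norm.integral_hasStrictDerivAt 0 t).hasDerivAt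
  have h1 : ∀ t ∈ Icc 0 T, ‖d t‖ ≤ L * ∫ s in (0 : ℝ)..t, ‖e s‖ := fun t ht => by
    have h2 := h t ht
    have h3 : ∫⁻ s in Icc 0 t, ofReal ‖d s‖ = ofReal (∫ s in (0 : ℝ)..t, ‖e s‖) := by
      rw [intervalIntegral.integral_of_le ht.1, ofReal_integral_eq_lintegral_ofReal
        ((intervalIntegrable_iff_integrableOn_Ioc_of_le ht.1).1 (he.norm.intervalIntegrable _ _))
        (of_forall fun _ => norm_nonneg _), setLIntegral_congr Ioc_ae_eq_Icc]
      exact setLIntegral_congr_fun measurableSet_Icc fun s hs => by simp only [hed s ⟨hs.1, hs.2.trans ht.2⟩]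
    have h4 : 0 ≤ ∫ s in (0 : ℝ)..t, ‖e s‖ := intervalIntegral.integral_nonneg ht.1 fun _ _ => norm_nonneg _
    rwa [h3, ← ofReal_mul hL, ofReal_le_ofReal_iff (by positivity)] at h2
  have h5 := eq_zero_of_abs_deriv_le_mul_abs_self_of_eq_zero_right (K := L)
    (fun t _ => (hG t).continuousAt.continuousWithinAt) (fun t _ => (hG t).hasDerivWithinAt)
    intervalIntegral.integral_same (fun t ht => ?_) t₀ ht₀
  · have := h1 t₀ ht₀
    rw [h5, mul_zero] at this
    exact norm_le_zero_iff.1 this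
  · rw [norm_norm, hed t ⟨ht.1, ht.2.le⟩]
    exact (h1 t ⟨ht.1, ht.2.le⟩).trans (mul_le_mul_of_nonneg_left (Real.le_norm_self _) hL)

include S

theorem SolX.unique (hbT : b * T < 1) (hv : SolX A (nlX A α) (coefNL N lam α b) (Icc 0 T) v)
    (hw : SolX A (nlX A α) (coefNL N lam α b) (Icc 0 T) w) (h0 : v 0 = w 0) :
    ∀ t ∈ Icc 0 T, v t = w t := by
  obtain ⟨c, hc, hl⟩ := hv.lower
  obtain ⟨c', hc', hl'⟩ := hw.lower
  obtain ⟨R, hR⟩ := isCompact_Icc.exists_bound_of_continuousOn hv.cont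
  obtain ⟨R', hR'⟩ := isCompact_Icc.exists_bound_of_continuousOn hw.cont
  obtain ⟨H, hH⟩ := isCompact_Icc.exists_bound_of_continuousOn (S.continuousOn_coefNL hbT)
  obtain ⟨Q, hQ, hlip⟩ := regLip_nlX A S.hα.1 (max R R') (min c c') (lt_min hc hc')
  have hH' : ∀ t ∈ Icc 0 T, ‖coefNL N lam α b t‖ ≤ max H 0 := fun t ht => (hH t ht).trans (le_max_left _ _)
  have hd := hv.cont.sub hw.cont
  have hB : 0 ≤ max H 0 * Q := mul_nonneg (le_max_right _ _) hQ
  have key := fun t ht => norm_le_lintegral (A := A) (t := t) hd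
    ((hv.continuousOn_nl S hbT).sub (hw.continuousOn_nl S hbT)) (fun t ht x => ?_) (sub_eq_zero.2 h0) hB
    (fun t ht => ?_) ht
  · refine fun t ht => sub_eq_zero.1 (eq_zero_of_le_lintegral hd ?_ key t ht)
    have := one_le_linC A
    positivity
  · have := (hv.eqn t ht x).sub (hw.eqn t ht x)
    simp only [Pi.sub_apply, fnX_sub, fnX_smul]
    refine this.congr_deriv ?_
    simp only [lapX, jetX_sub A _ _ (order_two_le _), sum_sub_distrib]
    ring
  · change ‖coefNL N lam α b t • nlX A α (v t) - coefNL N lam α b t • nlX A α (w t)‖ ≤ _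
    rw [show coefNL N lam α b t • nlX A α (v t) - coefNL N lam α b t • nlX A α (w t)
      = coefNL N lam α b t • (nlX A α (v t) - nlX A α (w t)) from (smul_sub ..).symm, norm_smul, mul_assoc]
    exact mul_le_mul (hH' t ht) ((hlip _ ⟨(hR t ht).trans (le_max_left _ _), fun x => (min_le_left _ _).trans (hl t ht x)⟩).2 _
      ⟨(hR' t ht).trans (le_max_right _ _), fun x => (min_le_right _ _).trans (hl' t ht x)⟩) (norm_nonneg _)
      (le_max_right _ _)

omit S

lemma SolX.glue {F : 𝕏 → 𝕏} {h : ℝ → ℂ} {t₀ t₁ : ℝ} (h0 : 0 ≤ t₀) (h1 : t₀ ≤ t₁)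
    (hv : SolX A F h (Icc 0 t₀) v) (hw : SolX A F h (Icc t₀ t₁) w) (hvw : w t₀ = v t₀) :
    ∃ u, u 0 = v 0 ∧ SolX A F h (Icc 0 t₁) u := by
  set u := fun s => if s ≤ t₀ then v s else w s
  have huv : ∀ s ∈ Icc 0 t₀, u s = v s := fun s hs => if_pos hs.2
  have huw : ∀ s ∈ Icc t₀ t₁, u s = w s := fun s hs => by
    rcases hs.1.eq_or_lt with rfl | h
    · exact (if_pos le_rfl).trans hvw.symm
    · exact if_neg h.not_ge
  have hI : Icc 0 t₁ = Icc 0 t₀ ∪ Icc t₀ t₁ := (Icc_union_Icc_eq_Icc h0 h1).symm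
  obtain ⟨c, hc, hl⟩ := hv.lower
  obtain ⟨c', hc', hl'⟩ := hw.lower
  refine ⟨u, huv 0 ⟨le_rfl, h0⟩, ?_, fun t ht x => ?_, min c c', lt_min hc hc', fun t ht x => ?_⟩
  · rw [hI]
    exact (hv.cont.congr huv).union_of_isClosed (hw.cont.congr huw) isClosed_Icc isClosed_Icc
  · rw [hI]
    have e : ∀ {U : Set ℝ} {z : ℝ → 𝕏}, IsClosed U → SolX A F h U z → (∀ s ∈ U, u s = z s) →
        HasDerivWithinAt (fun s => fnX A (u s) x) (I * lapX A (u t) x + h t * fnX A (F (u t)) x) U t := by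
      intro U z hI hz hu
      by_cases htI : t ∈ U
      · rw [hu t htI]
        exact (hz.eqn t htI x).congr (fun s hs => by rw [hu s hs]) (by rw [hu t htI])
      · exact HasFDerivWithinAt.of_notMem_closure (by rwa [hI.closure_eq])
    exact (e isClosed_Icc hv huv).union (e isClosed_Icc hw huw)
  · rw [hI] at ht
    rcases ht with ht | ht
    · rw [huv t ht]; exact (min_le_left _ _).trans (hl t ht x)
    · rw [huw t ht]; exact (min_le_right _ _).trans (hl' t ht x)

include S

theorem exists_solX (hT : 0 ≤ T) (hbT : b * T < 1) {f : 𝕏} (h0 : Init A K f) :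
    ∃ v, v 0 = f ∧ SolX A (nlX A α) (coefNL N lam α b) (Icc 0 T) v := by
  have hK := S.hK
  have hτ : 0 < 1 - b * T := by linarith
  have hc : 0 < (1 - b * T) ^ σ₁ / (4 * K) := by positivity
  obtain ⟨ε, hε, hloc⟩ := exists_local A (regLip_nlX A S.hα.1) (S.continuousOn_coefNL hbT)
    (4 * K * (1 - b * T) ^ (-(1 / 2) : ℝ)) hc
  have key : ∀ j : ℕ, ∃ v, v 0 = f ∧ SolX A (nlX A α) (coefNL N lam α b) (Icc 0 (min (j * ε) T)) v := by
    intro j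
    induction j with
    | zero =>
      refine ⟨fun _ => f, rfl, ?_⟩
      simp only [Nat.cast_zero, zero_mul, min_eq_left hT, Icc_self]
      refine ⟨continuousOn_const, fun t ht x => ?_, 1 / K, by positivity, fun t _ x => ?_⟩
      · rw [mem_singleton_iff.1 ht]; exact HasFDerivWithinAt.of_subsingleton subsingleton_singleton
      · rw [div_le_iff₀' (by linarith)]; exact h0.lower x
    | succ j ih =>
      obtain ⟨v, hv0, hv⟩ := ih
      set t₀ := min (j * ε) T with ht₀
      have ht : t₀ ∈ Icc 0 T := ⟨le_min (by positivity) hT, min_le_right _ _⟩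
      have hbt := mul_le_mul_of_nonneg_left ht.2 S.hb.le
      have hbt' := mul_nonneg S.hb.le ht.1
      have hC := hv.cond S (by linarith) (hv0 ▸ h0) t₀ ⟨ht.1, le_rfl⟩
      have hreg : v t₀ ∈ Reg A (4 * K * (1 - b * T) ^ (-(1 / 2) : ℝ)) ((1 - b * T) ^ σ₁ / (4 * K)) := by
        refine ⟨(hC.norm_le_half (by linarith) (by linarith) S.hα (by linarith)).trans
          (mul_le_mul_of_nonneg_left (Real.rpow_le_rpow_of_nonpos hτ (by linarith) (by norm_num)) (by linarith)),
          fun x => ?_⟩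
        rw [div_le_iff₀' (by linarith)]
        exact (rpow_le_rpow hτ.le (by linarith) (sigmaOne_pos A).le).trans (hC.lower x)
      obtain ⟨w, hw0, hw⟩ := hloc t₀ ht _ hreg
      obtain ⟨u, hu0, hu⟩ := hv.glue ht.1 (le_min (by linarith) ht.2) hw hw0
      refine ⟨u, hu0.trans hv0, ?_⟩
      have : min ((j + 1 : ℕ) * ε) T = min (t₀ + ε) T := by
        rw [ht₀, ← min_add_add_right, min_assoc, min_eq_right (by linarith : T ≤ T + ε), Nat.cast_succ, add_one_mul]
      rwa [this]
  obtain ⟨j, hj⟩ := exists_nat_ge (T / ε)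
  have := key j
  rwa [min_eq_right ((div_le_iff₀ hε).1 hj)] at this

end

/-! ### Solutions on half-open intervals -/

lemma le_lowerS_iff {u : Sp N → ℂ} {c : ℝ} : ofReal c ≤ lowerS n u ↔ ∀ x, c ≤ bracket x ^ n * ‖u x‖ := by
  unfold lowerS
  rw [le_iInf_iff]
  exact forall_congr' fun x => ofReal_le_ofReal_iff (mul_nonneg (pow_pos (bracket_pos x) n).le (norm_nonneg _))

section

variable {A : Adm N k m n} {α b K C M T : ℝ} {lam : ℂ} {f : ℝ → XS N k m n} (S : Small A lam α b K C M)

lemma Init.of_le {g : 𝕏} (hK : 1 ≤ K)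
    (h : normS N k m n (fnX A g) + (lowerS n (fnX A g))⁻¹ ≤ ofReal K) : Init A K g := by
  have h2 := ENNReal.inv_le_iff_inv_le.1 (le_add_self.trans h)
  rw [← ENNReal.ofReal_inv_of_pos (by linarith), le_lowerS_iff] at h2
  exact ⟨le_self_add.trans h, fun x => by have := h2 x; rwa [inv_le_iff_one_le_mul₀' (by linarith)] at this⟩

include S

theorem isSolution_fnX (h : ∀ T' ∈ Ico 0 T, SolX A (nlX A α) (coefNL N lam α b) (Icc 0 T') f) :
    IsSolution N k m n lam α b (fnX A (f 0)) T fun t => fnX A (f t) := by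
  have hn : ∀ t ∈ Ico 0 T, ∃ T' ∈ Ico 0 T, t ∈ Icc 0 T' ∧ Icc 0 T' ∈ 𝓝[Ico 0 T] t := fun t ht => by
    have h2 := ht.2
    refine ⟨(t + T) / 2, ⟨by linarith [ht.1], by linarith⟩, ⟨ht.1, by linarith⟩, ?_⟩
    filter_upwards [self_mem_nhdsWithin, mem_nhdsWithin_of_mem_nhds (Iio_mem_nhds (by linarith : t < (t + T) / 2))]
      with s hs hs' using ⟨hs.1, le_of_lt hs'⟩
  refine ⟨(contInS_iff A fun _ _ => rfl).2 fun t ht => ?_, rfl, fun t ht x => ?_, fun T' hT' => ?_⟩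
  · obtain ⟨T', hT', ht', hm⟩ := hn t ht
    exact ((h T' hT').cont t ht').mono_of_mem_nhdsWithin hm
  · obtain ⟨T', hT', ht', hm⟩ := hn t ht
    obtain ⟨c, hc, hl⟩ := (h T' hT').lower
    have := (h T' hT').eqn t ht' x
    rw [fnX_nlX A S.hα.1 hc (hl t ht')] at this
    rw [laplacian_fnX]
    exact this.mono_of_mem_nhdsWithin hm
  · obtain ⟨c, hc, hl⟩ := (h T' hT').lower
    exact (ofReal_pos.2 hc).trans_le (le_iInf₂ fun t ht => le_lowerS_iff.2 (hl t ht))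

theorem IsSolution.exists_fnX {v₀ : Sp N → ℂ} {w : ℝ → Sp N → ℂ} (h : IsSolution N k m n lam α b v₀ T w) :
    ∃ f : ℝ → 𝕏, (∀ t ∈ Ico 0 T, fnX A (f t) = w t) ∧
      ∀ T' ∈ Ico 0 T, SolX A (nlX A α) (coefNL N lam α b) (Icc 0 T') f := by
  obtain ⟨f, hf, hc⟩ := h.cont.exists_XS A
  refine ⟨f, hf, fun T' hT' => ?_⟩
  have hI : Icc 0 T' ⊆ Ico 0 T := fun t ht => ⟨ht.1, ht.2.trans_lt hT'.2⟩
  obtain ⟨c, -, hc0, hcl⟩ := ENNReal.lt_iff_exists_real_btwn.1 (h.lower T' hT')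
  have hl : ∀ t ∈ Icc 0 T', ∀ x, c ≤ bracket x ^ n * ‖fnX A (f t) x‖ := fun t ht => by
    rw [hf t (hI ht)]
    exact le_lowerS_iff.1 (hcl.le.trans (iInf₂_le t ht))
  refine ⟨hc.mono hI, fun t ht x => ?_, c, ofReal_pos.1 hc0, hl⟩
  have := (h.eqn t (hI ht) x).mono hI
  beta_reduce at this
  rw [← hf t (hI ht), laplacian_fnX, ← fnX_nlX A S.hα.1 (ofReal_pos.1 hc0) (hl t ht)] at this
  exact this.congr (fun s hs => by rw [hf s (hI hs)]) (by rw [hf t (hI ht)])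

theorem bigPsi_le (hbT : b * T < 1) (h : ∀ t ∈ Icc 0 T, Cond A α (4 * K) (1 - b * t) (f t)) :
    bigPsi N k m n α b T (fun t => fnX A (f t)) ≤ ofReal (4 * K) := by
  have hK := S.hK
  have hτ : ∀ s ∈ Icc 0 T, 0 < 1 - b * s := fun s hs => by
    have := mul_le_mul_of_nonneg_left hs.2 S.hb.le; linarith
  have hτ1 : ∀ s ∈ Icc 0 T, 1 - b * s ≤ 1 := fun s hs => by
    have := mul_nonneg S.hb.le hs.1; linarith
  have key : ∀ t ∈ Icc 0 T, ∀ (j : ℕ) (w : ℝ≥0∞), w ≤ ofReal (4 * K * (1 - b * t) ^ (-𝔰 α j)) →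
      decayFactor N k m n α b j t * w ≤ ofReal (4 * K) := fun t ht j w hw => by
    refine (mul_le_mul_right hw _).trans ?_
    unfold decayFactor
    rw [← ofReal_mul (rpow_nonneg (hτ t ht).le _), mul_left_comm, ← rpow_add (hτ t ht),
      add_neg_cancel, rpow_zero, mul_one]
  refine max_le (max_le (max_le ?_ ?_) ?_) ?_ <;> refine iSup₂_le fun t ht => ?_
  · exact iSup₂_le fun j hj => key t ht _ _ ((h t ht).norm1_le (hτ t ht) (hτ1 t ht) S.hα (by linarith) hj.2)
  · exact iSup₂_le fun j hj => key t ht _ _ ((h t ht).norm2_le (hτ t ht) (hτ1 t ht) S.hα (by linarith) hj.2)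
  · exact iSup₂_le fun j hj => key t ht _ _ ((h t ht).norm3_le (hτ t ht) (hτ1 t ht) S.hα (by linarith) hj.2)
  · refine ENNReal.div_le_of_le_mul ?_
    have h2 : ofReal ((1 - b * t) ^ σ₁ / (4 * K)) ≤ lowerS n (fnX A (f t)) :=
      le_lowerS_iff.2 fun x => (div_le_iff₀' (by linarith)).2 ((h t ht).lower x)
    refine le_trans ?_ (mul_le_mul_right h2 _)
    rw [← ofReal_mul (by linarith), mul_div_cancel₀ _ (by linarith), decayFactor, sigma_one]

theorem exists_solution {g : 𝕏} (h0 : Init A K g) : ∃ v : ℝ → Sp N → ℂ,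
    IsSolution N k m n lam α b (fnX A g) (1 / b) v ∧
    (∀ T ∈ Ioc 0 (1 / b), ∀ w : ℝ → Sp N → ℂ, IsSolution N k m n lam α b (fnX A g) T w → ∀ t ∈ Ico 0 T, w t = v t) ∧
    (⨆ T ∈ Ico 0 (1 / b), bigPsi N k m n α b T v) ≤ ofReal (4 * K) := by
  have hb := S.hb
  have hbT : ∀ T < 1 / b, b * T < 1 := fun T hT => by rwa [lt_div_iff₀' hb] at hT
  choose! V hV0 hV using fun T (hT : T ∈ Ico 0 (1 / b)) => exists_solX S hT.1 (hbT T hT.2) h0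
  have hVV : ∀ T ∈ Ico 0 (1 / b), ∀ t ∈ Icc 0 T, V t t = V T t := fun T hT t ht => by
    have ht' : t ∈ Ico 0 (1 / b) := ⟨ht.1, ht.2.trans_lt hT.2⟩
    exact (hV t ht').unique S (hbT t ht'.2) ((hV T hT).mono (Icc_subset_Icc_right ht.2))
      ((hV0 t ht').trans (hV0 T hT).symm) t ⟨ht.1, le_rfl⟩
  set f := fun t => V t t
  have hf : ∀ T ∈ Ico 0 (1 / b), SolX A (nlX A α) (coefNL N lam α b) (Icc 0 T) f := fun T hT => by
    obtain ⟨h1, h2, h3⟩ := hV T hT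
    refine ⟨h1.congr (hVV T hT), fun t ht x => ?_, ?_⟩
    · rw [show f t = V T t from hVV T hT t ht]
      exact (h2 t ht x).congr (fun s hs => by rw [show f s = V T s from hVV T hT s hs])
        (by rw [show f t = V T t from hVV T hT t ht])
    · exact h3.imp fun c hc => ⟨hc.1, fun t ht => by rw [show f t = V T t from hVV T hT t ht]; exact hc.2 t ht⟩
  have hf0 : f 0 = g := hV0 0 ⟨le_rfl, by positivity⟩
  refine ⟨fun t => fnX A (f t), hf0 ▸ isSolution_fnX S hf, fun T hT w hw t ht => ?_, iSup₂_le fun T hT => ?_⟩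
  · obtain ⟨e, he, hsol⟩ := hw.exists_fnX (A := A) S
    have ht' : t ∈ Ico 0 (1 / b) := ⟨ht.1, ht.2.trans_le hT.2⟩
    have : e 0 = f 0 := by
      rw [hf0]
      exact fnX_injective A ((he 0 ⟨le_rfl, hT.1⟩).trans hw.init)
    rw [← he t ht, (hsol t ht).unique S (hbT t ht'.2) (hf t ht') this t ⟨ht.1, le_rfl⟩]
  · exact bigPsi_le S (hbT T hT.2) ((hf T hT).cond S (hbT T hT.2) (hf0 ▸ h0))

end

/-! ### The choice of the constants -/

/-- The constant in the growth estimate. -/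
def growthC : ℝ := max (linC A * cardS N k m n) (max (cardS N k m n) (2 * (N : ℝ) ^ (N + 1)))

lemma exists_alpha (A : Adm N k m n) {D r : ℝ} (hr : 0 < r) (hD : r ≤ D) :
    ∃ a ∈ Ioo (alphaMin N) (2 / (N : ℝ)), 12 * D / (σ₁ * r) * (2 / a - N) = 1 := by
  have hN : (1 : ℝ) ≤ N := by exact_mod_cast A.one_le
  have hs := sigmaOne_pos A
  have hD0 : 0 < D := by linarith
  have hmin : alphaMin N ≤ 2 / (N : ℝ) := by
    unfold alphaMin
    refine max_le ?_ ?_ <;> rw [div_le_div_iff₀ (by linarith) (by linarith)] <;> linarith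
  have hs2 : σ₁ ≤ 1 / 2 :=
    (sigma_one (α := 2 / (N : ℝ))).symm.le.trans (sigma_bigJ_le A ⟨hmin, le_rfl⟩ (by unfold bigJ; omega))
  set δ := σ₁ * r / (12 * D) with hδ
  have hδ0 : 0 < δ := by positivity
  have hδ1 : δ ≤ 1 / 24 := by
    rw [hδ, div_le_iff₀ (by positivity)]
    nlinarith
  refine ⟨2 / (N + δ), ⟨?_, ?_⟩, ?_⟩
  · unfold alphaMin
    refine max_lt ?_ ?_ <;> rw [div_lt_div_iff₀ (by linarith) (by linarith)] <;> linarith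
  · exact div_lt_div_of_pos_left two_pos (by linarith) (by linarith)
  · rw [div_div_cancel₀ two_ne_zero, add_sub_cancel_left, hδ]
    field_simp

lemma sixteen_mul_le {X C b : ℝ} (hN : 1 ≤ N) (hX : 1 ≤ X) (hC : 2 * (N : ℝ) ^ (N + 1) ≤ C)
    (h1 : 16 / (N : ℝ) * X ^ (4 / (N : ℝ) + 2) ≤ b) (h2 : 8 * C ≤ b) : 16 * N * X ^ 2 ≤ b := by
  have hN' : (1 : ℝ) ≤ N := by exact_mod_cast hN
  have hX0 : 0 < X := by linarith
  rcases le_total ((N : ℝ) ^ 2) (X ^ (4 / (N : ℝ))) with h | h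
  · refine le_trans ?_ h1
    rw [rpow_add hX0, rpow_two, ← mul_assoc]
    refine mul_le_mul_of_nonneg_right ?_ (by positivity)
    rw [div_mul_eq_mul_div, le_div_iff₀ (by linarith)]
    nlinarith
  · have h3 : X ^ 2 ≤ (N : ℝ) ^ N := by
      have := pow_le_pow_left₀ (by positivity) h N
      rw [← Real.rpow_mul_natCast hX0.le, div_mul_cancel₀ _ (by positivity), ← pow_mul, mul_comm 2 N, pow_mul,
        show (4 : ℝ) = (4 : ℕ) by norm_num, rpow_natCast, show X ^ 4 = (X ^ 2) ^ 2 by ring] at this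
      exact (pow_le_pow_iff_left₀ (by positivity) (by positivity) two_ne_zero).1 this
    rw [pow_succ] at hC
    nlinarith [mul_le_mul_of_nonneg_left h3 (by linarith : (0 : ℝ) ≤ N)]

lemma mul_max_le {K α b s δ r D : ℝ} (hK : 1 ≤ K) (hα : 0 < α) (hα2 : α ≤ 2) (hr : 0 < r) (hD : 0 ≤ D) (hb : 0 < b)
    (h : 32 * ((4 * K) ^ 3 * D) ≤ b * s) (hδ : δ * (12 * D) ≤ α / 2 * (s * r)) :
    D * max (K ^ α) (b * δ / (α * r)) ≤ b * s / 24 := by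
  rw [mul_max_of_nonneg _ _ hD]
  refine max_le ?_ ?_
  · have h1 : K ^ α ≤ K ^ 2 := by
      rw [← rpow_two]; exact Real.rpow_le_rpow_of_exponent_le hK hα2
    have h2 : K ^ 2 ≤ (4 * K) ^ 3 := by nlinarith [sq_nonneg K]
    have := mul_le_mul_of_nonneg_left (h1.trans h2) hD
    have h3 : 0 ≤ D * (4 * K) ^ 3 := by positivity
    linarith
  · rw [mul_div_assoc', div_le_iff₀ (by positivity)]
    have := mul_le_mul_of_nonneg_left hδ hb.le
    linarith

theorem small_of_bOne {C K α a b : ℝ} {lam : ℂ} (hC : 1 ≤ C) (hNL : IsNonlinearConst N k m n C)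
    (hlam : lam.re < 0) (hK : 1 ≤ K) (ha : a ∈ Ioo (alphaMin N) (2 / (N : ℝ)))
    (ha1 : 12 * (linC A * C * (4 * K) ^ (4 * J + 1) * ‖lam‖) / (σ₁ * |lam.re|) * (2 / a - N) = 1)
    (hα : α ∈ Ico a (2 / (N : ℝ))) (hb : bOne N k m n (linC A) C (growthC A) lam K α ≤ b) :
    ∃ M, Small A lam α b K C M := by
  have hN : (1 : ℝ) ≤ N := by exact_mod_cast A.one_le
  have hs := sigmaOne_pos A
  have hL := one_le_linC A
  have hα' : α ∈ 𝕀 := ⟨ha.1.le.trans hα.1, hα.2.le⟩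
  have ha0 := (alphaMin_pos A).trans ha.1
  have hα0 : 0 < α := ha0.trans_le hα.1
  have hα2 := (alpha_mem A hα').2
  have hR : 0 < |lam.re| := abs_pos.2 hlam.ne
  have hRl := Complex.abs_re_le_norm lam
  have hb1 := (le_max_left _ _).trans ((le_max_left _ _).trans hb)
  have hb2 := (le_max_right _ _).trans ((le_max_left _ _).trans hb)
  have hb3 := (le_max_left _ _).trans ((le_max_right _ _).trans hb)
  have hg1 : linC A * cardS N k m n ≤ growthC A := le_max_left _ _
  have hg2 : 2 * (N : ℝ) ^ (N + 1) ≤ growthC A := (le_max_right _ _).trans (le_max_right _ _)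
  have hb4 := sixteen_mul_le A.one_le (by linarith : 1 ≤ 4 * K) hg2 hb1 hb2
  have hb0 : 0 < b := lt_of_lt_of_le (by positivity) hb4
  set q := 2 * N * (4 * K) ^ 2 / b with hq
  have hq0 : 0 ≤ q := by positivity
  have hq1 : q ≤ 1 / 8 := by rw [hq, div_le_iff₀ hb0]; linarith
  have hexp : ∀ x : ℝ, 0 ≤ x → x ≤ 1 / 4 → exp x ≤ 4 / 3 := fun x h0 h1 =>
    (Real.exp_bound_div_one_sub_of_interval h0 (by linarith)).trans
      (by rw [div_le_div_iff₀ (by linarith) (by norm_num)]; linarith)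
  set s := σ₁
  set P := (4 * K) ^ (4 * J + 1) with hP
  have hP1 : 1 ≤ P := one_le_pow₀ (by linarith)
  set D := linC A * C * P * ‖lam‖ with hD
  have hl0 : 0 < ‖lam‖ := hR.trans_le hRl
  have hLC : 1 ≤ linC A * C := one_le_mul_of_one_le_of_one_le hL hC
  have hDl : ‖lam‖ ≤ D := le_mul_of_one_le_left hl0.le (one_le_mul_of_one_le_of_one_le hLC hP1)
  have hb3' : 32 * ((4 * K) ^ 3 * D) ≤ b * s := by
    rw [div_le_iff₀ hs] at hb3
    refine le_trans (le_of_eq ?_) hb3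
    rw [hD, hP]; ring
  set δ := (2 - N * α) / 2 with hδ
  have hδD : δ * (12 * D) ≤ α / 2 * (s * |lam.re|) := by
    have h1 : 12 * D * (2 / a - N) = s * |lam.re| := by
      field_simp at ha1 ⊢
      linarith
    have h2 : δ ≤ α / 2 * (2 / a - N) := by
      have : 1 ≤ α / a := (one_le_div ha0).2 hα.1
      rw [show α / 2 * (2 / a - N) = α / a - N * α / 2 by ring, hδ]
      linarith
    rw [← h1]
    have := mul_le_mul_of_nonneg_right h2 (by positivity : 0 ≤ 12 * D)
    linarith
  set E := exp (α * q) with hE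
  have hE1 : E ≤ 4 / 3 := hexp _ (by positivity) (by nlinarith)
  have hE0 : 0 < E := exp_pos _
  set M := max (K ^ α) (b * δ / (α * |lam.re|)) with hM
  have hM0 : 0 ≤ M := le_max_of_le_left (by positivity)
  have hbs : 0 < b * s := by positivity
  have key : D * (E * M) ≤ b * s / 16 := by
    have hDM : D * M ≤ b * s / 24 := mul_max_le hK hα0 hα2 hR (by positivity) hb0 hb3' hδD
    calc D * (E * M) = E * (D * M) := by ring
      _ ≤ 4 / 3 * (b * s / 24) := mul_le_mul hE1 hDM (by positivity) (by norm_num)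
      _ ≤ b * s / 16 := by linarith
  refine ⟨M, hα', hα.2, hb0, hK, by linarith, hNL, hlam, (hexp q hq0 (by linarith)).trans (by norm_num),
    le_max_left _ _, le_max_right _ _, ?_, ?_, ?_⟩
  · refine (mul_le_mul_of_nonneg_right (hRl.trans hDl) (by positivity)).trans (key.trans (by linarith))
  · rw [mul_div_assoc', div_le_iff₀ hb0]
    have := mul_le_mul_of_nonneg_left ((mul_le_mul_of_nonneg_left hg1 (by norm_num)).trans hb2) (by linarith : 0 ≤ K)
    linarith
  · rw [show (4 * J + 1 : ℝ) = ((4 * J + 1 : ℕ) : ℝ) by push_cast; ring,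
      show (4 * J + 5 : ℝ) = ((4 * J + 1 + 4 : ℕ) : ℝ) by push_cast; ring,
      rpow_natCast, rpow_natCast, pow_add _ _ 4, ← hP]
    calc _ = 3 * (D * (E * M)) + 4 * K * ((4 * K) ^ 3 * D) := by rw [hD]; ring
      _ ≤ 3 * (b * s / 16) + 4 * K * (b * s / 32) := by
        exact add_le_add (by linarith) (mul_le_mul_of_nonneg_left (by linarith) (by linarith))
      _ ≤ K * (b * s) := by have := mul_le_mul_of_nonneg_right hK hbs.le; linarith

end DissipativeNLS

end

open DissipativeNLS
theorem proposition3p2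
    (N k m n : ℕ) (hN : 1 ≤ N)
    (hk : (N : ℝ) / 2 < k)
    (hn : max ((N : ℝ) / 2 + 1) ((N : ℝ) * (N + 1) / 4) < n)
    (hm : k + n + 1 ≤ 2 * m) :
    ∃ C₁ C₂ C₃ : ℝ, 1 ≤ C₁ ∧ 1 ≤ C₂ ∧ 1 ≤ C₃ ∧
      IsLinearConst N k m n C₁ ∧ IsNonlinearConst N k m n C₂ ∧ IsGrowthConst N k m n C₃ ∧
      ∀ (lam : ℂ) (K : ℝ), lam.re < 0 → 1 ≤ K →
        ∃ α₁ ∈ Set.Ioo (alphaMin N) (2 / (N : ℝ)),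
          12 * C₁ * C₂ * (4 * K) ^ (4 * bigJ k m n + 1) * ‖lam‖
              / (sigmaOne N k m n * |lam.re|) * (2 / α₁ - N) = 1 ∧
          ∀ v₀ : Sp N → ℂ, MemS N k m n v₀ →
            normS N k m n v₀ + (lowerS n v₀)⁻¹ ≤ ENNReal.ofReal K →
            ∀ α ∈ Set.Ico α₁ (2 / (N : ℝ)), ∀ b : ℝ, bOne N k m n C₁ C₂ C₃ lam K α ≤ b →
              ∃ v : ℝ → Sp N → ℂ,
                IsSolution N k m n lam α b v₀ (1 / b) v ∧
                (∀ T ∈ Set.Ioc 0 (1 / b), ∀ w : ℝ → Sp N → ℂ,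
                  IsSolution N k m n lam α b v₀ T w → ∀ t ∈ Set.Ico 0 T, w t = v t) ∧
                (⨆ T ∈ Set.Ico 0 (1 / b), bigPsi N k m n α b T v) ≤ ENNReal.ofReal (4 * K) := by
  have A : Adm N k m n := ⟨hN, hk, (le_max_left _ _).trans_lt hn, (le_max_right _ _).trans_lt hn, hm⟩
  obtain ⟨C, hC, hNL⟩ := exists_isNonlinearConst A
  have hL := one_le_linC A
  have hg : (1 : ℝ) ≤ growthC A := by
    have h1 : (1 : ℝ) ≤ N := by exact_mod_cast hN
    have h2 : (1 : ℝ) ≤ (N : ℝ) ^ (N + 1) := one_le_pow₀ h1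
    exact (by linarith : (1 : ℝ) ≤ 2 * (N : ℝ) ^ (N + 1)).trans ((le_max_right _ _).trans (le_max_right _ _))
  refine ⟨linC A, C, growthC A, hL, hC, hg, isLinearConst_linC A, hNL,
    isGrowthConst A ((le_max_left _ _).trans (le_max_right _ _)), fun lam K hlam hK => ?_⟩
  obtain ⟨a, ha, ha1⟩ := exists_alpha A (abs_pos.2 hlam.ne)
    (D := linC A * C * (4 * K) ^ (4 * bigJ k m n + 1) * ‖lam‖) ((Complex.abs_re_le_norm lam).trans
      (le_mul_of_one_le_left (norm_nonneg _) (one_le_mul_of_one_le_of_one_le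
        (one_le_mul_of_one_le_of_one_le hL hC) (one_le_pow₀ (by linarith)))))
  refine ⟨a, ha, ?_, fun v₀ hv₀ hK₀ α hα b hb => ?_⟩
  · rw [← ha1]; ring
  · obtain ⟨g, rfl⟩ := exists_XS A hv₀
    obtain ⟨M, S⟩ := small_of_bOne A hC hNL hlam hK ha ha1 hα hb
    exact exists_solution S (Init.of_le hK hK₀)
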